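/- Proposition 3.3. Let $\Omega=\mathbb R\times(0,1)$, $\kappa>0$, $C_0\ne0$, $T>0$ and let $k\ge4$ be an integer. Let $(\bar\Phi,\Psi)\in C([0,T];H^{k+3}(0,1))$ be a background flow, i.e. $$\partial_t\bar\Phi+C_0\Psi=0,\qquad \partial_t\Psi+\kappa\Psi=-C_0\,\partial_y^2\bar\Phi ,\qquad \partial_y^{2n-1}\bar\Phi=\partial_y^{2n-1}\Psi=0\ \text{ at } y=0,1\quad (n\ge1),$$ and let $u=(u_1,u_2)\in C([0,T];H^{k+1}(\Omega))\cap C^1([0,T];H^{k}(\Omega))$ and $\rho\in C([0,T];H^{k+2}(\Omega))\cap C^1([0,T];H^{k+1}(\Omega))$ solve, for some pressure $P$ and with $\nabla^\perp\rho=(\partial_y\rho,-\partial_x\rho)$, $$\partial_t\rho+u_2\partial_y\bar\Phi+C_0u_1+(u\cdot\nabla)\rho+\Psi\partial_x\rho=0,\qquad \nabla\cdot u=0,$$ $$\partial_tu+(u\cdot\nabla)u+(u_2\partial_y\Psi,0)+\kappa u+\Psi\partial_xu+\nabla P=(\nabla^\perp\rho\cdot\nabla)\nabla^\perp\rho-(\partial_x\rho\,\partial_y^2\bar\Phi,0)+(\partial_y\bar\Phi\,\partial_{xy}\rho,-\partial_y\bar\Phi\,\partial_x^2\rho)-C_0(\partial_y^2\rho,-\partial_{xy}\rho)$$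 in $\Omega\times[0,T]$, with $\partial_y^{2n}u_2=\partial_y^{2n+1}u_1=\partial_y^{2n+1}\rho=0$ at $y=0,1$ for all $n\ge0$ (all boundary conditions are imposed for those orders for which the traces are defined). Put $$E_m^2=\tfrac12\big(\|u\|_{H^m}^2+\|\partial_tu\|_{H^m}^2+\|\rho\|_{H^{m+1}}^2+\|\partial_t\rho\|_{H^{m+1}}^2\big),\qquad \Gamma_m^2=\tfrac12\int_\Omega(1+\partial_x\rho)\big(|\nabla^mu|^2+|\nabla^m\nabla^\perp\rho|^2\big)\,dx\,dy .$$ Assume $\|\partial_x\rho(t)\|_{H^2(\Omega)}<\frac14$ for all $t\in[0,T]$. Then $\Gamma_{k+1}^2$ is differentiable on $[0,T]$ (one-sidedly at the end points). Moreover, for every $M$ there is a constant $C$ depending only on $k,\kappa,C_0$ and $M$ (not on $T$, the background or the solution) such that $$\frac{d}{dt}\Gamma_{k+1}^2+\kappa\int_\Omega(1+\partial_x\rho)|\nabla^{k+1}u|^2\,dx\,dy\le C\,(E_k^2+\Gamma_{k+1}^2)\big(E_4+E_4^2+\|\bar\Phi\|_{H^{k+3}}+\|\Psi\|_{H^{k+3}}\big)$$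 at every $t\in[0,T]$ at which $E_4\le M$ or $\|\bar\Phi\|_{H^{k+3}}+\|\Psi\|_{H^{k+3}}\le M$. In particular, for small perturbations ($E_4\le1$) the constant depends only on $k,\kappa,C_0$, whatever the size of the background. -/

import Mathlib

open MeasureTheory Set
open scoped ContDiff

noncomputable section

namespace MHDStrip

section Weak

variable {E : Type*} [NormedAddCommGroup E] [NormedSpace ℝ E] [MeasureSpace E]

/-- Real-valued `L²(U)` with respect to Lebesgue measure. -/
abbrev L2 (U : Set E) : Type _ := Lp ℝ 2 (volume.restrict U : Measure E)

/-- `φ ∈ C_c^∞(U)`. -/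
def IsTest (U : Set E) (φ : E → ℝ) : Prop :=
  ContDiff ℝ ∞ φ ∧ HasCompactSupport φ ∧ tsupport φ ⊆ U

/-- `g` is the weak derivative of `f` in the direction `v` on the open set `U`. -/
def HasWeakDeriv (U : Set E) (v : E) (f g : E → ℝ) : Prop :=
  ∀ φ : E → ℝ, IsTest U φ →
    ∫ z in U, f z * fderiv ℝ φ z v = -∫ z in U, g z * φ z

open Classical in
/-- The weak derivative in the direction `v` of `f ∈ L²(U)`, if it exists in `L²(U)`
(and `0` otherwise). -/
def wderiv {U : Set E} (v : E) (f : L2 U) : L2 U :=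
  if h : ∃ g : L2 U, HasWeakDeriv U v f g then h.choose else 0

/-- Weak derivatives in `L²(U)` are unique, so `wderiv` is the weak derivative. -/
theorem wderiv_eq [FiniteDimensional ℝ E] [BorelSpace E] {U : Set E} (hU : IsOpen U)
    [IsLocallyFiniteMeasure (volume : Measure E)]
    {v : E} {f g : L2 U} (h : HasWeakDeriv U v f g) : wderiv v f = g := by
  have hex : ∃ g : L2 U, HasWeakDeriv U v f g := ⟨g, h⟩
  have h2 : HasWeakDeriv U v f (wderiv v f) := by
    rw [wderiv, dif_pos hex]; exact hex.choose_spec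
  have loc : ∀ r : L2 U, LocallyIntegrable r (volume.restrict U) := fun r =>
    (Lp.memLp r).locallyIntegrable (by norm_num)
  have key : ∀ᵐ z ∂(volume.restrict U : Measure E), z ∈ U →
      (wderiv v f : E → ℝ) z - (g : E → ℝ) z = 0 := by
    refine hU.ae_eq_zero_of_integral_contDiff_smul_eq_zero
      (((loc _).sub (loc _)).locallyIntegrableOn _) ?_
    intro φ hφ hc hs
    have e1 := h φ ⟨hφ, hc, hs⟩
    have e2 := h2 φ ⟨hφ, hc, hs⟩
    have i : ∀ r : L2 U, Integrable (fun z => φ z * r z) (volume.restrict U) := fun r => by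
      simpa [smul_eq_mul] using
        (loc r).integrable_smul_left_of_hasCompactSupport hφ.continuous hc
    have e3 : ∫ z in U, (wderiv v f : E → ℝ) z * φ z = ∫ z in U, (g : E → ℝ) z * φ z := by
      linarith
    simp only [smul_eq_mul, mul_sub]
    rw [integral_sub (i _) (i _)]
    simp only [mul_comm (φ _)]
    rw [e3, sub_self]
  have hm : ∀ᵐ z ∂(volume.restrict U : Measure E), z ∈ U := ae_restrict_mem hU.measurableSet
  refine Lp.ext ?_
  filter_upwards [key, hm] with z hz hzU
  linarith [hz hzU]

/-- Vanishing of the trace of `f` on the part of `∂U` that is transversal to `v`: Green's formula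
for `f` in the direction `v` holds without boundary term for test functions that need not vanish
near `∂U`.  For `U = ℝ × (0,1)`, `v = (0,1)` and `f, ∂_y f ∈ L²(U)`, Green's formula
`∫_U (f ∂_yφ + ∂_y f φ) = ∫_ℝ f φ (x,1) dx - ∫_ℝ f φ (x,0) dx` shows that this
says `f|_{y=0,1} = 0`; likewise for `U = (0,1)`, `v = 1`. -/
def TraceZero {U : Set E} (v : E) (f : L2 U) : Prop :=
  ∀ φ : E → ℝ, IsTest univ φ →
    ∫ z in U, f z * fderiv ℝ φ z v = -∫ z in U, wderiv v f z * φ z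

end Weak

/-! ### The strip `ℝ × (0,1)` -/

/-- The (open) strip. -/
def strip : Set (ℝ × ℝ) := univ ×ˢ Ioo (0 : ℝ) 1

/-- `∂_x` on the strip. -/
abbrev dx (f : L2 strip) : L2 strip := wderiv ((1, 0) : ℝ × ℝ) f

/-- `∂_y` on the strip. -/
abbrev dy (f : L2 strip) : L2 strip := wderiv ((0, 1) : ℝ × ℝ) f

/-- `∂_x^a ∂_y^b` on the strip. -/
def D (a b : ℕ) (f : L2 strip) : L2 strip := dx^[a] (dy^[b] f)

/-- `f ∈ H^m(ℝ × (0,1))`. -/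
def MemH (m : ℕ) (f : L2 strip) : Prop :=
  ∀ a b : ℕ, a + b < m →
    (∃ g : L2 strip, HasWeakDeriv strip (1, 0) (D a b f) g) ∧
    (∃ g : L2 strip, HasWeakDeriv strip (0, 1) (D a b f) g)

/-- `‖f‖_{H^m}^2`, the sum of `‖∂^α f‖_{L²}^2` over the multi-indices `|α| ≤ m`. -/
def HNormSq (m : ℕ) (f : L2 strip) : ℝ :=
  ∑ j ∈ Finset.range (m + 1), ∑ a ∈ Finset.range (j + 1), ‖D a (j - a) f‖ ^ 2

/-- `‖f‖_{H^m}`. -/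
def HNorm (m : ℕ) (f : L2 strip) : ℝ := Real.sqrt (HNormSq m f)

/-- `f ∈ C([0,T]; H^m)`. -/
def ContH (m : ℕ) (T : ℝ) (f : ℝ → L2 strip) : Prop :=
  (∀ t ∈ Icc 0 T, MemH m (f t)) ∧
  ∀ a b : ℕ, a + b ≤ m → ContinuousOn (fun t => D a b (f t)) (Icc 0 T)

/-- `f' = ∂_t f` on `[0,T]` (one-sided at the ends) in the norm of `H^m`. -/
def TimeDerivH (m : ℕ) (T : ℝ) (f f' : ℝ → L2 strip) : Prop :=
  ∀ a b : ℕ, a + b ≤ m → ∀ t ∈ Icc 0 T,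
    HasDerivWithinAt (fun s => D a b (f s)) (D a b (f' t)) (Icc 0 T) t

/-- `f ∈ Y^m`: `f ∈ H^m` and `∂_y^{2n+1} f = 0` at `y = 0, 1`, for all orders
at which the trace is defined. -/
def MemY (m : ℕ) (f : L2 strip) : Prop :=
  MemH m f ∧ ∀ n : ℕ, 2 * n + 1 < m → TraceZero ((0, 1) : ℝ × ℝ) (D 0 (2 * n + 1) f)

/-- `f ∈ H^m` and `∂_y^{2n} f = 0` at `y = 0, 1`, `n = 0, 1, …`, for all orders
at which the trace is defined: this is `f ∈ X^m` together with `f|_{y=0,1} = 0`. -/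
def MemX₀ (m : ℕ) (f : L2 strip) : Prop :=
  MemH m f ∧ ∀ n : ℕ, 2 * n < m → TraceZero ((0, 1) : ℝ × ℝ) (D 0 (2 * n) f)

/-! ### The interval `(0,1)` -/

/-- The interval `(0,1)`. -/
def unitI : Set ℝ := Ioo 0 1

/-- `∂_y^j` on `(0,1)`. -/
def D1 (j : ℕ) (f : L2 unitI) : L2 unitI := (wderiv (1 : ℝ))^[j] f

/-- `f ∈ H^m(0,1)`. -/
def MemH1 (m : ℕ) (f : L2 unitI) : Prop :=
  ∀ j < m, ∃ g : L2 unitI, HasWeakDeriv unitI 1 (D1 j f) g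

/-- `‖f‖_{H^m(0,1)}`. -/
def HNorm1 (m : ℕ) (f : L2 unitI) : ℝ :=
  Real.sqrt (∑ j ∈ Finset.range (m + 1), ‖D1 j f‖ ^ 2)

/-- `f ∈ C([0,T]; H^m(0,1))`. -/
def ContH1 (m : ℕ) (T : ℝ) (f : ℝ → L2 unitI) : Prop :=
  (∀ t ∈ Icc 0 T, MemH1 m (f t)) ∧
  ∀ j ≤ m, ContinuousOn (fun t => D1 j (f t)) (Icc 0 T)

/-- `f ∈ H^m(0,1)` and `∂_y^{2n+1} f = 0` at `y = 0, 1`, for all orders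
at which the boundary value is defined. -/
def MemY1 (m : ℕ) (f : L2 unitI) : Prop :=
  MemH1 m f ∧ ∀ n : ℕ, 2 * n + 1 < m → TraceZero (1 : ℝ) (D1 (2 * n + 1) f)

/-! ### The background flow and the perturbation -/

/-- The unknowns as curves in `L²`: the background `Φ̄(t,y)`, `Ψ(t,y)`, the perturbation
`u = (u₁, u₂)`, `ρ`, and the time derivatives `∂_t u₁`, `∂_t u₂`, `∂_t ρ`. -/
structure Flow where
  Φ : ℝ → L2 unitI
  Ψ : ℝ → L2 unitI
  u₁ : ℝ → L2 strip
  u₂ : ℝ → L2 strip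
  ρ : ℝ → L2 strip
  ut₁ : ℝ → L2 strip
  ut₂ : ℝ → L2 strip
  ρt : ℝ → L2 strip

namespace Flow

/-- The background `(Φ̄, Ψ) ∈ C([0,T]; H^{k+3})` solves
`∂_t Φ̄ + C₀ Ψ = 0`, `∂_t Ψ + κ Ψ = -C₀ ∂_y² Φ̄` (that is,
`∂_t² Φ̄ + κ ∂_t Φ̄ - C₀² ∂_y² Φ̄ = 0` and `Ψ = -∂_t Φ̄ / C₀`), and the odd
`y`-derivatives of `Φ̄` and `Ψ` vanish at `y = 0, 1`. -/
structure IsBackground (F : Flow) (k : ℕ) (κ C₀ T : ℝ) : Prop where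
  contΦ : ContH1 (k + 3) T F.Φ
  contΨ : ContH1 (k + 3) T F.Ψ
  bdryΦ : ∀ t ∈ Icc 0 T, MemY1 (k + 3) (F.Φ t)
  bdryΨ : ∀ t ∈ Icc 0 T, MemY1 (k + 3) (F.Ψ t)
  eqΦ : ∀ t ∈ Icc 0 T, HasDerivWithinAt F.Φ (-(C₀ • F.Ψ t)) (Icc 0 T) t
  eqΨ : ∀ t ∈ Icc 0 T,
    HasDerivWithinAt F.Ψ (-(κ • F.Ψ t) - C₀ • D1 2 (F.Φ t)) (Icc 0 T) t

/-- The transport equation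
`∂_t ρ + u₂ ∂_y Φ̄ + C₀ u₁ + (u·∇)ρ + Ψ ∂_x ρ = 0` at time `t`. -/
def TransportEq (F : Flow) (C₀ t : ℝ) : Prop :=
  ∀ᵐ z ∂(volume.restrict strip : Measure (ℝ × ℝ)),
    F.ρt t z + F.u₂ t z * D1 1 (F.Φ t) z.2 + C₀ * F.u₁ t z
      + (F.u₁ t z * D 1 0 (F.ρ t) z + F.u₂ t z * D 0 1 (F.ρ t) z)
      + F.Ψ t z.2 * D 1 0 (F.ρ t) z = 0

/-- The momentum equation
`∂_t u + (u·∇)u + (u₂ ∂_y Ψ, 0) + κ u + Ψ ∂_x u + ∇P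
  = (∇^⊥ρ·∇)∇^⊥ρ - (∂_x ρ ∂_y² Φ̄, 0) + (∂_y Φ̄ ∂_{xy} ρ, -∂_y Φ̄ ∂_x² ρ)
    - C₀ (∂_y² ρ, -∂_{xy} ρ)`
at time `t` with some pressure `P`, where `∇^⊥ρ = (∂_y ρ, -∂_x ρ)` and `(q₁, q₂) = ∇P`.
All terms but `∇P` are in `L²`, hence so is `∇P`. -/
def MomentumEq (F : Flow) (κ C₀ t : ℝ) : Prop :=
  ∃ (P : ℝ × ℝ → ℝ) (q₁ q₂ : L2 strip), LocallyIntegrableOn P strip volume ∧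
    HasWeakDeriv strip (1, 0) P q₁ ∧ HasWeakDeriv strip (0, 1) P q₂ ∧
    ∀ᵐ z ∂(volume.restrict strip : Measure (ℝ × ℝ)),
      (F.ut₁ t z + (F.u₁ t z * D 1 0 (F.u₁ t) z + F.u₂ t z * D 0 1 (F.u₁ t) z)
          + F.u₂ t z * D1 1 (F.Ψ t) z.2 + κ * F.u₁ t z
          + F.Ψ t z.2 * D 1 0 (F.u₁ t) z + q₁ z
        = (D 0 1 (F.ρ t) z * D 1 1 (F.ρ t) z - D 1 0 (F.ρ t) z * D 0 2 (F.ρ t) z)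
          - D 1 0 (F.ρ t) z * D1 2 (F.Φ t) z.2
          + D1 1 (F.Φ t) z.2 * D 1 1 (F.ρ t) z
          - C₀ * D 0 2 (F.ρ t) z) ∧
      (F.ut₂ t z + (F.u₁ t z * D 1 0 (F.u₂ t) z + F.u₂ t z * D 0 1 (F.u₂ t) z)
          + κ * F.u₂ t z
          + F.Ψ t z.2 * D 1 0 (F.u₂ t) z + q₂ z
        = (-(D 0 1 (F.ρ t) z * D 2 0 (F.ρ t) z) + D 1 0 (F.ρ t) z * D 1 1 (F.ρ t) z)
          - D1 1 (F.Φ t) z.2 * D 2 0 (F.ρ t) z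
          + C₀ * D 1 1 (F.ρ t) z)

/-- `(u, ρ)` is a solution on `[0,T]` of the perturbation equations around the background, in the
class `u ∈ C([0,T]; H^{k+1}) ∩ C¹([0,T]; H^k)`, `ρ ∈ C([0,T]; H^{k+2}) ∩ C¹([0,T]; H^{k+1})`
in which all norms in `E_k` and `Γ_{k+1}` are defined, with the boundary conditions
`∂_y^{2n} u₂ = ∂_y^{2n+1} u₁ = ∂_y^{2n+1} ρ = 0` at `y = 0, 1`. (These contain `u₂ = 0` and
`∂_y u₁ - ∂_x u₂ = 0` at `y = 0, 1`; the condition `u → 0` as `|x| → ∞` is contained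
in `u(t) ∈ H^{k+1}`.) -/
structure IsSolution (F : Flow) (k : ℕ) (κ C₀ T : ℝ) : Prop where
  background : F.IsBackground k κ C₀ T
  cont_u₁ : ContH (k + 1) T F.u₁
  cont_u₂ : ContH (k + 1) T F.u₂
  cont_ρ : ContH (k + 2) T F.ρ
  cont_ut₁ : ContH k T F.ut₁
  cont_ut₂ : ContH k T F.ut₂
  cont_ρt : ContH (k + 1) T F.ρt
  deriv_u₁ : TimeDerivH k T F.u₁ F.ut₁
  deriv_u₂ : TimeDerivH k T F.u₂ F.ut₂
  deriv_ρ : TimeDerivH (k + 1) T F.ρ F.ρt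
  bdry_u₁ : ∀ t ∈ Icc 0 T, MemY (k + 1) (F.u₁ t)
  bdry_u₂ : ∀ t ∈ Icc 0 T, MemX₀ (k + 1) (F.u₂ t)
  bdry_ρ : ∀ t ∈ Icc 0 T, MemY (k + 2) (F.ρ t)
  transport : ∀ t ∈ Icc 0 T, F.TransportEq C₀ t
  momentum : ∀ t ∈ Icc 0 T, F.MomentumEq κ C₀ t
  div_free : ∀ t ∈ Icc 0 T, dx (F.u₁ t) + dy (F.u₂ t) = 0

/-- `E_k²(t) = ½ (‖u‖²_{H^k} + ‖∂_t u‖²_{H^k} + ‖ρ‖²_{H^{k+1}} + ‖∂_t ρ‖²_{H^{k+1}})`. -/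
def ESq (F : Flow) (k : ℕ) (t : ℝ) : ℝ :=
  (1 / 2) * ((HNormSq k (F.u₁ t) + HNormSq k (F.u₂ t))
    + (HNormSq k (F.ut₁ t) + HNormSq k (F.ut₂ t))
    + HNormSq (k + 1) (F.ρ t) + HNormSq (k + 1) (F.ρt t))

/-- `E_k(t)`. -/
def En (F : Flow) (k : ℕ) (t : ℝ) : ℝ := Real.sqrt (F.ESq k t)

/-- `∫_Ω (1 + ∂_x ρ(t)) |∇^m f|² dx dy`, where `∇^m f` is the tensor of all `m`-th derivatives:
the derivative `∂_x^a ∂_y^(m-a) f` occurs in it `m.choose a` times. -/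
def weighted (F : Flow) (m : ℕ) (t : ℝ) (f : L2 strip) : ℝ :=
  ∑ a ∈ Finset.range (m + 1), (m.choose a : ℝ) *
    ∫ z in strip, (1 + D 1 0 (F.ρ t) z) * (D a (m - a) f z) ^ 2

/-- `∫_Ω (1 + ∂_x ρ) |∇^m u|² dx dy` at time `t`. -/
def weightedU (F : Flow) (m : ℕ) (t : ℝ) : ℝ :=
  F.weighted m t (F.u₁ t) + F.weighted m t (F.u₂ t)

/-- `Γ_m²(t) = ½ ∫_Ω (1 + ∂_x ρ) |∇^m u|² + (1 + ∂_x ρ) |∇^m ∇^⊥ρ|² dx dy`. -/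
def ΓSq (F : Flow) (m : ℕ) (t : ℝ) : ℝ :=
  (1 / 2) * (F.weightedU m t
    + (F.weighted m t (dy (F.ρ t)) + F.weighted m t (-dx (F.ρ t))))

/-- `‖Φ̄(t)‖_{H^m} + ‖Ψ(t)‖_{H^m}`. -/
def bgNorm (F : Flow) (m : ℕ) (t : ℝ) : ℝ := HNorm1 m (F.Φ t) + HNorm1 m (F.Ψ t)

end Flow

end MHDStrip

end

/-!
The boundary conditions say that `u₁` and `ρ` extend evenly, and `u₂` oddly, across the walls
`y = 0, 1`, and that the extended functions are as regular on the cylinder `ℝ × ℝ/2ℤ` as the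
original ones are on the strip (`MemH.grid_extD`). This follows by testing the extended function and
splitting the test function into its even and odd parts: against the even part a vanishing trace is
used, which is itself defined by testing up to the walls, and the odd part vanishes on the walls, so
that it can be cut off there (`integral_eq_zero_of_isTest`). On the cylinder weak derivatives in
`L²` are the generators of translations (`HasD`), so that Sobolev regularity (`Hm`) and convergence
(`ConvH`) can be handled by the functional analysis of isometric groups, and finite differences are
available.

On the cylinder the equations are rewritten in the Elsässer variables `z^± = u ± ∇^⊥ρ`
(`els`, `Flow.IsSolution.exists_elsasser`): with `β^± = Ψ ± ∂_yΦ̄`,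
`∂_t z^± + (z^∓ + (β^∓, ± C₀))·∇z^± + (z^∓₂ ∂_yβ^±, 0) + (κ/2) (z^+ + z^-) + ∇p = 0`,
`∇·z^± = 0`.
Each variable is transported by a divergence free field, and no other term except the pressure
contains derivatives of `z^±`. The weighted energy of `u` and `∇^⊥ρ` is that of `z^+` and `z^-`,
with the same weight `1 + ∂_xρ` for both. So in the energy estimate for `∂^v z^±`, `|v| = k + 1`
(`Elsasser.energy_estimate`):

* the transport term only hits the weight, and gives a derivative of the weight times the energy;
* in the pressure term an integration by parts moves a derivative onto the weight, because
  `∂^v z^±` is divergence free. Only derivatives of order `k` of the pressure gradient are left, as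
  it is curl free, and these are expressed by the equation itself, hence by `z` in `H^{k+1}` and
  `∂_t z` in `H^k` (`Elsasser.N_pressure_le`);
* the commutators of `∂^v` with the transport are bounded in `L²` by a low norm times the top norm,
  by interpolation between Sobolev norms of integer order (`NN_mul_le`, `norm_comm_le`);
* the damping gives the term `κ ∫ (1 + ∂_xρ) |∇^{k+1}u|²`.

Derivatives of order `k + 1` of the solution are not known to be differentiable in time. Therefore
the energy identity is proved for difference quotients of derivatives of order `k`, and the limit
is taken under a time integral (`hasDerivWithinAt_of_tendsto`, `hasDerivWithinAt_weighted_energy`);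
this also gives the differentiability of the energy.

Finally the energies on the cylinder are multiples of those on the strip
(`Flow.IsSolution.energy_eq`, `Flow.IsSolution.damping_eq`). A Sobolev embedding with an explicit
constant (`cyl_sup_bound_real`) shows that the weight is at least `1/4`
(`Flow.IsSolution.wt_ge`), so that `E_k² + Γ_{k+1}²` controls the norms in the estimate. The
estimate on the cylinder contains the product of `E_4` and the norm of the background; this is
where one of the two is required to be at most `M` (`Flow.IsSolution.main_estimate`).
-/

noncomputable section

namespace MHDStrip

open Filter Topology

open scoped RealInnerProductSpace

/-! ### Isometric shift groups and the derivatives they generate -/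

/-- A normed space with a strongly continuous isometric action of the translation group `ℝ²`. -/
class Shift (E : Type*) [NormedAddCommGroup E] [NormedSpace ℝ E] where
  /-- The translation by a vector of the plane. -/
  τ : ℝ × ℝ → E →L[ℝ] E
  τ_zero : ∀ f, τ 0 f = f
  τ_add : ∀ s t f, τ (s + t) f = τ s (τ t f)
  norm_τ : ∀ s f, ‖τ s f‖ = ‖f‖
  continuous_τ : ∀ f, Continuous fun s => τ s f

/-- The coordinate vectors of the plane. -/
def dir (i : Fin 2) : ℝ × ℝ := if i = 0 then (1, 0) else (0, 1)

section Generator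

variable {E : Type*} [NormedAddCommGroup E] [NormedSpace ℝ E] [Shift E]
variable {F : Type*} [NormedAddCommGroup F] [NormedSpace ℝ F] [Shift F]

/-- Translation by `t` in the `i`-th coordinate direction. -/
def sh (i : Fin 2) (t : ℝ) : E →L[ℝ] E := Shift.τ (t • dir i)

theorem sh_zero (i : Fin 2) (f : E) : sh i 0 f = f := by simp [sh, Shift.τ_zero]

theorem sh_add (i : Fin 2) (s t : ℝ) (f : E) : sh i (s + t) f = sh i s (sh i t f) := by
  simp [sh, add_smul, Shift.τ_add]

theorem norm_sh (i : Fin 2) (t : ℝ) (f : E) : ‖sh i t f‖ = ‖f‖ := Shift.norm_τ _ _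

theorem sh_comm (i j : Fin 2) (s t : ℝ) (f : E) : sh i s (sh j t f) = sh j t (sh i s f) := by
  simp only [sh, ← Shift.τ_add, add_comm]

theorem continuous_sh (i : Fin 2) (f : E) : Continuous fun t => sh i t f :=
  (Shift.continuous_τ f).comp (by fun_prop)

/-- Translates converge along with the translated vectors and the translation lengths. -/
theorem tendsto_sh {ι : Type*} {l : Filter ι} (i : Fin 2) {t : ι → ℝ} {t₀ : ℝ} {f : ι → E} {f₀ : E}
    (ht : Tendsto t l (𝓝 t₀)) (hf : Tendsto f l (𝓝 f₀)) :
    Tendsto (fun n => sh i (t n) (f n)) l (𝓝 (sh i t₀ f₀)) := by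
  have h1 : Tendsto (fun n => sh i (t n) (f n - f₀)) l (𝓝 0) := by
    refine tendsto_zero_iff_norm_tendsto_zero.2 ?_
    simp only [norm_sh]
    exact tendsto_iff_norm_sub_tendsto_zero.1 hf
  have h2 := h1.add (((continuous_sh i f₀).tendsto t₀).comp ht)
  simpa using h2

/-- `g` is the derivative of `f` along the translations in the `i`-th direction. -/
def HasD (i : Fin 2) (f g : E) : Prop := HasDerivAt (fun t : ℝ => sh i t f) g 0

/-- The derivative of `f` in the `i`-th direction, `0` if `f` is not differentiable. -/
def der (i : Fin 2) (f : E) : E := deriv (fun t : ℝ => sh i t f) 0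

theorem HasD.der_eq {i : Fin 2} {f g : E} (h : HasD i f g) : der i f = g := HasDerivAt.deriv h

theorem HasD.add {i : Fin 2} {f g f' g' : E} (h : HasD i f g) (h' : HasD i f' g') :
    HasD i (f + f') (g + g') := by
  simpa only [HasD, map_add] using HasDerivAt.fun_add h h'

theorem HasD.const_smul {i : Fin 2} {f g : E} (c : ℝ) (h : HasD i f g) :
    HasD i (c • f) (c • g) := by
  simpa only [HasD, map_smul] using HasDerivAt.fun_const_smul c h

theorem HasD.neg {i : Fin 2} {f g : E} (h : HasD i f g) : HasD i (-f) (-g) := by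
  simpa using h.const_smul (-1)

theorem HasD.sub {i : Fin 2} {f g f' g' : E} (h : HasD i f g) (h' : HasD i f' g') :
    HasD i (f - f') (g - g') := by
  simpa [sub_eq_add_neg] using h.add h'.neg

theorem HasD.zero (i : Fin 2) : HasD i (0 : E) 0 := by
  simpa [HasD] using hasDerivAt_const (0 : ℝ) (0 : E)

/-- Continuous linear maps that commute with the translations respect derivatives. -/
theorem HasD.map {i : Fin 2} {f g : E} (h : HasD i f g) (A : E →L[ℝ] F)
    (hA : ∀ t f, A (sh i t f) = sh i t (A f)) : HasD i (A f) (A g) := by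
  have := A.hasFDerivAt.comp_hasDerivAt (0 : ℝ) h
  simpa [HasD, Function.comp_def, hA] using this

/-- Isometric linear maps that commute with the translations reflect derivatives. -/
theorem HasD.of_map {i : Fin 2} {f g : E} (A : E →L[ℝ] F) {c : ℝ} (hc : c ≠ 0)
    (hn : ∀ f, ‖A f‖ = c * ‖f‖)
    (hA : ∀ t f, A (sh i t f) = sh i t (A f)) (h : HasD i (A f) (A g)) : HasD i f g := by
  rw [HasD, hasDerivAt_iff_tendsto_slope] at h ⊢
  rw [tendsto_iff_norm_sub_tendsto_zero] at h ⊢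
  have h2 := h.const_mul c⁻¹
  rw [mul_zero] at h2
  refine h2.congr fun t => ?_
  have : slope (fun t => sh i t (A f)) 0 t - A g
      = A (slope (fun t => sh i t f) 0 t - g) := by
    simp [slope_def_module, hA]
  rw [this, hn, ← mul_assoc, inv_mul_cancel₀ hc, one_mul]

theorem HasD.shift {i : Fin 2} {f g : E} (h : HasD i f g) (j : Fin 2) (s : ℝ) :
    HasD i (sh j s f) (sh j s g) :=
  h.map _ fun t f => (sh_comm i j t s f).symm

theorem HasD.hasDerivAt {i : Fin 2} {f g : E} (h : HasD i f g) (t : ℝ) :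
    HasDerivAt (fun t : ℝ => sh i t f) (sh i t g) t := by
  have h1 := h.shift i t
  have h2 : HasDerivAt (fun r : ℝ => sh i (r - t) (sh i t f))
      (sh i t g) t := by
    have h3 : HasDerivAt (fun r : ℝ => sh i r (sh i t f))
      (sh i t g) (t - t) := by simpa [HasD] using h1
    exact h3.comp_sub_const t t
  refine h2.congr_of_eventuallyEq (Eventually.of_forall fun r => ?_)
  simp [← sh_add]

theorem HasD.eq_integral [CompleteSpace E] {i : Fin 2} {f g : E} (h : HasD i f g) (t : ℝ) :
    sh i t f - f = ∫ s in (0 : ℝ)..t, sh i s g := by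
  have := intervalIntegral.integral_eq_sub_of_hasDerivAt (a := 0) (b := t)
    (fun s _ => h.hasDerivAt s) ((continuous_sh i g).intervalIntegrable _ _)
  rw [this, sh_zero]

theorem hasD_of_integral [CompleteSpace E] {i : Fin 2} {f g : E}
    (h : ∀ t, sh i t f - f = ∫ s in (0 : ℝ)..t, sh i s g) : HasD i f g := by
  have h1 : HasDerivAt (fun t => ∫ s in (0 : ℝ)..t, sh i s g) (sh i 0 g) 0 :=
    intervalIntegral.integral_hasDerivAt_right ((continuous_sh i g).intervalIntegrable _ _)
      (continuous_sh i g).stronglyMeasurable.stronglyMeasurableAtFilter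
      (continuous_sh i g).continuousAt
  have h2 := h1.add_const f
  rw [sh_zero] at h2
  refine h2.congr_of_eventuallyEq (Eventually.of_forall fun t => ?_)
  simp [← h t]

/-- The derivative is a closed operator. -/
theorem hasD_of_tendsto [CompleteSpace E] {ι : Type*} {l : Filter ι} [l.NeBot] {i : Fin 2}
    {f g : ι → E} {f₀ g₀ : E} (hf : Tendsto f l (𝓝 f₀)) (hg : Tendsto g l (𝓝 g₀))
    (h : ∀ᶠ n in l, HasD i (f n) (g n)) : HasD i f₀ g₀ := by
  refine hasD_of_integral fun t => ?_
  have h1 : Tendsto (fun n => sh i t (f n) - f n) l (𝓝 (sh i t f₀ - f₀)) :=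
    (((sh i t).continuous.tendsto f₀).comp hf).sub hf
  refine tendsto_nhds_unique h1 ?_
  have h2 : Tendsto (fun n => ∫ s in (0 : ℝ)..t, sh i s (g n)) l
      (𝓝 (∫ s in (0 : ℝ)..t, sh i s g₀)) := by
    rw [tendsto_iff_norm_sub_tendsto_zero]
    have h3 : Tendsto (fun n => ‖g n - g₀‖ * |t - 0|) l (𝓝 0) := by
      simpa using (tendsto_iff_norm_sub_tendsto_zero.1 hg).mul_const |t - 0|
    refine squeeze_zero (fun _ => norm_nonneg _) (fun n => ?_) h3
    rw [← intervalIntegral.integral_sub ((continuous_sh i _).intervalIntegrable _ _)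
      ((continuous_sh i _).intervalIntegrable _ _)]
    refine intervalIntegral.norm_integral_le_of_norm_le_const fun s _ => ?_
    rw [← map_sub, norm_sh]
  refine h2.congr' ?_
  filter_upwards [h] with n hn
  exact (hn.eq_integral t).symm

/-- The difference quotient in the `i`-th direction. -/
def dq (i : Fin 2) (h : ℝ) (f : E) : E := h⁻¹ • (sh i h f - f)

theorem dq_add (i : Fin 2) (h : ℝ) (f g : E) : dq i h (f + g) = dq i h f + dq i h g := by
  simp [dq, ← smul_add]; congr 1; abel

theorem dq_neg (i : Fin 2) (h : ℝ) (f : E) : dq i h (-f) = -dq i h f := by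
  rw [dq, dq, ← smul_neg, map_neg, neg_sub, sub_neg_eq_add, add_comm, sub_eq_add_neg]

theorem dq_sum {ι : Type*} (s : Finset ι) (i : Fin 2) (h : ℝ) (f : ι → E) :
    dq i h (∑ j ∈ s, f j) = ∑ j ∈ s, dq i h (f j) := by
  simp [dq, ← Finset.smul_sum, Finset.sum_sub_distrib]

theorem tendsto_dq {i : Fin 2} {f g : E} (h : HasD i f g) :
    Tendsto (fun t => dq i t f) (𝓝[≠] 0) (𝓝 g) := by
  have := hasDerivAt_iff_tendsto_slope.1 h
  refine this.congr fun t => ?_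
  simp [slope_def_module, dq, sh_zero]

theorem norm_dq_le [CompleteSpace E] {i : Fin 2} {f g : E} (h : HasD i f g) (t : ℝ) :
    ‖dq i t f‖ ≤ ‖g‖ := by
  rcases eq_or_ne t 0 with rfl | ht
  · simp [dq]
  rw [dq, h.eq_integral t, norm_smul, norm_inv, Real.norm_eq_abs]
  have := intervalIntegral.norm_integral_le_of_norm_le_const (a := 0) (b := t) (C := ‖g‖)
    (f := fun s => sh i s g) fun s _ => (norm_sh i s g).le
  rw [sub_zero] at this
  calc |t|⁻¹ * _ ≤ |t|⁻¹ * (‖g‖ * |t|) := by gcongr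
    _ = ‖g‖ := by field_simp

theorem HasD.diffQuot {i : Fin 2} {f g : E} (h : HasD i f g) (j : Fin 2) (t : ℝ) :
    HasD i (dq j t f) (dq j t g) := ((h.shift j t).sub h).const_smul _

/-- Derivatives in the two directions commute. -/
theorem HasD.comm [CompleteSpace E] {i j : Fin 2} {f fi fj fji : E} (hi : HasD i f fi)
    (hj : HasD j f fj) (hji : HasD i fj fji) : HasD j fi fji := by
  refine hasD_of_integral fun t => ?_
  have h1 := tendsto_dq ((hi.shift j t).sub hi)
  refine tendsto_nhds_unique h1 ?_
  rw [hj.eq_integral t]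
  have e : ∀ r, dq i r (∫ s in (0 : ℝ)..t, sh j s fj)
      = ∫ s in (0 : ℝ)..t, sh j s (dq i r fj) := by
    intro r
    have c : Continuous fun s => sh j s fj := continuous_sh j fj
    have c2 : Continuous fun s => sh i r (sh j s fj) := (sh i r).continuous.comp c
    simp only [dq, map_smul, map_sub, ← sh_comm i j]
    rw [intervalIntegral.integral_smul, intervalIntegral.integral_sub
      (c2.intervalIntegrable _ _) (c.intervalIntegrable _ _),
      ContinuousLinearMap.intervalIntegral_comp_comm _ (c.intervalIntegrable _ _)]
  simp only [e]
  rw [tendsto_iff_norm_sub_tendsto_zero]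
  have h3 : Tendsto (fun r => ‖dq i r fj - fji‖ * |t - 0|) (𝓝[≠] 0) (𝓝 0) := by
    simpa using (tendsto_iff_norm_sub_tendsto_zero.1 (tendsto_dq hji)).mul_const |t - 0|
  refine squeeze_zero (fun _ => norm_nonneg _) (fun n => ?_) h3
  rw [← intervalIntegral.integral_sub ((continuous_sh j _).intervalIntegrable _ _)
    ((continuous_sh j _).intervalIntegrable _ _)]
  refine intervalIntegral.norm_integral_le_of_norm_le_const fun s _ => ?_
  rw [← map_sub, norm_sh]

/-! ### Sobolev regularity with respect to a shift group -/

/-- `f` has all derivatives of order at most `m`. -/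
def Hm : ℕ → E → Prop
  | 0, _ => True
  | m + 1, f => ∀ i, HasD i f (der i f) ∧ Hm m (der i f)

theorem Hm.hasD {m : ℕ} {f : E} (h : Hm (m + 1) f) (i : Fin 2) : HasD i f (der i f) := (h i).1

theorem Hm.der {m : ℕ} {f : E} (h : Hm (m + 1) f) (i : Fin 2) : Hm m (der i f) := (h i).2

theorem hm_succ {m : ℕ} {f : E} {g : Fin 2 → E} (h : ∀ i, HasD i f (g i)) (h' : ∀ i, Hm m (g i)) :
    Hm (m + 1) f := fun i => by
  rw [(h i).der_eq]; exact ⟨h i, h' i⟩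

theorem Hm.mono {m n : ℕ} (hmn : m ≤ n) {f : E} (h : Hm n f) : Hm m f := by
  induction m generalizing n f with
  | zero => trivial
  | succ m ih =>
    obtain ⟨n, rfl⟩ : ∃ k, n = k + 1 := ⟨n - 1, by omega⟩
    exact fun i => ⟨h.hasD i, ih (by omega) (h.der i)⟩

theorem Hm.hasD' {m : ℕ} {f : E} (h : Hm m f) (hm : 1 ≤ m) (i : Fin 2) :
    HasD i f (MHDStrip.der i f) := (h.mono hm).hasD i

theorem der_add {f g : E} (hf : Hm 1 f) (hg : Hm 1 g) (i : Fin 2) :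
    der i (f + g) = der i f + der i g := ((hf.hasD i).add (hg.hasD i)).der_eq

theorem der_smul {f : E} (c : ℝ) (hf : Hm 1 f) (i : Fin 2) :
    der i (c • f) = c • der i f := ((hf.hasD i).const_smul c).der_eq

theorem der_neg {f : E} (hf : Hm 1 f) (i : Fin 2) :
    der i (-f) = -der i f := (hf.hasD i).neg.der_eq

theorem der_zero (i : Fin 2) : der i (0 : E) = 0 := (HasD.zero i).der_eq

theorem Hm.add {m : ℕ} {f g : E} (hf : Hm m f) (hg : Hm m g) : Hm m (f + g) := by
  induction m generalizing f g with
  | zero => trivial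
  | succ m ih =>
    exact hm_succ (fun i => (hf.hasD i).add (hg.hasD i)) fun i => ih (hf.der i) (hg.der i)

theorem Hm.smul {m : ℕ} {f : E} (c : ℝ) (hf : Hm m f) : Hm m (c • f) := by
  induction m generalizing f with
  | zero => trivial
  | succ m ih => exact hm_succ (fun i => (hf.hasD i).const_smul c) fun i => ih (hf.der i)

theorem Hm.neg {m : ℕ} {f : E} (hf : Hm m f) : Hm m (-f) := by simpa using hf.smul (-1)

theorem Hm.sub {m : ℕ} {f g : E} (hf : Hm m f) (hg : Hm m g) : Hm m (f - g) := by
  simpa [sub_eq_add_neg] using hf.add hg.neg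

theorem Hm.zero (m : ℕ) : Hm m (0 : E) := by
  induction m with
  | zero => trivial
  | succ m ih => exact hm_succ (fun i => HasD.zero i) fun _ => ih

theorem Hm.sum {ι : Type*} {m : ℕ} (s : Finset ι) {f : ι → E} (h : ∀ j ∈ s, Hm m (f j)) :
    Hm m (∑ j ∈ s, f j) := by
  classical
  induction s using Finset.induction_on with
  | empty => simpa using Hm.zero m
  | insert a s ha ih =>
    rw [Finset.sum_insert ha]
    exact (h a (by simp)).add (ih fun j hj => h j (by simp [hj]))

theorem der_sum {ι : Type*} (s : Finset ι) {f : ι → E} (h : ∀ j ∈ s, Hm 1 (f j)) (i : Fin 2) :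
    der i (∑ j ∈ s, f j) = ∑ j ∈ s, der i (f j) := by
  classical
  induction s using Finset.induction_on with
  | empty => simpa using der_zero i
  | insert a s ha ih =>
    rw [Finset.sum_insert ha, Finset.sum_insert ha, der_add (h a (by simp))
      (Hm.sum _ fun j hj => h j (by simp [hj])), ih fun j hj => h j (by simp [hj])]

theorem der_dq {f : E} (hf : Hm 1 f) (i j : Fin 2) (t : ℝ) :
    der i (dq j t f) = dq j t (der i f) := ((hf.hasD i).diffQuot j t).der_eq

theorem Hm.shift {m : ℕ} {f : E} (hf : Hm m f) (j : Fin 2) (t : ℝ) : Hm m (sh j t f) := by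
  induction m generalizing f with
  | zero => trivial
  | succ m ih => exact hm_succ (fun i => (hf.hasD i).shift j t) fun i => ih (hf.der i)

theorem Hm.diffQuot {m : ℕ} {f : E} (hf : Hm m f) (j : Fin 2) (t : ℝ) : Hm m (dq j t f) :=
  ((hf.shift j t).sub hf).smul _

theorem der_comm [CompleteSpace E] {f : E} (hf : Hm 2 f) (i j : Fin 2) :
    der i (der j f) = der j (der i f) :=
  ((hf.hasD i).comm (hf.hasD j) ((hf.der j).hasD i)).der_eq.symm

/-- The Sobolev norm of order `m`, as the sum of the norms of the derivatives along all words of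
length at most `m` in the two directions. -/
def N : ℕ → E → ℝ
  | 0, f => ‖f‖
  | m + 1, f => ‖f‖ + (N m (der 0 f) + N m (der 1 f))

theorem N_nonneg (m : ℕ) (f : E) : 0 ≤ N m f := by
  induction m generalizing f with
  | zero => exact norm_nonneg f
  | succ m ih => exact add_nonneg (norm_nonneg f) (add_nonneg (ih _) (ih _))

theorem norm_le_N (m : ℕ) (f : E) : ‖f‖ ≤ N m f := by
  cases m with
  | zero => exact le_rfl
  | succ m => exact le_add_of_nonneg_right (add_nonneg (N_nonneg _ _) (N_nonneg _ _))

theorem N_der_le (m : ℕ) (f : E) (i : Fin 2) : N m (der i f) ≤ N (m + 1) f := by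
  have h0 := N_nonneg m (der 0 f)
  have h1 := N_nonneg m (der 1 f)
  have h2 := norm_nonneg f
  fin_cases i <;> simp only [N, Fin.zero_eta, Fin.mk_one] <;> linarith

theorem N_mono {m n : ℕ} (hmn : m ≤ n) (f : E) : N m f ≤ N n f := by
  induction m generalizing n f with
  | zero => exact norm_le_N n f
  | succ m ih =>
    obtain ⟨n, rfl⟩ : ∃ k, n = k + 1 := ⟨n - 1, by omega⟩
    have h0 := ih (n := n) (by omega) (der 0 f)
    have h1 := ih (n := n) (by omega) (der 1 f)
    simp only [N]; linarith

theorem N_add_le {m : ℕ} {f g : E} (hf : Hm m f) (hg : Hm m g) : N m (f + g) ≤ N m f + N m g := by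
  induction m generalizing f g with
  | zero => exact norm_add_le f g
  | succ m ih =>
    have h0 := ih (hf.der 0) (hg.der 0)
    have h1 := ih (hf.der 1) (hg.der 1)
    have h2 := norm_add_le f g
    simp only [N, der_add (hf.mono (by omega)) (hg.mono (by omega))]
    linarith

theorem N_smul {m : ℕ} {f : E} (c : ℝ) (hf : Hm m f) : N m (c • f) = |c| * N m f := by
  induction m generalizing f with
  | zero => exact norm_smul c f
  | succ m ih =>
    simp only [N, der_smul c (hf.mono (by omega)), ih (hf.der _), norm_smul, Real.norm_eq_abs]
    ring

theorem N_neg {m : ℕ} {f : E} (hf : Hm m f) : N m (-f) = N m f := by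
  simpa using N_smul (-1) hf

theorem N_sub_le {m : ℕ} {f g : E} (hf : Hm m f) (hg : Hm m g) : N m (f - g) ≤ N m f + N m g := by
  rw [sub_eq_add_neg, ← N_neg hg]; exact N_add_le hf hg.neg

theorem N_zero (m : ℕ) : N m (0 : E) = 0 := by
  simpa using N_smul 0 (Hm.zero (E := E) m)

/-- The derivative along a word of directions, the first letter being applied last. -/
def dw : List (Fin 2) → E → E
  | [], f => f
  | i :: w, f => der i (dw w f)

theorem dw_append (v w : List (Fin 2)) (f : E) : dw (v ++ w) f = dw v (dw w f) := by
  induction v with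
  | nil => rfl
  | cons i v ih => simp [dw, ih]

theorem Hm.dw {m n : ℕ} {f : E} {w : List (Fin 2)} (hf : Hm n f) (h : m + w.length ≤ n) :
    Hm m (dw w f) := by
  induction w generalizing m with
  | nil => exact hf.mono (by simpa using h)
  | cons i w ih => exact (ih (m := m + 1) (by simp at h; omega)).der i

theorem N_dw_le (m : ℕ) (w : List (Fin 2)) (f : E) : N m (dw w f) ≤ N (m + w.length) f := by
  induction w generalizing m with
  | nil => exact le_rfl
  | cons i w ih =>
    refine (N_der_le m (dw w f) i).trans ((ih (m + 1)).trans (le_of_eq ?_))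
    congr 1; simp; omega

theorem norm_dw_le (w : List (Fin 2)) (f : E) : ‖dw w f‖ ≤ N w.length f := by
  simpa [N] using N_dw_le 0 w f

theorem dw_add {w : List (Fin 2)} {f g : E} (hf : Hm w.length f) (hg : Hm w.length g) :
    dw w (f + g) = dw w f + dw w g := by
  induction w with
  | nil => rfl
  | cons i w ih =>
    simp only [dw]
    rw [ih (hf.mono (by simp)) (hg.mono (by simp)),
      der_add (hf.dw (by simp [add_comm])) (hg.dw (by simp [add_comm]))]

theorem dw_smul {w : List (Fin 2)} {f : E} (c : ℝ) (hf : Hm w.length f) :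
    dw w (c • f) = c • dw w f := by
  induction w with
  | nil => rfl
  | cons i w ih =>
    simp only [dw]
    rw [ih (hf.mono (by simp)), der_smul c (hf.dw (by simp [add_comm]))]

theorem dw_neg {w : List (Fin 2)} {f : E} (hf : Hm w.length f) : dw w (-f) = -dw w f := by
  simpa using dw_smul (-1) hf

theorem dw_zero (w : List (Fin 2)) : dw w (0 : E) = 0 := by
  simpa using dw_smul 0 (Hm.zero (E := E) w.length)

theorem dw_sum {ι : Type*} (s : Finset ι) {w : List (Fin 2)} {f : ι → E}
    (h : ∀ j ∈ s, Hm w.length (f j)) : dw w (∑ j ∈ s, f j) = ∑ j ∈ s, dw w (f j) := by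
  classical
  induction s using Finset.induction_on with
  | empty => simpa using dw_zero w
  | insert a s ha ih =>
    rw [Finset.sum_insert ha, Finset.sum_insert ha, dw_add (h a (by simp))
      (Hm.sum _ fun j hj => h j (by simp [hj])), ih fun j hj => h j (by simp [hj])]

theorem dw_der [CompleteSpace E] {w : List (Fin 2)} {f : E} (hf : Hm (w.length + 1) f)
    (i : Fin 2) : dw w (der i f) = der i (dw w f) := by
  induction w with
  | nil => rfl
  | cons j w ih =>
    simp only [dw]
    rw [ih (hf.mono (by simp)), der_comm (hf.dw (by simp; omega))]

/-- The word of `a` letters `0` followed by `b` letters `1`: it stands for `∂_x^a ∂_y^b`. -/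
def wd (a b : ℕ) : List (Fin 2) := List.replicate a 0 ++ List.replicate b 1

theorem length_wd (a b : ℕ) : (wd a b).length = a + b := by simp [wd]

theorem wd_succ (a b : ℕ) : wd (a + 1) b = 0 :: wd a b := by simp [wd, List.replicate_succ]

theorem dw_wd_der_zero [CompleteSpace E] {a b : ℕ} {f : E} (hf : Hm (a + b + 1) f) :
    dw (wd a b) (der 0 f) = dw (wd (a + 1) b) f := by
  rw [dw_der (by rwa [length_wd]), wd_succ]; rfl

theorem dw_wd_der_one (a b : ℕ) (f : E) : dw (wd a b) (der 1 f) = dw (wd a (b + 1)) f := by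
  have : wd a (b + 1) = wd a b ++ [1] := by
    simp [wd, List.append_assoc, List.replicate_succ']
  rw [this, dw_append]; rfl

/-- It suffices to bound the derivatives `∂_x^a ∂_y^b`. -/
theorem N_le_of_wd [CompleteSpace E] {m : ℕ} {f : E} {B : ℝ} (hf : Hm m f)
    (h : ∀ a b, a + b ≤ m → ‖dw (wd a b) f‖ ≤ B) : N m f ≤ (2 ^ (m + 1) - 1) * B := by
  induction m generalizing f with
  | zero => have := h 0 0 (by omega); simp only [N]; simp [wd, dw] at this; norm_num; linarith
  | succ m ih =>
    have h0 : N m (der 0 f) ≤ (2 ^ (m + 1) - 1) * B := ih (hf.der 0) fun a b hab => by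
      rw [dw_wd_der_zero (hf.mono (by omega))]; exact h _ _ (by omega)
    have h1 : N m (der 1 f) ≤ (2 ^ (m + 1) - 1) * B := ih (hf.der 1) fun a b hab => by
      rw [dw_wd_der_one]; exact h _ _ (by omega)
    have h2 : ‖f‖ ≤ B := by simpa [wd, dw] using h 0 0 (by omega)
    have h5 : ((2 : ℝ) ^ (m + 1 + 1) - 1) * B
        = B + ((2 ^ (m + 1) - 1) * B + (2 ^ (m + 1) - 1) * B) := by ring
    rw [h5]
    simp only [N]; linarith

/-- Convergence of all derivatives of order at most `m`, which are required to exist along the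
family (eventually) and in the limit. -/
def ConvH {ι : Type*} : ℕ → (ι → E) → Filter ι → E → Prop
  | 0, F, l, f => Tendsto F l (𝓝 f)
  | m + 1, F, l, f => Tendsto F l (𝓝 f) ∧ ∀ i, (∀ᶠ n in l, HasD i (F n) (der i (F n))) ∧
      HasD i f (der i f) ∧ ConvH m (fun n => der i (F n)) l (der i f)

section ConvH

variable {ι : Type*} {l : Filter ι} {m : ℕ} {F G : ι → E} {f g : E}

theorem ConvH.tendsto (h : ConvH m F l f) : Tendsto F l (𝓝 f) := by
  cases m with
  | zero => exact h
  | succ m => exact h.1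

theorem ConvH.der (h : ConvH (m + 1) F l f) (i : Fin 2) :
    ConvH m (fun n => der i (F n)) l (der i f) := (h.2 i).2.2

theorem ConvH.congr' (h : ConvH m F l f) (hFG : F =ᶠ[l] G) : ConvH m G l f := by
  induction m generalizing F G f with
  | zero => exact Tendsto.congr' hFG h
  | succ m ih =>
    refine ⟨h.1.congr' hFG, fun i => ⟨?_, (h.2 i).2.1, ih (h.der i) ?_⟩⟩
    · filter_upwards [(h.2 i).1, hFG] with n h1 h2
      rwa [← h2]
    · filter_upwards [hFG] with n h2
      rw [h2]

theorem convH_succ {F' : Fin 2 → ι → E} {f' : Fin 2 → E} (h : Tendsto F l (𝓝 f))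
    (h1 : ∀ i, ∀ᶠ n in l, HasD i (F n) (F' i n)) (h2 : ∀ i, HasD i f (f' i))
    (h3 : ∀ i, ConvH m (F' i) l (f' i)) : ConvH (m + 1) F l f := by
  refine ⟨h, fun i => ⟨?_, ?_, ?_⟩⟩
  · filter_upwards [h1 i] with n hn
    rwa [hn.der_eq]
  · rw [(h2 i).der_eq]; exact h2 i
  · rw [(h2 i).der_eq]
    refine (h3 i).congr' ?_
    filter_upwards [h1 i] with n hn
    rw [hn.der_eq]

theorem ConvH.hm (h : ConvH m F l f) : Hm m f := by
  induction m generalizing F f with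
  | zero => trivial
  | succ m ih => exact fun i => ⟨(h.2 i).2.1, ih (h.der i)⟩

theorem ConvH.eventually_hm (h : ConvH m F l f) : ∀ᶠ n in l, Hm m (F n) := by
  induction m generalizing F f with
  | zero => exact Eventually.of_forall fun _ => trivial
  | succ m ih =>
    have h1 : ∀ᶠ n in l, ∀ i, HasD i (F n) (MHDStrip.der i (F n)) :=
      eventually_all.2 fun i => (h.2 i).1
    have h2 : ∀ᶠ n in l, ∀ i, Hm m (MHDStrip.der i (F n)) := eventually_all.2 fun i => ih (h.der i)
    filter_upwards [h1, h2] with n h1 h2 i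
    exact ⟨h1 i, h2 i⟩

theorem ConvH.mono {n : ℕ} (hmn : m ≤ n) (h : ConvH n F l f) : ConvH m F l f := by
  induction m generalizing n F f with
  | zero => exact h.tendsto
  | succ m ih =>
    obtain ⟨n, rfl⟩ : ∃ k, n = k + 1 := ⟨n - 1, by omega⟩
    exact ⟨h.1, fun i => ⟨(h.2 i).1, (h.2 i).2.1, ih (by omega) (h.der i)⟩⟩

theorem convH_const (hf : Hm m f) : ConvH m (fun _ => f) l f := by
  induction m generalizing f with
  | zero => exact tendsto_const_nhds
  | succ m ih =>
    exact ⟨tendsto_const_nhds, fun i => ⟨Eventually.of_forall fun _ => hf.hasD i, hf.hasD i,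
      ih (hf.der i)⟩⟩

theorem ConvH.add (hf : ConvH m F l f) (hg : ConvH m G l g) :
    ConvH m (fun n => F n + G n) l (f + g) := by
  induction m generalizing F G f g with
  | zero => exact Tendsto.add hf hg
  | succ m ih =>
    refine convH_succ (hf.1.add hg.1) (fun i => ?_) (fun i => (hf.2 i).2.1.add (hg.2 i).2.1)
      (fun i => ih (hf.der i) (hg.der i))
    filter_upwards [(hf.2 i).1, (hg.2 i).1] with n h1 h2 using h1.add h2

theorem ConvH.smul (c : ℝ) (hf : ConvH m F l f) : ConvH m (fun n => c • F n) l (c • f) := by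
  induction m generalizing F f with
  | zero => exact Tendsto.const_smul hf c
  | succ m ih =>
    refine convH_succ (hf.1.const_smul c) (fun i => ?_) (fun i => (hf.2 i).2.1.const_smul c)
      (fun i => ih (hf.der i))
    filter_upwards [(hf.2 i).1] with n h1 using h1.const_smul c

theorem ConvH.neg (hf : ConvH m F l f) : ConvH m (fun n => -F n) l (-f) := by
  simpa using hf.smul (-1)

theorem ConvH.sub (hf : ConvH m F l f) (hg : ConvH m G l g) :
    ConvH m (fun n => F n - G n) l (f - g) := by
  simpa [sub_eq_add_neg] using hf.add hg.neg

theorem ConvH.sum {κ : Type*} (s : Finset κ) {F : κ → ι → E} {f : κ → E}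
    (h : ∀ j ∈ s, ConvH m (F j) l (f j)) :
    ConvH m (fun n => ∑ j ∈ s, F j n) l (∑ j ∈ s, f j) := by
  classical
  induction s using Finset.induction_on with
  | empty => simpa using convH_const (Hm.zero m)
  | insert a s ha ih =>
    simp only [Finset.sum_insert ha]
    exact (h a (by simp)).add (ih fun j hj => h j (by simp [hj]))

theorem ConvH.dw {n : ℕ} {w : List (Fin 2)} (h : ConvH n F l f) (hn : m + w.length ≤ n) :
    ConvH m (fun n => dw w (F n)) l (dw w f) := by
  induction w generalizing m with
  | nil => exact h.mono (by simpa using hn)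
  | cons i w ih => exact (ih (m := m + 1) (by simp at hn; omega)).der i

theorem ConvH.comp {κ : Type*} {l' : Filter κ} {u : κ → ι} (h : ConvH m F l f)
    (hu : Tendsto u l' l) : ConvH m (fun n => F (u n)) l' f := by
  induction m generalizing F f with
  | zero => exact Tendsto.comp h hu
  | succ m ih =>
    exact ⟨h.1.comp hu, fun i => ⟨hu.eventually (h.2 i).1, (h.2 i).2.1, ih (h.der i)⟩⟩

theorem ConvH.tendsto_N (h : ConvH m F l f) : Tendsto (fun n => N m (F n - f)) l (𝓝 0) := by
  induction m generalizing F f with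
  | zero => exact tendsto_iff_norm_sub_tendsto_zero.1 h
  | succ m ih =>
    have h0 := tendsto_iff_norm_sub_tendsto_zero.1 h.1
    have h1 := h0.add ((ih (h.der 0)).add (ih (h.der 1)))
    simp only [add_zero] at h1
    refine h1.congr' ?_
    filter_upwards [(h.2 0).1, (h.2 1).1] with n h2 h3
    simp only [N, (h2.sub (h.2 0).2.1).der_eq, (h3.sub (h.2 1).2.1).der_eq]

theorem convH_dq [CompleteSpace E] {i : Fin 2} (hf : Hm (m + 1) f) :
    ConvH m (fun h => dq i h f) (𝓝[≠] 0) (der i f) := by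
  induction m generalizing f with
  | zero => exact tendsto_dq (hf.hasD i)
  | succ m ih =>
    refine convH_succ (tendsto_dq (hf.hasD i)) (F' := fun j h => dq i h (MHDStrip.der j f))
      (f' := fun j => MHDStrip.der i (MHDStrip.der j f))
      (fun j => Eventually.of_forall fun h => (hf.hasD j).diffQuot i h) (fun j => ?_)
      (fun j => ih (hf.der j))
    rw [der_comm (hf.mono (by omega))]
    exact (hf.der i).hasD j

theorem convH_sh {i : Fin 2} {t : ι → ℝ} {t₀ : ℝ} (ht : Tendsto t l (𝓝 t₀)) (hf : Hm m f) :
    ConvH m (fun n => sh i (t n) f) l (sh i t₀ f) := by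
  induction m generalizing f with
  | zero => exact tendsto_sh i ht tendsto_const_nhds
  | succ m ih =>
    exact convH_succ (tendsto_sh i ht tendsto_const_nhds)
      (fun j => Eventually.of_forall fun n => (hf.hasD j).shift i _)
      (fun j => (hf.hasD j).shift i _) (fun j => ih (hf.der j))

/-- It suffices that the derivatives `∂_x^a ∂_y^b` converge. -/
theorem convH_of_wd [CompleteSpace E] (hF : ∀ᶠ n in l, Hm m (F n)) (hf : Hm m f)
    (h : ∀ a b, a + b ≤ m → Tendsto (fun n => MHDStrip.dw (wd a b) (F n)) l
      (𝓝 (MHDStrip.dw (wd a b) f))) : ConvH m F l f := by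
  induction m generalizing F f with
  | zero => exact h 0 0 (by omega)
  | succ m ih =>
    have h00 : Tendsto F l (𝓝 f) := h 0 0 (by omega)
    refine ⟨h00, fun i => ⟨?_, hf.hasD i, ih ?_ (hf.der i) fun a b hab => ?_⟩⟩
    · filter_upwards [hF] with n hn using hn.hasD i
    · filter_upwards [hF] with n hn using hn.der i
    · fin_cases i
      · simp only [Fin.zero_eta]
        rw [dw_wd_der_zero (hf.mono (by omega))]
        refine (h (a + 1) b (by omega)).congr' ?_
        filter_upwards [hF] with n hn
        rw [dw_wd_der_zero (hn.mono (by omega))]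
      · simp only [Fin.mk_one, dw_wd_der_one]
        exact h a (b + 1) (by omega)

end ConvH

end Generator

section

open scoped ENNReal

/-! ### Square-integrable functions on a group, and their averages -/

section Lp2

variable {Y : Type*} [MeasurableSpace Y] {μ : Measure Y}

theorem enorm_sq_eq (g : Lp ℝ 2 μ) : ‖g‖ₑ ^ 2 = ∫⁻ z, ‖g z‖ₑ ^ 2 ∂μ := by
  rw [Lp.enorm_def]
  have h := eLpNorm_nnreal_eq_lintegral (f := g) (μ := μ) (p := 2) (by norm_num)
  have h2 : ((2 : NNReal) : ℝ≥0∞) = 2 := by norm_num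
  rw [h2] at h
  rw [h, ← ENNReal.rpow_natCast, ← ENNReal.rpow_mul]
  norm_num

theorem ofReal_norm_sq (g : Lp ℝ 2 μ) : ENNReal.ofReal (‖g‖ ^ 2) = ∫⁻ z, ‖g z‖ₑ ^ 2 ∂μ := by
  rw [ENNReal.ofReal_pow (norm_nonneg _), ofReal_norm, enorm_sq_eq]

end Lp2

section Average

variable {E : Type*} [NormedAddCommGroup E] [NormedSpace ℝ E] [Shift E]

/-- A differentiable vector is an average of its translates and those of its derivative. -/
theorem HasD.eq_average [CompleteSpace E] {i : Fin 2} {f g : E} (h : HasD i f g) :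
    f = ∫ s in (0 : ℝ)..1, (sh i s f - (1 - s) • sh i s g) := by
  have hd : ∀ s : ℝ, HasDerivAt (fun s : ℝ => -((1 - s) • sh i s f))
      (sh i s f - (1 - s) • sh i s g) s := fun s => by
    have h1 : HasDerivAt (fun s : ℝ => 1 - s) (-1) s := by
      simpa using (hasDerivAt_id s).const_sub 1
    have := (h1.smul (h.hasDerivAt s)).neg
    convert! this using 1
    simp; abel
  have hc : Continuous fun s : ℝ => sh i s f - (1 - s) • sh i s g :=
    (continuous_sh i f).sub ((by fun_prop : Continuous fun s : ℝ => 1 - s).smul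
      (continuous_sh i g))
  rw [intervalIntegral.integral_eq_sub_of_hasDerivAt (fun s _ => hd s)
    (hc.intervalIntegrable _ _)]
  simp [sh_zero]

end Average

/-- The inequality of Cauchy-Schwarz on the unit interval. -/
theorem sq_integral_le {a : ℝ → ℝ} (ca : Continuous a) :
    (∫ s in (0 : ℝ)..1, a s) ^ 2 ≤ ∫ s in (0 : ℝ)..1, a s ^ 2 := by
  set c := ∫ s in (0 : ℝ)..1, a s with hc
  have e : ∫ s in (0 : ℝ)..1, (a s - c) ^ 2 = (∫ s in (0 : ℝ)..1, a s ^ 2) - c ^ 2 := by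
    have e1 : (fun s => (a s - c) ^ 2) = fun s => a s ^ 2 - 2 * c * a s + c ^ 2 := by
      ext s; ring
    have c1 : Continuous fun s => a s ^ 2 := ca.pow 2
    have c2 : Continuous fun s => 2 * c * a s := ca.const_mul _
    have c3 : Continuous fun s => a s ^ 2 - 2 * c * a s := c1.sub c2
    rw [e1, intervalIntegral.integral_add (c3.intervalIntegrable _ _)
      (continuous_const.intervalIntegrable _ _),
      intervalIntegral.integral_sub (c1.intervalIntegrable _ _)
      (c2.intervalIntegrable _ _), intervalIntegral.integral_const_mul, ← hc]
    simp; ring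
  have := intervalIntegral.integral_nonneg (μ := volume) (f := fun s => (a s - c) ^ 2)
    (zero_le_one (α := ℝ)) fun s _ => sq_nonneg _
  linarith

section ShiftLp

variable {Y : Type*} [AddCommGroup Y] [TopologicalSpace Y] [IsTopologicalAddGroup Y]
  [MeasurableSpace Y] [BorelSpace Y] [SecondCountableTopology Y] [R1Space Y]
  (μ : Measure Y) [μ.IsAddLeftInvariant] [IsLocallyFiniteMeasure μ] [μ.InnerRegularCompactLTTop]
  [SigmaFinite μ]

/-- A continuous homomorphism from the plane to a group lets the plane act on `L²` of that group
by translations. -/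
abbrev shiftLp (π : ℝ × ℝ →+ Y) (hπ : Continuous π) : Shift (Lp ℝ 2 μ) where
  τ s := (Lp.compMeasurePreservingₗᵢ ℝ (fun y => π s + y)
    (measurePreserving_add_left μ (π s))).toContinuousLinearMap
  τ_zero f := by
    refine Lp.ext ((Lp.coeFn_compMeasurePreserving f _).trans ?_)
    exact Eventually.of_forall fun y => by simp
  τ_add s t f := by
    refine Lp.ext ((Lp.coeFn_compMeasurePreserving f _).trans ?_)
    refine EventuallyEq.symm ((Lp.coeFn_compMeasurePreserving _
      (measurePreserving_add_left μ (π s))).trans ?_)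
    have := (measurePreserving_add_left μ (π s)).quasiMeasurePreserving.ae_eq_comp
      (Lp.coeFn_compMeasurePreserving f (measurePreserving_add_left μ (π t)))
    refine this.trans (Eventually.of_forall fun y => ?_)
    simp [add_assoc, add_left_comm]
  norm_τ s f := Lp.norm_compMeasurePreserving _ _
  continuous_τ f := by
    let g : C((ℝ × ℝ) × Y, Y) := ⟨fun p => π p.1 + p.2, by fun_prop⟩
    exact (continuous_const (y := f)).compMeasurePreservingLp (g := fun s => g.curry s)
      g.curry.continuous (fun s => measurePreserving_add_left μ (π s)) (by norm_num)

variable {μ}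

/-- A function that is differentiable in `L²` is pointwise controlled by averages along the
direction of differentiation. -/
theorem enorm_sq_le_average (π : ℝ × ℝ →+ Y) (hπ : Continuous π) {i : Fin 2} {f g : Lp ℝ 2 μ}
    (h : @HasD _ _ _ (shiftLp μ π hπ) i f g) :
    ∀ᵐ z ∂μ, ‖f z‖ₑ ^ 2 ≤ 2 * ∫⁻ s in Ioc (0 : ℝ) 1,
      (‖f (π (s • dir i) + z)‖ₑ ^ 2 + ‖g (π (s • dir i) + z)‖ₑ ^ 2) := by
  let _ : Shift (Lp ℝ 2 μ) := shiftLp μ π hπ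
  have hsh : ∀ (s : ℝ) (q : Lp ℝ 2 μ), ((sh i s q : Lp ℝ 2 μ) : Y → ℝ) =ᵐ[μ] fun z => q (π (s • dir i) + z) :=
    fun s q => Lp.coeFn_compMeasurePreserving q _
  refine ae_le_of_forall_setLIntegral_le_of_sigmaFinite
    ((Lp.stronglyMeasurable f).measurable.enorm.pow_const 2) fun A hA _ => ?_
  set R := LpToLpRestrictCLM Y ℝ ℝ μ 2 A with hR
  have hRn : ∀ q : Lp ℝ 2 μ, ENNReal.ofReal (‖R q‖ ^ 2) = ∫⁻ z in A, ‖q z‖ₑ ^ 2 ∂μ := fun q => by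
    rw [ofReal_norm_sq]
    refine lintegral_congr_ae ?_
    filter_upwards [LpToLpRestrictCLM_coeFn ℝ A q] with z hz
    rw [hR, hz]
  have cf : Continuous fun s => ‖R (sh i s f)‖ := (R.continuous.comp (continuous_sh i f)).norm
  have cg : Continuous fun s => ‖R (sh i s g)‖ := (R.continuous.comp (continuous_sh i g)).norm
  have h1 : ‖R f‖ ≤ ∫ s in (0 : ℝ)..1, (‖R (sh i s f)‖ + ‖R (sh i s g)‖) := by
    have hc : Continuous fun s : ℝ => sh i s f - (1 - s) • sh i s g :=
      (continuous_sh i f).sub ((by fun_prop : Continuous fun s : ℝ => 1 - s).smul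
        (continuous_sh i g))
    conv_lhs => rw [h.eq_average]
    rw [← ContinuousLinearMap.intervalIntegral_comp_comm R (hc.intervalIntegrable _ _)]
    refine intervalIntegral.norm_integral_le_of_norm_le zero_le_one
      (Eventually.of_forall fun s hs => ?_) ((cf.add cg).intervalIntegrable _ _)
    rw [map_sub, map_smul]
    refine (norm_sub_le _ _).trans ?_
    rw [norm_smul, Real.norm_eq_abs, abs_of_nonneg (by linarith [hs.2])]
    have := mul_le_mul_of_nonneg_right (show 1 - s ≤ 1 by linarith [hs.1])
      (norm_nonneg (R (sh i s g)))
    linarith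
  set a : ℝ → ℝ := fun s => ‖R (sh i s f)‖ + ‖R (sh i s g)‖ with ha
  have ca : Continuous a := cf.add cg
  have h2 := sq_integral_le ca
  have h3 : ‖R f‖ ^ 2 ≤ ∫ s in (0 : ℝ)..1, 2 * (‖R (sh i s f)‖ ^ 2 + ‖R (sh i s g)‖ ^ 2) := by
    refine (pow_le_pow_left₀ (norm_nonneg _) h1 2).trans (h2.trans ?_)
    refine intervalIntegral.integral_mono_on zero_le_one ((ca.pow 2).intervalIntegrable _ _)
      ((((cf.pow 2).add (cg.pow 2)).const_mul 2).intervalIntegrable _ _) fun s _ => ?_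
    simp only [ha]
    nlinarith [sq_nonneg (‖R (sh i s f)‖ - ‖R (sh i s g)‖)]
  have cI : Continuous fun s => 2 * (‖R (sh i s f)‖ ^ 2 + ‖R (sh i s g)‖ ^ 2) :=
    ((cf.pow 2).add (cg.pow 2)).const_mul 2
  have hm : ∀ q : Lp ℝ 2 μ, Measurable fun p : ℝ × Y => ‖q (π (p.1 • dir i) + p.2)‖ₑ ^ 2 :=
    fun q => by
      have : Measurable fun p : ℝ × Y => π (p.1 • dir i) + p.2 := by
        have : Continuous fun p : ℝ × Y => π (p.1 • dir i) + p.2 := by fun_prop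
        exact this.measurable
      exact ((Lp.stronglyMeasurable q).measurable.comp this).enorm.pow_const 2
  have hm' : ∀ (q : Lp ℝ 2 μ) (s : ℝ), Measurable fun z : Y => ‖q (π (s • dir i) + z)‖ₑ ^ 2 :=
    fun q s => ((Lp.stronglyMeasurable q).measurable.comp
      (measurable_const_add _)).enorm.pow_const 2
  calc ∫⁻ z in A, ‖f z‖ₑ ^ 2 ∂μ = ENNReal.ofReal (‖R f‖ ^ 2) := (hRn f).symm
    _ ≤ ENNReal.ofReal (∫ s in (0 : ℝ)..1, 2 * (‖R (sh i s f)‖ ^ 2 + ‖R (sh i s g)‖ ^ 2)) :=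
      ENNReal.ofReal_le_ofReal h3
    _ = ∫⁻ s in Ioc (0 : ℝ) 1, ENNReal.ofReal (2 * (‖R (sh i s f)‖ ^ 2 + ‖R (sh i s g)‖ ^ 2)) := by
      rw [intervalIntegral.integral_of_le zero_le_one, ofReal_integral_eq_lintegral_ofReal]
      · exact (cI.integrableOn_Icc).mono_set Ioc_subset_Icc_self
      · exact Eventually.of_forall fun s => by positivity
    _ = ∫⁻ s in Ioc (0 : ℝ) 1, ∫⁻ z in A, 2 * (‖f (π (s • dir i) + z)‖ₑ ^ 2
          + ‖g (π (s • dir i) + z)‖ₑ ^ 2) ∂μ := by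
      refine lintegral_congr fun s => ?_
      rw [ENNReal.ofReal_mul (by norm_num), ENNReal.ofReal_add (by positivity) (by positivity),
        hRn, hRn, lintegral_const_mul' _ _ (by norm_num), lintegral_add_left]
      · congr 1
        · norm_num
        congr 1
        · refine lintegral_congr_ae (ae_restrict_of_ae ?_)
          filter_upwards [hsh s f] with z hz
          rw [hz]
        · refine lintegral_congr_ae (ae_restrict_of_ae ?_)
          filter_upwards [hsh s g] with z hz
          rw [hz]
      · exact hm' f s
    _ = ∫⁻ z in A, (∫⁻ s in Ioc (0 : ℝ) 1, 2 * (‖f (π (s • dir i) + z)‖ₑ ^ 2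
          + ‖g (π (s • dir i) + z)‖ₑ ^ 2)) ∂μ := by
      have hmm : Measurable fun p : ℝ × Y => 2 * (‖f (π (p.1 • dir i) + p.2)‖ₑ ^ 2
          + ‖g (π (p.1 • dir i) + p.2)‖ₑ ^ 2) :=
        ((hm f).add (hm g)).const_mul 2
      exact lintegral_lintegral_swap (μ := volume.restrict (Ioc (0 : ℝ) 1)) (ν := μ.restrict A)
        (f := fun s z => 2 * (‖f (π (s • dir i) + z)‖ₑ ^ 2 + ‖g (π (s • dir i) + z)‖ₑ ^ 2))
        hmm.aemeasurable
    _ = _ := by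
      refine lintegral_congr fun z => ?_
      rw [lintegral_const_mul' _ _ (by norm_num)]

end ShiftLp

end

section

open scoped ENNReal

/-! ### The cylinder `ℝ × ℝ/2ℤ` -/

instance fact_zero_lt_two : Fact ((0 : ℝ) < 2) := ⟨two_pos⟩

/-- The circle of length `2`, the double of the interval `(0,1)`. -/
abbrev Circ : Type := AddCircle (2 : ℝ)

/-- The cylinder, the double of the strip `ℝ × (0,1)`. -/
abbrev Cyl : Type := ℝ × Circ

/-- Real-valued `L²` of the cylinder. -/
abbrev LG : Type := Lp ℝ 2 (volume : Measure Cyl)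

/-- Real-valued `L²` of the circle. -/
abbrev LT : Type := Lp ℝ 2 (volume : Measure Circ)

/-- The covering of the cylinder by the plane. -/
def toCyl : ℝ × ℝ →+ Cyl where
  toFun s := (s.1, (s.2 : Circ))
  map_zero' := rfl
  map_add' _ _ := rfl

/-- The plane acts on the circle through its second coordinate. -/
def toCirc : ℝ × ℝ →+ Circ where
  toFun s := (s.2 : Circ)
  map_zero' := rfl
  map_add' _ _ := rfl

theorem toCyl_apply (s : ℝ × ℝ) : toCyl s = (s.1, (s.2 : Circ)) := rfl

theorem toCirc_apply (s : ℝ × ℝ) : toCirc s = (s.2 : Circ) := rfl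

theorem continuous_toCyl : Continuous toCyl :=
  continuous_fst.prodMk ((AddCircle.continuous_mk' 2).comp continuous_snd)

theorem continuous_toCirc : Continuous toCirc := (AddCircle.continuous_mk' 2).comp continuous_snd

instance isAddHaarMeasure_cyl : (volume : Measure Cyl).IsAddHaarMeasure :=
  inferInstanceAs ((volume : Measure ℝ).prod (volume : Measure Circ)).IsAddHaarMeasure

instance shiftLG : Shift LG := shiftLp volume toCyl continuous_toCyl

instance shiftLT : Shift LT := shiftLp volume toCirc continuous_toCirc

theorem sh_ae_cyl (i : Fin 2) (t : ℝ) (f : LG) :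
    ((sh i t f : LG) : Cyl → ℝ) =ᵐ[volume] fun z => f (toCyl (t • dir i) + z) :=
  Lp.coeFn_compMeasurePreserving f _

theorem sh_ae_circ (i : Fin 2) (t : ℝ) (f : LT) :
    ((sh i t f : LT) : Circ → ℝ) =ᵐ[volume] fun z => f (toCirc (t • dir i) + z) :=
  Lp.coeFn_compMeasurePreserving f _

theorem lintegral_circ_le (q : Circ → ℝ≥0∞) (y : Circ) :
    ∫⁻ s in Ioc (0 : ℝ) 1, q ((s : Circ) + y) ≤ ∫⁻ b, q b := by
  calc ∫⁻ s in Ioc (0 : ℝ) 1, q ((s : Circ) + y)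
      ≤ ∫⁻ s in Ioc (0 : ℝ) (0 + 2), q ((s : Circ) + y) :=
        lintegral_mono_set (Ioc_subset_Ioc_right (by norm_num))
    _ = ∫⁻ b : Circ, q (b + y) := AddCircle.lintegral_preimage 2 0 fun b => q (b + y)
    _ = ∫⁻ b, q b := lintegral_add_right_eq_self q y

/-- One-dimensional Sobolev embedding on the circle. -/
theorem circ_sup_bound {f g : LT} (h : HasD 1 f g) :
    ∀ᵐ y : Circ, ‖f y‖ₑ ^ 2 ≤ 2 * (‖f‖ₑ ^ 2 + ‖g‖ₑ ^ 2) := by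
  filter_upwards [enorm_sq_le_average toCirc continuous_toCirc h] with y hy
  refine hy.trans ?_
  gcongr
  have e : ∀ s : ℝ, toCirc (s • dir 1) = (s : Circ) := fun s => by
    simp [toCirc_apply, dir]
  simp only [e]
  rw [enorm_sq_eq, enorm_sq_eq, ← lintegral_add_left
    ((Lp.stronglyMeasurable f).measurable.enorm.pow_const 2)]
  exact lintegral_circ_le (fun b => ‖f b‖ₑ ^ 2 + ‖g b‖ₑ ^ 2) y

/-- One-dimensional Sobolev embedding on almost every circle of the cylinder. -/
theorem cyl_circle_bound {f g : LG} (h : HasD 1 f g) :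
    ∀ᵐ z : Cyl, ‖f z‖ₑ ^ 2 ≤ 2 * ∫⁻ y : Circ, (‖f (z.1, y)‖ₑ ^ 2 + ‖g (z.1, y)‖ₑ ^ 2) := by
  filter_upwards [enorm_sq_le_average toCyl continuous_toCyl h] with z hz
  refine hz.trans ?_
  gcongr
  have e : ∀ s : ℝ, toCyl (s • dir 1) + z = (z.1, (s : Circ) + z.2) := fun s => by
    simp [toCyl_apply, dir, Prod.ext_iff]
  simp only [e]
  exact lintegral_circ_le (fun b => ‖f (z.1, b)‖ₑ ^ 2 + ‖g (z.1, b)‖ₑ ^ 2) z.2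

theorem lintegral_cyl_slices (f g : LG) :
    ∫⁻ x : ℝ, ∫⁻ y : Circ, (‖f (x, y)‖ₑ ^ 2 + ‖g (x, y)‖ₑ ^ 2) = ‖f‖ₑ ^ 2 + ‖g‖ₑ ^ 2 := by
  have mf := (Lp.stronglyMeasurable f).measurable.enorm.pow_const 2
  have mg := (Lp.stronglyMeasurable g).measurable.enorm.pow_const 2
  rw [enorm_sq_eq, enorm_sq_eq, ← lintegral_add_left mf]
  exact (lintegral_prod _ (mf.add mg).aemeasurable).symm

/-- Sobolev embedding on the cylinder: only the mixed second derivative is needed. -/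
theorem cyl_sup_bound {f f0 f1 f01 : LG} (h0 : HasD 0 f f0) (h1 : HasD 1 f f1)
    (h01 : HasD 1 f0 f01) :
    ∀ᵐ z : Cyl, ‖f z‖ₑ ^ 2 ≤ 4 * ((‖f‖ₑ ^ 2 + ‖f1‖ₑ ^ 2) + (‖f0‖ₑ ^ 2 + ‖f01‖ₑ ^ 2)) := by
  have hm : Measurable fun p : Cyl × ℝ => toCyl (p.2 • dir 0) + p.1 := by
    have : Continuous fun p : Cyl × ℝ => toCyl (p.2 • dir 0) + p.1 :=
      (continuous_toCyl.comp (by fun_prop)).add continuous_fst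
    exact this.measurable
  have hq : Measure.QuasiMeasurePreserving (fun p : Cyl × ℝ => toCyl (p.2 • dir 0) + p.1)
      ((volume : Measure Cyl).prod (volume.restrict (Ioc (0 : ℝ) 1))) volume :=
    QuasiMeasurePreserving.prod_of_left hm (Eventually.of_forall fun s =>
      (measurePreserving_add_left volume (toCyl (s • dir 0))).quasiMeasurePreserving)
  have hA := Measure.ae_ae_of_ae_prod (hq.ae (cyl_circle_bound h1))
  have hB := Measure.ae_ae_of_ae_prod (hq.ae (cyl_circle_bound h01))
  filter_upwards [enorm_sq_le_average toCyl continuous_toCyl h0, hA, hB] with z hz hzA hzB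
  have e : ∀ s : ℝ, (toCyl (s • dir 0) + z).1 = s + z.1 := fun s => by simp [toCyl_apply, dir]
  simp only [e] at hzA hzB
  set m : ℝ → ℝ≥0∞ := fun x => ∫⁻ y : Circ, (‖f (x, y)‖ₑ ^ 2 + ‖f1 (x, y)‖ₑ ^ 2) with hmdef
  set m' : ℝ → ℝ≥0∞ := fun x => ∫⁻ y : Circ, (‖f0 (x, y)‖ₑ ^ 2 + ‖f01 (x, y)‖ₑ ^ 2) with hmdef'
  have mm : Measurable m := Measurable.lintegral_prod_right'
    (f := fun p : Cyl => ‖f p‖ₑ ^ 2 + ‖f1 p‖ₑ ^ 2)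
    (((Lp.stronglyMeasurable f).measurable.enorm.pow_const 2).add
      ((Lp.stronglyMeasurable f1).measurable.enorm.pow_const 2))
  calc ‖f z‖ₑ ^ 2 ≤ 2 * ∫⁻ s in Ioc (0 : ℝ) 1, (‖f (toCyl (s • dir 0) + z)‖ₑ ^ 2
          + ‖f0 (toCyl (s • dir 0) + z)‖ₑ ^ 2) := hz
    _ ≤ 2 * ∫⁻ s in Ioc (0 : ℝ) 1, (2 * m (s + z.1) + 2 * m' (s + z.1)) := by
      refine mul_le_mul_right (lintegral_mono_ae ?_) _
      filter_upwards [hzA, hzB] with s hs hs'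
      exact add_le_add hs hs'
    _ ≤ 2 * ∫⁻ s : ℝ, (2 * m (s + z.1) + 2 * m' (s + z.1)) :=
      mul_le_mul_right (setLIntegral_le_lintegral _ _) _
    _ = 2 * ∫⁻ s : ℝ, (2 * m s + 2 * m' s) := by
      rw [lintegral_add_right_eq_self (fun s => 2 * m s + 2 * m' s) z.1]
    _ = _ := by
      rw [lintegral_add_left (mm.const_mul 2), lintegral_const_mul' _ _ (by norm_num),
        lintegral_const_mul' _ _ (by norm_num), hmdef, hmdef', lintegral_cyl_slices,
        lintegral_cyl_slices]
      ring

theorem abs_le_of_enorm_sq_le {a b : ℝ} (hb : 0 ≤ b) (h : ‖a‖ₑ ^ 2 ≤ ENNReal.ofReal (b ^ 2)) :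
    |a| ≤ b := by
  rw [← ofReal_norm, ← ENNReal.ofReal_pow (norm_nonneg _), ENNReal.ofReal_le_ofReal_iff
    (by positivity)] at h
  simpa using abs_le_of_sq_le_sq h hb

/-- The Sobolev embedding on the cylinder: two derivatives in `L²`, of which only the mixed one is
of second order, control the supremum. -/
theorem cyl_sup_bound_real {f f0 f1 f01 : LG} (h0 : HasD 0 f f0) (h1 : HasD 1 f f1)
    (h01 : HasD 1 f0 f01) {b : ℝ} (hb : 0 ≤ b)
    (h : 4 * ((‖f‖ ^ 2 + ‖f1‖ ^ 2) + (‖f0‖ ^ 2 + ‖f01‖ ^ 2)) ≤ b ^ 2) :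
    ∀ᵐ z : Cyl, |f z| ≤ b := by
  filter_upwards [cyl_sup_bound h0 h1 h01] with z hz
  refine abs_le_of_enorm_sq_le hb (hz.trans ?_)
  refine le_trans (le_of_eq ?_) (ENNReal.ofReal_le_ofReal h)
  rw [ENNReal.ofReal_mul (by norm_num), ENNReal.ofReal_add (by positivity) (by positivity),
    ENNReal.ofReal_add (by positivity) (by positivity),
    ENNReal.ofReal_add (by positivity) (by positivity)]
  simp [ENNReal.ofReal_pow]

theorem abs_le_N_cyl {f : LG} (hf : Hm 2 f) : ∀ᵐ z : Cyl, |f z| ≤ 2 * N 2 f := by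
  refine cyl_sup_bound_real (hf.hasD 0) (hf.hasD 1) ((hf.der 0).hasD 1)
    (by have := N_nonneg 2 f; positivity) ?_
  have e : N 2 f = ‖f‖ + ((‖der 0 f‖ + (‖der 0 (der 0 f)‖ + ‖der 1 (der 0 f)‖))
    + (‖der 1 f‖ + (‖der 0 (der 1 f)‖ + ‖der 1 (der 1 f)‖))) := rfl
  have h1 := norm_nonneg f
  have h2 := norm_nonneg (der 0 f)
  have h3 := norm_nonneg (der 1 f)
  have h4 := norm_nonneg (der 1 (der 0 f))
  have h5 := norm_nonneg (der 0 (der 0 f))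
  have h6 := norm_nonneg (der 0 (der 1 f))
  have h7 := norm_nonneg (der 1 (der 1 f))
  have h8 : ‖f‖ + ‖der 1 f‖ + ‖der 0 f‖ + ‖der 1 (der 0 f)‖ ≤ N 2 f := by rw [e]; linarith
  have h9 := pow_le_pow_left₀ (by positivity) h8 2
  nlinarith [mul_nonneg h1 h2, mul_nonneg h1 h3, mul_nonneg h1 h4, mul_nonneg h2 h3,
    mul_nonneg h2 h4, mul_nonneg h3 h4]

theorem abs_le_N_circ {f : LT} (hf : Hm 1 f) : ∀ᵐ y : Circ, |f y| ≤ 2 * N 1 f := by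
  filter_upwards [circ_sup_bound (hf.hasD 1)] with z hz
  refine abs_le_of_enorm_sq_le (by have := N_nonneg 1 f; positivity) (hz.trans ?_)
  have e : N 1 f = ‖f‖ + (‖der 0 f‖ + ‖der 1 f‖) := rfl
  have h1 := norm_nonneg f
  have h2 := norm_nonneg (der 0 f)
  have h3 := norm_nonneg (der 1 f)
  have h : 2 * (‖f‖ ^ 2 + ‖der 1 f‖ ^ 2) ≤ (2 * N 1 f) ^ 2 := by
    rw [e]
    nlinarith [mul_nonneg h1 h2, mul_nonneg h1 h3, mul_nonneg h2 h3]
  refine le_trans (le_of_eq ?_) (ENNReal.ofReal_le_ofReal h)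
  rw [ENNReal.ofReal_mul (by norm_num), ENNReal.ofReal_add (by positivity) (by positivity)]
  simp [ENNReal.ofReal_pow]

end

section

open scoped ENNReal

/-! ### Products of shift spaces; skew-symmetry of derivatives -/

section Prod

variable {E : Type*} [NormedAddCommGroup E] [NormedSpace ℝ E] [Shift E]
variable {F : Type*} [NormedAddCommGroup F] [NormedSpace ℝ F] [Shift F]

instance shiftProd : Shift (E × F) where
  τ s := (Shift.τ s).prodMap (Shift.τ s)
  τ_zero f := Prod.ext (Shift.τ_zero f.1) (Shift.τ_zero f.2)
  τ_add s t f := Prod.ext (Shift.τ_add s t f.1) (Shift.τ_add s t f.2)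
  norm_τ s f := by simp [Prod.norm_def, Shift.norm_τ]
  continuous_τ f := (Shift.continuous_τ f.1).prodMk (Shift.continuous_τ f.2)

theorem sh_prod (i : Fin 2) (t : ℝ) (f : E × F) : sh i t f = (sh i t f.1, sh i t f.2) := rfl

theorem HasD.prodMk {i : Fin 2} {f g : E} {f' g' : F} (h : HasD i f g) (h' : HasD i f' g') :
    HasD i (f, f') (g, g') := HasDerivAt.prodMk h h'

theorem HasD.fst {i : Fin 2} {f g : E × F} (h : HasD i f g) : HasD i f.1 g.1 :=
  h.map (ContinuousLinearMap.fst ℝ E F) fun _ _ => rfl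

theorem HasD.snd {i : Fin 2} {f g : E × F} (h : HasD i f g) : HasD i f.2 g.2 :=
  h.map (ContinuousLinearMap.snd ℝ E F) fun _ _ => rfl

theorem Hm.prodMk {m : ℕ} {f : E} {g : F} (hf : Hm m f) (hg : Hm m g) : Hm m (f, g) := by
  induction m generalizing f g with
  | zero => trivial
  | succ m ih =>
    exact hm_succ (fun i => (hf.hasD i).prodMk (hg.hasD i)) fun i => ih (hf.der i) (hg.der i)

theorem Hm.fst {m : ℕ} {f : E × F} (hf : Hm m f) : Hm m f.1 := by
  induction m generalizing f with
  | zero => trivial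
  | succ m ih => exact hm_succ (fun i => (hf.hasD i).fst) fun i => ih (hf.der i)

theorem Hm.snd {m : ℕ} {f : E × F} (hf : Hm m f) : Hm m f.2 := by
  induction m generalizing f with
  | zero => trivial
  | succ m ih => exact hm_succ (fun i => (hf.hasD i).snd) fun i => ih (hf.der i)

theorem der_mk {f : E} {g : F} (hf : Hm 1 f) (hg : Hm 1 g) (i : Fin 2) :
    der i (f, g) = (der i f, der i g) := ((hf.hasD i).prodMk (hg.hasD i)).der_eq

theorem dw_mk {w : List (Fin 2)} {f : E} {g : F} (hf : Hm w.length f) (hg : Hm w.length g) :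
    dw w (f, g) = (dw w f, dw w g) := by
  induction w with
  | nil => rfl
  | cons i w ih =>
    simp only [dw]
    rw [ih (hf.mono (by simp)) (hg.mono (by simp)),
      der_mk (hf.dw (by simp [add_comm])) (hg.dw (by simp [add_comm]))]

theorem N_fst_le {m : ℕ} {f : E × F} (hf : Hm m f) : N m f.1 ≤ N m f := by
  induction m generalizing f with
  | zero => exact norm_fst_le f
  | succ m ih =>
    have h0 := ih (hf.der 0)
    have h1 := ih (hf.der 1)
    have h2 := norm_fst_le f
    simp only [N, (hf.hasD _).fst.der_eq]
    linarith

theorem N_snd_le {m : ℕ} {f : E × F} (hf : Hm m f) : N m f.2 ≤ N m f := by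
  induction m generalizing f with
  | zero => exact norm_snd_le f
  | succ m ih =>
    have h0 := ih (hf.der 0)
    have h1 := ih (hf.der 1)
    have h2 := norm_snd_le f
    simp only [N, (hf.hasD _).snd.der_eq]
    linarith

theorem N_mk_le {m : ℕ} {f : E} {g : F} (hf : Hm m f) (hg : Hm m g) :
    N m (f, g) ≤ N m f + N m g := by
  induction m generalizing f g with
  | zero =>
    simp only [N, Prod.norm_mk]
    exact max_le_add_of_nonneg (norm_nonneg _) (norm_nonneg _)
  | succ m ih =>
    have h0 := ih (hf.der 0) (hg.der 0)
    have h1 := ih (hf.der 1) (hg.der 1)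
    have h2 : ‖(f, g)‖ ≤ ‖f‖ + ‖g‖ :=
      max_le_add_of_nonneg (norm_nonneg _) (norm_nonneg _)
    simp only [N, der_mk (hf.mono (by omega : 1 ≤ m + 1)) (hg.mono (by omega : 1 ≤ m + 1))]
    linarith

theorem ConvH.prodMk {ι : Type*} {m : ℕ} {l : Filter ι} {f : ι → E} {g : ι → F} {f₀ : E} {g₀ : F}
    (hf : ConvH m f l f₀) (hg : ConvH m g l g₀) : ConvH m (fun n => (f n, g n)) l (f₀, g₀) := by
  induction m generalizing f g f₀ g₀ with
  | zero => exact Tendsto.prodMk_nhds hf hg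
  | succ m ih =>
    refine convH_succ (hf.1.prodMk_nhds hg.1) (fun i => ?_)
      (fun i => (hf.2 i).2.1.prodMk (hg.2 i).2.1) fun i => ih (hf.der i) (hg.der i)
    filter_upwards [(hf.2 i).1, (hg.2 i).1] with n h1 h2 using h1.prodMk h2

end Prod

section Skew

variable {E : Type*} [NormedAddCommGroup E] [InnerProductSpace ℝ E] [Shift E]

theorem inner_sh (i : Fin 2) (t : ℝ) (f g : E) : ⟪sh i t f, sh i t g⟫ = ⟪f, g⟫ :=
  (⟨(sh i t).toLinearMap, norm_sh i t⟩ : E →ₗᵢ[ℝ] E).inner_map_map f g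

/-- Integration by parts. -/
theorem HasD.inner_eq_neg {i : Fin 2} {f g f' g' : E} (hf : HasD i f f') (hg : HasD i g g') :
    ⟪f', g⟫ = -⟪f, g'⟫ := by
  have h1 := HasDerivAt.inner ℝ hf hg
  simp only [inner_sh, sh_zero] at h1
  have h2 := h1.unique (hasDerivAt_const (0 : ℝ) (⟪f, g⟫))
  linarith

end Skew

/-! ### Multiplication by coefficients on the cylinder -/

/-- Coefficients: the sum of a square-integrable function on the cylinder and of a function that
depends on the second variable only, and is square-integrable on the circle. -/
abbrev Coef : Type := LG × LT

/-- The function on the cylinder that a coefficient stands for. -/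
def fn (F : Coef) (z : Cyl) : ℝ := F.1 z + F.2 z.2

theorem ae_snd {p : Circ → Prop} (h : ∀ᵐ y : Circ, p y) : ∀ᵐ z : Cyl, p z.2 :=
  (Measure.quasiMeasurePreserving_snd (μ := (volume : Measure ℝ))
    (ν := (volume : Measure Circ))).ae h

theorem aestronglyMeasurable_fn (F : Coef) : AEStronglyMeasurable (fn F) volume :=
  ((Lp.stronglyMeasurable F.1).add
    ((Lp.stronglyMeasurable F.2).comp_measurable measurable_snd)).aestronglyMeasurable

theorem fn_add (F F' : Coef) : fn (F + F') =ᵐ[volume] fun z => fn F z + fn F' z := by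
  filter_upwards [Lp.coeFn_add F.1 F'.1, ae_snd (Lp.coeFn_add F.2 F'.2)] with z h1 h2
  simp only [fn, Prod.fst_add, Prod.snd_add, h1, h2, Pi.add_apply]
  ring

theorem fn_smul (c : ℝ) (F : Coef) : fn (c • F) =ᵐ[volume] fun z => c * fn F z := by
  filter_upwards [Lp.coeFn_smul c F.1, ae_snd (Lp.coeFn_smul c F.2)] with z h1 h2
  simp only [fn, Prod.smul_fst, Prod.smul_snd, h1, h2, Pi.smul_apply, smul_eq_mul]
  ring

theorem fn_sh (i : Fin 2) (t : ℝ) (F : Coef) :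
    fn (sh i t F) =ᵐ[volume] fun z => fn F (toCyl (t • dir i) + z) := by
  filter_upwards [sh_ae_cyl i t F.1, ae_snd (sh_ae_circ i t F.2)] with z h1 h2
  simp only [fn, sh_prod, h1, h2]
  rfl

/-- The product of the coefficient `F` and `g` is square-integrable. -/
def Ok (F : Coef) (g : LG) : Prop := MemLp (fun z => fn F z * g z) 2 (volume : Measure Cyl)

open Classical in
/-- The product of a coefficient and a square-integrable function, `0` if the product is not
square-integrable. -/
def mul (F : Coef) (g : LG) : LG := if h : Ok F g then MemLp.toLp _ h else 0

theorem coeFn_mul {F : Coef} {g : LG} (h : Ok F g) :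
    (mul F g : Cyl → ℝ) =ᵐ[volume] fun z => fn F z * g z := by
  rw [mul, dif_pos h]; exact MemLp.coeFn_toLp h

theorem mul_eq_of_ae {F : Coef} {g h : LG} (e : (h : Cyl → ℝ) =ᵐ[volume] fun z => fn F z * g z) :
    Ok F g ∧ mul F g = h := by
  have ok : Ok F g := (memLp_congr_ae e).1 (Lp.memLp h)
  exact ⟨ok, Lp.ext ((coeFn_mul ok).trans e.symm)⟩

theorem ok_mul_add_left {F F' : Coef} {g : LG} (h : Ok F g) (h' : Ok F' g) :
    Ok (F + F') g ∧ mul (F + F') g = mul F g + mul F' g := by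
  refine mul_eq_of_ae ?_
  filter_upwards [Lp.coeFn_add (mul F g) (mul F' g), coeFn_mul h, coeFn_mul h', fn_add F F']
    with z h1 h2 h3 h4
  rw [h1, Pi.add_apply, h2, h3, h4]; ring

theorem ok_mul_add_right {F : Coef} {g g' : LG} (h : Ok F g) (h' : Ok F g') :
    Ok F (g + g') ∧ mul F (g + g') = mul F g + mul F g' := by
  refine mul_eq_of_ae ?_
  filter_upwards [Lp.coeFn_add (mul F g) (mul F g'), coeFn_mul h, coeFn_mul h',
    Lp.coeFn_add g g'] with z h1 h2 h3 h4
  rw [h1, Pi.add_apply, h2, h3, h4, Pi.add_apply]; ring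

theorem ok_mul_smul_left {F : Coef} {g : LG} (c : ℝ) (h : Ok F g) :
    Ok (c • F) g ∧ mul (c • F) g = c • mul F g := by
  refine mul_eq_of_ae ?_
  filter_upwards [Lp.coeFn_smul c (mul F g), coeFn_mul h, fn_smul c F] with z h1 h2 h3
  rw [h1, Pi.smul_apply, h2, h3, smul_eq_mul]; ring

theorem ok_mul_smul_right {F : Coef} {g : LG} (c : ℝ) (h : Ok F g) :
    Ok F (c • g) ∧ mul F (c • g) = c • mul F g := by
  refine mul_eq_of_ae ?_
  filter_upwards [Lp.coeFn_smul c (mul F g), coeFn_mul h, Lp.coeFn_smul c g] with z h1 h2 h3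
  rw [h1, Pi.smul_apply, h2, h3, Pi.smul_apply, smul_eq_mul, smul_eq_mul]; ring

theorem ok_mul_sub_left {F F' : Coef} {g : LG} (h : Ok F g) (h' : Ok F' g) :
    Ok (F - F') g ∧ mul (F - F') g = mul F g - mul F' g := by
  have h1 := ok_mul_smul_left (-1) h'
  have h2 := ok_mul_add_left h h1.1
  rw [h1.2] at h2
  simpa [sub_eq_add_neg] using h2

theorem ok_mul_sub_right {F : Coef} {g g' : LG} (h : Ok F g) (h' : Ok F g') :
    Ok F (g - g') ∧ mul F (g - g') = mul F g - mul F g' := by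
  have h1 := ok_mul_smul_right (-1) h'
  have h2 := ok_mul_add_right h h1.1
  rw [h1.2] at h2
  simpa [sub_eq_add_neg] using h2

theorem ok_mul_sh {F : Coef} {g : LG} (i : Fin 2) (t : ℝ) (h : Ok F g) :
    Ok (sh i t F) (sh i t g) ∧ mul (sh i t F) (sh i t g) = sh i t (mul F g) := by
  refine mul_eq_of_ae ?_
  filter_upwards [sh_ae_cyl i t (mul F g), sh_ae_cyl i t g, fn_sh i t F,
    (measurePreserving_add_left volume (toCyl (t • dir i))).quasiMeasurePreserving.ae_eq_comp
      (coeFn_mul h)] with z h1 h2 h3 h4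
  rw [h1, h2, h3]; exact h4

theorem mul_zero_left (g : LG) : mul 0 g = 0 := by
  refine (mul_eq_of_ae ?_).2
  filter_upwards [fn_smul 0 0, Lp.coeFn_zero ℝ 2 (volume : Measure Cyl)] with z h1 h2
  rw [zero_smul, zero_mul] at h1
  rw [h1, h2, Pi.zero_apply, zero_mul]

theorem mul_zero_right (F : Coef) : mul F 0 = 0 := by
  refine (mul_eq_of_ae ?_).2
  filter_upwards [Lp.coeFn_zero ℝ 2 (volume : Measure Cyl)] with z h2
  rw [h2, Pi.zero_apply, mul_zero]

/-! ### Bounds for products -/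

theorem abs_fn_le {F : Coef} (hF : Hm 2 F) : ∀ᵐ z : Cyl, |fn F z| ≤ 4 * N 2 F := by
  filter_upwards [abs_le_N_cyl hF.fst, ae_snd (abs_le_N_circ (hF.snd.mono one_le_two))] with z h1 h2
  have h3 := N_fst_le hF
  have h4 := (N_mono one_le_two F.2).trans (N_snd_le hF)
  exact (abs_add_le _ _).trans (by linarith)

theorem norm_mul_le_of_abs_le {F : Coef} {b : ℝ} (h : ∀ᵐ z : Cyl, |fn F z| ≤ b) (g : LG) :
    Ok F g ∧ ‖mul F g‖ ≤ b * ‖g‖ := by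
  have h' : ∀ᵐ z : Cyl, ‖fn F z * g z‖ ≤ b * ‖g z‖ := by
    filter_upwards [h] with z hz
    rw [norm_mul]
    exact mul_le_mul_of_nonneg_right hz (norm_nonneg _)
  have ok : Ok F g := (Lp.memLp g).of_le_mul
    ((aestronglyMeasurable_fn F).mul (Lp.aestronglyMeasurable g)) h'
  refine ⟨ok, Lp.norm_le_mul_norm_of_ae_le_mul ?_⟩
  filter_upwards [h', coeFn_mul ok] with z hz h1
  rwa [h1]

theorem norm_mul_le_left {F : Coef} (hF : Hm 2 F) (g : LG) :
    Ok F g ∧ ‖mul F g‖ ≤ 4 * N 2 F * ‖g‖ := norm_mul_le_of_abs_le (abs_fn_le hF) g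

theorem norm_mul_circ_le (β : LT) {g g1 : LG} (hg : HasD 1 g g1) :
    Ok (0, β) g ∧ ‖mul (0, β) g‖ ≤ 2 * ‖β‖ * (‖g‖ + ‖g1‖) := by
  have e : (fun z => fn (0, β) z * g z) =ᵐ[volume] fun z => β z.2 * g z := by
    filter_upwards [Lp.coeFn_zero ℝ 2 (volume : Measure Cyl)] with z hz
    simp only [fn, hz, Pi.zero_apply, zero_add]
  have mβ : AEStronglyMeasurable (fun z : Cyl => β z.2 * g z) volume :=
    ((Lp.stronglyMeasurable β).comp_measurable measurable_snd).aestronglyMeasurable.mul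
      (Lp.aestronglyMeasurable g)
  have key : ∫⁻ z : Cyl, ‖β z.2 * g z‖ₑ ^ 2
      ≤ ENNReal.ofReal ((2 * ‖β‖ * (‖g‖ + ‖g1‖)) ^ 2) := by
    calc ∫⁻ z : Cyl, ‖β z.2 * g z‖ₑ ^ 2
        ≤ ∫⁻ z : Cyl, (2 * ∫⁻ y : Circ, (‖g (z.1, y)‖ₑ ^ 2 + ‖g1 (z.1, y)‖ₑ ^ 2))
            * ‖β z.2‖ₑ ^ 2 := by
          refine lintegral_mono_ae ?_
          filter_upwards [cyl_circle_bound hg] with z hz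
          rw [enorm_mul, mul_pow, mul_comm]
          gcongr
      _ = (∫⁻ x : ℝ, 2 * ∫⁻ y : Circ, (‖g (x, y)‖ₑ ^ 2 + ‖g1 (x, y)‖ₑ ^ 2))
            * ∫⁻ y : Circ, ‖β y‖ₑ ^ 2 := by
          have mm : Measurable fun x : ℝ => 2 * ∫⁻ y : Circ, (‖g (x, y)‖ₑ ^ 2 + ‖g1 (x, y)‖ₑ ^ 2) :=
            (Measurable.lintegral_prod_right'
              (f := fun p : Cyl => ‖g p‖ₑ ^ 2 + ‖g1 p‖ₑ ^ 2)
              (((Lp.stronglyMeasurable g).measurable.enorm.pow_const 2).add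
                ((Lp.stronglyMeasurable g1).measurable.enorm.pow_const 2))).const_mul 2
          exact lintegral_prod_mul mm.aemeasurable
            ((Lp.stronglyMeasurable β).measurable.enorm.pow_const 2).aemeasurable
      _ = 2 * (‖g‖ₑ ^ 2 + ‖g1‖ₑ ^ 2) * ‖β‖ₑ ^ 2 := by
          rw [lintegral_const_mul' _ _ (by norm_num), lintegral_cyl_slices, enorm_sq_eq β]
      _ = ENNReal.ofReal (2 * (‖g‖ ^ 2 + ‖g1‖ ^ 2) * ‖β‖ ^ 2) := by
          rw [ENNReal.ofReal_mul (by positivity), ENNReal.ofReal_mul (by norm_num),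
            ENNReal.ofReal_add (by positivity) (by positivity)]
          simp [ENNReal.ofReal_pow]
      _ ≤ _ := by
          refine ENNReal.ofReal_le_ofReal ?_
          have h1 := mul_nonneg (norm_nonneg g) (norm_nonneg g1)
          have h2 : 2 * (‖g‖ ^ 2 + ‖g1‖ ^ 2) ≤ 4 * (‖g‖ + ‖g1‖) ^ 2 := by nlinarith
          calc _ ≤ 4 * (‖g‖ + ‖g1‖) ^ 2 * ‖β‖ ^ 2 := by gcongr
            _ = _ := by ring
  have hsq := eLpNorm_nnreal_eq_lintegral (f := fun z : Cyl => β z.2 * g z)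
    (μ := (volume : Measure Cyl)) (p := 2) (by norm_num)
  have hsq2 : (eLpNorm (fun z : Cyl => β z.2 * g z) 2 volume) ^ 2
      = ∫⁻ z : Cyl, ‖β z.2 * g z‖ₑ ^ 2 := by
    have h2 : ((2 : NNReal) : ℝ≥0∞) = 2 := by norm_num
    rw [h2] at hsq
    rw [hsq, ← ENNReal.rpow_natCast, ← ENNReal.rpow_mul]
    norm_num
  have ok : Ok (0, β) g := by
    refine (memLp_congr_ae e).2 ⟨mβ, ?_⟩
    have : (eLpNorm (fun z : Cyl => β z.2 * g z) 2 volume) ^ 2 < ⊤ := by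
      rw [hsq2]; exact key.trans_lt ENNReal.ofReal_lt_top
    exact (ENNReal.pow_lt_top_iff.1 this).resolve_right two_ne_zero
  refine ⟨ok, ?_⟩
  have h3 : ENNReal.ofReal (‖mul (0, β) g‖ ^ 2) ≤ ENNReal.ofReal ((2 * ‖β‖ * (‖g‖ + ‖g1‖)) ^ 2) := by
    rw [ofReal_norm_sq]
    refine le_trans (le_of_eq (lintegral_congr_ae ?_)) key
    filter_upwards [coeFn_mul ok, e] with z h1 h2
    rw [h1, h2]
  rw [ENNReal.ofReal_le_ofReal_iff (by positivity)] at h3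
  exact le_of_sq_le_sq h3 (by positivity)

theorem norm_mul_le_right (F : Coef) {g : LG} (hg : Hm 2 g) :
    Ok F g ∧ ‖mul F g‖ ≤ 4 * ‖F‖ * N 2 g := by
  have hβ := norm_mul_circ_le F.2 (hg.hasD 1)
  have hf' : ∀ᵐ z : Cyl, ‖fn (F.1, 0) z * g z‖ ≤ 2 * N 2 g * ‖F.1 z‖ := by
    filter_upwards [abs_le_N_cyl hg, ae_snd (Lp.coeFn_zero ℝ 2 (volume : Measure Circ))] with z h1 h2
    simp only [fn, h2, Pi.zero_apply, add_zero, norm_mul]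
    rw [mul_comm]
    exact mul_le_mul_of_nonneg_right h1 (norm_nonneg _)
  have hf : Ok (F.1, 0) g := (Lp.memLp F.1).of_le_mul
    ((aestronglyMeasurable_fn _).mul (Lp.aestronglyMeasurable g)) hf'
  have hfn : ‖mul (F.1, 0) g‖ ≤ 2 * N 2 g * ‖F.1‖ := by
    refine Lp.norm_le_mul_norm_of_ae_le_mul ?_
    filter_upwards [hf', coeFn_mul hf] with z h1 h2
    rwa [h2]
  have h := ok_mul_add_left hf hβ.1
  have e : ((F.1, 0) + (0, F.2) : Coef) = F := by simp
  rw [e] at h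
  refine ⟨h.1, ?_⟩
  rw [h.2]
  have h1 := norm_fst_le F
  have h2 := norm_snd_le F
  have h3 : ‖g‖ + ‖der 1 g‖ ≤ N 2 g := by
    have h4 := norm_le_N 1 (der 1 g)
    have h5 := N_nonneg 1 (der 0 g)
    have e : N 2 g = ‖g‖ + (N 1 (der 0 g) + N 1 (der 1 g)) := rfl
    linarith
  have h4 := N_nonneg 2 g
  calc ‖mul (F.1, 0) g + mul (0, F.2) g‖ ≤ 2 * N 2 g * ‖F.1‖ + 2 * ‖F.2‖ * (‖g‖ + ‖der 1 g‖) :=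
        (norm_add_le _ _).trans (add_le_add hfn hβ.2)
    _ ≤ 2 * N 2 g * ‖F‖ + 2 * ‖F‖ * N 2 g := by gcongr
    _ = _ := by ring

end

/-! ### The product rule -/

theorem ok_of_hm {a b : ℕ} {F : Coef} {g : LG} (hF : Hm a F) (hg : Hm b g) (h : 3 ≤ a + b) :
    Ok F g := by
  rcases le_or_gt 2 a with ha | ha
  · exact (norm_mul_le_left (hF.mono ha) g).1
  · exact (norm_mul_le_right F (hg.mono (by omega))).1

theorem tendsto_mul_left {ι : Type*} {l : Filter ι} {F : ι → Coef} {F₀ : Coef} {g : ι → LG}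
    {g₀ : LG} (hF : ConvH 2 F l F₀) (hg : Tendsto g l (𝓝 g₀)) :
    Tendsto (fun n => mul (F n) (g n)) l (𝓝 (mul F₀ g₀)) := by
  rw [tendsto_iff_norm_sub_tendsto_zero]
  have h1 : Tendsto (fun n => 4 * N 2 (F n - F₀) * ‖g n‖ + 4 * N 2 F₀ * ‖g n - g₀‖) l (𝓝 0) := by
    have := ((hF.tendsto_N.const_mul 4).mul hg.norm).add
      ((tendsto_iff_norm_sub_tendsto_zero.1 hg).const_mul (4 * N 2 F₀))
    simpa using this
  refine squeeze_zero' (Eventually.of_forall fun _ => norm_nonneg _) ?_ h1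
  filter_upwards [hF.eventually_hm] with n hn
  have e1 := norm_mul_le_left hn (g n)
  have e2 := norm_mul_le_left hF.hm (g n)
  have e3 := norm_mul_le_left hF.hm g₀
  have e4 := norm_mul_le_left (hn.sub hF.hm) (g n)
  have e5 := norm_mul_le_left hF.hm (g n - g₀)
  rw [(ok_mul_sub_left e1.1 e2.1).2] at e4
  rw [(ok_mul_sub_right e2.1 e3.1).2] at e5
  calc ‖mul (F n) (g n) - mul F₀ g₀‖
      = ‖(mul (F n) (g n) - mul F₀ (g n)) + (mul F₀ (g n) - mul F₀ g₀)‖ := by congr 1; abel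
    _ ≤ _ := (norm_add_le _ _).trans (add_le_add e4.2 e5.2)

theorem tendsto_mul_right {ι : Type*} {l : Filter ι} {F : ι → Coef} {F₀ : Coef} {g : ι → LG}
    {g₀ : LG} (hF : Tendsto F l (𝓝 F₀)) (hg : ConvH 2 g l g₀) :
    Tendsto (fun n => mul (F n) (g n)) l (𝓝 (mul F₀ g₀)) := by
  rw [tendsto_iff_norm_sub_tendsto_zero]
  have h1 : Tendsto (fun n => 4 * ‖F n‖ * N 2 (g n - g₀) + 4 * ‖F n - F₀‖ * N 2 g₀) l (𝓝 0) := by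
    have := ((hF.norm.const_mul 4).mul hg.tendsto_N).add
      (((tendsto_iff_norm_sub_tendsto_zero.1 hF).const_mul 4).mul_const (N 2 g₀))
    simpa using this
  refine squeeze_zero' (Eventually.of_forall fun _ => norm_nonneg _) ?_ h1
  filter_upwards [hg.eventually_hm] with n hn
  have e1 := norm_mul_le_right (F n) hn
  have e2 := norm_mul_le_right (F n) hg.hm
  have e3 := norm_mul_le_right F₀ hg.hm
  have e4 := norm_mul_le_right (F n) (hn.sub hg.hm)
  have e5 := norm_mul_le_right (F n - F₀) hg.hm
  rw [(ok_mul_sub_right e1.1 e2.1).2] at e4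
  rw [(ok_mul_sub_left e2.1 e3.1).2] at e5
  calc ‖mul (F n) (g n) - mul F₀ g₀‖
      = ‖(mul (F n) (g n) - mul (F n) g₀) + (mul (F n) g₀ - mul F₀ g₀)‖ := by congr 1; abel
    _ ≤ _ := (norm_add_le _ _).trans (add_le_add e4.2 e5.2)

theorem hasD_of_tendsto_dq {E : Type*} [NormedAddCommGroup E] [NormedSpace ℝ E] [Shift E]
    {i : Fin 2} {f g : E} (h : Tendsto (fun t => dq i t f) (𝓝[≠] 0) (𝓝 g)) : HasD i f g := by
  refine hasDerivAt_iff_tendsto_slope.2 (h.congr fun t => ?_)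
  simp [slope_def_module, dq, sh_zero]

theorem dq_mul {F : Coef} {g : LG} {i : Fin 2} {t : ℝ} (h1 : Ok F g)
    (h3 : Ok F (sh i t g)) :
    dq i t (mul F g) = mul (dq i t F) (sh i t g) + mul F (dq i t g) := by
  have h2 := ok_mul_sh i t h1
  have e1 := ok_mul_sub_left h2.1 h3
  have e2 := ok_mul_sub_right h3 h1
  rw [dq, dq, dq, (ok_mul_smul_left _ e1.1).2, (ok_mul_smul_right _ e2.1).2, e1.2, e2.2, h2.2,
    ← smul_add]
  congr 1; abel

/-- The product rule. -/
theorem HasD.mul {a b : ℕ} {F : Coef} {g : LG} (hF : Hm a F) (hg : Hm b g) (ha : 1 ≤ a)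
    (hb : 1 ≤ b) (hab : 4 ≤ a + b) (i : Fin 2) :
    HasD i (mul F g) (MHDStrip.mul (der i F) g + MHDStrip.mul F (der i g)) := by
  refine hasD_of_tendsto_dq ?_
  have ok := ok_of_hm hF hg (by omega)
  have hid : Tendsto (fun t : ℝ => t) (𝓝[≠] 0) (𝓝 0) := nhdsWithin_le_nhds
  have hs : ConvH b (fun t : ℝ => sh i t g) (𝓝[≠] 0) g := by
    simpa [sh_zero] using convH_sh (i := i) hid hg
  have t1 : Tendsto (fun t => MHDStrip.mul (dq i t F) (sh i t g)) (𝓝[≠] 0)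
      (𝓝 (MHDStrip.mul (der i F) g)) := by
    rcases le_or_gt 3 a with h | h
    · exact tendsto_mul_left (convH_dq (hF.mono h)) hs.tendsto
    · exact tendsto_mul_right (tendsto_dq (hF.hasD' ha i)) (hs.mono (by omega))
  have t2 : Tendsto (fun t => MHDStrip.mul F (dq i t g)) (𝓝[≠] 0)
      (𝓝 (MHDStrip.mul F (der i g))) := by
    rcases le_or_gt 3 b with h | h
    · exact tendsto_mul_right tendsto_const_nhds (convH_dq (hg.mono h))
    · exact tendsto_mul_left (convH_const (hF.mono (by omega))) (tendsto_dq (hg.hasD' hb i))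
  refine (t1.add t2).congr fun t => ?_
  exact (dq_mul ok (ok_of_hm hF (hg.shift i t) (by omega))).symm

theorem ConvH.mul {ι : Type*} {l : Filter ι} {a b c : ℕ} {F : ι → Coef} {F₀ : Coef} {g : ι → LG}
    {g₀ : LG} (hF : ConvH a F l F₀) (hg : ConvH b g l g₀) (ha : c ≤ a) (hb : c ≤ b)
    (hab : c + 3 ≤ a + b) : ConvH c (fun n => mul (F n) (g n)) l (mul F₀ g₀) := by
  have h0 : Tendsto (fun n => MHDStrip.mul (F n) (g n)) l (𝓝 (MHDStrip.mul F₀ g₀)) := by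
    rcases le_or_gt 2 a with h | h
    · exact tendsto_mul_left (hF.mono h) hg.tendsto
    · exact tendsto_mul_right hF.tendsto (hg.mono (by omega))
  induction c generalizing a b F F₀ g g₀ with
  | zero => exact h0
  | succ c ih =>
    obtain ⟨a, rfl⟩ : ∃ k, a = k + 1 := ⟨a - 1, by omega⟩
    obtain ⟨b, rfl⟩ : ∃ k, b = k + 1 := ⟨b - 1, by omega⟩
    refine convH_succ (F' := fun i n => MHDStrip.mul (MHDStrip.der i (F n)) (g n)
      + MHDStrip.mul (F n) (MHDStrip.der i (g n))) h0 (fun i => ?_) (fun i => HasD.mul hF.hm hg.hm (by omega) (by omega)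
      (by omega) i) (fun i => ?_)
    · filter_upwards [hF.eventually_hm, hg.eventually_hm] with n h1 h2
      exact HasD.mul h1 h2 (by omega) (by omega) (by omega) i
    · have c1 : ConvH c (fun n => MHDStrip.mul (MHDStrip.der i (F n)) (g n)) l
          (MHDStrip.mul (MHDStrip.der i F₀) g₀) := by
        refine ih (hF.der i) hg (by omega) (by omega) (by omega) ?_
        rcases le_or_gt 2 a with h | h
        · exact tendsto_mul_left ((hF.der i).mono h) hg.tendsto
        · exact tendsto_mul_right (hF.der i).tendsto (hg.mono (by omega))
      have c2 : ConvH c (fun n => MHDStrip.mul (F n) (MHDStrip.der i (g n))) l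
          (MHDStrip.mul F₀ (MHDStrip.der i g₀)) := by
        refine ih hF (hg.der i) (by omega) (by omega) (by omega) ?_
        rcases le_or_gt 2 b with h | h
        · exact tendsto_mul_right hF.tendsto ((hg.der i).mono h)
        · exact tendsto_mul_left (hF.mono (by omega)) (hg.der i).tendsto
      exact c1.add c2

theorem Hm.mul {a b c : ℕ} {F : Coef} {g : LG} (hF : Hm a F) (hg : Hm b g) (ha : c ≤ a)
    (hb : c ≤ b) (hab : c + 3 ≤ a + b) : Hm c (mul F g) :=
  (ConvH.mul (l := (⊤ : Filter Unit)) (convH_const hF) (convH_const hg) ha hb hab).hm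

/-- The pairs of words that occur in the commutator of a word of derivatives with a
multiplication: all ways to distribute the letters of the word over the two factors with at least
one letter on the first factor. -/
def csplits : List (Fin 2) → List (List (Fin 2) × List (Fin 2))
  | [] => []
  | i :: w => ([i], w) :: ((csplits w).map (fun p => (i :: p.1, p.2))
      ++ (csplits w).map (fun p => (p.1, i :: p.2)))

theorem length_of_mem_csplits {w : List (Fin 2)} {p : List (Fin 2) × List (Fin 2)}
    (h : p ∈ csplits w) : 1 ≤ p.1.length ∧ p.1.length + p.2.length = w.length := by
  induction w generalizing p with
  | nil => simp [csplits] at h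
  | cons i w ih =>
    simp only [csplits, List.mem_cons, List.mem_append, List.mem_map] at h
    rcases h with rfl | ⟨q, hq, rfl⟩ | ⟨q, hq, rfl⟩
    · simp; omega
    · have := ih hq; simp; omega
    · have := ih hq; simp; omega

theorem length_csplits_le (w : List (Fin 2)) : (csplits w).length ≤ 2 ^ w.length := by
  have : (csplits w).length + 1 = 2 ^ w.length := by
    induction w with
    | nil => rfl
    | cons i w ih =>
      simp only [csplits, List.length_cons, List.length_append, List.length_map, pow_succ]
      omega
  omega

/-- The commutator of the derivative along a word with the multiplication by `F`, applied to `g`. -/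
def comm (w : List (Fin 2)) (F : Coef) (g : LG) : LG :=
  ((csplits w).map fun p => mul (dw p.1 F) (dw p.2 g)).sum

theorem norm_list_sum_le {E κ : Type*} [NormedAddCommGroup E] {f : κ → E} {L : List κ} {B : ℝ}
    (h : ∀ p ∈ L, ‖f p‖ ≤ B) : ‖(L.map f).sum‖ ≤ L.length * B := by
  induction L with
  | nil => simp
  | cons a L ih =>
    rw [List.map_cons, List.sum_cons, List.length_cons]
    have h1 := ih fun p hp => h p (by simp [hp])
    have h2 := h a (by simp)
    have h3 := norm_add_le (f a) (L.map f).sum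
    push_cast
    linarith

section ListSum

variable {E : Type*} [NormedAddCommGroup E] [NormedSpace ℝ E] [Shift E] {κ : Type*}

theorem hm_list_sum {m : ℕ} {f : κ → E} {L : List κ} (h : ∀ p ∈ L, Hm m (f p)) :
    Hm m (L.map f).sum := by
  induction L with
  | nil => simpa using Hm.zero m
  | cons a L ih =>
    rw [List.map_cons, List.sum_cons]
    exact (h a (by simp)).add (ih fun p hp => h p (by simp [hp]))

theorem der_list_sum {f : κ → E} {L : List κ} (i : Fin 2) (h : ∀ p ∈ L, Hm 1 (f p)) :
    der i (L.map f).sum = (L.map fun p => der i (f p)).sum := by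
  induction L with
  | nil => simpa using der_zero i
  | cons a L ih =>
    rw [List.map_cons, List.sum_cons, der_add (h a (by simp))
      (hm_list_sum fun p hp => h p (by simp [hp])), ih fun p hp => h p (by simp [hp])]
    simp

theorem convH_list_sum {ι : Type*} {l : Filter ι} {m : ℕ} {f : κ → ι → E} {f₀ : κ → E}
    {L : List κ} (h : ∀ p ∈ L, ConvH m (f p) l (f₀ p)) :
    ConvH m (fun n => (L.map fun p => f p n).sum) l (L.map f₀).sum := by
  induction L with
  | nil => simpa using convH_const (Hm.zero m)
  | cons a L ih =>
    simp only [List.map_cons, List.sum_cons]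
    exact (h a (by simp)).add (ih fun p hp => h p (by simp [hp]))

end ListSum

theorem hm_comm {a b c : ℕ} {w : List (Fin 2)} {F : Coef} {g : LG} (hF : Hm a F) (hg : Hm b g)
    (ha : c + w.length ≤ a) (hb : c + w.length ≤ b + 1) (hab : c + 3 + w.length ≤ a + b) :
    Hm c (comm w F g) := by
  refine hm_list_sum fun p hp => ?_
  have h := length_of_mem_csplits hp
  exact Hm.mul (hF.dw (m := a - p.1.length) (by omega)) (hg.dw (m := b - p.2.length) (by omega))
    (by omega) (by omega) (by omega)

theorem convH_comm {ι : Type*} {l : Filter ι} {a b c : ℕ} {w : List (Fin 2)} {F : ι → Coef}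
    {F₀ : Coef} {g : ι → LG} {g₀ : LG} (hF : ConvH a F l F₀) (hg : ConvH b g l g₀)
    (ha : c + w.length ≤ a) (hb : c + w.length ≤ b + 1) (hab : c + 3 + w.length ≤ a + b) :
    ConvH c (fun n => comm w (F n) (g n)) l (comm w F₀ g₀) := by
  have key : ∀ p ∈ csplits w, ConvH c (fun n => mul (dw p.1 (F n)) (dw p.2 (g n))) l
      (mul (dw p.1 F₀) (dw p.2 g₀)) := fun p hp => by
    have h := length_of_mem_csplits hp
    have h1 : ConvH (a - p.1.length) (fun n => dw p.1 (F n)) l (dw p.1 F₀) := hF.dw (by omega)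
    have h2 : ConvH (b - p.2.length) (fun n => dw p.2 (g n)) l (dw p.2 g₀) := hg.dw (by omega)
    exact h1.mul h2 (by omega) (by omega) (by omega)
  exact convH_list_sum key

/-- The commutator of a word with one more letter in front. -/
theorem comm_cons {a b : ℕ} {w : List (Fin 2)} {F : Coef} {g : LG} (i : Fin 2) (hF : Hm a F)
    (hg : Hm b g) (ha : 1 + w.length ≤ a) (hb : w.length ≤ b)
    (hab : 4 + w.length ≤ a + b) :
    comm (i :: w) F g = mul (der i F) (dw w g) + der i (comm w F g) := by
  have h1 : ∀ p ∈ csplits w, HasD i (mul (dw p.1 F) (dw p.2 g))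
      (mul (dw (i :: p.1) F) (dw p.2 g) + mul (dw p.1 F) (dw (i :: p.2) g)) := fun p hp => by
    have h := length_of_mem_csplits hp
    exact HasD.mul (hF.dw (m := a - p.1.length) (by omega))
      (hg.dw (m := b - p.2.length) (by omega)) (by omega) (by omega) (by omega) i
  have h2 : ∀ p ∈ csplits w, Hm 1 (mul (dw p.1 F) (dw p.2 g)) := fun p hp => by
    have h := length_of_mem_csplits hp
    exact Hm.mul (hF.dw (m := a - p.1.length) (by omega))
      (hg.dw (m := b - p.2.length) (by omega)) (by omega) (by omega) (by omega)
  simp only [comm, csplits]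
  rw [der_list_sum i h2, List.map_cons, List.sum_cons, List.map_append, List.sum_append,
    List.map_map, List.map_map]
  have e : (List.map (fun p => der i (mul (dw p.1 F) (dw p.2 g))) (csplits w)).sum
      = (List.map (fun p => mul (dw (i :: p.1) F) (dw p.2 g)
        + mul (dw p.1 F) (dw (i :: p.2) g)) (csplits w)).sum := by
    congr 1
    exact List.map_congr_left fun p hp => (h1 p hp).der_eq
  rw [e, List.sum_map_add]
  rfl

/-- The Leibniz rule. -/
theorem dw_mul {a b : ℕ} {w : List (Fin 2)} {F : Coef} {g : LG} (hF : Hm a F) (hg : Hm b g)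
    (ha : w.length ≤ a) (hb : w.length ≤ b) (hab : w.length + 3 ≤ a + b) :
    dw w (mul F g) = mul F (dw w g) + comm w F g := by
  induction w with
  | nil => simp [dw, comm, csplits]
  | cons i w ih =>
    simp only [List.length_cons] at ha hb hab
    simp only [dw]
    rw [ih (by omega) (by omega) (by omega),
      der_add (Hm.mul hF (hg.dw (m := b - w.length) (by omega)) (by omega) (by omega) (by omega))
        (hm_comm hF hg (by omega) (by omega) (by omega)),
      (HasD.mul hF (hg.dw (m := b - w.length) (w := w) (by omega)) (by omega) (by omega)
        (by omega) i).der_eq, comm_cons i hF hg (by omega) (by omega) (by omega)]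
    abel

theorem inner_mul {F : Coef} {g h : LG} (h1 : Ok F g) (h2 : Ok F h) :
    ⟪mul F g, h⟫ = ⟪g, mul F h⟫ := by
  rw [L2.inner_def, L2.inner_def]
  refine integral_congr_ae ?_
  filter_upwards [coeFn_mul h1, coeFn_mul h2] with z e1 e2
  rw [e1, e2]
  simp only [RCLike.inner_apply, conj_trivial]
  ring

theorem mul_left_comm' {F F' : Coef} (hF : Hm 2 F) (hF' : Hm 2 F') (g : LG) :
    mul F (mul F' g) = mul F' (mul F g) := by
  have h1 := (norm_mul_le_left hF (mul F' g)).1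
  have h2 := (norm_mul_le_left hF' (mul F g)).1
  refine Lp.ext ?_
  filter_upwards [coeFn_mul h1, coeFn_mul h2, coeFn_mul (norm_mul_le_left hF g).1,
    coeFn_mul (norm_mul_le_left hF' g).1] with z e1 e2 e3 e4
  rw [e1, e2, e3, e4]; ring

/-! ### Differentiating the top order energy -/

/-- A pointwise limit of differentiable functions is differentiable if the derivatives are
uniformly bounded and converge pointwise to a continuous function. -/
theorem hasDerivWithinAt_of_tendsto {T : ℝ} (hT : 0 < T) {Q R : ℝ → ℝ} {Qn Rn : ℕ → ℝ → ℝ} {B : ℝ}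
    (hd : ∀ n, ∀ t ∈ Icc 0 T, HasDerivWithinAt (Qn n) (Rn n t) (Icc 0 T) t)
    (hRc : ∀ n, ContinuousOn (Rn n) (Icc 0 T)) (hR : ContinuousOn R (Icc 0 T))
    (hQl : ∀ t ∈ Icc 0 T, Tendsto (fun n => Qn n t) atTop (𝓝 (Q t)))
    (hRl : ∀ t ∈ Icc 0 T, Tendsto (fun n => Rn n t) atTop (𝓝 (R t)))
    (hB : ∀ n, ∀ t ∈ Icc 0 T, |Rn n t| ≤ B) :
    ∀ t ∈ Icc 0 T, HasDerivWithinAt Q (R t) (Icc 0 T) t := by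
  have key : ∀ t ∈ Icc 0 T, Q t = Q 0 + ∫ s in (0 : ℝ)..t, R s := by
    intro t ht
    have hsub : Icc 0 t ⊆ Icc 0 T := Icc_subset_Icc_right ht.2
    have h1 : ∀ n, ∫ s in (0 : ℝ)..t, Rn n s = Qn n t - Qn n 0 := fun n => by
      refine intervalIntegral.integral_eq_sub_of_hasDerivAt_of_le ht.1 ?_ ?_ ?_
      · exact fun s hs => ((hd n s (hsub hs)).continuousWithinAt).mono hsub
      · intro s hs
        exact (hd n s (hsub (Ioo_subset_Icc_self hs))).hasDerivAt
          (Icc_mem_nhds hs.1 (hs.2.trans_le ht.2))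
      · exact ((hRc n).mono (by rwa [uIcc_of_le ht.1])).intervalIntegrable
    have h2 : Tendsto (fun n => ∫ s in (0 : ℝ)..t, Rn n s) atTop (𝓝 (∫ s in (0 : ℝ)..t, R s)) := by
      refine intervalIntegral.tendsto_integral_filter_of_dominated_convergence (fun _ => B)
        (Eventually.of_forall fun n => ?_) (Eventually.of_forall fun n => ?_)
        intervalIntegrable_const ?_
      · exact ((hRc n).mono (by
          rw [uIoc_of_le ht.1]; exact Ioc_subset_Icc_self.trans hsub)).aestronglyMeasurable
          measurableSet_uIoc
      · refine Eventually.of_forall fun s hs => ?_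
        rw [uIoc_of_le ht.1] at hs
        exact hB n s (hsub (Ioc_subset_Icc_self hs))
      · refine Eventually.of_forall fun s hs => ?_
        rw [uIoc_of_le ht.1] at hs
        exact hRl s (hsub (Ioc_subset_Icc_self hs))
    have h3 := (hQl t ht).sub (hQl 0 ⟨le_rfl, hT.le⟩)
    have h4 := tendsto_nhds_unique h2 (h3.congr fun n => (h1 n).symm)
    linarith
  set R' := IccExtend hT.le ((Icc 0 T).domRestrict R) with hR'
  have cR' : Continuous R' := (continuousOn_iff_continuous_domRestrict.1 hR).Icc_extend'
  have eR' : ∀ t ∈ Icc 0 T, R' t = R t := fun t ht => by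
    rw [hR', IccExtend_of_mem _ _ ht]; rfl
  intro t ht
  have h1 : HasDerivWithinAt (fun t => Q 0 + ∫ s in (0 : ℝ)..t, R' s) (R' t) (Icc 0 T) t :=
    (((cR'.integral_hasStrictDerivAt 0 t).hasDerivAt).const_add _).hasDerivWithinAt
  rw [eR' t ht] at h1
  refine h1.congr_of_mem (fun s hs => ?_) ht
  rw [key s hs]
  congr 1
  refine intervalIntegral.integral_congr fun r hr => ?_
  rw [uIcc_of_le hs.1] at hr
  exact (eR' r ⟨hr.1, hr.2.trans hs.2⟩).symm

/-- The value of the time derivative of the weighted energy `½ Σ_c ∫ w G_c²` when `G` is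
transported by the divergence free field `V`, with forcing `-K - ∇P`. -/
def flux (w w' : Coef) (V : Fin 2 → Coef) (G K : Fin 2 → LG) (P : LG) : ℝ :=
  ∑ c, ((1 / 2) * ⟪mul w' (G c), G c⟫
    + (1 / 2) * ∑ j, ⟪mul (der j w) (mul (V j) (G c)), G c⟫
    - ⟪mul w (G c), K c⟫ + ⟪mul (der c w) (G c), P⟫)

theorem tendsto_flux {ι : Type*} {l : Filter ι} {w w' : ι → Coef} {w₀ w₀' : Coef}
    {V : Fin 2 → ι → Coef} {V₀ : Fin 2 → Coef} {G K : Fin 2 → ι → LG} {G₀ K₀ : Fin 2 → LG}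
    {P : ι → LG} {P₀ : LG} (hw : ConvH 3 w l w₀) (hw' : ConvH 2 w' l w₀')
    (hV : ∀ j, ConvH 2 (V j) l (V₀ j)) (hG : ∀ c, Tendsto (G c) l (𝓝 (G₀ c)))
    (hK : ∀ c, Tendsto (K c) l (𝓝 (K₀ c))) (hP : Tendsto P l (𝓝 P₀)) :
    Tendsto (fun n => flux (w n) (w' n) (fun j => V j n) (fun c => G c n) (fun c => K c n) (P n)) l
      (𝓝 (flux w₀ w₀' V₀ G₀ K₀ P₀)) := by
  refine tendsto_finsetSum _ fun c _ => Tendsto.add (Tendsto.sub (Tendsto.add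
    (((tendsto_mul_left hw' (hG c)).inner (hG c)).const_mul _)
    (Tendsto.const_mul _ (tendsto_finsetSum _ fun j _ => ?_)))
    ((tendsto_mul_left (hw.mono (by norm_num)) (hG c)).inner (hK c)))
    ((tendsto_mul_left (hw.der c) (hG c)).inner hP)
  exact (tendsto_mul_left (hw.der j) (tendsto_mul_left (hV j) (hG c))).inner (hG c)

theorem abs_inner_mul_le {F : Coef} (hF : Hm 2 F) (g h : LG) :
    |⟪mul F g, h⟫| ≤ 4 * N 2 F * ‖g‖ * ‖h‖ :=
  (abs_real_inner_le_norm _ _).trans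
    (mul_le_mul_of_nonneg_right (norm_mul_le_left hF g).2 (norm_nonneg _))

theorem abs_flux_le {w w' : Coef} {V : Fin 2 → Coef} {G K : Fin 2 → LG} {P : LG}
    {a d a' v u k p : ℝ} (hw : Hm 3 w) (hw' : Hm 2 w') (hV : ∀ j, Hm 2 (V j))
    (ha : N 2 w ≤ a) (hd : ∀ j, N 2 (der j w) ≤ d) (ha' : N 2 w' ≤ a') (hv : ∀ j, N 2 (V j) ≤ v)
    (hu : ∀ c, ‖G c‖ ≤ u)
    (hk : ∀ c, ‖K c‖ ≤ k) (hp : ‖P‖ ≤ p) :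
    |flux w w' V G K P| ≤ 2 * ((1 / 2) * (4 * a' * u * u)
      + (1 / 2) * (2 * (4 * d * (4 * v * u) * u)) + 4 * a * u * k + 4 * d * u * p) := by
  have u0 : 0 ≤ u := (norm_nonneg _).trans (hu 0)
  have a0 : 0 ≤ a := (N_nonneg _ _).trans ha
  have d0 : 0 ≤ d := (N_nonneg _ _).trans (hd 0)
  have a0' : 0 ≤ a' := (N_nonneg _ _).trans ha'
  have v0 : 0 ≤ v := (N_nonneg _ _).trans (hv 0)
  have key : ∀ c, |(1 / 2) * ⟪mul w' (G c), G c⟫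
    + (1 / 2) * ∑ j, ⟪mul (der j w) (mul (V j) (G c)), G c⟫
    - ⟪mul w (G c), K c⟫ + ⟪mul (der c w) (G c), P⟫| ≤ (1 / 2) * (4 * a' * u * u)
      + (1 / 2) * (2 * (4 * d * (4 * v * u) * u)) + 4 * a * u * k + 4 * d * u * p := by
    intro c
    have h1 : |⟪mul w' (G c), G c⟫| ≤ 4 * a' * u * u := by
      refine (abs_inner_mul_le hw' _ _).trans ?_
      gcongr <;> exact hu c
    have h2 : ∀ j, |⟪mul (der j w) (mul (V j) (G c)), G c⟫| ≤ 4 * d * (4 * v * u) * u := fun j => by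
      refine (abs_inner_mul_le (hw.der j) _ _).trans ?_
      have := (norm_mul_le_left (hV j) (G c)).2
      have h' : ‖mul (V j) (G c)‖ ≤ 4 * v * u := this.trans (by gcongr; exacts [hv j, hu c])
      gcongr
      · exact hd j
      · exact hu c
    have h3 : |⟪mul w (G c), K c⟫| ≤ 4 * a * u * k := by
      refine (abs_inner_mul_le (hw.mono (by norm_num)) _ _).trans ?_
      gcongr
      · exact hu c
      · exact hk c
    have h4 : |⟪mul (der c w) (G c), P⟫| ≤ 4 * d * u * p := by
      refine (abs_inner_mul_le (hw.der c) _ _).trans ?_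
      gcongr
      · exact hd c
      · exact hu c
    have h5 := h2 0
    have h6 := h2 1
    rw [Fin.sum_univ_two]
    rw [abs_le] at *
    constructor <;> linarith [h1.1, h1.2, h3.1, h3.2, h4.1, h4.2, h5.1, h5.2, h6.1, h6.2]
  refine (Finset.abs_sum_le_sum_abs _ _).trans ((Finset.sum_le_sum fun c _ => key c).trans ?_)
  rw [Fin.sum_univ_two]
  linarith

/-- Transport by a divergence free field contributes only through the derivatives of the weight. -/
theorem sum_inner_transport {w : Coef} {V : Fin 2 → Coef} {G : LG} (hw : Hm 3 w)
    (hV : ∀ j, Hm 3 (V j)) (hG : Hm 1 G) (hdiv : ∑ j, der j (V j) = 0) :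
    ∑ j, ⟪mul w G, mul (V j) (der j G)⟫
      = -((1 / 2) * ∑ j, ⟪mul (der j w) (mul (V j) G), G⟫) := by
  have w2 : Hm 2 w := hw.mono (by norm_num)
  have V2 : ∀ j, Hm 2 (V j) := fun j => (hV j).mono (by norm_num)
  have okl : ∀ {F : Coef} (_ : Hm 2 F) (g : LG), Ok F g := fun hF g => (norm_mul_le_left hF g).1
  have key : ∀ j, 2 * ⟪mul w G, mul (V j) (der j G)⟫
      = -⟪mul (der j w) (mul (V j) G), G⟫ - ⟪mul w (mul (der j (V j)) G), G⟫ := by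
    intro j
    have h1 := HasD.mul (hV j) hG (by norm_num) le_rfl (by norm_num) j
    have hVG : Hm 1 (mul (V j) G) := Hm.mul (hV j) hG (by norm_num) le_rfl (by norm_num)
    have h2 := HasD.mul hw hVG (by norm_num) le_rfl (by norm_num) j
    rw [h1.der_eq, (ok_mul_add_right (okl w2 _) (okl w2 _)).2] at h2
    have h3 := h2.inner_eq_neg (hG.hasD j)
    rw [inner_add_left, inner_add_left] at h3
    have h4 : ⟪mul w (mul (V j) (der j G)), G⟫ = ⟪mul w G, mul (V j) (der j G)⟫ := by
      rw [inner_mul (okl w2 _) (okl w2 _), real_inner_comm]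
    have h5 : ⟪mul w (mul (V j) G), der j G⟫ = ⟪mul w G, mul (V j) (der j G)⟫ := by
      rw [mul_left_comm' w2 (V2 j), inner_mul (okl (V2 j) _) (okl (V2 j) _)]
    linarith
  have h0 : ∑ j, ⟪mul w (mul (der j (V j)) G), G⟫ = 0 := by
    have e : ∑ j, mul (der j (V j)) G = 0 := by
      rw [Fin.sum_univ_two, ← (ok_mul_add_left (okl ((hV 0).der 0) G) (okl ((hV 1).der 1) G)).2,
        ← Fin.sum_univ_two (f := fun j => der j (V j)), hdiv, mul_zero_left]
    rw [Fin.sum_univ_two] at e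
    rw [Fin.sum_univ_two, ← inner_add_left, ← (ok_mul_add_right (okl w2 _) (okl w2 _)).2, e,
      mul_zero_right, inner_zero_left]
  rw [Fin.sum_univ_two] at h0 ⊢
  rw [Fin.sum_univ_two]
  linarith [key 0, key 1]

/-- A gradient is orthogonal to divergence free fields, up to derivatives of the weight. -/
theorem sum_inner_gradient {w : Coef} {G : Fin 2 → LG} {p : LG} (hw : Hm 3 w)
    (hG : ∀ c, Hm 1 (G c)) (hp : Hm 1 p) (hdiv : ∑ c, der c (G c) = 0) :
    ∑ c, ⟪mul w (G c), der c p⟫ = -∑ c, ⟪mul (der c w) (G c), p⟫ := by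
  have w2 : Hm 2 w := hw.mono (by norm_num)
  have okl : ∀ {F : Coef} (_ : Hm 2 F) (g : LG), Ok F g := fun hF g => (norm_mul_le_left hF g).1
  have key : ∀ c, ⟪mul w (G c), der c p⟫
      = -⟪mul (der c w) (G c), p⟫ - ⟪mul w (der c (G c)), p⟫ := fun c => by
    have h := (HasD.mul hw (hG c) (by norm_num) le_rfl (by norm_num) c).inner_eq_neg (hp.hasD c)
    rw [inner_add_left] at h
    linarith
  have h0 : ∑ c, ⟪mul w (der c (G c)), p⟫ = 0 := by
    rw [Fin.sum_univ_two] at hdiv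
    rw [Fin.sum_univ_two, ← inner_add_left, ← (ok_mul_add_right (okl w2 _) (okl w2 _)).2, hdiv,
      mul_zero_right, inner_zero_left]
  rw [Fin.sum_univ_two] at h0 ⊢
  rw [Fin.sum_univ_two]
  linarith [key 0, key 1]

theorem HasDerivWithinAt.mul_coef {w : ℝ → Coef} {w' : Coef} {G : ℝ → LG} {G' : LG} {s : Set ℝ}
    {t : ℝ} (hw : Hm 2 (w t)) (hws : ∀ᶠ r in 𝓝[s \ {t}] t, Hm 2 (w r))
    (hw' : ConvH 2 (fun r => (r - t)⁻¹ • (w r - w t)) (𝓝[s \ {t}] t) w')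
    (hG : HasDerivWithinAt G G' s t) :
    HasDerivWithinAt (fun r => mul (w r) (G r)) (mul w' (G t) + mul (w t) G') s t := by
  rw [hasDerivWithinAt_iff_tendsto_slope]
  have h1 : Tendsto G (𝓝[s \ {t}] t) (𝓝 (G t)) :=
    hG.continuousWithinAt.tendsto.mono_left (nhdsWithin_mono _ sdiff_subset)
  have h2 := hasDerivWithinAt_iff_tendsto_slope.1 hG
  refine ((tendsto_mul_left hw' h1).add (tendsto_mul_left (convH_const hw) h2)).congr' ?_
  filter_upwards [hws] with r hr
  have e1 := (norm_mul_le_left hr (G r)).1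
  have e2 := (norm_mul_le_left hw (G r)).1
  have e3 := (norm_mul_le_left hw (G t)).1
  have e4 := ok_mul_sub_left e1 e2
  have e5 := ok_mul_sub_right e2 e3
  rw [slope_def_module, slope_def_module, (ok_mul_smul_left _ e4.1).2,
    (ok_mul_smul_right _ e5.1).2, e4.2, e5.2, ← smul_add]
  congr 1; abel

theorem ConvH.continuousOn_N {E : Type*} [NormedAddCommGroup E] [NormedSpace ℝ E] [Shift E]
    {m : ℕ} {F : ℝ → E} {s : Set ℝ} (h : ∀ t ∈ s, ConvH m F (𝓝[s] t) (F t)) :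
    ContinuousOn (fun t => N m (F t)) s := by
  intro t ht
  rw [ContinuousWithinAt, tendsto_iff_norm_sub_tendsto_zero]
  refine squeeze_zero' (Eventually.of_forall fun _ => norm_nonneg _) ?_ (h t ht).tendsto_N
  filter_upwards [(h t ht).eventually_hm] with r hr
  have h1 := N_add_le (hr.sub (h t ht).hm) (h t ht).hm
  have h2 := N_sub_le hr (hr.sub (h t ht).hm)
  simp only [sub_add_cancel, sub_sub_cancel] at h1 h2
  rw [Real.norm_eq_abs, abs_le]
  constructor <;> linarith

theorem exists_N_bound {E : Type*} [NormedAddCommGroup E] [NormedSpace ℝ E] [Shift E]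
    {m : ℕ} {F : ℝ → E} {T : ℝ} (h : ∀ t ∈ Icc 0 T, ConvH m F (𝓝[Icc 0 T] t) (F t)) :
    ∃ B, ∀ t ∈ Icc 0 T, N m (F t) ≤ B := by
  obtain ⟨B, hB⟩ := isCompact_Icc.exists_bound_of_continuousOn (ConvH.continuousOn_N h)
  exact ⟨B, fun t ht => (le_abs_self _).trans (hB t ht)⟩

theorem N_dq_le {E : Type*} [NormedAddCommGroup E] [NormedSpace ℝ E] [Shift E] [CompleteSpace E]
    {m : ℕ} {f : E} (hf : Hm (m + 1) f) (i : Fin 2) (h : ℝ) : N m (dq i h f) ≤ N m (der i f) := by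
  induction m generalizing f with
  | zero => exact norm_dq_le (hf.hasD i) h
  | succ m ih =>
    have h0 := ih (hf.der 0)
    have h1 := ih (hf.der 1)
    have h2 := norm_dq_le (hf.hasD i) h
    simp only [N, der_dq (hf.mono (by omega))]
    rw [der_comm (hf.mono (by omega)) 0 i, der_comm (hf.mono (by omega)) 1 i]
    linarith

/-! ### The energy identity by difference quotients -/

theorem ConvH.shift {E ι : Type*} [NormedAddCommGroup E] [NormedSpace ℝ E] [Shift E]
    {m : ℕ} {l : Filter ι} {F : ι → E} {f : E} (h : ConvH m F l f) (j : Fin 2) (t : ℝ) :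
    ConvH m (fun n => sh j t (F n)) l (sh j t f) := by
  induction m generalizing F f with
  | zero => exact tendsto_sh j tendsto_const_nhds h
  | succ m ih =>
    refine convH_succ (F' := fun i n => sh j t (MHDStrip.der i (F n)))
      (f' := fun i => sh j t (MHDStrip.der i f))
      (tendsto_sh j tendsto_const_nhds h.tendsto) (fun i => ?_) (fun i => ?_) (fun i => ih (h.der i))
    · filter_upwards [h.eventually_hm] with n hn using (hn.hasD i).shift j t
    · exact (h.hm.hasD i).shift j t

theorem ConvH.diffQuot {E ι : Type*} [NormedAddCommGroup E] [NormedSpace ℝ E] [Shift E]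
    {m : ℕ} {l : Filter ι} {F : ι → E} {f : E} (h : ConvH m F l f) (j : Fin 2) (t : ℝ) :
    ConvH m (fun n => dq j t (F n)) l (dq j t f) := ((h.shift j t).sub h).smul _

theorem exists_N_bound_fin {E : Type*} [NormedAddCommGroup E] [NormedSpace ℝ E] [Shift E]
    {m : ℕ} {F : Fin 2 → ℝ → E} {T : ℝ}
    (h : ∀ c, ∀ t ∈ Icc 0 T, ConvH m (F c) (𝓝[Icc 0 T] t) (F c t)) :
    ∃ B, ∀ c, ∀ t ∈ Icc 0 T, N m (F c t) ≤ B := by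
  choose B hB using fun c => exists_N_bound (h c)
  exact ⟨max (B 0) (B 1), fun c t ht => (hB c t ht).trans (by fin_cases c <;> simp)⟩

/-- The time derivative of a finite difference of a solution of a transport equation with
pressure; the commutator of the difference quotient with the transport operator is put into the
forcing. -/
theorem hasDerivWithinAt_dq {I : Set ℝ} {t : ℝ} (i : Fin 2) (h : ℝ) {c : Fin 2}
    {g : ℝ → LG} {V : Fin 2 → Coef} {S p : LG}
    (hg : Hm 1 (g t)) (hp : Hm 1 p) (hV : ∀ j, Hm 3 (V j))
    (he : HasDerivWithinAt g (-((∑ j, mul (V j) (der j (g t))) + S + der c p)) I t) :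
    HasDerivWithinAt (fun s => dq i h (g s))
      (-((∑ j, mul (V j) (der j (dq i h (g t))))
        + ((∑ j, mul (dq i h (V j)) (sh i h (der j (g t)))) + dq i h S)
        + der c (dq i h p))) I t := by
  have h1 : HasDerivWithinAt (fun s => dq i h (g s))
      (dq i h (-((∑ j, mul (V j) (der j (g t))) + S + der c p))) I t := by
    have a1 := (sh i h : LG →L[ℝ] LG).hasFDerivAt.comp_hasDerivWithinAt t he
    exact (a1.sub he).const_smul h⁻¹
  convert h1 using 1
  rw [dq_neg, dq_add, dq_add, dq_sum, der_dq hp]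
  have h2 : ∀ j, dq i h (mul (V j) (der j (g t))) = mul (dq i h (V j)) (sh i h (der j (g t)))
      + mul (V j) (der j (dq i h (g t))) := fun j => by
    have V2 : Hm 2 (V j) := (hV j).mono (by norm_num)
    rw [dq_mul (norm_mul_le_left V2 _).1 (norm_mul_le_left V2 _).1, der_dq hg]
  simp only [h2, Finset.sum_add_distrib]
  abel

/-- The energy identity for finite differences. -/
theorem hasDerivWithinAt_energy {I : Set ℝ} {t : ℝ} {w : ℝ → Coef} {w' : Coef}
    {V : Fin 2 → Coef} {G : Fin 2 → ℝ → LG} {K : Fin 2 → LG} {P : LG}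
    (hw : Hm 3 (w t)) (hws : ∀ᶠ r in 𝓝[I \ {t}] t, Hm 2 (w r))
    (hw' : ConvH 2 (fun r => (r - t)⁻¹ • (w r - w t)) (𝓝[I \ {t}] t) w')
    (hV : ∀ j, Hm 3 (V j)) (hG : ∀ c, Hm 1 (G c t)) (hP : Hm 1 P)
    (hdiv : ∑ c, der c (G c t) = 0) (hdivV : ∑ j, der j (V j) = 0)
    (he : ∀ c, HasDerivWithinAt (G c)
      (-((∑ j, mul (V j) (der j (G c t))) + K c + der c P)) I t) :
    HasDerivWithinAt (fun s => (1 / 2) * ∑ c, ⟪mul (w s) (G c s), G c s⟫)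
      (flux (w t) w' V (fun c => G c t) K P) I t := by
  have w2 : Hm 2 (w t) := hw.mono (by norm_num)
  have h1 : ∀ c, HasDerivWithinAt (fun s => ⟪mul (w s) (G c s), G c s⟫)
      (⟪mul w' (G c t), G c t⟫ - 2 * (∑ j, ⟪mul (w t) (G c t), mul (V j) (der j (G c t))⟫)
        - 2 * ⟪mul (w t) (G c t), K c⟫ - 2 * ⟪mul (w t) (G c t), der c P⟫) I t := fun c => by
    have a1 := (HasDerivWithinAt.mul_coef w2 hws hw' (he c)).inner ℝ (he c)
    refine a1.congr_deriv ?_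
    rw [inner_add_left, inner_mul (norm_mul_le_left w2 _).1 (norm_mul_le_left w2 _).1 (g := -_),
      real_inner_comm (mul (w t) (G c t)) (-_), inner_neg_right, inner_add_right, inner_add_right,
      inner_sum]
    ring
  have h2 := (HasDerivWithinAt.fun_sum (u := Finset.univ) fun c _ => h1 c).const_mul (1 / 2)
  refine h2.congr_deriv ?_
  have a := sum_inner_gradient hw hG hP hdiv
  have b := fun c => sum_inner_transport hw hV (hG c) hdivV
  simp only [flux, Fin.sum_univ_two] at a b ⊢
  linarith [b 0, b 1]

/-- The weighted energy of the derivatives of a solution of a transport equation with pressure is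
differentiable in time, although its time derivative formally contains one derivative more than
the regularity provides. -/
theorem hasDerivWithinAt_weighted_energy {T : ℝ} (hT : 0 < T) (i : Fin 2)
    {w w' : ℝ → Coef} {V : Fin 2 → ℝ → Coef} {g S : Fin 2 → ℝ → LG} {p : ℝ → LG}
    (hw : ∀ t ∈ Icc 0 T, ConvH 3 w (𝓝[Icc 0 T] t) (w t))
    (hw' : ∀ t ∈ Icc 0 T, ConvH 2 w' (𝓝[Icc 0 T] t) (w' t))
    (hdw : ∀ t ∈ Icc 0 T,
      ConvH 2 (fun r => (r - t)⁻¹ • (w r - w t)) (𝓝[Icc 0 T \ {t}] t) (w' t))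
    (hV : ∀ j, ∀ t ∈ Icc 0 T, ConvH 3 (V j) (𝓝[Icc 0 T] t) (V j t))
    (hg : ∀ c, ∀ t ∈ Icc 0 T, ConvH 1 (g c) (𝓝[Icc 0 T] t) (g c t))
    (hS : ∀ c, ∀ t ∈ Icc 0 T, ConvH 1 (S c) (𝓝[Icc 0 T] t) (S c t))
    (hp : ∀ t ∈ Icc 0 T, ConvH 1 p (𝓝[Icc 0 T] t) (p t))
    (hdiv : ∀ t ∈ Icc 0 T, ∑ c, der c (g c t) = 0)
    (hdivV : ∀ t ∈ Icc 0 T, ∑ j, der j (V j t) = 0)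
    (he : ∀ c, ∀ t ∈ Icc 0 T, HasDerivWithinAt (g c)
      (-((∑ j, mul (V j t) (der j (g c t))) + S c t + der c (p t))) (Icc 0 T) t) :
    ∀ t ∈ Icc 0 T, HasDerivWithinAt
      (fun t => (1 / 2) * ∑ c, ⟪mul (w t) (der i (g c t)), der i (g c t)⟫)
      (flux (w t) (w' t) (fun j => V j t) (fun c => der i (g c t))
        (fun c => (∑ j, mul (der i (V j t)) (der j (g c t))) + der i (S c t)) (der i (p t)))
      (Icc 0 T) t := by
  obtain ⟨a, ha⟩ := exists_N_bound hw
  obtain ⟨a', ha'⟩ := exists_N_bound hw'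
  obtain ⟨v, hv⟩ := exists_N_bound_fin hV
  obtain ⟨u, hu⟩ := exists_N_bound_fin hg
  obtain ⟨k, hk⟩ := exists_N_bound_fin hS
  obtain ⟨q, hq⟩ := exists_N_bound hp
  have hn : Tendsto (fun n : ℕ => ((1 : ℝ) / (n + 1))) atTop (𝓝[≠] 0) :=
    tendsto_nhdsWithin_iff.2 ⟨tendsto_one_div_add_atTop_nhds_zero_nat,
      Eventually.of_forall fun n => by simp only [mem_compl_iff, mem_singleton_iff]; positivity⟩
  have hdcont : ∀ (E : Type) [NormedAddCommGroup E] [NormedSpace ℝ E] [Shift E] (f : E),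
      Hm 1 f → Tendsto (fun n : ℕ => dq i (1 / ((n : ℝ) + 1)) f) atTop (𝓝 (der i f)) :=
    fun E _ _ _ f hf => (tendsto_dq (hf.hasD i)).comp hn
  have cV2 : ∀ j, ∀ t ∈ Icc 0 T, ConvH 2 (V j) (𝓝[Icc 0 T] t) (V j t) :=
    fun j t ht => (hV j t ht).mono (by norm_num)
  -- the commutator of the difference quotient with the transport operator, and its limits
  set K : ℝ → Fin 2 → ℝ → LG := fun h c t =>
    (∑ j, mul (dq i h (V j t)) (sh i h (der j (g c t)))) + dq i h (S c t) with hK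
  have cK : ∀ h c, ∀ t ∈ Icc 0 T, Tendsto (K h c) (𝓝[Icc 0 T] t) (𝓝 (K h c t)) := by
    intro h c t ht
    refine Tendsto.add (tendsto_finsetSum _ fun j _ => ?_) ((hS c t ht).diffQuot i h).tendsto
    exact tendsto_mul_left ((cV2 j t ht).diffQuot i h) (((hg c t ht).der j).shift i h).tendsto
  have lK : ∀ c, ∀ t ∈ Icc 0 T, Tendsto (fun n : ℕ => K (1 / ((n : ℝ) + 1)) c t) atTop
      (𝓝 ((∑ j, mul (der i (V j t)) (der j (g c t))) + der i (S c t))) := by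
    intro c t ht
    refine Tendsto.add (tendsto_finsetSum _ fun j _ => ?_) (hdcont _ _ (hS c t ht).hm)
    refine tendsto_mul_left ((convH_dq (hV j t ht).hm).comp hn) ?_
    have := tendsto_sh i (hn.mono_right nhdsWithin_le_nhds)
      (tendsto_const_nhds (x := der j (g c t)))
    rwa [sh_zero] at this
  have bK : ∀ h c, ∀ t ∈ Icc 0 T, ‖K h c t‖ ≤ 2 * (4 * v * u) + k := by
    intro h c t ht
    have e1 : ∀ j, ‖mul (dq i h (V j t)) (sh i h (der j (g c t)))‖ ≤ 4 * v * u := fun j => by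
      refine (norm_mul_le_left ((hV j t ht).hm.mono (by norm_num : 2 ≤ 3) |>.diffQuot i h) _).2.trans ?_
      have e2 := (N_dq_le (hV j t ht).hm i h).trans ((N_der_le 2 _ i).trans (hv j t ht))
      have e3 := (norm_le_N 0 _).trans ((N_der_le 0 _ j).trans (hu c t ht))
      rw [norm_sh]
      have e4 := (N_nonneg _ _).trans e2
      gcongr
    have e2 : ‖dq i h (S c t)‖ ≤ k := (norm_dq_le ((hS c t ht).hm.hasD i) h).trans
      ((norm_le_N 0 _).trans ((N_der_le 0 _ i).trans (hk c t ht)))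
    refine (norm_add_le _ _).trans (add_le_add ((norm_sum_le _ _).trans ?_) e2)
    rw [Fin.sum_univ_two]
    linarith [e1 0, e1 1]
  refine hasDerivWithinAt_of_tendsto hT (B := 2 * ((1 / 2) * (4 * a' * u * u)
      + (1 / 2) * (2 * (4 * a * (4 * v * u) * u)) + 4 * a * u * (2 * (4 * v * u) + k)
      + 4 * a * u * q))
    (Qn := fun n t => (1 / 2) * ∑ c, ⟪mul (w t) (dq i (1 / ((n : ℝ) + 1)) (g c t)),
      dq i (1 / ((n : ℝ) + 1)) (g c t)⟫)
    (Rn := fun n t => flux (w t) (w' t) (fun j => V j t)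
      (fun c => dq i (1 / ((n : ℝ) + 1)) (g c t)) (fun c => K (1 / ((n : ℝ) + 1)) c t)
      (dq i (1 / ((n : ℝ) + 1)) (p t)))
    (fun n t ht => ?_) (fun n t ht => ?_) (fun t ht => ?_) (fun t ht => ?_) (fun t ht => ?_)
    (fun n t ht => ?_)
  · set h := 1 / ((n : ℝ) + 1)
    refine hasDerivWithinAt_energy (w := w) (V := fun j => V j t)
      (G := fun c s => dq i h (g c s)) (hw t ht).hm ?_ (hdw t ht)
      (fun j => (hV j t ht).hm) (fun c => (hg c t ht).hm.diffQuot i h)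
      ((hp t ht).hm.diffQuot i h) ?_ (hdivV t ht) (fun c => ?_)
    · refine (((hw t ht).mono (by norm_num : 2 ≤ 3)).eventually_hm).filter_mono
        (nhdsWithin_mono _ sdiff_subset)
    · have e := hdiv t ht
      rw [Fin.sum_univ_two] at e ⊢
      rw [der_dq (hg 0 t ht).hm, der_dq (hg 1 t ht).hm, ← dq_add, e]
      simp [dq]
    · exact hasDerivWithinAt_dq i h (hg c t ht).hm (hp t ht).hm (fun j => (hV j t ht).hm)
        (he c t ht)
  · exact tendsto_flux (hw t ht) (hw' t ht) (fun j => cV2 j t ht)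
      (fun c => ((hg c t ht).diffQuot i _).tendsto) (fun c => cK _ c t ht)
      ((hp t ht).diffQuot i _).tendsto
  · refine tendsto_flux (hw t ht) (hw' t ht) (fun j => cV2 j t ht)
      (fun c => ((hg c t ht).der i).tendsto) (fun c => ?_) ((hp t ht).der i).tendsto
    refine Tendsto.add (tendsto_finsetSum _ fun j _ => ?_) ((hS c t ht).der i).tendsto
    exact tendsto_mul_left ((hV j t ht).der i) ((hg c t ht).der j).tendsto
  · refine Tendsto.const_mul _ (tendsto_finsetSum _ fun c _ => ?_)
    have e := hdcont _ _ (hg c t ht).hm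
    exact (tendsto_mul_left (convH_const ((hw t ht).hm.mono (by norm_num))) e).inner e
  · exact tendsto_flux (convH_const (hw t ht).hm) (convH_const (hw' t ht).hm)
      (fun j => convH_const (cV2 j t ht).hm) (fun c => hdcont _ _ (hg c t ht).hm)
      (fun c => lK c t ht) (hdcont _ _ (hp t ht).hm)
  · have e3 : ∀ {f : LG} {B : ℝ}, Hm 1 f → N 1 f ≤ B → ‖dq i (1 / ((n : ℝ) + 1)) f‖ ≤ B :=
      fun hf hB => (norm_dq_le (hf.hasD i) _).trans
        ((norm_le_N 0 _).trans ((N_der_le 0 _ i).trans hB))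
    exact abs_flux_le (hw t ht).hm (hw' t ht).hm (fun j => (cV2 j t ht).hm)
      ((N_mono (by norm_num : 2 ≤ 3) (w t)).trans (ha t ht))
      (fun j => (N_der_le 2 _ j).trans (ha t ht)) (ha' t ht)
      (fun j => (N_mono (by norm_num) _).trans (hv j t ht))
      (fun c => e3 (hg c t ht).hm (hu c t ht)) (fun c => bK _ c t ht)
      (e3 (hp t ht).hm (hq t ht))

/-! ### Interpolation and commutator estimates -/

theorem norm_der_sq_le {f : LG} (hf : Hm 2 f) (i : Fin 2) :
    ‖der i f‖ ^ 2 ≤ ‖f‖ * ‖der i (der i f)‖ := by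
  have h := (hf.hasD' (by norm_num) i).inner_eq_neg ((hf.der i).hasD i)
  rw [← real_inner_self_eq_norm_sq, h]
  exact (neg_le_abs _).trans (abs_real_inner_le_norm _ _)

/-- The Sobolev norms of a function are logarithmically convex in the order. -/
theorem N_sq_le {m : ℕ} {f : LG} (hf : Hm (m + 2) f) :
    N (m + 1) f ^ 2 ≤ (2 ^ (m + 2)) ^ 2 * (N m f * N (m + 2) f) := by
  set B := √(N m f * N (m + 2) f) with hB
  have hB2 : B ^ 2 = N m f * N (m + 2) f :=
    Real.sq_sqrt (mul_nonneg (N_nonneg _ _) (N_nonneg _ _))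
  have hle : N m f ≤ B := Real.le_sqrt_of_sq_le (by
    rw [sq]; exact mul_le_mul_of_nonneg_left (N_mono (by omega) f) (N_nonneg _ _))
  have h1 : N (m + 1) f ≤ (2 ^ (m + 2) - 1) * B := by
    refine N_le_of_wd (hf.mono (by omega)) fun a b hab => ?_
    rcases Nat.lt_or_ge (a + b) (m + 1) with h | h
    · refine ((norm_dw_le _ _).trans (N_mono ?_ f)).trans hle
      rw [length_wd]; omega
    · obtain ⟨i, v, hv, hl⟩ : ∃ i v, wd a b = i :: v ∧ v.length = m := by
        rcases hw : wd a b with _ | ⟨i, v⟩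
        · have := length_wd a b; simp [hw] at this; omega
        · exact ⟨i, v, rfl, by have := length_wd a b; simp [hw] at this; omega⟩
      rw [hv]
      refine Real.le_sqrt_of_sq_le ((norm_der_sq_le (hf.dw (by omega)) i).trans ?_)
      have h2 := norm_dw_le v f
      have h3 := norm_dw_le (i :: i :: v) f
      rw [hl] at h2
      simp only [List.length_cons, hl] at h3
      exact mul_le_mul h2 h3 (norm_nonneg _) (N_nonneg _ _)
  have hB0 : 0 ≤ B := Real.sqrt_nonneg _
  have h2 : N (m + 1) f ≤ 2 ^ (m + 2) * B := h1.trans (by nlinarith)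
  calc N (m + 1) f ^ 2 ≤ (2 ^ (m + 2) * B) ^ 2 := by
        gcongr; exact N_nonneg _ _
    _ = _ := by rw [mul_pow, hB2]

/-- Logarithmic convexity, extended over several steps. -/
theorem mul_le_of_log_convex {x : ℕ → ℝ} {C : ℝ} {U : ℕ} (h0 : ∀ m, 0 ≤ x m) (hC : 1 ≤ C)
    (h : ∀ m, m + 2 ≤ U → x (m + 1) ^ 2 ≤ C * (x m * x (m + 2))) (a d : ℕ) (hd : a + d + 2 ≤ U) :
    x (a + 1) * x (a + d + 1) ≤ C ^ (d + 1) * (x a * x (a + d + 2)) := by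
  induction d with
  | zero => simpa [sq] using h a hd
  | succ d ih =>
    have h1 := ih (by omega)
    have h2 := h (a + d + 1) (by omega)
    rw [show a + (d + 1) + 1 = a + d + 1 + 1 by ring, show a + (d + 1) + 2 = a + d + 1 + 2 by ring]
    rw [show a + d + 2 = a + d + 1 + 1 by ring] at h1
    set p := x (a + d + 1)
    set q := x (a + d + 1 + 1)
    set r := x (a + d + 1 + 2)
    have hp : 0 ≤ p := h0 _
    have hq : 0 ≤ q := h0 _
    have hr : 0 ≤ r := h0 _
    have ha := h0 a
    have hR : 0 ≤ C ^ (d + 1 + 1) * (x a * r) := by positivity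
    rcases hq.eq_or_lt with e | hq'
    · rw [← e, mul_zero]; exact hR
    rcases hp.eq_or_lt with e | hp'
    · rw [← e] at h2; nlinarith
    refine le_of_mul_le_mul_right (a := p * q) ?_ (by positivity)
    calc x (a + 1) * q * (p * q) = x (a + 1) * p * q ^ 2 := by ring
      _ ≤ C ^ (d + 1) * (x a * q) * (C * (p * r)) :=
          mul_le_mul h1 h2 (by positivity) (by positivity)
      _ = C ^ (d + 1 + 1) * (x a * r) * (p * q) := by ring

theorem mul_le_of_log_convex_of_add_eq {x : ℕ → ℝ} {C : ℝ} {L U : ℕ} (h0 : ∀ m, 0 ≤ x m)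
    (hC : 1 ≤ C) (h : ∀ m, m + 2 ≤ U → x (m + 1) ^ 2 ≤ C * (x m * x (m + 2))) {a b : ℕ}
    (ha : L ≤ a) (hb : L ≤ b) (hab : a + b = L + U) :
    x a * x b ≤ C ^ (U * U) * (x L * x U) := by
  have key : ∀ j a d, a = L + j → a + d + a = L + U →
      x a * x (a + d) ≤ C ^ (U * j) * (x L * x U) := by
    intro j
    induction j with
    | zero =>
      rintro a d rfl hd
      rw [show a + d = U by omega]; simp
    | succ j ih =>
      rintro a d rfl hd
      have h1 := mul_le_of_log_convex h0 hC h (L + j) d (by omega)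
      have h2 := ih (L + j) (d + 2) rfl (by omega)
      calc x (L + (j + 1)) * x (L + (j + 1) + d)
          ≤ C ^ (d + 1) * (x (L + j) * x (L + j + d + 2)) := by
            rwa [show L + (j + 1) + d = L + j + d + 1 by ring]
        _ ≤ C ^ U * (C ^ (U * j) * (x L * x U)) := by
            refine mul_le_mul (pow_le_pow_right₀ hC (by omega)) h2
              (mul_nonneg (h0 _) (h0 _)) (by positivity)
        _ = C ^ (U * (j + 1)) * (x L * x U) := by ring
  have hLU : 0 ≤ x L * x U := mul_nonneg (h0 _) (h0 _)
  have fin : ∀ a d, L ≤ a → a + d + a = L + U →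
      x a * x (a + d) ≤ C ^ (U * U) * (x L * x U) := by
    intro a d ha hd
    refine (key (a - L) a d (by omega) hd).trans ?_
    exact mul_le_mul_of_nonneg_right (pow_le_pow_right₀ hC (by gcongr; omega)) hLU
  rcases le_total a b with hle | hle
  · have := fin a (b - a) ha (by omega)
    rwa [show a + (b - a) = b by omega] at this
  · have := fin b (a - b) hb (by omega)
    rwa [show b + (a - b) = a by omega, mul_comm] at this

/-- The total Sobolev norm of order `m` of a finite family. -/
def NN {κ : Type*} [Fintype κ] (m : ℕ) (z : κ → LG) : ℝ := ∑ s, N m (z s)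

section NN

variable {κ : Type*} [Fintype κ]

theorem NN_nonneg (m : ℕ) (z : κ → LG) : 0 ≤ NN m z := Finset.sum_nonneg fun _ _ => N_nonneg _ _

theorem N_le_NN (m : ℕ) (z : κ → LG) (s : κ) : N m (z s) ≤ NN m z :=
  Finset.single_le_sum (f := fun s => N m (z s)) (fun _ _ => N_nonneg _ _) (Finset.mem_univ s)

theorem NN_mono {m n : ℕ} (h : m ≤ n) (z : κ → LG) : NN m z ≤ NN n z :=
  Finset.sum_le_sum fun _ _ => N_mono h _

/-- Sobolev norms are log-convex in the order, up to constants. -/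
theorem NN_sq_le {m U : ℕ} {z : κ → LG} (hz : ∀ s, Hm (m + 2) (z s)) (hU : m + 2 ≤ U) :
    NN (m + 1) z ^ 2 ≤ ((Fintype.card κ + 1) * 2 ^ U) ^ 2 * (NN m z * NN (m + 2) z) := by
  set B := √(NN m z * NN (m + 2) z) with hB
  have hB2 : B ^ 2 = NN m z * NN (m + 2) z :=
    Real.sq_sqrt (mul_nonneg (NN_nonneg _ _) (NN_nonneg _ _))
  have hB0 : 0 ≤ B := Real.sqrt_nonneg _
  have h1 : ∀ s, N (m + 1) (z s) ≤ 2 ^ U * B := fun s => by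
    refine le_of_sq_le_sq ?_ (by positivity)
    rw [mul_pow, hB2]
    refine (N_sq_le (hz s)).trans ?_
    have e1 := N_le_NN m z s
    have e2 := N_le_NN (m + 2) z s
    have e3 := N_nonneg m (z s)
    have e4 := N_nonneg (m + 2) (z s)
    have e5 := NN_nonneg m z
    gcongr
    norm_num
  have h2 : NN (m + 1) z ≤ (Fintype.card κ + 1) * 2 ^ U * B := by
    refine (Finset.sum_le_sum fun s _ => h1 s).trans ?_
    rw [Finset.sum_const, Finset.card_univ, nsmul_eq_mul]
    have : 0 ≤ 2 ^ U * B := by positivity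
    nlinarith
  calc NN (m + 1) z ^ 2 ≤ ((Fintype.card κ + 1) * 2 ^ U * B) ^ 2 := by
        gcongr; exact NN_nonneg _ _
    _ = _ := by rw [mul_pow, hB2]

/-- Products of intermediate Sobolev norms are bounded by products of the extreme ones. -/
theorem NN_mul_le {z : κ → LG} {K a b l : ℕ} (hz : ∀ s, Hm K (z s)) (hl : l ≤ K) (ha : 3 ≤ a)
    (hb : 3 ≤ b) (hab : a + b = 3 + l) :
    NN a z * NN b z ≤ (((Fintype.card κ + 1) * 2 ^ K) ^ 2) ^ (K * K) * (NN 4 z * NN K z) := by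
  have hC : (1 : ℝ) ≤ ((Fintype.card κ + 1) * 2 ^ K) ^ 2 := by
    have h1 : (1 : ℝ) ≤ 2 ^ K := one_le_pow₀ (by norm_num)
    have h2 : (0 : ℝ) ≤ Fintype.card κ := by positivity
    exact one_le_pow₀ (by nlinarith)
  refine (mul_le_of_log_convex_of_add_eq (x := fun m => NN m z) (L := 3) (U := l)
    (fun m => NN_nonneg m z) hC (fun m hm => NN_sq_le (fun s => (hz s).mono (by omega))
    (by omega)) ha hb hab).trans ?_
  have h1 := NN_nonneg 3 z
  have h2 := NN_nonneg l z
  have h3 := NN_nonneg 4 z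
  exact mul_le_mul (pow_le_pow_right₀ hC (by gcongr))
    (mul_le_mul (NN_mono (by norm_num) z) (NN_mono hl z) h2 h3) (mul_nonneg h1 h2)
    (by positivity)

end NN

/-- The constant in the commutator estimate. -/
def cInt (K n : ℕ) : ℝ := (((n + 1) * 2 ^ K) ^ 2) ^ (K * K)

theorem one_le_cInt (K n : ℕ) : 1 ≤ cInt K n := by
  have h1 : (1 : ℝ) ≤ 2 ^ K := one_le_pow₀ (by norm_num)
  have h2 : (0 : ℝ) ≤ n := by positivity
  exact one_le_pow₀ (one_le_pow₀ (by nlinarith))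

theorem dw_dw_le {m n : ℕ} {f : LG} (w : List (Fin 2)) (h : m + w.length ≤ n) :
    N m (dw w f) ≤ N n f := (N_dw_le m w f).trans (N_mono h f)

/-- One term of the commutator of derivatives of order at most `K` with the transport operator. -/
theorem norm_mul_dw_le {κ : Type*} [Fintype κ] {K : ℕ} (hK : 5 ≤ K) {z : κ → LG} {β : LT} {g : ℝ}
    (hz : ∀ s, Hm K (z s)) (hβ : Hm (K + 1) β) (hg : ∀ i, N K (der i β) ≤ g) (s s' : κ)
    (j : Fin 2) {v v' : List (Fin 2)} (h1 : 1 ≤ v.length) (h2 : v.length + v'.length ≤ K) :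
    ‖mul (dw v (z s, β)) (dw v' (der j (z s')))‖
      ≤ 4 * cInt K (Fintype.card κ) * (NN 4 z + g) * NN K z := by
  have hc := one_le_cInt K (Fintype.card κ)
  have n4 := NN_nonneg 4 z
  have nK := NN_nonneg K z
  have n4K : NN 4 z ≤ NN K z := NN_mono (by omega) z
  have g0 : 0 ≤ g := (N_nonneg _ _).trans (hg 0)
  have hzs := (hz s).mono (show v.length ≤ K by omega)
  have hβv := hβ.mono (show v.length ≤ K + 1 by omega)
  have ez : Hm (K - v.length) (dw v (z s)) := (hz s).dw (by omega)
  have eβ : Hm (K + 1 - v.length) (dw v β) := hβ.dw (by omega)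
  have ef : Hm (K - 1 - v'.length) (dw v' (der j (z s'))) := by
    have : Hm (K - 1) (der j (z s')) := ((hz s').mono (show K - 1 + 1 ≤ K by omega)).der j
    exact this.dw (by omega)
  have nf : ∀ m, m + v'.length + 1 ≤ K → N m (dw v' (der j (z s'))) ≤ NN (m + v'.length + 1) z :=
    fun m hm => ((N_dw_le m v' _).trans (N_der_le _ _ j)).trans (N_le_NN _ z s')
  have nβ : ∀ m, m + v.length ≤ K + 1 → N m (dw v β) ≤ g := fun m hm => by
    obtain ⟨u, i, rfl⟩ : ∃ u i, v = u ++ [i] :=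
      ⟨v.dropLast, v.getLast (by rintro rfl; simp at h1), (List.dropLast_append_getLast _).symm⟩
    rw [dw_append]
    refine ((N_dw_le m u _).trans (N_mono ?_ _)).trans (hg i)
    simp at hm; omega
  have ok1 : Ok (dw v (z s), 0) (dw v' (der j (z s'))) ∧
      ‖mul (dw v (z s), (0 : LT)) (dw v' (der j (z s')))‖
        ≤ 4 * (cInt K (Fintype.card κ) * (NN 4 z * NN K z)) := by
    rcases Nat.lt_or_ge v'.length 2 with hv | hv
    · have a := norm_mul_le_right (dw v (z s), (0 : LT)) (ef.mono (show 2 ≤ _ by omega))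
      refine ⟨a.1, a.2.trans ?_⟩
      have b1 : ‖(dw v (z s), (0 : LT))‖ ≤ NN K z := by
        rw [Prod.norm_def]
        simp only [norm_zero, norm_nonneg, sup_of_le_left]
        exact ((norm_dw_le v _).trans (N_le_NN _ z s)).trans (NN_mono (by omega) z)
      have b2 := (nf 2 (by omega)).trans (NN_mono (show 2 + v'.length + 1 ≤ 4 by omega) z)
      calc 4 * ‖(dw v (z s), (0 : LT))‖ * N 2 (dw v' (der j (z s'))) ≤ 4 * NN K z * NN 4 z := by
            gcongr; exact N_nonneg _ _
        _ ≤ _ := by nlinarith [mul_nonneg n4 nK]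
    · have a := norm_mul_le_left (F := (dw v (z s), 0)) ((ez.mono (show 2 ≤ _ by omega)).prodMk
        (Hm.zero 2)) (dw v' (der j (z s')))
      refine ⟨a.1, a.2.trans ?_⟩
      have b1 : N 2 (dw v (z s), (0 : LT)) ≤ NN (2 + v.length) z := by
        refine (N_mk_le (ez.mono (by omega)) (Hm.zero 2)).trans ?_
        rw [N_zero, add_zero]
        exact (N_dw_le 2 v _).trans (N_le_NN _ z s)
      have b2 := nf 0 (by omega)
      rw [mul_assoc]
      refine mul_le_mul_of_nonneg_left ?_ (by norm_num)
      refine (mul_le_mul b1 b2 (norm_nonneg _) (NN_nonneg _ _)).trans ?_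
      exact NN_mul_le hz h2 (by omega) (by omega) (by omega)
  have ok2 : Ok (0, dw v β) (dw v' (der j (z s'))) ∧
      ‖mul ((0 : LG), dw v β) (dw v' (der j (z s')))‖ ≤ 4 * (g * NN K z) := by
    rcases Nat.lt_or_ge v.length K with hv | hv
    · have a := norm_mul_le_left (F := ((0 : LG), dw v β)) ((Hm.zero 2).prodMk
        (eβ.mono (show 2 ≤ _ by omega))) (dw v' (der j (z s')))
      refine ⟨a.1, a.2.trans ?_⟩
      have b1 : N 2 ((0 : LG), dw v β) ≤ g := by
        refine (N_mk_le (Hm.zero 2) (eβ.mono (by omega))).trans ?_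
        rw [N_zero, zero_add]
        exact nβ 2 (by omega)
      have b2 := (nf 0 (by omega)).trans (NN_mono (show 0 + v'.length + 1 ≤ K by omega) z)
      rw [mul_assoc]
      exact mul_le_mul_of_nonneg_left (mul_le_mul b1 b2 (norm_nonneg _) g0) (by norm_num)
    · have a := norm_mul_le_right ((0 : LG), dw v β) (ef.mono (show 2 ≤ _ by omega))
      refine ⟨a.1, a.2.trans ?_⟩
      have b1 : ‖((0 : LG), dw v β)‖ ≤ g := by
        rw [Prod.norm_def]
        simp only [norm_zero, norm_nonneg, sup_of_le_right]
        exact nβ 0 (by omega)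
      have b2 := (nf 2 (by omega)).trans (NN_mono (show 2 + v'.length + 1 ≤ K by omega) z)
      rw [mul_assoc]
      exact mul_le_mul_of_nonneg_left (mul_le_mul b1 b2 (N_nonneg _ _) g0) (by norm_num)
  have e := ok_mul_add_left ok1.1 ok2.1
  rw [dw_mk hzs hβv, show (dw v (z s), dw v β) = (dw v (z s), (0 : LT)) + ((0 : LG), dw v β) by simp,
    e.2]
  refine (norm_add_le _ _).trans ((add_le_add ok1.2 ok2.2).trans ?_)
  have := mul_nonneg g0 nK
  nlinarith

/-- The commutator of at most `K` derivatives with the transport operator is bounded by the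
product of a low order norm and a norm of order `K`. -/
theorem norm_comm_le {κ : Type*} [Fintype κ] {K : ℕ} (hK : 5 ≤ K) {z : κ → LG} {β : LT} {g : ℝ}
    (hz : ∀ s, Hm K (z s)) (hβ : Hm (K + 1) β) (hg : ∀ i, N K (der i β) ≤ g) (s s' : κ)
    (j : Fin 2) {v : List (Fin 2)} (hv : v.length ≤ K) :
    ‖comm v (z s, β) (der j (z s'))‖
      ≤ 2 ^ K * (4 * cInt K (Fintype.card κ) * (NN 4 z + g) * NN K z) := by
  have g0 : 0 ≤ g := (N_nonneg _ _).trans (hg 0)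
  have hc := one_le_cInt K (Fintype.card κ)
  have n4 := NN_nonneg 4 z
  have nK := NN_nonneg K z
  refine (norm_list_sum_le (B := 4 * cInt K (Fintype.card κ) * (NN 4 z + g) * NN K z)
    fun p hp => ?_).trans ?_
  · have h := length_of_mem_csplits hp
    exact norm_mul_dw_le hK hz hβ hg s s' j h.1 (by omega)
  · refine mul_le_mul_of_nonneg_right ?_ (by positivity)
    refine (Nat.cast_le.2 (length_csplits_le v)).trans ?_
    push_cast
    exact pow_le_pow_right₀ (by norm_num) hv

/-- Derivatives of the product with a function of one variable. -/
theorem norm_dw_mul_circ_le {K : ℕ} (hK : 5 ≤ K) {β : LT} {f : LG} (hβ : Hm K β) (hf : Hm K f)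
    {v : List (Fin 2)} (hv : v.length ≤ K) :
    ‖dw v (mul (0, β) f)‖ ≤ (2 ^ K + 1) * (4 * N K β * N K f) := by
  have key : ∀ u u' : List (Fin 2), u.length + u'.length ≤ K →
      ‖mul (dw u ((0 : LG), β)) (dw u' f)‖ ≤ 4 * N K β * N K f := by
    intro u u' h
    rw [dw_mk (Hm.zero _) (hβ.mono (by omega)), dw_zero]
    have nβ := N_nonneg K β
    have nf := N_nonneg K f
    rcases Nat.lt_or_ge (K - 2) u.length with hu | hu
    · have a := norm_mul_le_right ((0 : LG), dw u β) (hf.dw (m := 2) (w := u') (by omega))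
      refine a.2.trans ?_
      have b1 : ‖((0 : LG), dw u β)‖ ≤ N K β := by
        rw [Prod.norm_def]
        simp only [norm_zero, norm_nonneg, sup_of_le_right]
        exact (norm_dw_le u β).trans (N_mono (by omega) β)
      have b2 : N 2 (dw u' f) ≤ N K f := dw_dw_le u' (by omega)
      gcongr
      exact N_nonneg _ _
    · have a := norm_mul_le_left (F := ((0 : LG), dw u β)) ((Hm.zero 2).prodMk
        (hβ.dw (m := 2) (w := u) (by omega))) (dw u' f)
      refine a.2.trans ?_
      have b1 : N 2 ((0 : LG), dw u β) ≤ N K β := by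
        refine (N_mk_le (Hm.zero 2) (hβ.dw (by omega))).trans ?_
        rw [N_zero, zero_add]
        exact (N_dw_le 2 u β).trans (N_mono (by omega) β)
      have b2 : ‖dw u' f‖ ≤ N K f := (norm_dw_le u' f).trans (N_mono (by omega) f)
      gcongr
  have h1 := dw_mul (w := v) ((Hm.zero K).prodMk hβ) hf hv hv (by omega)
  rw [h1]
  have h2 := key [] v (by simpa using hv)
  have h3 : ‖comm v ((0 : LG), β) f‖ ≤ 2 ^ K * (4 * N K β * N K f) := by
    refine (norm_list_sum_le (B := 4 * N K β * N K f) fun p hp => ?_).trans ?_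
    · have h := length_of_mem_csplits hp
      exact key p.1 p.2 (by omega)
    · have nβ := N_nonneg K β
      have nf := N_nonneg K f
      refine mul_le_mul_of_nonneg_right ?_ (by positivity)
      refine (Nat.cast_le.2 (length_csplits_le v)).trans ?_
      push_cast
      exact pow_le_pow_right₀ (by norm_num) hv
  refine (norm_add_le _ _).trans ?_
  have h2' : ‖mul ((0 : LG), β) (dw v f)‖ ≤ 4 * N K β * N K f := h2
  linarith

/-! ### The system in Elsässer variables on the cylinder -/

theorem sh_zero_circ (t : ℝ) (β : LT) : sh 0 t β = β := by
  refine Lp.ext ((sh_ae_circ 0 t β).trans (Eventually.of_forall fun y => ?_))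
  simp [toCirc_apply, dir]

theorem hasD_zero_circ (β : LT) : HasD 0 β 0 := by
  simpa [HasD, sh_zero_circ] using hasDerivAt_const (0 : ℝ) β

/-- The constant function `1` on the circle. -/
def one : LT := Lp.const 2 volume (1 : ℝ)

theorem one_ae : (one : Circ → ℝ) =ᵐ[volume] fun _ => (1 : ℝ) := Lp.coeFn_const 2 volume 1

theorem hasD_one (i : Fin 2) : HasD i one 0 := by
  have h : ∀ t, sh i t one = one := fun t => by
    refine Lp.ext ((sh_ae_circ i t one).trans ?_)
    have h1 := (measurePreserving_add_left (volume : Measure Circ)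
      (toCirc (t • dir i))).quasiMeasurePreserving.ae_eq_comp one_ae
    exact h1.trans one_ae.symm
  simpa [HasD, h] using hasDerivAt_const (0 : ℝ) one

theorem hm_one (m : ℕ) : Hm m one := by
  cases m with
  | zero => trivial
  | succ m => exact hm_succ (fun i => hasD_one i) fun _ => Hm.zero m

/-- The signs of the two Elsässer variables. -/
def sgn (σ : Bool) : ℝ := if σ then 1 else -1

/-- The components of the field that transports the Elsässer variable of sign `σ`: the opposite
Elsässer variable including the background flow and the background magnetic field. -/
def transp (C₀ : ℝ) (z : Bool × Fin 2 → LG) (β : Bool → LT) (σ : Bool) (j : Fin 2) : Coef :=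
  (z (!σ, j), if j = 0 then β (!σ) else (-(sgn (!σ) * C₀)) • one)

/-- The terms without derivatives of the perturbation that the background shear produces. -/
def reac (z : Bool × Fin 2 → LG) (β : Bool → LT) (σ : Bool) (c : Fin 2) : LG :=
  if c = 0 then mul (0, der 1 (β σ)) (z (!σ, 1)) else 0

/-- The Elsässer variables `z σ = u + σ ∇^⊥ρ` (perturbation) and `β σ = Ψ + σ ∂_yΦ̄` (background)
solve the perturbation equations on the cylinder, `zt` and `q` are the time derivative and the
pressure gradient, and `1 + r` is the weight in the energy, with `rt = ∂_t r`. -/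
structure Elsasser (k : ℕ) (κ C₀ T : ℝ) (z zt : Bool × Fin 2 → ℝ → LG) (β : Bool → ℝ → LT)
    (q : Fin 2 → ℝ → LG) (r rt : ℝ → LG) : Prop where
  cont_z : ∀ s, ∀ t ∈ Icc 0 T, ConvH (k + 1) (z s) (𝓝[Icc 0 T] t) (z s t)
  cont_zt : ∀ s, ∀ t ∈ Icc 0 T, ConvH k (zt s) (𝓝[Icc 0 T] t) (zt s t)
  deriv_z : ∀ s, ∀ v : List (Fin 2), v.length ≤ k → ∀ t ∈ Icc 0 T,
    HasDerivWithinAt (fun t => dw v (z s t)) (dw v (zt s t)) (Icc 0 T) t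
  cont_β : ∀ σ, ∀ t ∈ Icc 0 T, ConvH (k + 2) (β σ) (𝓝[Icc 0 T] t) (β σ t)
  cont_r : ∀ t ∈ Icc 0 T, ConvH 3 r (𝓝[Icc 0 T] t) (r t)
  cont_rt : ∀ t ∈ Icc 0 T, ConvH 2 rt (𝓝[Icc 0 T] t) (rt t)
  deriv_r : ∀ t ∈ Icc 0 T,
    ConvH 2 (fun s => (s - t)⁻¹ • (r s - r t)) (𝓝[Icc 0 T \ {t}] t) (rt t)
  div_free : ∀ σ, ∀ t ∈ Icc 0 T, ∑ c, der c (z (σ, c) t) = 0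
  curl_free : ∀ t ∈ Icc 0 T, der 0 (q 1 t) = der 1 (q 0 t)
  eq : ∀ σ c, ∀ t ∈ Icc 0 T, zt (σ, c) t = -((∑ j, mul (transp C₀ (fun s => z s t)
      (fun σ => β σ t) σ j) (der j (z (σ, c) t))) + reac (fun s => z s t) (fun σ => β σ t) σ c
    + (κ / 2) • (z (true, c) t + z (false, c) t) + q c t)

namespace Elsasser

variable {k : ℕ} {κ C₀ T : ℝ} {z zt : Bool × Fin 2 → ℝ → LG} {β : Bool → ℝ → LT}
    {q : Fin 2 → ℝ → LG} {r rt : ℝ → LG}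

/-- The weight `1 + r`. -/
def wt (r : LG) : Coef := (r, one)

theorem convH_transp (h : Elsasser k κ C₀ T z zt β q r rt) (σ : Bool) (j : Fin 2) {t : ℝ}
    (ht : t ∈ Icc 0 T) :
    ConvH (k + 1) (fun t => transp C₀ (fun s => z s t) (fun σ => β σ t) σ j) (𝓝[Icc 0 T] t)
      (transp C₀ (fun s => z s t) (fun σ => β σ t) σ j) := by
  refine (h.cont_z (!σ, j) t ht).prodMk ?_
  by_cases hj : j = 0
  · simp only [hj, if_true]
    exact (h.cont_β (!σ) t ht).mono (by omega)
  · simp only [hj, if_false]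
    exact convH_const ((hm_one _).smul _)

theorem convH_reac (hk : 4 ≤ k) (h : Elsasser k κ C₀ T z zt β q r rt) (σ : Bool) (c : Fin 2)
    {t : ℝ} (ht : t ∈ Icc 0 T) :
    ConvH (k + 1) (fun t => reac (fun s => z s t) (fun σ => β σ t) σ c) (𝓝[Icc 0 T] t)
      (reac (fun s => z s t) (fun σ => β σ t) σ c) := by
  unfold reac
  by_cases hc : c = 0
  · simp only [hc, if_true]
    have h1 : ConvH (k + 1) (fun t => ((0 : LG), der 1 (β σ t))) (𝓝[Icc 0 T] t)
        ((0 : LG), der 1 (β σ t)) :=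
      (convH_const (Hm.zero _)).prodMk ((h.cont_β σ t ht).der 1)
    exact h1.mul (h.cont_z (!σ, 1) t ht) le_rfl le_rfl (by omega)
  · simp only [hc, if_false]
    exact convH_const (Hm.zero _)

theorem convH_pressure (hk : 4 ≤ k) (h : Elsasser k κ C₀ T z zt β q r rt) (c : Fin 2)
    {t : ℝ} (ht : t ∈ Icc 0 T) : ConvH k (q c) (𝓝[Icc 0 T] t) (q c t) := by
  have e : ∀ t ∈ Icc 0 T, q c t = -(zt (true, c) t + ((∑ j, mul (transp C₀ (fun s => z s t)
      (fun σ => β σ t) true j) (der j (z (true, c) t)))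
      + reac (fun s => z s t) (fun σ => β σ t) true c
      + (κ / 2) • (z (true, c) t + z (false, c) t))) := fun t ht => by
    rw [h.eq true c t ht]; abel
  have h1 : ConvH k (fun t => ∑ j, mul (transp C₀ (fun s => z s t)
      (fun σ => β σ t) true j) (der j (z (true, c) t))) (𝓝[Icc 0 T] t)
      (∑ j, mul (transp C₀ (fun s => z s t) (fun σ => β σ t) true j) (der j (z (true, c) t))) :=
    ConvH.sum Finset.univ fun j _ => (h.convH_transp true j ht).mul
      ((h.cont_z (true, c) t ht).der j) (by omega) le_rfl (by omega)
  have h2 : ConvH k (fun t => reac (fun s => z s t) (fun σ => β σ t) true c) (𝓝[Icc 0 T] t)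
      (reac (fun s => z s t) (fun σ => β σ t) true c) :=
    (h.convH_reac hk true c ht).mono (by omega)
  have h3 : ConvH k (fun t => (κ / 2) • (z (true, c) t + z (false, c) t)) (𝓝[Icc 0 T] t)
      ((κ / 2) • (z (true, c) t + z (false, c) t)) :=
    (((h.cont_z (true, c) t ht).mono (by omega)).add
      ((h.cont_z (false, c) t ht).mono (by omega))).smul _
  rw [e t ht]
  refine ((h.cont_zt (true, c) t ht).add ((h1.add h2).add h3)).neg.congr' ?_
  filter_upwards [self_mem_nhdsWithin] with s hs
  exact (e s hs).symm

theorem der_wt {r : LG} (hr : Hm 1 r) (i : Fin 2) : der i (wt r) = (der i r, 0) := by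
  rw [wt, der_mk hr (hm_one 1), (hasD_one i).der_eq]

/-- The curve of derivatives `∂^v z` of order `k` solves a transport equation with pressure. -/
theorem hasDerivWithinAt_dw (hk : 4 ≤ k) (h : Elsasser k κ C₀ T z zt β q r rt) (σ c : _)
    (j : Fin 2) {v : List (Fin 2)} (hv : v.length + 1 = k) {t : ℝ} (ht : t ∈ Icc 0 T) :
    HasDerivWithinAt (fun t => dw (j :: v) (z (σ, c) t))
      (-((∑ i, mul (transp C₀ (fun s => z s t) (fun σ => β σ t) σ i)
          (der i (dw (j :: v) (z (σ, c) t))))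
        + ((∑ i, comm (j :: v) (transp C₀ (fun s => z s t) (fun σ => β σ t) σ i)
            (der i (z (σ, c) t)))
          + dw (j :: v) (reac (fun s => z s t) (fun σ => β σ t) σ c
            + (κ / 2) • (z (true, c) t + z (false, c) t)))
        + der c (dw v (q j t)))) (Icc 0 T) t := by
  have hl : (j :: v).length = k := by simpa using hv
  refine (h.deriv_z (σ, c) (j :: v) hl.le t ht).congr_deriv ?_
  have hz : ∀ s, Hm (k + 1) (z s t) := fun s => (h.cont_z s t ht).hm
  have hV : ∀ i, Hm (k + 1) (transp C₀ (fun s => z s t) (fun σ => β σ t) σ i) :=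
    fun i => (h.convH_transp σ i ht).hm
  have hq : ∀ c, Hm k (q c t) := fun c => (h.convH_pressure hk c ht).hm
  have hm1 : ∀ i, Hm k (mul (transp C₀ (fun s => z s t) (fun σ => β σ t) σ i)
      (der i (z (σ, c) t))) := fun i =>
    (hV i).mul ((hz (σ, c)).der i) (by omega) le_rfl (by omega)
  have hr : Hm k (reac (fun s => z s t) (fun σ => β σ t) σ c
      + (κ / 2) • (z (true, c) t + z (false, c) t)) :=
    ((h.convH_reac hk σ c ht).hm.mono (by omega)).add
      ((((hz _).mono (by omega)).add ((hz _).mono (by omega))).smul _)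
  -- `∂_c ∂^v q_j = ∂_j ∂^v q_c`, as `q` is curl free: all terms but the gradient have order `k`.
  have hq' : der c (dw v (q j t)) = dw (j :: v) (q c t) := by
    have e1 := dw_der (w := v) ((hq j).mono (by omega)) c
    have e2 := dw_der (w := v) ((hq c).mono (by omega)) j
    rw [dw, ← e1, ← e2]
    congr 1
    have e3 := h.curl_free t ht
    fin_cases c <;> fin_cases j <;> simp [e3]
  have hS : Hm (j :: v).length (∑ i, mul (transp C₀ (fun s => z s t) (fun σ => β σ t) σ i)
      (der i (z (σ, c) t))) := Hm.sum _ fun i _ => (hm1 i).mono hl.le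
  rw [h.eq σ c t ht, add_assoc (∑ j, _) (reac _ _ _ _) _,
    dw_neg ((hS.add (hr.mono hl.le)).add ((hq c).mono hl.le)),
    dw_add (hS.add (hr.mono hl.le)) ((hq c).mono hl.le), dw_add hS (hr.mono hl.le),
    dw_sum _ (fun i _ => (hm1 i).mono hl.le), hq']
  have e : ∀ i, dw (j :: v) (mul (transp C₀ (fun s => z s t) (fun σ => β σ t) σ i)
      (der i (z (σ, c) t))) = mul (transp C₀ (fun s => z s t) (fun σ => β σ t) σ i)
          (der i (dw (j :: v) (z (σ, c) t)))
        + comm (j :: v) (transp C₀ (fun s => z s t) (fun σ => β σ t) σ i)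
            (der i (z (σ, c) t)) := fun i => by
    rw [dw_mul (hV i) ((hz (σ, c)).der i) (by omega) (by omega) (by omega),
      dw_der ((hz (σ, c)).mono (by omega)) i]
  simp only [e, Finset.sum_add_distrib]
  abel

/-- The time derivative of the weighted energy of the derivatives `∂^v z σ`, `|v| = k + 1`. -/
theorem hasDerivWithinAt_energy (hT : 0 < T) (hk : 4 ≤ k) (h : Elsasser k κ C₀ T z zt β q r rt)
    (σ : Bool) (i j : Fin 2) {v : List (Fin 2)} (hv : v.length + 1 = k) {t : ℝ}
    (ht : t ∈ Icc 0 T) :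
    HasDerivWithinAt (fun t => (1 / 2) * ∑ c, ⟪mul (wt (r t)) (dw (i :: j :: v) (z (σ, c) t)),
        dw (i :: j :: v) (z (σ, c) t)⟫)
      (flux (wt (r t)) (rt t, 0) (transp C₀ (fun s => z s t) (fun σ => β σ t) σ)
        (fun c => dw (i :: j :: v) (z (σ, c) t))
        (fun c => ((∑ l, comm (i :: j :: v) (transp C₀ (fun s => z s t) (fun σ => β σ t) σ l)
            (der l (z (σ, c) t))) + dw (i :: j :: v) (reac (fun s => z s t) (fun σ => β σ t) σ c))
          + (κ / 2) • (dw (i :: j :: v) (z (true, c) t) + dw (i :: j :: v) (z (false, c) t)))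
        (dw (i :: v) (q j t))) (Icc 0 T) t := by
  have hl : (j :: v).length = k := by simpa using hv
  have h1 : ∀ c, ∀ t ∈ Icc 0 T, ConvH 1 (fun t => ((∑ i, comm (j :: v) (transp C₀
      (fun s => z s t) (fun σ => β σ t) σ i) (der i (z (σ, c) t)))
      + dw (j :: v) (reac (fun s => z s t) (fun σ => β σ t) σ c
        + (κ / 2) • (z (true, c) t + z (false, c) t)))) (𝓝[Icc 0 T] t)
      ((∑ i, comm (j :: v) (transp C₀
      (fun s => z s t) (fun σ => β σ t) σ i) (der i (z (σ, c) t)))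
      + dw (j :: v) (reac (fun s => z s t) (fun σ => β σ t) σ c
        + (κ / 2) • (z (true, c) t + z (false, c) t))) := by
    intro c t ht
    have a1 : ConvH 1 (fun t => ∑ i, comm (j :: v) (transp C₀
        (fun s => z s t) (fun σ => β σ t) σ i) (der i (z (σ, c) t))) (𝓝[Icc 0 T] t)
        (∑ i, comm (j :: v) (transp C₀
          (fun s => z s t) (fun σ => β σ t) σ i) (der i (z (σ, c) t))) :=
      ConvH.sum Finset.univ fun i _ => convH_comm (h.convH_transp σ i ht)
        ((h.cont_z (σ, c) t ht).der i) (by omega) (by omega) (by omega)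
    have a2 : ConvH (k + 1) (fun t => reac (fun s => z s t) (fun σ => β σ t) σ c
        + (κ / 2) • (z (true, c) t + z (false, c) t)) (𝓝[Icc 0 T] t)
        (reac (fun s => z s t) (fun σ => β σ t) σ c
        + (κ / 2) • (z (true, c) t + z (false, c) t)) :=
      (h.convH_reac hk σ c ht).add
        (((h.cont_z (true, c) t ht).add (h.cont_z (false, c) t ht)).smul _)
    exact a1.add (a2.dw (by omega))
  have hz : ∀ s, ∀ t ∈ Icc 0 T, Hm (k + 1) (z s t) := fun s t ht => (h.cont_z s t ht).hm
  have key := hasDerivWithinAt_weighted_energy hT i (w := fun t => wt (r t))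
    (w' := fun t => (rt t, 0))
    (V := fun j t => transp C₀ (fun s => z s t) (fun σ => β σ t) σ j)
    (g := fun c t => dw (j :: v) (z (σ, c) t))
    (S := fun c t => ((∑ i, comm (j :: v) (transp C₀
      (fun s => z s t) (fun σ => β σ t) σ i) (der i (z (σ, c) t)))
      + dw (j :: v) (reac (fun s => z s t) (fun σ => β σ t) σ c
        + (κ / 2) • (z (true, c) t + z (false, c) t)))) (p := fun t => dw v (q j t))
    (fun t ht => (h.cont_r t ht).prodMk (convH_const (hm_one 3)))
    (fun t ht => (h.cont_rt t ht).prodMk (convH_const (Hm.zero 2)))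
    (fun t ht => by
      refine ((h.deriv_r t ht).prodMk (convH_const (Hm.zero 2))).congr'
        (Eventually.of_forall fun s => ?_)
      simp [wt])
    (fun j t ht => (h.convH_transp σ j ht).mono (by omega))
    (fun c t ht => (h.cont_z (σ, c) t ht).dw (by omega)) h1
    (fun t ht => (h.convH_pressure hk j ht).dw (by omega))
    (fun t ht => by
      have e : ∀ c, der c (dw (j :: v) (z (σ, c) t)) = dw (j :: v) (der c (z (σ, c) t)) :=
        fun c => (dw_der ((hz (σ, c) t ht).mono (by omega)) c).symm
      simp only [e]
      rw [← dw_sum _ fun c _ => ((hz (σ, c) t ht).der c).mono (by omega), h.div_free σ t ht,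
        dw_zero])
    (fun t ht => by
      have e : ∀ l, der l (transp C₀ (fun s => z s t) (fun σ => β σ t) σ l)
          = (der l (z (!σ, l) t), (0 : LT)) := fun l => by
        have b1 : Hm 1 (β (!σ) t) := (h.cont_β (!σ) t ht).hm.mono (by omega)
        fin_cases l
        · simp only [transp, Fin.zero_eta, if_true]
          rw [der_mk ((hz _ t ht).mono (by omega)) b1, (hasD_zero_circ _).der_eq]
        · simp only [transp, Fin.mk_one, Fin.isValue, one_ne_zero, if_false]
          rw [der_mk ((hz _ t ht).mono (by omega)) ((hm_one 1).smul _),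
            der_smul _ (hm_one 1), (hasD_one 1).der_eq, smul_zero]
      simp only [e]
      rw [Fin.sum_univ_two]
      have e2 := h.div_free (!σ) t ht
      rw [Fin.sum_univ_two] at e2
      simp [e2])
    (fun c t ht => h.hasDerivWithinAt_dw hk σ c j hv ht) t ht
  refine key.congr_deriv ?_
  have b : ∀ c, (∑ l, mul (der i (transp C₀ (fun s => z s t) (fun σ => β σ t) σ l))
        (der l (dw (j :: v) (z (σ, c) t))))
      + der i ((∑ i, comm (j :: v) (transp C₀
      (fun s => z s t) (fun σ => β σ t) σ i) (der i (z (σ, c) t)))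
      + dw (j :: v) (reac (fun s => z s t) (fun σ => β σ t) σ c
        + (κ / 2) • (z (true, c) t + z (false, c) t)))
      = ((∑ l, comm (i :: j :: v) (transp C₀ (fun s => z s t) (fun σ => β σ t) σ l)
            (der l (z (σ, c) t))) + dw (i :: j :: v) (reac (fun s => z s t) (fun σ => β σ t) σ c))
          + (κ / 2) • (dw (i :: j :: v) (z (true, c) t) + dw (i :: j :: v) (z (false, c) t)) := by
    intro c
    have hc : ∀ l, Hm 1 (comm (j :: v) (transp C₀ (fun s => z s t) (fun σ => β σ t) σ l)
        (der l (z (σ, c) t))) := fun l => hm_comm (h.convH_transp σ l ht).hm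
          ((hz (σ, c) t ht).der l) (by omega) (by omega) (by omega)
    have hr := (h.convH_reac hk σ c ht).hm
    have hzz := (hz (true, c) t ht).add (hz (false, c) t ht)
    have e1 : der i (dw (j :: v) (reac (fun s => z s t) (fun σ => β σ t) σ c
        + (κ / 2) • (z (true, c) t + z (false, c) t)))
        = dw (i :: j :: v) (reac (fun s => z s t) (fun σ => β σ t) σ c)
          + (κ / 2) • (dw (i :: j :: v) (z (true, c) t) + dw (i :: j :: v) (z (false, c) t)) := by
      have hl2 : (i :: j :: v).length ≤ k + 1 := by simp at hl ⊢; omega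
      change dw (i :: j :: v) _ = _
      rw [dw_add (hr.mono hl2) ((hzz.smul _).mono hl2), dw_smul _ (hzz.mono hl2),
        dw_add ((hz _ t ht).mono hl2) ((hz _ t ht).mono hl2)]
    have hsum : Hm 1 (∑ i, comm (j :: v) (transp C₀ (fun s => z s t) (fun σ => β σ t) σ i)
        (der i (z (σ, c) t))) := Hm.sum _ fun l _ => hc l
    have hrz : Hm (k + 1) (reac (fun s => z s t) (fun σ => β σ t) σ c
        + (κ / 2) • (z (true, c) t + z (false, c) t)) := hr.add (hzz.smul _)
    rw [der_add hsum (hrz.dw (by omega)), der_sum _ (fun l _ => hc l), e1,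
      ← add_assoc, ← add_assoc, ← Finset.sum_add_distrib]
    congr 2
    refine Finset.sum_congr rfl fun l _ => ?_
    rw [comm_cons i (h.convH_transp σ l ht).hm ((hz (σ, c) t ht).der l) (by omega) (by omega)
      (by omega), dw_der ((hz (σ, c) t ht).mono (by omega)) l]
  have b' := funext b
  exact congrArg (fun K => flux _ _ _ _ K _) b'

end Elsasser

/-! ### The energy estimate on the cylinder -/

theorem flux_add {w w' : Coef} {V : Fin 2 → Coef} {G K K' : Fin 2 → LG} {P : LG} :
    flux w w' V G (fun c => K c + K' c) P = flux w w' V G K P - ∑ c, ⟪mul w (G c), K' c⟫ := by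
  simp only [flux, inner_add_right, Fin.sum_univ_two]
  ring

/-- The commutator constant for the four components of the Elsässer variables. -/
def cComm (k : ℕ) : ℝ := 2 ^ (k + 1) * (4 * cInt (k + 1) 4)

/-- The constant in the estimate of the reaction terms. -/
def cReac (k : ℕ) : ℝ := (2 ^ (k + 1) + 1) * 4

/-- The constant of the energy estimate on the cylinder. -/
def cEnergy (k : ℕ) (κ C₀ : ℝ) : ℝ :=
  36 + 32 * (|C₀| * N 2 one) + 8 * (2 * cComm k + cReac k)
    + 8 * N 2 one * (2 * cComm k + cReac k)
    + 8 * (2 ^ (k + 1) * (1 + κ + 8 * (|C₀| * N 2 one)))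
    + 8 * (2 ^ (k + 1) * (8 + 2 * cComm k + cReac k))

theorem cComm_nonneg (k : ℕ) : 0 ≤ cComm k := by
  have := one_le_cInt (k + 1) 4
  unfold cComm; positivity

theorem cReac_nonneg (k : ℕ) : 0 ≤ cReac k := by unfold cReac; positivity

namespace Elsasser

variable {k : ℕ} {κ C₀ T : ℝ} {z zt : Bool × Fin 2 → ℝ → LG} {β : Bool → ℝ → LT}
    {q : Fin 2 → ℝ → LG} {r rt : ℝ → LG}

section Bounds

variable {t e g X : ℝ}

theorem N_transp_le (h : Elsasser k κ C₀ T z zt β q r rt) (hk : 4 ≤ k) (ht : t ∈ Icc 0 T)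
    (he : NN 4 (fun s => z s t) ≤ e) (hg' : ∀ σ, N 2 (β σ t) ≤ g) (σ : Bool) (j : Fin 2) :
    N 2 (transp C₀ (fun s => z s t) (fun σ => β σ t) σ j) ≤ e + g + |C₀| * N 2 one := by
  have h1 : N 2 (z (!σ, j) t) ≤ e :=
    ((N_mono (by norm_num : 2 ≤ 4) _).trans (N_le_NN 4 (fun s => z s t) (!σ, j))).trans he
  have h2 : Hm 2 (z (!σ, j) t) := (h.cont_z (!σ, j) t ht).hm.mono (by omega)
  have g0 : 0 ≤ g := (N_nonneg _ _).trans (hg' true)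
  have n1 := N_nonneg 2 one
  by_cases hj : j = 0
  · simp only [transp, hj, if_true]
    rw [hj] at h1 h2
    refine (N_mk_le h2 ((h.cont_β (!σ) t ht).hm.mono (by omega))).trans ?_
    have := hg' (!σ)
    have : 0 ≤ |C₀| * N 2 one := by positivity
    linarith
  · simp only [transp, hj, if_false]
    refine (N_mk_le h2 ((hm_one 2).smul _)).trans ?_
    rw [N_smul _ (hm_one 2), abs_neg, abs_mul]
    have : |sgn (!σ)| = 1 := by cases σ <;> simp [sgn]
    rw [this, one_mul]
    linarith

/-- The commutator of `∂^v` with the transport. Here `e` bounds a low norm of the perturbation and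
`g` the background without its constant magnetic field, which commutes with `∂^v`. -/
theorem norm_comm_transp_le (h : Elsasser k κ C₀ T z zt β q r rt) (hk : 4 ≤ k) (ht : t ∈ Icc 0 T)
    (he : NN 4 (fun s => z s t) ≤ e) (hg : ∀ σ i, N (k + 1) (der i (β σ t)) ≤ g)
    (hX : NN (k + 1) (fun s => z s t) ≤ X) (σ : Bool) (c j : Fin 2) {v : List (Fin 2)}
    (hv : v.length ≤ k + 1) :
    ‖comm v (transp C₀ (fun s => z s t) (fun σ => β σ t) σ j) (der j (z (σ, c) t))‖
      ≤ cComm k * (e + g) * X := by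
  have hz : ∀ s, Hm (k + 1) (z s t) := fun s => (h.cont_z s t ht).hm
  have g0 : 0 ≤ g := (N_nonneg _ _).trans (hg true 0)
  have e0 : 0 ≤ e := (NN_nonneg _ _).trans he
  have X0 : 0 ≤ X := (NN_nonneg _ _).trans hX
  have hc := one_le_cInt (k + 1) 4
  have n4 := NN_nonneg 4 (fun s => z s t)
  have key : ∀ b : LT, Hm (k + 2) b → (∀ i, N (k + 1) (der i b) ≤ g) →
      ‖comm v (z (!σ, j) t, b) (der j (z (σ, c) t))‖ ≤ cComm k * (e + g) * X := fun b hb hgb => by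
    have h1 := norm_comm_le (by omega : 5 ≤ k + 1) hz hb hgb (!σ, j) (σ, c) j hv
    refine h1.trans ?_
    have : (Fintype.card (Bool × Fin 2)) = 4 := by simp
    rw [this]
    calc _ ≤ 2 ^ (k + 1) * (4 * cInt (k + 1) 4 * (e + g) * X) := by
          gcongr
          exact NN_nonneg _ _
      _ = cComm k * (e + g) * X := by rw [cComm]; ring
  by_cases hj : j = 0
  · simp only [transp, hj, if_true]
    rw [hj] at key
    exact key _ (h.cont_β (!σ) t ht).hm (hg (!σ))
  · simp only [transp, hj, if_false]
    refine key _ ((hm_one _).smul _) fun i => ?_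
    rw [der_smul _ (hm_one 1), (hasD_one i).der_eq, smul_zero, N_zero]
    exact g0

theorem norm_dw_reac_le (h : Elsasser k κ C₀ T z zt β q r rt) (hk : 4 ≤ k) (ht : t ∈ Icc 0 T)
    (hg : ∀ σ i, N (k + 1) (der i (β σ t)) ≤ g)
    (hX : NN (k + 1) (fun s => z s t) ≤ X) (σ : Bool) (c : Fin 2) {v : List (Fin 2)}
    (hv : v.length ≤ k + 1) :
    ‖dw v (reac (fun s => z s t) (fun σ => β σ t) σ c)‖ ≤ cReac k * g * X := by
  have g0 : 0 ≤ g := (N_nonneg _ _).trans (hg true 0)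
  have X0 : 0 ≤ X := (NN_nonneg _ _).trans hX
  have c0 := cReac_nonneg k
  by_cases hc : c = 0
  · simp only [reac, hc, if_true]
    have h1 := norm_dw_mul_circ_le (by omega : 5 ≤ k + 1) ((h.cont_β σ t ht).hm.der 1)
      (h.cont_z (!σ, 1) t ht).hm hv
    refine h1.trans ?_
    have h2 := hg σ 1
    have h3 := (N_le_NN (k + 1) (fun s => z s t) (!σ, 1)).trans hX
    have h4 := N_nonneg (k + 1) (z (!σ, 1) t)
    calc (2 ^ (k + 1) + 1) * (4 * N (k + 1) (der 1 (β σ t)) * N (k + 1) (z (!σ, 1) t))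
        ≤ (2 ^ (k + 1) + 1) * (4 * g * X) := by gcongr
      _ = cReac k * g * X := by rw [cReac]; ring
  · simp only [reac, hc, if_false, dw_zero, norm_zero]
    positivity

/-- The pressure gradient in `H^k`, expressed by the equation. The bound does not tend to `0` with
`e` and `g`; in the energy it is multiplied by a derivative of the weight, which is at most `e`. -/
theorem N_pressure_le (h : Elsasser k κ C₀ T z zt β q r rt) (hκ : 0 ≤ κ) (hk : 4 ≤ k)
    (ht : t ∈ Icc 0 T)
    (he : NN 4 (fun s => z s t) ≤ e) (hg : ∀ σ i, N (k + 1) (der i (β σ t)) ≤ g)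
    (hg' : ∀ σ, N 2 (β σ t) ≤ g) (hX : NN (k + 1) (fun s => z s t) ≤ X)
    (hX' : NN k (fun s => zt s t) ≤ X) (c : Fin 2) :
    N k (q c t) ≤ (2 ^ (k + 1) * (1 + κ + 8 * (|C₀| * N 2 one))
      + 2 ^ (k + 1) * (8 + 2 * cComm k + cReac k) * (e + g)) * X := by
  have hz : ∀ s, Hm (k + 1) (z s t) := fun s => (h.cont_z s t ht).hm
  have g0 : 0 ≤ g := (N_nonneg _ _).trans (hg true 0)
  have e0 : 0 ≤ e := (NN_nonneg _ _).trans he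
  have X0 : 0 ≤ X := (NN_nonneg _ _).trans hX
  have n1 := N_nonneg 2 one
  have c1 := cComm_nonneg k
  have c2 := cReac_nonneg k
  have hq := (h.convH_pressure hk c ht).hm
  set B : ℝ := (1 + κ + 8 * (|C₀| * N 2 one)) * X + (8 + 2 * cComm k + cReac k) * (e + g) * X
    with hB
  have B0 : 0 ≤ B := by positivity
  have key := N_le_of_wd (B := B) hq fun a b hab => ?_
  · refine key.trans ?_
    calc (2 ^ (k + 1) - 1) * B ≤ 2 ^ (k + 1) * B := by linarith
      _ = _ := by rw [hB]; ring
  set v := wd a b with hv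
  have hl : v.length ≤ k := by rw [hv, length_wd]; exact hab
  have hV : ∀ i, Hm (k + 1) (transp C₀ (fun s => z s t) (fun σ => β σ t) true i) :=
    fun i => (h.convH_transp true i ht).hm
  have hm1 : ∀ i, Hm k (mul (transp C₀ (fun s => z s t) (fun σ => β σ t) true i)
      (der i (z (true, c) t))) := fun i =>
    (hV i).mul ((hz (true, c)).der i) (by omega) le_rfl (by omega)
  have hr : Hm k (reac (fun s => z s t) (fun σ => β σ t) true c) :=
    (h.convH_reac hk true c ht).hm.mono (by omega)
  have hzz : Hm k (z (true, c) t + z (false, c) t) :=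
    ((hz _).mono (by omega)).add ((hz _).mono (by omega))
  have hzt : Hm k (zt (true, c) t) := (h.cont_zt (true, c) t ht).hm
  have hS : Hm k (∑ i, mul (transp C₀ (fun s => z s t) (fun σ => β σ t) true i)
      (der i (z (true, c) t))) := Hm.sum _ fun i _ => hm1 i
  have e1 : q c t = -(zt (true, c) t + ((∑ j, mul (transp C₀ (fun s => z s t)
      (fun σ => β σ t) true j) (der j (z (true, c) t)))
      + (reac (fun s => z s t) (fun σ => β σ t) true c
      + (κ / 2) • (z (true, c) t + z (false, c) t)))) := by
    rw [h.eq true c t ht]; abel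
  rw [e1, dw_neg ((hzt.add (hS.add (hr.add (hzz.smul _)))).mono hl), norm_neg,
    dw_add (hzt.mono hl) ((hS.add (hr.add (hzz.smul _))).mono hl),
    dw_add (hS.mono hl) ((hr.add (hzz.smul _)).mono hl),
    dw_add (hr.mono hl) ((hzz.smul _).mono hl), dw_smul _ (hzz.mono hl),
    dw_add (((hz _).mono (by omega))) (((hz _).mono (by omega))),
    dw_sum _ fun i _ => (hm1 i).mono hl]
  have b1 : ‖dw v (zt (true, c) t)‖ ≤ X :=
    ((norm_dw_le v _).trans (N_mono hl _)).trans ((N_le_NN k (fun s => zt s t) _).trans hX')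
  have b2 : ∀ i, ‖dw v (mul (transp C₀ (fun s => z s t) (fun σ => β σ t) true i)
      (der i (z (true, c) t)))‖ ≤ 4 * (e + g + |C₀| * N 2 one) * X + cComm k * (e + g) * X := by
    intro i
    rw [dw_mul (hV i) ((hz (true, c)).der i) (by omega) (by omega) (by omega)]
    refine (norm_add_le _ _).trans (add_le_add ?_
      (h.norm_comm_transp_le hk ht he hg hX true c i (by omega)))
    refine (norm_mul_le_left ((hV i).mono (by omega)) _).2.trans ?_
    have d1 := h.N_transp_le hk ht he hg' true i
    have d2 : ‖dw v (der i (z (true, c) t))‖ ≤ X :=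
      ((norm_dw_le v _).trans (N_mono hl _)).trans ((N_der_le k _ i).trans
        ((N_le_NN (k + 1) (fun s => z s t) _).trans hX))
    gcongr
  have b3 := h.norm_dw_reac_le hk ht hg hX true c (show v.length ≤ k + 1 by omega)
  have b4 : ∀ s, ‖dw v (z s t)‖ ≤ X := fun s =>
    ((norm_dw_le v _).trans (N_mono (by omega) _)).trans
      ((N_le_NN (k + 1) (fun s => z s t) _).trans hX)
  have b5 : ‖(κ / 2) • (dw v (z (true, c) t) + dw v (z (false, c) t))‖ ≤ κ * X := by
    rw [norm_smul, Real.norm_eq_abs, abs_of_nonneg (by positivity)]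
    have := norm_add_le (dw v (z (true, c) t)) (dw v (z (false, c) t))
    have := b4 (true, c)
    have := b4 (false, c)
    calc κ / 2 * ‖dw v (z (true, c) t) + dw v (z (false, c) t)‖ ≤ κ / 2 * (2 * X) := by
          gcongr; linarith
      _ = κ * X := by ring
  have b6 := norm_sum_le (Finset.univ : Finset (Fin 2)) fun i =>
    dw v (mul (transp C₀ (fun s => z s t) (fun σ => β σ t) true i) (der i (z (true, c) t)))
  rw [Fin.sum_univ_two (f := fun i => ‖_‖)] at b6
  refine (norm_add_le _ _).trans ((add_le_add_right (norm_add_le _ _) _).trans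
    ((add_le_add_right (add_le_add_right (norm_add_le _ _) _) _).trans ?_))
  have b7 := b2 0
  have b8 := b2 1
  have b9 : cReac k * g * X ≤ cReac k * (e + g) * X := by gcongr; linarith
  rw [hB]
  linarith

end Bounds

/-- The energy estimate on the cylinder. The damping contributes a multiple of the weighted norm
of `z⁺ + z⁻ = 2u`. -/
theorem energy_estimate (hT : 0 < T) (hκ : 0 ≤ κ) (hk : 4 ≤ k)
    (h : Elsasser k κ C₀ T z zt β q r rt)
    {v : List (Fin 2)} (hv : v.length = k + 1) {t : ℝ} (ht : t ∈ Icc 0 T) :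
    ∃ R, HasDerivWithinAt (fun t => ∑ σ, (1 / 2) * ∑ c, ⟪mul (wt (r t)) (dw v (z (σ, c) t)),
        dw v (z (σ, c) t)⟫) R (Icc 0 T) t ∧
      ∀ e g X, NN 4 (fun s => z s t) ≤ e → N 3 (r t) ≤ e → N 2 (rt t) ≤ e →
        (∀ σ i, N (k + 1) (der i (β σ t)) ≤ g) → (∀ σ, N 2 (β σ t) ≤ g) →
        NN (k + 1) (fun s => z s t) ≤ X → NN k (fun s => zt s t) ≤ X →
        R + (κ / 2) * ∑ c, ⟪mul (wt (r t)) (dw v (z (true, c) t) + dw v (z (false, c) t)),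
            dw v (z (true, c) t) + dw v (z (false, c) t)⟫
          ≤ 2 * (cEnergy k κ C₀ * (e + g + e ^ 2 + e * g) * X ^ 2) := by
  -- Two letters of `v` are singled out: the difference quotient is taken in the direction `i`, and
  -- `j` is the component of the pressure gradient that remains.
  obtain ⟨i, v, rfl⟩ : ∃ i v', v = i :: v' := by
    rcases v with _ | ⟨i, v⟩
    · simp at hv
    · exact ⟨i, v, rfl⟩
  obtain ⟨j, v, rfl⟩ : ∃ i v', v = i :: v' := by
    rcases v with _ | ⟨i, v⟩
    · simp at hv; omega
    · exact ⟨i, v, rfl⟩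
  have hv' : v.length + 1 = k := by simpa using hv
  refine ⟨_, HasDerivWithinAt.fun_sum (u := Finset.univ) fun σ _ =>
    h.hasDerivWithinAt_energy hT hk σ i j hv' ht, ?_⟩
  intro e g X he hr hrt hg hg' hX hX'
  have hz : ∀ s, Hm (k + 1) (z s t) := fun s => (h.cont_z s t ht).hm
  have g0 : 0 ≤ g := (N_nonneg _ _).trans (hg true 0)
  have e0 : 0 ≤ e := (NN_nonneg _ _).trans he
  have X0 : 0 ≤ X := (NN_nonneg _ _).trans hX
  have hr3 := (h.cont_r t ht).hm
  have hw3 : Hm 3 (wt (r t)) := hr3.prodMk (hm_one 3)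
  have hw2 : Hm 2 (wt (r t)) := hw3.mono (by norm_num)
  set w := i :: j :: v with hw
  have hwl : w.length ≤ k + 1 := hv.le
  set Q : ℝ := 2 ^ (k + 1) * (1 + κ + 8 * (|C₀| * N 2 one))
      + 2 ^ (k + 1) * (8 + 2 * cComm k + cReac k) * (e + g) with hQ
  have main : ∀ σ, flux (wt (r t)) (rt t, 0) (transp C₀ (fun s => z s t) (fun σ => β σ t) σ)
        (fun c => dw w (z (σ, c) t))
        (fun c => ((∑ l, comm w (transp C₀ (fun s => z s t) (fun σ => β σ t) σ l)
            (der l (z (σ, c) t))) + dw w (reac (fun s => z s t) (fun σ => β σ t) σ c)))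
        (dw (i :: v) (q j t)) ≤ cEnergy k κ C₀ * (e + g + e ^ 2 + e * g) * X ^ 2 := by
    intro σ
    have a1 : N 2 (wt (r t)) ≤ e + N 2 one :=
      (N_mk_le (hr3.mono (by norm_num)) (hm_one 2)).trans
        (by have := N_mono (by norm_num : 2 ≤ 3) (r t); linarith)
    have a2 : ∀ j, N 2 (der j (wt (r t))) ≤ e := fun j => by
      rw [der_wt (hr3.mono (by norm_num))]
      refine (N_mk_le (hr3.der j) (Hm.zero 2)).trans ?_
      rw [N_zero, add_zero]
      exact (N_der_le 2 _ j).trans hr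
    have hrt2 := (h.cont_rt t ht).hm
    have a3 : N 2 ((rt t, 0) : Coef) ≤ e := by
      refine (N_mk_le hrt2 (Hm.zero 2)).trans ?_
      rw [N_zero, add_zero]
      exact hrt
    have a4 : ∀ c, ‖dw w (z (σ, c) t)‖ ≤ X := fun c =>
      ((norm_dw_le w _).trans (N_mono hwl _)).trans ((N_le_NN (k + 1) (fun s => z s t) _).trans hX)
    have a5 : ∀ c, ‖(∑ l, comm w (transp C₀ (fun s => z s t) (fun σ => β σ t) σ l)
            (der l (z (σ, c) t))) + dw w (reac (fun s => z s t) (fun σ => β σ t) σ c)‖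
          ≤ (2 * cComm k + cReac k) * (e + g) * X := fun c => by
      have b1 := fun l => h.norm_comm_transp_le hk ht he hg hX σ c l hwl
      have b2 := h.norm_dw_reac_le hk ht hg hX σ c hwl
      refine (norm_add_le _ _).trans ((add_le_add_left (norm_sum_le _ _) _).trans ?_)
      rw [Fin.sum_univ_two]
      have c2 := cReac_nonneg k
      have b9 : cReac k * g * X ≤ cReac k * (e + g) * X := by gcongr; linarith
      linarith [b1 0, b1 1]
    have a6 : ‖dw (i :: v) (q j t)‖ ≤ Q * X :=
      (norm_dw_le _ _).trans ((N_mono (by simp; omega) _).trans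
        (h.N_pressure_le hκ hk ht he hg hg' hX hX' j))
    have a7 := abs_flux_le hw3 (hrt2.prodMk (Hm.zero 2))
      (fun j => (h.convH_transp σ j ht).hm.mono (show 2 ≤ k + 1 by omega)) a1 a2 a3
      (h.N_transp_le hk ht he hg' σ) a4 a5 a6
    refine (le_abs_self _).trans (a7.trans ?_)
    have n1 := N_nonneg 2 one
    have c1 := cComm_nonneg k
    have c2 := cReac_nonneg k
    have m0 : 0 ≤ |C₀| * N 2 one := by positivity
    have d0 : 0 ≤ 2 * cComm k + cReac k := by positivity
    have q0 : 0 ≤ 2 ^ (k + 1) * (1 + κ + 8 * (|C₀| * N 2 one)) := by positivity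
    have q1 : 0 ≤ 2 ^ (k + 1) * (8 + 2 * cComm k + cReac k) := by positivity
    rw [hQ, cEnergy]
    set m := |C₀| * N 2 one
    set d := 2 * cComm k + cReac k
    set p := 2 ^ (k + 1) * (1 + κ + 8 * m)
    set p' := 2 ^ (k + 1) * (8 + 2 * cComm k + cReac k)
    set o := N 2 one
    set D := e + g + e ^ 2 + e * g with hD
    have eg : 0 ≤ e * g := by positivity
    have e2 : 0 ≤ e ^ 2 := by positivity
    have X2 : 0 ≤ X ^ 2 := by positivity
    have D1 : e ≤ D := by linarith
    have D2 : e * (e + g) ≤ D := by rw [hD]; linarith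
    have D3 : e + g ≤ D := by linarith
    have s1 := mul_le_mul_of_nonneg_left D1 m0
    have s2 := mul_le_mul_of_nonneg_left D2 d0
    have s3 := mul_le_mul_of_nonneg_left D3 (mul_nonneg n1 d0)
    have s4 := mul_le_mul_of_nonneg_left D1 q0
    have s5 := mul_le_mul_of_nonneg_left D2 q1
    have tot : 4 * e + 32 * (e * (e + g)) + 32 * (m * e) + 8 * (d * (e * (e + g)))
        + 8 * (o * d * (e + g)) + 8 * (p * e) + 8 * (p' * (e * (e + g)))
        ≤ (36 + 32 * m + 8 * d + 8 * o * d + 8 * p + 8 * p') * D := by linarith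
    calc _ = (4 * e + 32 * (e * (e + g)) + 32 * (m * e) + 8 * (d * (e * (e + g)))
        + 8 * (o * d * (e + g)) + 8 * (p * e) + 8 * (p' * (e * (e + g)))) * X ^ 2 := by ring
      _ ≤ _ := mul_le_mul_of_nonneg_right tot X2
  have okw : ∀ f, Ok (wt (r t)) f := fun f => (norm_mul_le_left hw2 f).1
  have fl : ∀ σ, flux (wt (r t)) (rt t, 0) (transp C₀ (fun s => z s t) (fun σ => β σ t) σ)
        (fun c => dw w (z (σ, c) t))
        (fun c => ((∑ l, comm w (transp C₀ (fun s => z s t) (fun σ => β σ t) σ l)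
            (der l (z (σ, c) t))) + dw w (reac (fun s => z s t) (fun σ => β σ t) σ c))
          + (κ / 2) • (dw w (z (true, c) t) + dw w (z (false, c) t)))
        (dw (i :: v) (q j t)) = _ := fun σ => flux_add
  simp only [fl]
  have m1 := main true
  have m2 := main false
  have e1 : ∀ c, ⟪mul (wt (r t)) (dw w (z (true, c) t) + dw w (z (false, c) t)),
      dw w (z (true, c) t) + dw w (z (false, c) t)⟫
      = ⟪mul (wt (r t)) (dw w (z (true, c) t)), dw w (z (true, c) t) + dw w (z (false, c) t)⟫
      + ⟪mul (wt (r t)) (dw w (z (false, c) t)), dw w (z (true, c) t) + dw w (z (false, c) t)⟫ :=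
    fun c => by rw [(ok_mul_add_right (okw _) (okw _)).2, inner_add_left]
  simp only [e1, inner_smul_right, Fintype.sum_bool, Fin.sum_univ_two] at m1 m2 ⊢
  linarith

end Elsasser

section

open scoped ENNReal

/-! ### Even and odd reflection -/

section Doubling

variable {S G : Type*} [MeasurableSpace S] [MeasurableSpace G]

/-- The measure space `(G, ν)` consists of two copies of `(S, μ)`: `inj` are the inclusions of the
copies, `fold` identifies them, and `sign` is `1` on the first copy and `-1` on the second. -/
structure Doubling (μ : Measure S) (ν : Measure G) where
  inj : Bool → S → G
  fold : G → S
  sign : G → ℝ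
  measurable_inj : ∀ τ, Measurable (inj τ)
  measurable_fold : Measurable fold
  measurable_sign : Measurable sign
  sign_eq : ∀ z, sign z = 1 ∨ sign z = -1
  measure_eq : ν = μ.map (inj false) + μ.map (inj true)
  fold_inj : ∀ τ, ∀ᵐ s ∂μ, fold (inj τ s) = s
  sign_inj : ∀ τ, ∀ᵐ s ∂μ, sign (inj τ s) = if τ then -1 else 1

namespace Doubling

variable {μ : Measure S} {ν : Measure G} (d : Doubling μ ν)

theorem map_fold : ν.map d.fold = (2 : ℝ≥0∞) • μ := by
  have h : ∀ τ, (μ.map (d.inj τ)).map d.fold = μ := fun τ => by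
    rw [Measure.map_map d.measurable_fold (d.measurable_inj τ)]
    have : d.fold ∘ d.inj τ =ᵐ[μ] id := d.fold_inj τ
    rw [Measure.map_congr this, Measure.map_id]
  refine (congrArg (Measure.map d.fold) d.measure_eq).trans ?_
  rw [Measure.map_add _ _ d.measurable_fold, h, h, two_smul]

theorem ae_fold {p : S → Prop} (h : ∀ᵐ s ∂μ, p s) : ∀ᵐ z ∂ν, p (d.fold z) := by
  have hq : Measure.QuasiMeasurePreserving d.fold ν μ := by
    refine ⟨d.measurable_fold, ?_⟩
    rw [d.map_fold]
    exact Measure.smul_absolutelyContinuous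
  exact hq.ae h

theorem quasi_inj (τ : Bool) : Measure.QuasiMeasurePreserving (d.inj τ) μ ν := by
  refine ⟨d.measurable_inj τ, ?_⟩
  refine (congrArg (fun m => μ.map (d.inj τ) ≪ m) d.measure_eq).mpr ?_
  cases τ
  · exact (Measure.le_add_right le_rfl).absolutelyContinuous
  · exact (Measure.le_add_left le_rfl).absolutelyContinuous

theorem ae_inj {p : G → Prop} (h : ∀ᵐ z ∂ν, p z) (τ : Bool) : ∀ᵐ s ∂μ, p (d.inj τ s) :=
  (d.quasi_inj τ).ae h

theorem integral_eq {F : G → ℝ} (hF : Integrable F ν) :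
    ∫ z, F z ∂ν = ∫ s, (F (d.inj false s) + F (d.inj true s)) ∂μ := by
  have h : Integrable F (μ.map (d.inj false) + μ.map (d.inj true)) := d.measure_eq ▸ hF
  have hm := integrable_add_measure.1 h
  have e : ∀ τ, Integrable F (μ.map (d.inj τ)) →
      (∫ z, F z ∂(μ.map (d.inj τ)) = ∫ s, F (d.inj τ s) ∂μ) ∧
      Integrable (fun s => F (d.inj τ s)) μ := fun τ h =>
    ⟨integral_map (d.measurable_inj τ).aemeasurable h.aestronglyMeasurable,
      h.comp_measurable (d.measurable_inj τ)⟩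
  have e0 := e false hm.1
  have e1 := e true hm.2
  rw [integral_add e0.2 e1.2, ← e0.1, ← e1.1, ← integral_add_measure hm.1 hm.2]
  exact congrArg (fun m => ∫ z, F z ∂m) d.measure_eq

/-- The factor in the even (`p = false`) and the odd (`p = true`) reflection. -/
def sg (p : Bool) (z : G) : ℝ := if p then d.sign z else 1

theorem sg_eq (p : Bool) (z : G) : d.sg p z = 1 ∨ d.sg p z = -1 := by
  cases p
  · exact Or.inl rfl
  · exact d.sign_eq z

theorem abs_sg (p : Bool) (z : G) : |d.sg p z| = 1 := by
  rcases d.sg_eq p z with h | h <;> simp [h]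

theorem measurable_sg (p : Bool) : Measurable (d.sg p) := by
  cases p
  · exact measurable_const
  · exact d.measurable_sign

theorem sg_inj (p τ : Bool) : ∀ᵐ s ∂μ, d.sg p (d.inj τ s) = if p && τ then -1 else 1 := by
  cases p
  · exact Eventually.of_forall fun s => by simp [sg]
  · simpa [sg] using d.sign_inj τ

theorem memLp_fold (p : Bool) (f : Lp ℝ 2 μ) :
    MemLp (fun z => d.sg p z * f (d.fold z)) 2 ν := by
  have h1 : MemLp f 2 (ν.map d.fold) := by
    rw [d.map_fold]
    exact (Lp.memLp f).smul_measure (by norm_num)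
  have h2 : MemLp (fun z => f (d.fold z)) 2 ν :=
    h1.comp_of_map d.measurable_fold.aemeasurable
  refine h2.congr_norm ((d.measurable_sg p).aestronglyMeasurable.mul h2.1)
    (Eventually.of_forall fun z => ?_)
  simp [abs_sg]

theorem norm_fold_sq (p : Bool) (f : Lp ℝ 2 μ) :
    ‖(d.memLp_fold p f).toLp‖ ^ 2 = 2 * ‖f‖ ^ 2 := by
  have h : ENNReal.ofReal (‖(d.memLp_fold p f).toLp‖ ^ 2) = ENNReal.ofReal (2 * ‖f‖ ^ 2) := by
    rw [ofReal_norm_sq, ENNReal.ofReal_mul (by norm_num), ofReal_norm_sq]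
    have e1 : ∫⁻ z, ‖(MemLp.toLp _ (d.memLp_fold p f) : G → ℝ) z‖ₑ ^ 2 ∂ν = ∫⁻ z, ‖f (d.fold z)‖ₑ ^ 2 ∂ν := by
      refine lintegral_congr_ae ?_
      filter_upwards [(d.memLp_fold p f).coeFn_toLp] with z hz
      rw [hz, enorm_mul, Real.enorm_eq_ofReal_abs, abs_sg]
      simp
    rw [e1, ← lintegral_map' (μ := ν) (g := d.fold) (f := fun s => ‖f s‖ₑ ^ 2)
      (by rw [d.map_fold]; exact ((Lp.stronglyMeasurable f).measurable.enorm.pow_const 2).aemeasurable)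
      d.measurable_fold.aemeasurable, d.map_fold, lintegral_smul_measure]
    simp
  exact (ENNReal.ofReal_eq_ofReal_iff (by positivity) (by positivity)).1 h

/-- The even (`p = false`) or odd (`p = true`) reflection of square-integrable functions. -/
def ext (p : Bool) : Lp ℝ 2 μ →L[ℝ] Lp ℝ 2 ν :=
  LinearMap.mkContinuous
    { toFun := fun f => (d.memLp_fold p f).toLp
      map_add' := fun f g => by
        refine Lp.ext ?_
        filter_upwards [(d.memLp_fold p (f + g)).coeFn_toLp, (d.memLp_fold p f).coeFn_toLp,
          (d.memLp_fold p g).coeFn_toLp, d.ae_fold (Lp.coeFn_add f g),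
          Lp.coeFn_add (d.memLp_fold p f).toLp (d.memLp_fold p g).toLp] with z h1 h2 h3 h4 h5
        rw [h1, h5, Pi.add_apply, h2, h3, h4, Pi.add_apply, mul_add]
      map_smul' := fun c f => by
        refine Lp.ext ?_
        filter_upwards [(d.memLp_fold p (c • f)).coeFn_toLp, (d.memLp_fold p f).coeFn_toLp,
          d.ae_fold (Lp.coeFn_smul c f), Lp.coeFn_smul c (d.memLp_fold p f).toLp] with z h1 h2 h3 h4
        simp only [RingHom.id_apply]
        rw [h1, h4, Pi.smul_apply, h2, h3, Pi.smul_apply, smul_eq_mul, smul_eq_mul]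
        ring } (√2) fun f => by
      refine le_of_sq_le_sq ?_ (by positivity)
      rw [mul_pow, Real.sq_sqrt (by norm_num)]
      exact (d.norm_fold_sq p f).le

theorem ext_ae (p : Bool) (f : Lp ℝ 2 μ) :
    (d.ext p f : G → ℝ) =ᵐ[ν] fun z => d.sg p z * f (d.fold z) := (d.memLp_fold p f).coeFn_toLp

theorem norm_ext_sq (p : Bool) (f : Lp ℝ 2 μ) : ‖d.ext p f‖ ^ 2 = 2 * ‖f‖ ^ 2 :=
  d.norm_fold_sq p f

theorem norm_ext (p : Bool) (f : Lp ℝ 2 μ) : ‖d.ext p f‖ = √2 * ‖f‖ := by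
  rw [← Real.sqrt_sq (norm_nonneg (d.ext p f)), norm_ext_sq, Real.sqrt_mul (by norm_num),
    Real.sqrt_sq (norm_nonneg _)]

theorem ext_inj (p τ : Bool) (f : Lp ℝ 2 μ) :
    ∀ᵐ s ∂μ, d.ext p f (d.inj τ s) = (if p && τ then -1 else 1) * f s := by
  filter_upwards [d.ae_inj (d.ext_ae p f) τ, d.sg_inj p τ, d.fold_inj τ] with s h1 h2 h3
  rw [h1, h2, h3]

/-- Pairing of a reflected function with a function on the doubled space. -/
theorem inner_ext (p : Bool) (f : Lp ℝ 2 μ) (h : Lp ℝ 2 ν) :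
    ⟪d.ext p f, h⟫ = ∫ s, f s * (h (d.inj false s) + (if p then -1 else 1) * h (d.inj true s)) ∂μ := by
  rw [L2.inner_def, d.integral_eq (L2.integrable_inner _ _)]
  refine integral_congr_ae ?_
  filter_upwards [d.ext_inj p false f, d.ext_inj p true f] with s h1 h2
  simp only [RCLike.inner_apply, conj_trivial, h1, h2]
  cases p <;> simp <;> ring

end Doubling

end Doubling

/-! ### The circle as the double of the interval, the cylinder as the double of the strip -/

/-- The representative in `(0, 2]` of a point of the circle. -/
def rep (y : Circ) : ℝ := AddCircle.equivIoc 2 0 y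

theorem measurable_rep : Measurable rep :=
  measurable_subtype_coe.comp (AddCircle.measurableEquivIoc 2 0).measurable

theorem rep_coe {y : ℝ} (h0 : 0 < y) (h2 : y ≤ 2) : rep (y : Circ) = y := by
  rw [rep, AddCircle.equivIoc_coe_eq (p := (2 : ℝ)) (a := 0) ⟨h0, by linarith⟩]

theorem coe_rep (y : Circ) : ((rep y : ℝ) : Circ) = y := AddCircle.coe_equivIoc

theorem rep_coe_neg {y : ℝ} (h0 : 0 ≤ y) (h2 : y < 2) : rep ((-y : ℝ) : Circ) = 2 - y := by
  have : ((-y : ℝ) : Circ) = ((2 - y : ℝ) : Circ) := by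
    rw [show (2 - y : ℝ) = -y + 2 by ring, AddCircle.coe_add_period]
  rw [this, rep_coe (by linarith) (by linarith)]

theorem map_coe_circ : (volume : Measure Circ)
    = ((volume : Measure ℝ).restrict (Ioo 0 1)).map (fun y : ℝ => (y : Circ))
      + ((volume : Measure ℝ).restrict (Ioo 0 1)).map (fun y : ℝ => ((-y : ℝ) : Circ)) := by
  have hmk : Measurable fun y : ℝ => (y : Circ) := AddCircle.measurable_mk'
  have h1 := (AddCircle.measurePreserving_mk 2 (-1)).map_eq
  have h2 : (volume : Measure ℝ).restrict (Ioc (-1) (-1 + 2))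
      = (volume : Measure ℝ).restrict (Ioo 0 1)
        + ((volume : Measure ℝ).restrict (Ioo 0 1)).map (fun y => -y) := by
    have e1 : ((volume : Measure ℝ).restrict (Ioo 0 1)).map (fun y => -y)
        = (volume : Measure ℝ).restrict (Ioo (-1) 0) := by
      have := (Measure.measurePreserving_neg (volume : Measure ℝ)).restrict_preimage
        (s := Ioo (-1) 0) measurableSet_Ioo
      have e : (Neg.neg ⁻¹' Ioo (-1 : ℝ) 0) = Ioo 0 1 := by
        ext y; simp only [mem_preimage, mem_Ioo]
        constructor <;> rintro ⟨a, b⟩ <;> constructor <;> linarith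
      rw [e] at this
      exact this.map_eq
    rw [e1, show (-1 + 2 : ℝ) = 1 by norm_num, ← Ioc_union_Ioc_eq_Ioc (by norm_num : (-1 : ℝ) ≤ 0)
      zero_le_one, Measure.restrict_union (by
        rw [Set.disjoint_left]; rintro x ⟨_, h⟩ ⟨h', _⟩; linarith) measurableSet_Ioc, add_comm,
      restrict_Ioo_eq_restrict_Ioc, restrict_Ioo_eq_restrict_Ioc]
  rw [← h1, h2, Measure.map_add _ _ hmk, Measure.map_map hmk measurable_neg]
  rfl

/-- The point of the interval that lies under a point of the circle. -/
def foldC (y : Circ) : ℝ := if rep y < 1 then rep y else 2 - rep y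

/-- `1` on the upper and `-1` on the lower half of the circle. -/
def signC (y : Circ) : ℝ := if rep y < 1 then 1 else -1

theorem measurable_foldC : Measurable foldC :=
  Measurable.ite (measurableSet_lt measurable_rep measurable_const) measurable_rep
    (measurable_const.sub measurable_rep)

theorem measurable_signC : Measurable signC :=
  Measurable.ite (measurableSet_lt measurable_rep measurable_const) measurable_const
    measurable_const

/-- The points over a point of the interval. -/
def injC (τ : Bool) (y : ℝ) : Circ := ((if τ then -y else y : ℝ) : Circ)

theorem measurable_injC (τ : Bool) : Measurable (injC τ) := by
  cases τ
  · exact AddCircle.measurable_mk'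
  · exact AddCircle.measurable_mk'.comp measurable_neg

theorem foldC_injC (τ : Bool) {y : ℝ} (hy : y ∈ Ioo (0 : ℝ) 1) : foldC (injC τ y) = y := by
  have h1 := hy.1
  have h2 := hy.2
  cases τ
  · simp only [foldC, injC, Bool.false_eq_true, if_false]
    rw [rep_coe h1 (by linarith), if_pos h2]
  · simp only [foldC, injC, if_true]
    rw [rep_coe_neg h1.le (by linarith), if_neg (by linarith)]
    ring

theorem signC_injC (τ : Bool) {y : ℝ} (hy : y ∈ Ioo (0 : ℝ) 1) :
    signC (injC τ y) = if τ then -1 else 1 := by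
  have h1 := hy.1
  have h2 := hy.2
  cases τ
  · simp only [signC, injC, Bool.false_eq_true, if_false]
    rw [rep_coe h1 (by linarith), if_pos h2]
  · simp only [signC, injC, if_true]
    rw [rep_coe_neg h1.le (by linarith), if_neg (by linarith)]

theorem signC_eq (y : Circ) : signC y = 1 ∨ signC y = -1 := by
  unfold signC; split_ifs <;> simp

/-- The circle is the double of the interval. -/
def dblC : Doubling (volume.restrict unitI : Measure ℝ) (volume : Measure Circ) where
  inj := injC
  fold := foldC
  sign := signC
  measurable_inj := measurable_injC
  measurable_fold := measurable_foldC
  measurable_sign := measurable_signC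
  sign_eq := signC_eq
  measure_eq := map_coe_circ
  fold_inj τ := (ae_restrict_mem measurableSet_Ioo).mono fun _ hy => foldC_injC τ hy
  sign_inj τ := (ae_restrict_mem measurableSet_Ioo).mono fun _ hy => signC_injC τ hy

theorem measurableSet_strip : MeasurableSet strip := MeasurableSet.univ.prod measurableSet_Ioo

theorem isOpen_strip : IsOpen strip := isOpen_univ.prod isOpen_Ioo

theorem volume_restrict_strip : (volume.restrict strip : Measure (ℝ × ℝ))
    = (volume : Measure ℝ).prod (volume.restrict unitI) := by
  rw [strip, Measure.volume_eq_prod, ← Measure.prod_restrict, Measure.restrict_univ]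
  rfl

/-- The cylinder is the double of the strip. -/
def dbl : Doubling (volume.restrict strip : Measure (ℝ × ℝ)) (volume : Measure Cyl) where
  inj τ z := (z.1, injC τ z.2)
  fold z := (z.1, foldC z.2)
  sign z := signC z.2
  measurable_inj τ := measurable_fst.prodMk ((measurable_injC τ).comp measurable_snd)
  measurable_fold := measurable_fst.prodMk (measurable_foldC.comp measurable_snd)
  measurable_sign := measurable_signC.comp measurable_snd
  sign_eq z := signC_eq z.2
  measure_eq := by
    have h : ∀ τ, ((volume.restrict strip : Measure (ℝ × ℝ))).map (fun z => (z.1, injC τ z.2))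
        = (volume : Measure ℝ).prod ((volume.restrict unitI : Measure ℝ).map (injC τ)) := fun τ => by
      have e := Measure.map_prod_map (volume : Measure ℝ) (volume.restrict unitI : Measure ℝ)
        measurable_id (measurable_injC τ)
      rw [Measure.map_id] at e
      rw [volume_restrict_strip, e]
      rfl
    rw [h, h, ← Measure.prod_add, Measure.volume_eq_prod]
    congr 1
    exact map_coe_circ
  fold_inj τ := (ae_restrict_mem measurableSet_strip).mono fun _ hy => by
    rw [foldC_injC τ hy.2]
  sign_inj τ := (ae_restrict_mem measurableSet_strip).mono fun _ hy => signC_injC τ hy.2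

end

/-! ### Weak derivatives on the cylinder -/

/-- A weak derivative with respect to sufficiently many test vectors is a derivative along the
translations. -/
theorem hasD_of_weak {E : Type*} [NormedAddCommGroup E] [InnerProductSpace ℝ E] [CompleteSpace E]
    [Shift E] {i : Fin 2} {f g : E} {P : Set (E × E)} (hP : ∀ p ∈ P, HasD i p.1 p.2)
    (hsh : ∀ p ∈ P, ∀ t, (sh i t p.1, sh i t p.2) ∈ P)
    (htot : ∀ h : E, (∀ p ∈ P, ⟪h, p.1⟫ = 0) → h = 0)
    (hw : ∀ p ∈ P, ⟪f, p.2⟫ = -⟪g, p.1⟫) : HasD i f g := by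
  refine hasD_of_integral fun t => ?_
  rw [← sub_eq_zero]
  refine htot _ fun p hp => ?_
  have e : ∀ (s : ℝ) (x y : E), ⟪sh i s x, y⟫ = ⟪x, sh i (-s) y⟫ := fun s x y => by
    rw [← inner_sh i (-s), ← sh_add, neg_add_cancel, sh_zero]
  have hd : ∀ s : ℝ, HasDerivAt (fun s => ⟪sh i s f, p.1⟫) ⟪sh i s g, p.1⟫ s := fun s => by
    have h1 : HasDerivAt (fun s => sh i (-s) p.1) (-sh i (-s) p.2) s := by
      have := ((hP p hp).hasDerivAt (-s)).scomp s (hasDerivAt_neg s)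
      simpa [Function.comp_def] using this
    have h2 := (hasDerivAt_const s f).inner ℝ h1
    simp only [inner_zero_left, add_zero, inner_neg_right] at h2
    rw [hw _ (hsh p hp (-s)), neg_neg] at h2
    simp only [e]
    exact h2
  have hc : Continuous fun s => ⟪sh i s g, p.1⟫ := (continuous_sh i g).inner continuous_const
  have h3 := intervalIntegral.integral_eq_sub_of_hasDerivAt (a := 0) (b := t) (fun s _ => hd s)
    (hc.intervalIntegrable _ _)
  have h4 : ⟪∫ s in (0 : ℝ)..t, sh i s g, p.1⟫ = ∫ s in (0 : ℝ)..t, ⟪sh i s g, p.1⟫ := by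
    have := (innerSL ℝ p.1).intervalIntegral_comp_comm (a := 0) (b := t) (μ := volume)
      ((continuous_sh i g).intervalIntegrable 0 t)
    simp only [innerSL_apply_apply] at this
    rw [real_inner_comm, ← this]
    simp only [real_inner_comm]
  rw [inner_sub_left, inner_sub_left, h4, h3, sh_zero, sub_self]

/-- Smooth functions on the plane that are `2`-periodic in `y` and vanish for large `|x|`: the
test functions on the cylinder. -/
structure IsPer (ψ : ℝ × ℝ → ℝ) : Prop where
  smooth : ContDiff ℝ ∞ ψ
  per : ∀ x y, ψ (x, y + 2) = ψ (x, y)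
  supp : ∃ R, ∀ x y, R < |x| → ψ (x, y) = 0

/-- The partial derivatives of a function on the plane. -/
def pd (i : Fin 2) (ψ : ℝ × ℝ → ℝ) (z : ℝ × ℝ) : ℝ := fderiv ℝ ψ z (dir i)

theorem contDiff_pd {ψ : ℝ × ℝ → ℝ} (h : ContDiff ℝ ∞ ψ) (i : Fin 2) : ContDiff ℝ ∞ (pd i ψ) :=
  (h.fderiv_right (m := ∞) (by norm_num)).clm_apply contDiff_const

theorem hasDerivAt_pd {ψ : ℝ × ℝ → ℝ} (h : ContDiff ℝ ∞ ψ) (i : Fin 2) (z : ℝ × ℝ) (t : ℝ) :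
    HasDerivAt (fun t : ℝ => ψ (t • dir i + z)) (pd i ψ (t • dir i + z)) t := by
  have h1 := (h.differentiable (by norm_num) (t • dir i + z)).hasFDerivAt
  have h2 : HasDerivAt (fun t : ℝ => t • dir i + z) (dir i) t := by
    simpa using ((hasDerivAt_id t).smul_const (dir i)).add_const z
  exact h1.comp_hasDerivAt t h2

namespace IsPer

variable {ψ φ : ℝ × ℝ → ℝ}

theorem shift (h : IsPer ψ) (s : ℝ × ℝ) : IsPer fun z => ψ (s + z) where
  smooth := h.smooth.comp (contDiff_const.add contDiff_id)
  per x y := by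
    have := h.per (s.1 + x) (s.2 + y)
    rw [add_assoc] at this
    exact this
  supp := by
    obtain ⟨R, hR⟩ := h.supp
    refine ⟨R + |s.1|, fun x y hx => hR _ _ ?_⟩
    have := abs_add_le (s.1 + x) (-s.1)
    rw [abs_neg, show s.1 + x + -s.1 = x by ring] at this
    linarith

theorem add (h : IsPer ψ) (h' : IsPer φ) : IsPer fun z => ψ z + φ z where
  smooth := h.smooth.add h'.smooth
  per x y := by rw [h.per, h'.per]
  supp := by
    obtain ⟨R, hR⟩ := h.supp
    obtain ⟨R', hR'⟩ := h'.supp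
    exact ⟨max R R', fun x y hx => by
      rw [hR x y ((le_max_left _ _).trans_lt hx), hR' x y ((le_max_right _ _).trans_lt hx),
        add_zero]⟩

theorem const_mul (h : IsPer ψ) (c : ℝ) : IsPer fun z => c * ψ z where
  smooth := contDiff_const.mul h.smooth
  per x y := by rw [h.per]
  supp := by
    obtain ⟨R, hR⟩ := h.supp
    exact ⟨R, fun x y hx => by rw [hR x y hx, mul_zero]⟩

theorem pd (h : IsPer ψ) (i : Fin 2) : IsPer (pd i ψ) where
  smooth := contDiff_pd h.smooth i
  per x y := by
    have e : (fun z : ℝ × ℝ => ψ (z + (0, 2))) = ψ := by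
      funext z
      have := h.per z.1 z.2
      simpa [Prod.add_def] using this
    have h1 : fderiv ℝ (fun z : ℝ × ℝ => ψ (z + (0, 2))) (x, y) = fderiv ℝ ψ ((x, y) + (0, 2)) :=
      fderiv_comp_add_right (𝕜 := ℝ) (f := ψ) (x := (x, y)) ((0, 2) : ℝ × ℝ)
    rw [e] at h1
    simp only [MHDStrip.pd, h1]
    simp
  supp := by
    obtain ⟨R, hR⟩ := h.supp
    refine ⟨R, fun x y hx => ?_⟩
    have h1 : ψ =ᶠ[𝓝 (x, y)] fun _ => 0 := by
      have : ∀ᶠ z : ℝ × ℝ in 𝓝 (x, y), R < |z.1| :=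
        continuous_fst.abs.continuousAt.eventually (lt_mem_nhds hx)
      filter_upwards [this] with z hz using hR z.1 z.2 hz
    simp [MHDStrip.pd, h1.fderiv_eq]

theorem per_int (h : IsPer ψ) (x y : ℝ) (n : ℤ) : ψ (x, y + n * 2) = ψ (x, y) := by
  have : Function.Periodic (fun y => ψ (x, y)) 2 := fun y => h.per x y
  exact this.int_mul n y

theorem eq_of_coe_eq (h : IsPer ψ) (x : ℝ) {y y' : ℝ} (e : (y : Circ) = (y' : Circ)) :
    ψ (x, y) = ψ (x, y') := by
  obtain ⟨n, hn⟩ := (AddCircle.coe_eq_zero_iff (p := (2 : ℝ)) (x := y - y')).1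
    (by rw [AddCircle.coe_sub, e, sub_self])
  rw [show y = y' + n * 2 by rw [zsmul_eq_mul] at hn; linarith, h.per_int]

theorem exists_bound (h : IsPer ψ) : ∃ M, 0 ≤ M ∧ ∀ z, |ψ z| ≤ M := by
  obtain ⟨R, hR⟩ := h.supp
  obtain ⟨M, hM⟩ := (isCompact_Icc.prod isCompact_Icc : IsCompact
    (Icc (-R) R ×ˢ Icc (0 : ℝ) 2)).exists_bound_of_continuousOn h.smooth.continuous.continuousOn
  refine ⟨max M 0, le_max_right _ _, fun z => ?_⟩
  rcases lt_or_ge R |z.1| with hz | hz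
  · have : ψ z = 0 := hR z.1 z.2 hz
    rw [this, abs_zero]
    exact le_max_right _ _
  · have e : ψ z = ψ (z.1, rep z.2) := h.eq_of_coe_eq z.1 (coe_rep (z.2 : Circ)).symm
    rw [e]
    have hr := (AddCircle.equivIoc 2 0 (z.2 : Circ)).2
    exact (hM (z.1, rep z.2) ⟨abs_le.1 hz, hr.1.le, hr.2.trans_eq (zero_add 2)⟩).trans
      (le_max_left _ _)

/-- The function on the cylinder induced by a periodic function on the plane. -/
def toG (ψ : ℝ × ℝ → ℝ) (z : Cyl) : ℝ := ψ (z.1, rep z.2)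

theorem toG_toCyl (h : IsPer ψ) (s : ℝ × ℝ) : toG ψ (toCyl s) = ψ s :=
  h.eq_of_coe_eq s.1 (coe_rep (s.2 : Circ))

theorem toG_add (h : IsPer ψ) (s : ℝ × ℝ) (z : Cyl) :
    toG ψ (toCyl s + z) = toG (fun z => ψ (s + z)) z := by
  refine h.eq_of_coe_eq _ ?_
  rw [coe_rep, toCyl_apply]
  simp [coe_rep]

theorem measurable_toG (h : IsPer ψ) : Measurable (toG ψ) :=
  h.smooth.continuous.measurable.comp
    (measurable_fst.prodMk (measurable_rep.comp measurable_snd))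

/-- A bounded piece of the cylinder. -/
def box (R : ℝ) : Set Cyl := Icc (-R) R ×ˢ univ

theorem measurableSet_box (R : ℝ) : MeasurableSet (box R) := measurableSet_Icc.prod .univ

theorem volume_box_lt_top (R : ℝ) : volume (box R) < ⊤ := by
  rw [box, Measure.volume_eq_prod, Measure.prod_prod]
  exact ENNReal.mul_lt_top (by simp) (measure_lt_top _ _)

theorem memLp (h : IsPer ψ) : MemLp (toG ψ) 2 (volume : Measure Cyl) := by
  obtain ⟨M, -, hM⟩ := h.exists_bound
  obtain ⟨R, hR⟩ := h.supp
  have e : toG ψ = (box R).indicator (toG ψ) := by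
    funext z
    by_cases hz : z ∈ box R
    · rw [indicator_of_mem hz]
    · rw [indicator_of_notMem hz]
      refine hR _ _ ?_
      by_contra! hc
      exact hz ⟨abs_le.1 hc, mem_univ _⟩
  rw [e, memLp_indicator_iff_restrict (measurableSet_box R)]
  have : IsFiniteMeasure (volume.restrict (box R) : Measure Cyl) :=
    ⟨by rw [Measure.restrict_apply_univ]; exact volume_box_lt_top R⟩
  exact MemLp.of_bound h.measurable_toG.aestronglyMeasurable M (Eventually.of_forall fun z => hM _)

/-- The element of `L²` of the cylinder given by a test function. -/
def vec (h : IsPer ψ) : LG := h.memLp.toLp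

theorem vec_ae (h : IsPer ψ) : (h.vec : Cyl → ℝ) =ᵐ[volume] toG ψ := h.memLp.coeFn_toLp

theorem norm_vec_le (h : IsPer ψ) {R ε : ℝ} (hε : 0 ≤ ε) (hb : ∀ z, |ψ z| ≤ ε)
    (hR : ∀ x y, R < |x| → ψ (x, y) = 0) : ‖h.vec‖ ≤ ε * √(volume.real (box R)) := by
  refine le_of_sq_le_sq ?_ (by positivity)
  rw [mul_pow, Real.sq_sqrt measureReal_nonneg]
  refine (ENNReal.ofReal_le_ofReal_iff (by positivity)).1 ?_
  rw [ofReal_norm_sq]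
  calc ∫⁻ z, ‖h.vec z‖ₑ ^ 2 ≤ ∫⁻ z, (box R).indicator (fun _ => ENNReal.ofReal (ε ^ 2)) z := by
        refine lintegral_mono_ae ?_
        filter_upwards [h.vec_ae] with z hz
        rw [hz]
        by_cases hzR : z ∈ box R
        · rw [indicator_of_mem hzR, Real.enorm_eq_ofReal_abs, ← ENNReal.ofReal_pow (abs_nonneg _)]
          refine ENNReal.ofReal_le_ofReal ?_
          have := hb (z.1, rep z.2)
          exact pow_le_pow_left₀ (abs_nonneg _) this 2
        · have : toG ψ z = 0 := by
            refine hR _ _ ?_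
            by_contra! hc
            exact hzR ⟨abs_le.1 hc, mem_univ _⟩
          simp [this]
    _ = ENNReal.ofReal (ε ^ 2 * volume.real (box R)) := by
        rw [lintegral_indicator (measurableSet_box R), lintegral_const,
          Measure.restrict_apply_univ, ENNReal.ofReal_mul (by positivity), measureReal_def,
          ENNReal.ofReal_toReal (volume_box_lt_top R).ne]

theorem sh_vec (h : IsPer ψ) (i : Fin 2) (t : ℝ) : sh i t h.vec = (h.shift (t • dir i)).vec := by
  refine Lp.ext ((sh_ae_cyl i t h.vec).trans ?_)
  have h1 := (measurePreserving_add_left (volume : Measure Cyl)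
    (toCyl (t • dir i))).quasiMeasurePreserving.ae_eq_comp h.vec_ae
  filter_upwards [h1, (h.shift (t • dir i)).vec_ae] with z h2 h3
  rw [h3, ← h.toG_add]
  exact h2

theorem hasD_vec (h : IsPer ψ) (i : Fin 2) : HasD i h.vec (h.pd i).vec := by
  obtain ⟨M, M0, hM⟩ := ((h.pd i).pd i).exists_bound
  obtain ⟨R, hR⟩ := h.supp
  obtain ⟨R', hR'⟩ := (h.pd i).supp
  have b1 : ∀ z (t : ℝ), |MHDStrip.pd i ψ (t • dir i + z) - MHDStrip.pd i ψ z| ≤ M * |t| := by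
    intro z t
    have := convex_univ.norm_image_sub_le_of_norm_hasDerivWithin_le (x := 0) (y := t) (C := M)
      (fun s _ => (hasDerivAt_pd (h.pd i).smooth i z s).hasDerivWithinAt) (fun s _ => hM _)
      (mem_univ _) (mem_univ _)
    simpa using this
  have b2 : ∀ z (t : ℝ), |ψ (t • dir i + z) - ψ z - t * MHDStrip.pd i ψ z| ≤ M * |t| * |t| := by
    intro z t
    have hd : ∀ s ∈ uIcc 0 t, HasDerivWithinAt (fun s : ℝ => ψ (s • dir i + z)
        - s * MHDStrip.pd i ψ z) (MHDStrip.pd i ψ (s • dir i + z) - MHDStrip.pd i ψ z)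
        (uIcc 0 t) s := fun s _ => by
      have := (hasDerivAt_pd h.smooth i z s).fun_sub ((hasDerivAt_id s).mul_const (MHDStrip.pd i ψ z))
      simpa using this.hasDerivWithinAt
    have := (convex_uIcc 0 t).norm_image_sub_le_of_norm_hasDerivWithin_le (x := 0) (y := t)
      (C := M * |t|) hd (fun s hs => (b1 z s).trans (mul_le_mul_of_nonneg_left
        (by simpa using abs_sub_left_of_mem_uIcc hs) M0)) left_mem_uIcc right_mem_uIcc
    simp only [zero_smul, zero_add, zero_mul, sub_zero, Real.norm_eq_abs] at this
    convert this using 2; ring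
  rw [HasD, hasDerivAt_iff_isLittleO]
  have key : ∀ t : ℝ, |t| ≤ 1 → ‖sh i t h.vec - sh i 0 h.vec - (t - 0) • (h.pd i).vec‖
      ≤ M * √(volume.real (box (max (R + 1) R'))) * ‖t ^ 2‖ := by
    intro t ht
    have hp := (h.shift (t • dir i)).add ((h.const_mul (-1)).add ((h.pd i).const_mul (-t)))
    have e : sh i t h.vec - sh i 0 h.vec - (t - 0) • (h.pd i).vec = hp.vec := by
      rw [sh_zero, sub_zero, h.sh_vec]
      refine Lp.ext ?_
      filter_upwards [hp.vec_ae, Lp.coeFn_sub ((h.shift (t • dir i)).vec - h.vec)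
        (t • (h.pd i).vec), Lp.coeFn_sub (h.shift (t • dir i)).vec h.vec,
        Lp.coeFn_smul t (h.pd i).vec, (h.shift (t • dir i)).vec_ae, h.vec_ae, (h.pd i).vec_ae]
        with z h1 h2 h3 h4 h5 h6 h7
      rw [h2, Pi.sub_apply, h3, Pi.sub_apply, h4, Pi.smul_apply, h5, h6, h7, h1]
      simp only [toG, smul_eq_mul]
      ring
    rw [e]
    refine (hp.norm_vec_le (R := max (R + 1) R') (ε := M * |t| * |t|) (by positivity)
      (fun z => ?_) (fun x y hx => ?_)).trans (le_of_eq ?_)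
    · refine le_of_eq_of_le ?_ (b2 z t)
      congr 1; ring
    · have h1 := (le_max_left _ _).trans_lt hx
      have h2 := (le_max_right _ _).trans_lt hx
      have h3 : ψ (t • dir i + (x, y)) = 0 := by
        refine hR _ _ ?_
        have hd : |(t • dir i).1| ≤ 1 := by
          fin_cases i <;> simp [dir, ht]
        have := abs_add_le ((t • dir i).1 + x) (-(t • dir i).1)
        rw [abs_neg, show (t • dir i).1 + x + -(t • dir i).1 = x by ring] at this
        change R < |(t • dir i).1 + x|
        linarith
      rw [h3, hR x y (by linarith), hR' x y h2]
      simp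
    · rw [Real.norm_eq_abs, abs_pow]; ring
  have hO : (fun t : ℝ => sh i t h.vec - sh i 0 h.vec - (t - 0) • (h.pd i).vec)
      =O[𝓝 0] fun t : ℝ => t ^ 2 := by
    refine Asymptotics.IsBigO.of_bound (M * √(volume.real (box (max (R + 1) R')))) ?_
    filter_upwards [Metric.closedBall_mem_nhds (0 : ℝ) one_pos] with t ht
    exact key t (by simpa using ht)
  refine hO.trans_isLittleO ?_
  simpa using Asymptotics.isLittleO_pow_id (𝕜 := ℝ) one_lt_two

/-- The periodic continuation of a function on `ℝ × (0, 2)`. -/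
def periodize (φ : ℝ × ℝ → ℝ) (z : ℝ × ℝ) : ℝ := φ (z.1, z.2 - 2 * ⌊z.2 / 2⌋)

theorem isPer_periodize (hφ : ContDiff ℝ ∞ φ) (hc : HasCompactSupport φ)
    (h0 : ∀ x y, (y ≤ 0 ∨ 2 ≤ y) → φ (x, y) = 0) : IsPer (periodize φ) where
  smooth := by
    refine contDiff_iff_contDiffAt.2 fun z => ?_
    set n := ⌊z.2 / 2⌋ with hn
    have h1 : periodize φ =ᶠ[𝓝 z] fun z => φ (z.1, z.2 - 2 * n) + φ (z.1, z.2 - 2 * n + 2) := by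
      have a1 : ∀ᶠ w : ℝ × ℝ in 𝓝 z, w.2 / 2 < n + 1 :=
        (continuous_snd.div_const 2).continuousAt.eventually (gt_mem_nhds (Int.lt_floor_add_one _))
      have a2 : ∀ᶠ w : ℝ × ℝ in 𝓝 z, (n : ℝ) - 1 < w.2 / 2 :=
        (continuous_snd.div_const 2).continuousAt.eventually
          (lt_mem_nhds (by have := Int.floor_le (z.2 / 2); rw [← hn] at this; linarith))
      filter_upwards [a1, a2] with w h1 h2
      rcases le_or_gt (n : ℝ) (w.2 / 2) with h3 | h3
      · have : ⌊w.2 / 2⌋ = n := Int.floor_eq_iff.2 ⟨h3, h1⟩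
        rw [periodize, this, h0 _ (w.2 - 2 * n + 2) (Or.inr (by linarith)), add_zero]
      · have : ⌊w.2 / 2⌋ = n - 1 := Int.floor_eq_iff.2 ⟨by push_cast; linarith, by push_cast; linarith⟩
        rw [periodize, this, h0 _ (w.2 - 2 * n) (Or.inl (by linarith)), zero_add]
        congr 2; push_cast; ring
    refine ContDiffAt.congr_of_eventuallyEq (ContDiff.contDiffAt ?_) h1
    exact (hφ.comp (contDiff_fst.prodMk (contDiff_snd.sub contDiff_const))).add
      (hφ.comp (contDiff_fst.prodMk ((contDiff_snd.sub contDiff_const).add contDiff_const)))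
  per x y := by
    simp only [periodize]
    rw [show (y + 2) / 2 = y / 2 + 1 by ring, Int.floor_add_one]
    congr 2; push_cast; ring
  supp := by
    obtain ⟨R, hR⟩ := hc.isCompact.isBounded.subset_closedBall 0
    refine ⟨R, fun x y hx => ?_⟩
    by_contra hne
    have h1 := hR (subset_tsupport φ hne)
    rw [mem_closedBall_zero_iff, Prod.norm_def] at h1
    exact absurd ((le_max_left _ _).trans h1) (not_le.2 hx)

/-- The test functions are total. -/
theorem eq_zero_of_inner {f : LG} (hf : ∀ (ψ : ℝ × ℝ → ℝ) (h : IsPer ψ), ⟪f, h.vec⟫ = 0) :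
    f = 0 := by
  set U : Set (ℝ × ℝ) := univ ×ˢ Ioo (0 : ℝ) 2 with hU
  have hUo : IsOpen U := isOpen_univ.prod isOpen_Ioo
  have hmp : MeasurePreserving (fun s : ℝ × ℝ => toCyl s) (volume.restrict U) volume := by
    have h1 : (volume.restrict U : Measure (ℝ × ℝ))
        = (volume : Measure ℝ).prod (volume.restrict (Ioc 0 (0 + 2))) := by
      rw [hU, Measure.volume_eq_prod, ← Measure.prod_restrict, Measure.restrict_univ, zero_add,
        restrict_Ioo_eq_restrict_Ioc]
    rw [h1]
    exact (MeasurePreserving.id volume).prod (AddCircle.measurePreserving_mk 2 0)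
  have hint : ∀ F : Cyl → ℝ, AEStronglyMeasurable F volume →
      ∫ z, F z = ∫ s in U, F (toCyl s) := fun F hF => by
    have := integral_map (μ := volume.restrict U) hmp.measurable.aemeasurable (f := F)
      (by rwa [hmp.map_eq])
    rwa [hmp.map_eq] at this
  have hae : ∀ p : Cyl → Prop, MeasurableSet {z | p z} →
      (∀ᵐ s ∂(volume.restrict U : Measure (ℝ × ℝ)), p (toCyl s)) → ∀ᵐ z : Cyl, p z :=
    fun p hp h => by
      have := (ae_map_iff hmp.measurable.aemeasurable hp).2 h
      rwa [hmp.map_eq] at this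
  have hL : MemLp (fun s => f (toCyl s)) 2 (volume.restrict U) :=
    (Lp.memLp f).comp_measurePreserving hmp
  have h0 : ∀ᵐ s : ℝ × ℝ, s ∈ U → f (toCyl s) = 0 := by
    refine hUo.ae_eq_zero_of_integral_contDiff_smul_eq_zero ?_ fun φ hφ hc hs => ?_
    · exact locallyIntegrableOn_of_locallyIntegrable_restrict (hL.locallyIntegrable (by norm_num))
    · have hz : ∀ x y, (y ≤ 0 ∨ 2 ≤ y) → φ (x, y) = 0 := fun x y hy => by
        by_contra hne
        have := (hs (subset_tsupport φ hne)).2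
        rcases hy with h | h
        · exact absurd this.1 (not_lt.2 h)
        · exact absurd this.2 (not_lt.2 h)
      have hp := isPer_periodize hφ hc hz
      have h1 := hf _ hp
      rw [L2.inner_def, hint _ (L2.integrable_inner f hp.vec).aestronglyMeasurable] at h1
      have h2 : ∫ s, φ s • f (toCyl s) = ∫ s in U, φ s • f (toCyl s) := by
        refine (setIntegral_eq_integral_of_forall_compl_eq_zero fun s hsU => ?_).symm
        have : φ s = 0 := by
          by_contra hne
          exact hsU (hs (subset_tsupport φ hne))
        rw [this, zero_smul]
      rw [h2, ← h1]
      refine integral_congr_ae ?_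
      filter_upwards [hmp.quasiMeasurePreserving.ae hp.vec_ae, ae_restrict_mem hUo.measurableSet]
        with s e hsU
      have e2 : periodize φ s = φ s := by
        have : ⌊s.2 / 2⌋ = 0 := Int.floor_eq_iff.2
          ⟨by have := hsU.2.1; push_cast; linarith, by have := hsU.2.2; push_cast; linarith⟩
        rw [periodize, this]; simp
      simp only [RCLike.inner_apply, conj_trivial, smul_eq_mul]
      rw [e, hp.toG_toCyl, e2]
  refine Lp.ext ?_
  have h1 : ∀ᵐ s ∂(volume.restrict U : Measure (ℝ × ℝ)), f (toCyl s) = 0 := by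
    filter_upwards [ae_restrict_of_ae h0, ae_restrict_mem hUo.measurableSet] with s h hs using h hs
  have hmeas : MeasurableSet {z : Cyl | f z = 0} :=
    (Lp.stronglyMeasurable f).measurable (measurableSet_singleton 0)
  have h2 : ∀ᵐ z : Cyl, f z = 0 := hae _ hmeas h1
  filter_upwards [h2, Lp.coeFn_zero ℝ 2 (volume : Measure Cyl)] with z h3 h4
  rw [h3, h4, Pi.zero_apply]

end IsPer

/-- A function on the cylinder with a weak derivative in `L²` is differentiable along the
translations. -/
theorem hasD_of_forall_isPer {i : Fin 2} {f g : LG}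
    (h : ∀ (ψ : ℝ × ℝ → ℝ) (hψ : IsPer ψ), ⟪f, (hψ.pd i).vec⟫ = -⟪g, hψ.vec⟫) : HasD i f g := by
  refine hasD_of_weak (P := {p | ∃ (ψ : ℝ × ℝ → ℝ) (hψ : IsPer ψ), p = (hψ.vec, (hψ.pd i).vec)})
    ?_ ?_ ?_ ?_
  · rintro _ ⟨ψ, hψ, rfl⟩
    exact hψ.hasD_vec i
  · rintro _ ⟨ψ, hψ, rfl⟩ t
    refine ⟨_, hψ.shift (t • dir i), ?_⟩
    simp only [hψ.sh_vec, (hψ.pd i).sh_vec, Prod.mk.injEq, true_and]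
    have : (fun z => pd i ψ (t • dir i + z)) = pd i fun z => ψ (t • dir i + z) := by
      funext z
      have := fderiv_comp_add_left (𝕜 := ℝ) (f := ψ) (x := z) (t • dir i)
      simp only [pd, this]
    congr 1
  · exact fun f hf => IsPer.eq_zero_of_inner fun ψ hψ => hf _ ⟨ψ, hψ, rfl⟩
  · rintro _ ⟨ψ, hψ, rfl⟩
    exact h ψ hψ

/-! ### Test functions that do not vanish near the boundary -/

theorem exists_deriv_smoothTransition_bound : ∃ B, 0 ≤ B ∧ ∀ s, |deriv Real.smoothTransition s| ≤ B ∧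
    (1 ≤ s → deriv Real.smoothTransition s = 0) := by
  have h1 : ∀ s, 1 ≤ s → deriv Real.smoothTransition s = 0 := fun s hs => by
    refine IsLocalMax.deriv_eq_zero (Eventually.of_forall fun x => ?_)
    rw [Real.smoothTransition.one_of_one_le hs]
    exact Real.smoothTransition.le_one x
  have h0 : ∀ s, s ≤ 0 → deriv Real.smoothTransition s = 0 := fun s hs => by
    refine IsLocalMin.deriv_eq_zero (Eventually.of_forall fun x => ?_)
    rw [Real.smoothTransition.zero_of_nonpos hs]
    exact Real.smoothTransition.nonneg x
  have hc : Continuous (deriv Real.smoothTransition) :=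
    (Real.smoothTransition.contDiff (n := 1)).continuous_deriv le_rfl
  obtain ⟨B, hB⟩ := (isCompact_Icc (a := (0 : ℝ)) (b := 1)).exists_bound_of_continuousOn
    hc.continuousOn
  refine ⟨max B 0, le_max_right _ _, fun s => ⟨?_, h1 s⟩⟩
  rcases le_or_gt s 0 with hs | hs
  · rw [h0 s hs, abs_zero]; exact le_max_right _ _
  rcases le_or_gt 1 s with hs' | hs'
  · rw [h1 s hs', abs_zero]; exact le_max_right _ _
  · exact (hB s ⟨hs.le, hs'.le⟩).trans (le_max_left _ _)

/-- A smooth cutoff function that vanishes near the end points of `[0,1]` and is `1` away from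
neighbourhoods of size `2 / m` of them. -/
def cutoff (m : ℝ) (y : ℝ) : ℝ :=
  Real.smoothTransition (m * y - 1) * Real.smoothTransition (m * (1 - y) - 1)

theorem contDiff_cutoff (m : ℝ) : ContDiff ℝ ∞ (cutoff m) :=
  (Real.smoothTransition.contDiff.comp ((contDiff_const.mul contDiff_id).sub contDiff_const)).mul
    (Real.smoothTransition.contDiff.comp
      ((contDiff_const.mul (contDiff_const.sub contDiff_id)).sub contDiff_const))

theorem abs_cutoff_le (m y : ℝ) : |cutoff m y| ≤ 1 := by
  rw [cutoff, abs_mul, abs_of_nonneg (Real.smoothTransition.nonneg _),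
    abs_of_nonneg (Real.smoothTransition.nonneg _)]
  exact mul_le_one₀ (Real.smoothTransition.le_one _) (Real.smoothTransition.nonneg _)
    (Real.smoothTransition.le_one _)

theorem deriv_cutoff (m y : ℝ) : deriv (cutoff m) y
    = m * deriv Real.smoothTransition (m * y - 1) * Real.smoothTransition (m * (1 - y) - 1)
      - Real.smoothTransition (m * y - 1)
        * (m * deriv Real.smoothTransition (m * (1 - y) - 1)) := by
  have hd : ∀ s, HasDerivAt Real.smoothTransition (deriv Real.smoothTransition s) s := fun s =>
    ((Real.smoothTransition.contDiff (n := 1)).differentiable (by norm_num) s).hasDerivAt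
  have h1 : HasDerivAt (fun y => Real.smoothTransition (m * y - 1))
      (deriv Real.smoothTransition (m * y - 1) * m) y := by
    have : HasDerivAt (fun y : ℝ => m * y - 1) m y := by
      simpa using ((hasDerivAt_id y).const_mul m).sub_const 1
    exact (hd _).comp y this
  have h2 : HasDerivAt (fun y => Real.smoothTransition (m * (1 - y) - 1))
      (deriv Real.smoothTransition (m * (1 - y) - 1) * -m) y := by
    have : HasDerivAt (fun y : ℝ => m * (1 - y) - 1) (-m) y := by
      simpa using (((hasDerivAt_id y).const_sub 1).const_mul m).sub_const 1
    exact (hd _).comp y this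
  have h3 := (h1.mul h2).deriv
  rw [show cutoff m = (fun y => Real.smoothTransition (m * y - 1)) *
    fun y => Real.smoothTransition (m * (1 - y) - 1) from rfl, h3]
  ring

/-- The derivatives of the cutoff functions are compensated by a factor that vanishes at the end
points. -/
theorem abs_deriv_cutoff_mul_le {B : ℝ} (hB : ∀ s, |deriv Real.smoothTransition s| ≤ B ∧
    (1 ≤ s → deriv Real.smoothTransition s = 0)) {m M y q : ℝ} (hm : 0 ≤ m) (hM : 0 ≤ M)
    (hy : y ∈ Icc (0 : ℝ) 1) (h0 : |q| ≤ M * y) (h1 : |q| ≤ M * (1 - y)) :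
    |deriv (cutoff m) y * q| ≤ 4 * B * M := by
  have B0 : 0 ≤ B := (abs_nonneg _).trans (hB 0).1
  have key : ∀ r : ℝ, 0 ≤ r → |q| ≤ M * r →
      |m * deriv Real.smoothTransition (m * r - 1)| * |q| ≤ 2 * B * M := by
    intro r hr hq
    rcases le_or_gt 1 (m * r - 1) with h | h
    · rw [(hB _).2 h, mul_zero, abs_zero, zero_mul]; positivity
    · rw [abs_mul, abs_of_nonneg hm]
      calc m * |deriv Real.smoothTransition (m * r - 1)| * |q| ≤ m * B * (M * r) := by
            gcongr; exact (hB _).1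
        _ = m * r * (B * M) := by ring
        _ ≤ 2 * (B * M) := mul_le_mul_of_nonneg_right (by linarith) (by positivity)
        _ = _ := by ring
  have e0 := key y hy.1 h0
  have e1 := key (1 - y) (by linarith [hy.2]) h1
  rw [deriv_cutoff, sub_mul]
  refine (abs_sub _ _).trans ?_
  have s0 := Real.smoothTransition.nonneg (m * y - 1)
  have s1 := Real.smoothTransition.nonneg (m * (1 - y) - 1)
  have t0 := Real.smoothTransition.le_one (m * y - 1)
  have t1 := Real.smoothTransition.le_one (m * (1 - y) - 1)
  have f0 : |m * deriv Real.smoothTransition (m * y - 1) * Real.smoothTransition (m * (1 - y) - 1) * q|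
      ≤ 2 * B * M := by
    rw [abs_mul, abs_mul _ (Real.smoothTransition _), abs_of_nonneg s1, mul_assoc,
      mul_comm (Real.smoothTransition _), ← mul_assoc]
    exact (mul_le_of_le_one_right (by positivity) t1).trans e0
  have f1 : |Real.smoothTransition (m * y - 1) * (m * deriv Real.smoothTransition (m * (1 - y) - 1)) * q|
      ≤ 2 * B * M := by
    rw [abs_mul, abs_mul (Real.smoothTransition _), abs_of_nonneg s0, mul_assoc]
    exact (mul_le_of_le_one_left (by positivity) t0).trans e1
  linarith

theorem integrable_indicator_box (f : L2 strip) (R : ℝ) :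
    Integrable ((Icc (-R) R ×ˢ (univ : Set ℝ)).indicator fun z => |f z|)
      (volume.restrict strip) := by
  have hK : MeasurableSet (Icc (-R) R ×ˢ (univ : Set ℝ)) := measurableSet_Icc.prod .univ
  rw [integrable_indicator_iff hK]
  have : IsFiniteMeasure ((volume.restrict strip : Measure (ℝ × ℝ)).restrict
      (Icc (-R) R ×ˢ (univ : Set ℝ))) := by
    refine ⟨?_⟩
    rw [Measure.restrict_apply_univ, Measure.restrict_apply hK, strip, prod_inter_prod,
      Measure.volume_eq_prod, Measure.prod_prod]
    exact ENNReal.mul_lt_top (by simp) (by simp)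
  exact (((Lp.memLp f).mono_measure Measure.restrict_le_self).integrable (by norm_num)).abs

theorem exists_strip_bound {θ : ℝ × ℝ → ℝ} (hθ : Continuous θ) {R : ℝ}
    (hR : ∀ x y, R < |x| → θ (x, y) = 0) :
    ∃ M, 0 ≤ M ∧ ∀ x, ∀ y ∈ Icc (0 : ℝ) 1, |θ (x, y)| ≤ M := by
  obtain ⟨M, hM⟩ := (isCompact_Icc.prod isCompact_Icc : IsCompact
    (Icc (-R) R ×ˢ Icc (0 : ℝ) 1)).exists_bound_of_continuousOn hθ.continuousOn
  refine ⟨max M 0, le_max_right _ _, fun x y hy => ?_⟩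
  rcases lt_or_ge R |x| with hx | hx
  · rw [hR x y hx, abs_zero]; exact le_max_right _ _
  · exact (hM (x, y) ⟨abs_le.1 hx, hy⟩).trans (le_max_left _ _)

theorem integrable_mul_of_supp (f : L2 strip) {θ : ℝ × ℝ → ℝ} (hθ : Continuous θ) {R : ℝ}
    (hR : ∀ x y, R < |x| → θ (x, y) = 0) :
    Integrable (fun z => f z * θ z) (volume.restrict strip) := by
  obtain ⟨M, M0, hM⟩ := exists_strip_bound hθ hR
  refine ((integrable_indicator_box f R).const_mul M).mono'
    ((Lp.aestronglyMeasurable f).mul hθ.aestronglyMeasurable) ?_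
  filter_upwards [ae_restrict_mem measurableSet_strip] with z hz
  rcases lt_or_ge R |z.1| with hx | hx
  · have : θ z = 0 := hR z.1 z.2 hx
    rw [this, mul_zero, norm_zero]
    exact mul_nonneg M0 (indicator_nonneg (fun _ _ => abs_nonneg _) z)
  · rw [indicator_of_mem (show z ∈ Icc (-R) R ×ˢ univ from ⟨abs_le.1 hx, mem_univ _⟩), norm_mul,
      mul_comm]
    exact mul_le_mul_of_nonneg_right (hM z.1 z.2 (Ioo_subset_Icc_self hz.2)) (abs_nonneg _)

theorem pd_supp {θ : ℝ × ℝ → ℝ} {R : ℝ} (hR : ∀ x y, R < |x| → θ (x, y) = 0) (i : Fin 2) :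
    ∀ x y, R < |x| → pd i θ (x, y) = 0 := by
  intro x y hx
  have h1 : θ =ᶠ[𝓝 (x, y)] fun _ => 0 := by
    have : ∀ᶠ z : ℝ × ℝ in 𝓝 (x, y), R < |z.1| :=
      continuous_fst.abs.continuousAt.eventually (lt_mem_nhds hx)
    filter_upwards [this] with z hz using hR z.1 z.2 hz
  simp [pd, h1.fderiv_eq]

theorem pd_mul_snd {χ : ℝ → ℝ} (hχ : ContDiff ℝ ∞ χ) {θ : ℝ × ℝ → ℝ} (hθ : ContDiff ℝ ∞ θ)
    (i : Fin 2) (z : ℝ × ℝ) : pd i (fun z => χ z.2 * θ z) z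
      = χ z.2 * pd i θ z + (dir i).2 * (deriv χ z.2 * θ z) := by
  have h1 : HasFDerivAt (fun z : ℝ × ℝ => χ z.2) (deriv χ z.2 • ContinuousLinearMap.snd ℝ ℝ ℝ) z :=
    ((hχ.differentiable (by norm_num) z.2).hasDerivAt).comp_hasFDerivAt z hasFDerivAt_snd
  have h2 := (hθ.differentiable (by norm_num) z).hasFDerivAt
  have h3 := (h1.mul h2).fderiv
  simp only [pd]
  rw [show (fun z : ℝ × ℝ => χ z.2 * θ z) = (fun z : ℝ × ℝ => χ z.2) * θ from rfl, h3]
  simp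
  ring

theorem abs_le_of_boundary_zero {θ : ℝ × ℝ → ℝ} (hθ : ContDiff ℝ ∞ θ) {M : ℝ}
    (hM : ∀ x, ∀ y ∈ Icc (0 : ℝ) 1, |pd 1 θ (x, y)| ≤ M) (x : ℝ)
    {y y' : ℝ} (hy : y ∈ Icc (0 : ℝ) 1) (hy' : y' ∈ Icc (0 : ℝ) 1) (h0 : θ (x, y') = 0) :
    |θ (x, y)| ≤ M * |y - y'| := by
  have hd : ∀ s ∈ Icc (0 : ℝ) 1, HasDerivWithinAt (fun s => θ (x, s)) (pd 1 θ (x, s))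
      (Icc 0 1) s := fun s _ => by
    have h1 := hasDerivAt_pd hθ 1 (x, 0) s
    simp only [dir, one_ne_zero, if_false, Prod.smul_mk, smul_eq_mul, mul_zero, mul_one,
      Prod.mk_add_mk, zero_add, add_zero, Fin.isValue] at h1
    exact h1.hasDerivWithinAt
  have := (convex_Icc (0 : ℝ) 1).norm_image_sub_le_of_norm_hasDerivWithin_le hd
    (fun s hs => hM x s hs) hy' hy
  simpa [h0] using this

/-- A first order identity that holds for test functions with support in the strip extends to
test functions that do not vanish near the boundary, provided that they vanish on the boundary or
that no derivatives across the boundary occur. -/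
theorem integral_eq_zero_of_isTest {a b c : L2 strip} {θ : ℝ × ℝ → ℝ} (hθ : ContDiff ℝ ∞ θ)
    {R : ℝ} (hR : ∀ x y, R < |x| → θ (x, y) = 0)
    (h : ∀ φ, IsTest strip φ →
      ∫ z in strip, (a z * pd 0 φ z + b z * pd 1 φ z + c z * φ z) = 0)
    (hb : b = 0 ∨ ∀ x, θ (x, 0) = 0 ∧ θ (x, 1) = 0) :
    ∫ z in strip, (a z * pd 0 θ z + b z * pd 1 θ z + c z * θ z) = 0 := by
  obtain ⟨B, B0, hB⟩ := exists_deriv_smoothTransition_bound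
  obtain ⟨M₀, M₀0, hM₀⟩ := exists_strip_bound hθ.continuous hR
  obtain ⟨M₁, M₁0, hM₁⟩ := exists_strip_bound (contDiff_pd hθ 0).continuous (pd_supp hR 0)
  obtain ⟨M₂, M₂0, hM₂⟩ := exists_strip_bound (contDiff_pd hθ 1).continuous (pd_supp hR 1)
  have hm : ∀ n : ℕ, (0 : ℝ) < n + 1 := fun n => by positivity
  set φ : ℕ → ℝ × ℝ → ℝ := fun n z => cutoff (n + 1) z.2 * θ z with hφ
  have hφs : ∀ n, ContDiff ℝ ∞ (φ n) := fun n =>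
    ((contDiff_cutoff _).comp contDiff_snd).mul hθ
  have htest : ∀ n, IsTest strip (φ n) := by
    intro n
    have hsub : tsupport (φ n) ⊆ Icc (-R) R ×ˢ Icc (1 / ((n : ℝ) + 1)) (1 - 1 / ((n : ℝ) + 1)) := by
      refine closure_minimal (fun z hz => ?_) (isClosed_Icc.prod isClosed_Icc)
      have hz1 : θ z ≠ 0 := fun h0 => hz (by simp [hφ, h0])
      have hz2 : cutoff (n + 1) z.2 ≠ 0 := fun h0 => hz (by simp [hφ, h0])
      have e1 : 0 < ((n : ℝ) + 1) * z.2 - 1 := by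
        by_contra! hc
        exact hz2 (by rw [cutoff, Real.smoothTransition.zero_of_nonpos hc, zero_mul])
      have e2 : 0 < ((n : ℝ) + 1) * (1 - z.2) - 1 := by
        by_contra! hc
        exact hz2 (by rw [cutoff, Real.smoothTransition.zero_of_nonpos hc, mul_zero])
      refine ⟨abs_le.1 (not_lt.1 fun hc => hz1 (hR z.1 z.2 hc)), ?_, ?_⟩
      · rw [div_le_iff₀ (hm n)]; linarith
      · have : 1 / ((n : ℝ) + 1) ≤ 1 - z.2 := by rw [div_le_iff₀ (hm n)]; linarith
        linarith
    refine ⟨hφs n, (isCompact_Icc.prod isCompact_Icc).of_isClosed_subset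
      (isClosed_tsupport _) hsub, fun z hz => ⟨mem_univ _, ?_⟩⟩
    have := (hsub hz).2
    have h1 : 0 < 1 / ((n : ℝ) + 1) := by positivity
    exact ⟨h1.trans_le this.1, by linarith [this.2]⟩
  have hbq : ∀ᵐ z ∂(volume.restrict strip : Measure (ℝ × ℝ)), ∀ n : ℕ,
      |b z * (deriv (cutoff (n + 1)) z.2 * θ z)| ≤ 4 * B * M₂ * |b z| := by
    rcases hb with rfl | hb
    · filter_upwards [Lp.coeFn_zero ℝ 2 (volume.restrict strip : Measure (ℝ × ℝ))] with z hz n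
      rw [hz]; simp
    · filter_upwards [ae_restrict_mem measurableSet_strip] with z hz n
      have hy : z.2 ∈ Icc (0 : ℝ) 1 := Ioo_subset_Icc_self hz.2
      have q0 := abs_le_of_boundary_zero hθ hM₂ z.1 hy (left_mem_Icc.2 zero_le_one) (hb z.1).1
      have q1 := abs_le_of_boundary_zero hθ hM₂ z.1 hy (right_mem_Icc.2 zero_le_one) (hb z.1).2
      rw [sub_zero, abs_of_nonneg hy.1] at q0
      rw [abs_sub_comm z.2 1, abs_of_nonneg (by linarith [hy.2] : (0 : ℝ) ≤ 1 - z.2)] at q1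
      rw [abs_mul, mul_comm]
      exact mul_le_mul_of_nonneg_right
        (abs_deriv_cutoff_mul_le hB (hm n).le M₂0 hy q0 q1) (abs_nonneg _)
  have hlim : Tendsto (fun n : ℕ => ∫ z in strip,
      (a z * pd 0 (φ n) z + b z * pd 1 (φ n) z + c z * φ n z)) atTop
      (𝓝 (∫ z in strip, (a z * pd 0 θ z + b z * pd 1 θ z + c z * θ z))) := by
    refine tendsto_integral_of_dominated_convergence
      (fun z => M₁ * (Icc (-R) R ×ˢ (univ : Set ℝ)).indicator (fun z => |a z|) z
        + (M₂ + 4 * B * M₂) * (Icc (-R) R ×ˢ (univ : Set ℝ)).indicator (fun z => |b z|) z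
        + M₀ * (Icc (-R) R ×ˢ (univ : Set ℝ)).indicator (fun z => |c z|) z)
      (fun n => ?_) ?_ (fun n => ?_) ?_
    · exact (((Lp.aestronglyMeasurable a).mul (contDiff_pd (hφs n) 0).continuous.aestronglyMeasurable).add
        ((Lp.aestronglyMeasurable b).mul
          (contDiff_pd (hφs n) 1).continuous.aestronglyMeasurable)).add
        ((Lp.aestronglyMeasurable c).mul (hφs n).continuous.aestronglyMeasurable)
    · exact (((integrable_indicator_box a R).const_mul _).add
        ((integrable_indicator_box b R).const_mul _)).add
        ((integrable_indicator_box c R).const_mul _)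
    · filter_upwards [hbq, ae_restrict_mem measurableSet_strip] with z hz hzs
      have hy : z.2 ∈ Icc (0 : ℝ) 1 := Ioo_subset_Icc_self hzs.2
      rcases lt_or_ge R |z.1| with hx | hx
      · have hR' : ∀ x y, R < |x| → φ n (x, y) = 0 := fun x y hx => by simp [hφ, hR x y hx]
        have e1 : φ n z = 0 := hR' z.1 z.2 hx
        have e2 : ∀ i, pd i (φ n) z = 0 := fun i => pd_supp hR' i z.1 z.2 hx
        rw [e1, e2, e2, mul_zero, mul_zero, mul_zero, add_zero, add_zero, norm_zero]
        have := fun f : L2 strip => indicator_nonneg (s := Icc (-R) R ×ˢ (univ : Set ℝ))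
          (f := fun z => |f z|) (fun _ _ => abs_nonneg _) z
        have i1 := this a
        have i2 := this b
        have i3 := this c
        positivity
      · have hmem : z ∈ Icc (-R) R ×ˢ (univ : Set ℝ) := ⟨abs_le.1 hx, mem_univ _⟩
        rw [indicator_of_mem hmem, indicator_of_mem hmem, indicator_of_mem hmem,
          pd_mul_snd (contDiff_cutoff _) hθ, pd_mul_snd (contDiff_cutoff _) hθ]
        simp only [dir, if_true, one_ne_zero, if_false, zero_mul, add_zero, one_mul, Fin.isValue]
        have g := abs_cutoff_le (n + 1) z.2
        have k0 : |cutoff (n + 1) z.2 * θ z| ≤ M₀ := by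
          rw [abs_mul]; exact (mul_le_of_le_one_left (abs_nonneg _) g).trans (hM₀ z.1 z.2 hy)
        have k1 : |cutoff (n + 1) z.2 * pd 0 θ z| ≤ M₁ := by
          rw [abs_mul]; exact (mul_le_of_le_one_left (abs_nonneg _) g).trans (hM₁ z.1 z.2 hy)
        have k2 : |cutoff (n + 1) z.2 * pd 1 θ z| ≤ M₂ := by
          rw [abs_mul]; exact (mul_le_of_le_one_left (abs_nonneg _) g).trans (hM₂ z.1 z.2 hy)
        have l0 : |c z * (cutoff (n + 1) z.2 * θ z)| ≤ M₀ * |c z| := by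
          rw [abs_mul, mul_comm]; exact mul_le_mul_of_nonneg_right k0 (abs_nonneg _)
        have l1 : |a z * (cutoff (n + 1) z.2 * pd 0 θ z)| ≤ M₁ * |a z| := by
          rw [abs_mul, mul_comm]; exact mul_le_mul_of_nonneg_right k1 (abs_nonneg _)
        have l2 : |b z * (cutoff (n + 1) z.2 * pd 1 θ z)| ≤ M₂ * |b z| := by
          rw [abs_mul, mul_comm]; exact mul_le_mul_of_nonneg_right k2 (abs_nonneg _)
        have l3 := hz n
        rw [mul_add]
        refine (abs_add_le _ _).trans ?_
        refine (add_le_add_left (abs_add_le _ _) _).trans ?_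
        have l4 := abs_add_le (b z * (cutoff (n + 1) z.2 * pd 1 θ z))
          (b z * (deriv (cutoff (n + 1)) z.2 * θ z))
        linarith
    · filter_upwards [ae_restrict_mem measurableSet_strip] with z hzs
      refine tendsto_const_nhds.congr' ?_
      obtain ⟨n₀, hn₀⟩ := exists_nat_gt (2 / min z.2 (1 - z.2))
      have hpos : 0 < min z.2 (1 - z.2) := lt_min hzs.2.1 (by linarith [hzs.2.2])
      filter_upwards [eventually_ge_atTop n₀] with n hn
      have hn' : 2 < ((n : ℝ) + 1) * min z.2 (1 - z.2) := by
        rw [div_lt_iff₀ hpos] at hn₀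
        have : (n₀ : ℝ) ≤ n := by exact_mod_cast hn
        nlinarith
      have heq : φ n =ᶠ[𝓝 z] θ := by
        have : ∀ᶠ w : ℝ × ℝ in 𝓝 z, 2 < ((n : ℝ) + 1) * min w.2 (1 - w.2) :=
          (continuous_const.mul (continuous_snd.min
            (continuous_const.sub continuous_snd))).continuousAt.eventually (lt_mem_nhds hn')
        filter_upwards [this] with w hw
        have w1 : 1 ≤ ((n : ℝ) + 1) * w.2 - 1 := by
          have := mul_le_mul_of_nonneg_left (min_le_left w.2 (1 - w.2)) (hm n).le
          linarith
        have w2 : 1 ≤ ((n : ℝ) + 1) * (1 - w.2) - 1 := by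
          have := mul_le_mul_of_nonneg_left (min_le_right w.2 (1 - w.2)) (hm n).le
          linarith
        simp only [hφ, cutoff]
        rw [Real.smoothTransition.one_of_one_le w1, Real.smoothTransition.one_of_one_le w2]
        ring
      simp only [pd, heq.fderiv_eq, heq.eq_of_nhds]
  refine tendsto_nhds_unique hlim (tendsto_const_nhds.congr fun n => ?_)
  exact (h _ (htest n)).symm

/-! ### Weak derivatives on the strip and derivatives of reflected functions -/

theorem pd_comm {ψ : ℝ × ℝ → ℝ} (h : ContDiff ℝ ∞ ψ) (z : ℝ × ℝ) :
    pd 0 (pd 1 ψ) z = pd 1 (pd 0 ψ) z := by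
  have hd : DifferentiableAt ℝ (fderiv ℝ ψ) z :=
    (h.fderiv_right (m := ∞) (by norm_num)).differentiable (by norm_num) z
  have hs : IsSymmSndFDerivAt ℝ ψ z :=
    (contDiff_infty.1 h 2).contDiffAt.isSymmSndFDerivAt (by simp)
  have e : ∀ v w : ℝ × ℝ, fderiv ℝ (fun z => fderiv ℝ ψ z v) z w = fderiv ℝ (fderiv ℝ ψ) z w v :=
    fun v w => by
      rw [fderiv_clm_apply hd (differentiableAt_const v)]
      simp
  change fderiv ℝ (fun z => fderiv ℝ ψ z (dir 1)) z (dir 0)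
    = fderiv ℝ (fun z => fderiv ℝ ψ z (dir 0)) z (dir 1)
  rw [e, e]
  exact hs _ _

/-- The sum (`p = false`) or the difference (`p = true`) of the values at points that are
symmetric to each other. -/
def refl (p : Bool) (ψ : ℝ × ℝ → ℝ) (z : ℝ × ℝ) : ℝ :=
  ψ z + (if p then -1 else 1) * ψ (z.1, -z.2)

theorem contDiff_refl {ψ : ℝ × ℝ → ℝ} (h : ContDiff ℝ ∞ ψ) (p : Bool) : ContDiff ℝ ∞ (refl p ψ) :=
  h.add (contDiff_const.mul (h.comp (contDiff_fst.prodMk contDiff_snd.neg)))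

theorem refl_supp {ψ : ℝ × ℝ → ℝ} {R : ℝ} (hR : ∀ x y, R < |x| → ψ (x, y) = 0) (p : Bool) :
    ∀ x y, R < |x| → refl p ψ (x, y) = 0 := fun x y hx => by
  simp [refl, hR x _ hx]

theorem pd_refl {ψ : ℝ × ℝ → ℝ} (h : ContDiff ℝ ∞ ψ) (p : Bool) (i : Fin 2) :
    pd i (refl p ψ) = refl (if i = 0 then p else !p) (pd i ψ) := by
  funext z
  have hd := h.differentiable (by norm_num)
  have h1 : HasFDerivAt (fun z : ℝ × ℝ => (z.1, -z.2))
      ((ContinuousLinearMap.fst ℝ ℝ ℝ).prod (-ContinuousLinearMap.snd ℝ ℝ ℝ)) z :=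
    hasFDerivAt_fst.prodMk hasFDerivAt_snd.neg
  have h2 := ((hd (z.1, -z.2)).hasFDerivAt.comp z h1).const_mul (if p then -1 else 1 : ℝ)
  have h3 := ((hd z).hasFDerivAt.add h2).fderiv
  have h4 : pd i (refl p ψ) z = fderiv ℝ ψ z (dir i)
      + (if p then -1 else 1 : ℝ) * fderiv ℝ ψ (z.1, -z.2) ((dir i).1, -(dir i).2) := by
    rw [pd]
    refine (congrArg (fun L => L (dir i)) h3).trans ?_
    cases p <;> simp
  rw [h4]
  fin_cases i
  · simp [refl, pd, dir]
  · have e : fderiv ℝ ψ (z.1, -z.2) (0, -1) = -fderiv ℝ ψ (z.1, -z.2) (0, 1) := by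
      rw [← map_neg]; simp
    cases p <;> simp [refl, pd, dir, e]

/-- Pairing a reflected function with a test function amounts to reflecting the test function. -/
theorem inner_ext_vec (p : Bool) (f : L2 strip) {ψ : ℝ × ℝ → ℝ} (hψ : IsPer ψ) :
    ⟪dbl.ext p f, hψ.vec⟫ = ∫ s in strip, f s * refl p ψ s := by
  rw [dbl.inner_ext]
  refine integral_congr_ae ?_
  filter_upwards [dbl.ae_inj hψ.vec_ae false, dbl.ae_inj hψ.vec_ae true] with s h0 h1
  have e0 : hψ.vec (dbl.inj false s) = ψ s := h0.trans (hψ.toG_toCyl s)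
  have e1 : hψ.vec (dbl.inj true s) = ψ (s.1, -s.2) := h1.trans (hψ.toG_toCyl (s.1, -s.2))
  rw [e0, e1, refl]

theorem IsTest.exists_supp {U : Set (ℝ × ℝ)} {φ : ℝ × ℝ → ℝ} (h : IsTest U φ) :
    ∃ R, ∀ x y, R < |x| → φ (x, y) = 0 := by
  obtain ⟨R, hR⟩ := h.2.1.isBounded.exists_norm_le
  refine ⟨R, fun x y hx => image_eq_zero_of_notMem_tsupport fun hz => ?_⟩
  exact absurd ((norm_fst_le (x, y)).trans (hR _ hz)) (not_le.2 hx)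

theorem integral_add_mul {a b : L2 strip} {θ θ' : ℝ × ℝ → ℝ} (h : Continuous θ)
    (h' : Continuous θ') {R : ℝ} (hR : ∀ x y, R < |x| → θ (x, y) = 0)
    (hR' : ∀ x y, R < |x| → θ' (x, y) = 0) :
    ∫ z in strip, (a z * θ z + b z * θ' z)
      = (∫ z in strip, a z * θ z) + ∫ z in strip, b z * θ' z :=
  integral_add (integrable_mul_of_supp a h hR) (integrable_mul_of_supp b h' hR')

theorem integral_eq_neg_of_isTest {i : Fin 2} {f g : L2 strip} {θ : ℝ × ℝ → ℝ}
    (hθ : ContDiff ℝ ∞ θ) {R : ℝ} (hR : ∀ x y, R < |x| → θ (x, y) = 0)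
    (h : HasWeakDeriv strip (dir i) f g) (hb : i = 0 ∨ ∀ x, θ (x, 0) = 0 ∧ θ (x, 1) = 0) :
    ∫ z in strip, f z * pd i θ z = -∫ z in strip, g z * θ z := by
  have hz : ∀ᵐ z ∂(volume.restrict strip : Measure (ℝ × ℝ)), (0 : L2 strip) z = 0 :=
    Lp.coeFn_zero ℝ 2 (volume.restrict strip : Measure (ℝ × ℝ))
  have key : ∀ φ : ℝ × ℝ → ℝ, ContDiff ℝ ∞ φ → ∀ R, (∀ x y, R < |x| → φ (x, y) = 0) →
      ∫ z in strip, ((if i = 0 then f else 0 : L2 strip) z * pd 0 φ z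
        + (if i = 0 then 0 else f : L2 strip) z * pd 1 φ z + g z * φ z)
        = (∫ z in strip, f z * pd i φ z) + ∫ z in strip, g z * φ z := by
    intro φ hφ R hR
    rw [← integral_add_mul (contDiff_pd hφ i).continuous hφ.continuous (pd_supp hR i) hR]
    refine integral_congr_ae ?_
    filter_upwards [hz] with z hz
    rcases eq_or_ne i 0 with rfl | hi
    · rw [if_pos rfl, if_pos rfl, hz]; ring
    · obtain rfl : i = 1 := by omega
      rw [if_neg hi, if_neg hi, hz]; ring
  rw [← add_eq_zero_iff_eq_neg, ← key θ hθ R hR]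
  refine integral_eq_zero_of_isTest hθ hR (fun φ hφ => ?_) ?_
  · obtain ⟨R', hR'⟩ := hφ.exists_supp
    rw [key φ hφ.1 R' hR', add_eq_zero_iff_eq_neg]
    exact h φ hφ
  · rcases hb with rfl | hb
    · exact Or.inl (if_pos rfl)
    · exact Or.inr hb

/-- Reflections commute with derivatives along the strip. -/
theorem hasD_ext_zero (p : Bool) {f g : L2 strip} (h : HasWeakDeriv strip (1, 0) f g) :
    HasD 0 (dbl.ext p f) (dbl.ext p g) := by
  refine hasD_of_forall_isPer fun ψ hψ => ?_
  obtain ⟨R, hR⟩ := hψ.supp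
  rw [inner_ext_vec, inner_ext_vec]
  have := integral_eq_neg_of_isTest (i := 0) (contDiff_refl hψ.smooth p) (refl_supp hR p) h
    (Or.inl rfl)
  rwa [pd_refl hψ.smooth] at this

theorem refl_true_boundary {ψ : ℝ × ℝ → ℝ} (hψ : IsPer ψ) (x : ℝ) :
    refl true ψ (x, 0) = 0 ∧ refl true ψ (x, 1) = 0 := by
  have := hψ.per x (-1)
  rw [show (-1 + 2 : ℝ) = 1 by norm_num] at this
  simp [refl, this]

/-- The derivative of the even reflection is the odd reflection of the derivative. -/
theorem hasD_ext_even {f g : L2 strip} (h : HasWeakDeriv strip (0, 1) f g) :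
    HasD 1 (dbl.ext false f) (dbl.ext true g) := by
  refine hasD_of_forall_isPer fun ψ hψ => ?_
  obtain ⟨R, hR⟩ := hψ.supp
  rw [inner_ext_vec, inner_ext_vec]
  have := integral_eq_neg_of_isTest (i := 1) (contDiff_refl hψ.smooth true) (refl_supp hR true) h
    (Or.inr (refl_true_boundary hψ))
  rwa [pd_refl hψ.smooth] at this

theorem smoothTransition_eventuallyEq_one {y : ℝ} (hy : y ∈ Ioo (0 : ℝ) 1) :
    (fun y : ℝ => Real.smoothTransition (y + 2) * Real.smoothTransition (3 - y))
      =ᶠ[𝓝 y] fun _ => 1 := by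
  filter_upwards [Ioo_mem_nhds hy.1 hy.2] with s hs
  rw [Real.smoothTransition.one_of_one_le (by linarith [hs.1]),
    Real.smoothTransition.one_of_one_le (by linarith [hs.2]), one_mul]

/-- The derivative of the odd reflection of a function that vanishes on the boundary is the even
reflection of the derivative. -/
theorem hasD_ext_odd {f : L2 strip} (h : TraceZero ((0, 1) : ℝ × ℝ) f) :
    HasD 1 (dbl.ext true f) (dbl.ext false (dy f)) := by
  refine hasD_of_forall_isPer fun ψ hψ => ?_
  obtain ⟨R, hR⟩ := hψ.supp
  rw [inner_ext_vec, inner_ext_vec]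
  set ζ : ℝ → ℝ := fun y => Real.smoothTransition (y + 2) * Real.smoothTransition (3 - y) with hζ
  have hζs : ContDiff ℝ ∞ ζ :=
    (Real.smoothTransition.contDiff.comp (contDiff_id.add contDiff_const)).mul
      (Real.smoothTransition.contDiff.comp (contDiff_const.sub contDiff_id))
  set θ := refl false ψ with hθ
  have hθs : ContDiff ℝ ∞ θ := contDiff_refl hψ.smooth false
  have hsub : tsupport (fun z : ℝ × ℝ => ζ z.2 * θ z) ⊆ Icc (-R) R ×ˢ Icc (-2 : ℝ) 3 := by
    refine closure_minimal (fun z hz => ?_) (isClosed_Icc.prod isClosed_Icc)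
    have hz1 : θ z ≠ 0 := fun h0 => hz (by simp [h0])
    have hz2 : ζ z.2 ≠ 0 := fun h0 => hz (by simp [h0])
    refine ⟨abs_le.1 (not_lt.1 fun hc => hz1 (refl_supp hR false z.1 z.2 hc)), ?_, ?_⟩
    · by_contra! hc
      exact hz2 (by
        simp only [hζ]; rw [Real.smoothTransition.zero_of_nonpos (by linarith), zero_mul])
    · by_contra! hc
      exact hz2 (by
        simp only [hζ]; rw [Real.smoothTransition.zero_of_nonpos (x := 3 - z.2) (by linarith),
          mul_zero])
  have hmem : ∀ᵐ z ∂(volume.restrict strip : Measure (ℝ × ℝ)), z ∈ strip :=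
    ae_restrict_mem measurableSet_strip
  have key := h (fun z => ζ z.2 * θ z) ⟨(hζs.comp contDiff_snd).mul hθs,
    (isCompact_Icc.prod isCompact_Icc).of_isClosed_subset (isClosed_tsupport _) hsub,
    subset_univ _⟩
  have e1 : ∫ z in strip, f z * fderiv ℝ (fun z => ζ z.2 * θ z) z (0, 1)
      = ∫ z in strip, f z * refl true (pd 1 ψ) z := by
    refine integral_congr_ae (hmem.mono fun z hz => ?_)
    have a1 := pd_mul_snd hζs hθs 1 z
    have a2 := smoothTransition_eventuallyEq_one hz.2
    rw [show deriv ζ z.2 = 0 from a2.deriv_eq.trans (deriv_const _ _),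
      show ζ z.2 = 1 from a2.eq_of_nhds, hθ, pd_refl hψ.smooth] at a1
    simp only [one_mul, zero_mul, mul_zero, add_zero, one_ne_zero, if_false, Fin.isValue,
      Bool.not_false] at a1
    exact congrArg (f z * ·) a1
  have e2 : ∫ z in strip, wderiv ((0, 1) : ℝ × ℝ) f z * (ζ z.2 * θ z)
      = ∫ z in strip, wderiv ((0, 1) : ℝ × ℝ) f z * θ z := by
    refine integral_congr_ae (hmem.mono fun z hz => ?_)
    have a2 := (smoothTransition_eventuallyEq_one hz.2).eq_of_nhds
    simp only [hζ, a2, one_mul]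
  rw [← e1, ← e2]
  exact key

/-- The gradient of a distribution is curl free; this survives the reflection that is even in the
first and odd in the second component. -/
theorem curl_free_ext {P : ℝ × ℝ → ℝ} {q₁ q₂ : L2 strip} (h₁ : HasWeakDeriv strip (1, 0) P q₁)
    (h₂ : HasWeakDeriv strip (0, 1) P q₂) {A B : LG} (hA : HasD 0 (dbl.ext true q₂) A)
    (hB : HasD 1 (dbl.ext false q₁) B) : A = B := by
  rw [← sub_eq_zero]
  refine IsPer.eq_zero_of_inner fun ψ hψ => ?_
  have a1 := hA.inner_eq_neg (hψ.hasD_vec 0)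
  have b1 := hB.inner_eq_neg (hψ.hasD_vec 1)
  obtain ⟨R, hR⟩ := hψ.supp
  have hz : ∀ᵐ z ∂(volume.restrict strip : Measure (ℝ × ℝ)), (0 : L2 strip) z = 0 :=
    Lp.coeFn_zero ℝ 2 (volume.restrict strip : Measure (ℝ × ℝ))
  have key : ∀ φ : ℝ × ℝ → ℝ, ContDiff ℝ ∞ φ → ∀ R, (∀ x y, R < |x| → φ (x, y) = 0) →
      ∫ z in strip, (q₂ z * pd 0 φ z + (-q₁) z * pd 1 φ z + (0 : L2 strip) z * φ z)
        = (∫ z in strip, q₂ z * pd 0 φ z) - ∫ z in strip, q₁ z * pd 1 φ z := by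
    intro φ hφ R hR
    rw [← integral_sub (integrable_mul_of_supp q₂ (contDiff_pd hφ 0).continuous (pd_supp hR 0))
      (integrable_mul_of_supp q₁ (contDiff_pd hφ 1).continuous (pd_supp hR 1))]
    refine integral_congr_ae ?_
    filter_upwards [hz, Lp.coeFn_neg q₁] with z hz hn
    rw [hz, hn, Pi.neg_apply]; ring
  have h3 := integral_eq_zero_of_isTest (a := q₂) (b := -q₁) (c := 0)
    (contDiff_refl hψ.smooth true) (refl_supp hR true) (fun φ hφ => by
      obtain ⟨R', hR'⟩ := hφ.exists_supp
      rw [key φ hφ.1 R' hR', sub_eq_zero]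
      have ht : ∀ i, IsTest strip (pd i φ) := fun i =>
        ⟨contDiff_pd hφ.1 i, hφ.2.1.fderiv_apply ℝ (dir i),
          (tsupport_fderiv_apply_subset ℝ (dir i)).trans hφ.2.2⟩
      have t1 := h₁ _ (ht 1)
      have t2 := h₂ _ (ht 0)
      have e : ∫ z in strip, P z * fderiv ℝ (pd 1 φ) z (1, 0)
          = ∫ z in strip, P z * fderiv ℝ (pd 0 φ) z (0, 1) :=
        integral_congr_ae (Eventually.of_forall fun z => congrArg (P z * ·) (pd_comm hφ.1 z))
      rw [t1, t2] at e
      linarith) (Or.inr (refl_true_boundary hψ))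
  rw [key _ (contDiff_refl hψ.smooth true) R (refl_supp hR true), pd_refl hψ.smooth,
    pd_refl hψ.smooth] at h3
  simp only [if_true, one_ne_zero, if_false, Bool.not_true, Fin.isValue] at h3
  rw [← inner_ext_vec true q₂ (hψ.pd 0), ← inner_ext_vec false q₁ (hψ.pd 1)] at h3
  rw [inner_sub_left]
  linarith

/-! ### Families of mixed derivatives -/

section Grid

variable {E : Type*} [NormedAddCommGroup E] [NormedSpace ℝ E] [Shift E]

/-- `F a b` is the mixed derivative `∂_x^a ∂_y^b` of `F 0 0`, for `a + b ≤ m`. -/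
structure Grid (m : ℕ) (F : ℕ → ℕ → E) : Prop where
  zero : ∀ a b, a + b < m → HasD 0 (F a b) (F (a + 1) b)
  one_zero : ∀ b < m, HasD 1 (F 0 b) (F 0 (b + 1))

namespace Grid

variable {m : ℕ} {F G : ℕ → ℕ → E}

theorem mono {n : ℕ} (h : Grid n F) (hmn : m ≤ n) : Grid m F :=
  ⟨fun a b hab => h.zero a b (by omega), fun b hb => h.one_zero b (by omega)⟩

theorem sub (hF : Grid m F) (hG : Grid m G) : Grid m fun a b => F a b - G a b :=
  ⟨fun a b hab => (hF.zero a b hab).sub (hG.zero a b hab),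
    fun b hb => (hF.one_zero b hb).sub (hG.one_zero b hb)⟩

theorem smul (c : ℝ) (hF : Grid m F) : Grid m fun a b => c • F a b :=
  ⟨fun a b hab => (hF.zero a b hab).const_smul c, fun b hb => (hF.one_zero b hb).const_smul c⟩

variable [CompleteSpace E]

theorem one (h : Grid m F) (a b : ℕ) (hab : a + b < m) : HasD 1 (F a b) (F a (b + 1)) := by
  induction a with
  | zero => exact h.one_zero b (by omega)
  | succ a ih =>
    exact (h.zero a b (by omega)).comm (ih (by omega)) (h.zero a (b + 1) (by omega))

theorem hm_apply (h : Grid m F) (n a b : ℕ) (hab : a + b + n ≤ m) : Hm n (F a b) := by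
  induction n generalizing a b with
  | zero => trivial
  | succ n ih =>
    refine hm_succ (g := fun i => if i = 0 then F (a + 1) b else F a (b + 1)) (fun i => ?_)
      fun i => ?_
    · rcases eq_or_ne i 0 with rfl | hi
      · exact h.zero a b (by omega)
      · obtain rfl : i = 1 := by omega
        exact h.one a b (by omega)
    · split_ifs
      · exact ih _ _ (by omega)
      · exact ih _ _ (by omega)

theorem hm (h : Grid m F) : Hm m (F 0 0) := h.hm_apply m 0 0 (by omega)

theorem dw_eq (h : Grid m F) {v : List (Fin 2)} (hv : v.length ≤ m) :
    dw v (F 0 0) = F (v.count 0) (v.count 1) := by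
  have hl : ∀ v : List (Fin 2), v.count 0 + v.count 1 = v.length := fun v => by
    induction v with
    | nil => rfl
    | cons i v ih =>
      rcases eq_or_ne i 0 with rfl | hi
      · simp; omega
      · obtain rfl : i = 1 := by omega
        simp; omega
  induction v with
  | nil => rfl
  | cons i v ih =>
    simp only [List.length_cons] at hv
    have hv' := hl v
    rw [dw, ih (by omega)]
    rcases eq_or_ne i 0 with rfl | hi
    · rw [(h.zero _ _ (by omega)).der_eq]; simp
    · obtain rfl : i = 1 := by omega
      rw [(h.one _ _ (by omega)).der_eq]; simp

theorem count_wd (a b : ℕ) : (wd a b).count 0 = a ∧ (wd a b).count 1 = b := by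
  constructor <;> simp [wd, List.count_replicate]

theorem dw_wd (h : Grid m F) {a b : ℕ} (hab : a + b ≤ m) : dw (wd a b) (F 0 0) = F a b := by
  rw [h.dw_eq (by rwa [length_wd]), (count_wd a b).1, (count_wd a b).2]

theorem N_le (h : Grid m F) {B : ℝ} (hB : ∀ a b, a + b ≤ m → ‖F a b‖ ≤ B) :
    N m (F 0 0) ≤ (2 ^ (m + 1) - 1) * B :=
  N_le_of_wd h.hm fun a b hab => by rw [h.dw_wd hab]; exact hB a b hab

theorem of_tendsto {ι : Type*} {l : Filter ι} [l.NeBot] {F : ι → ℕ → ℕ → E}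
    (hF : ∀ᶠ n in l, Grid m (F n)) (h : ∀ a b, a + b ≤ m → Tendsto (fun n => F n a b) l (𝓝 (G a b))) :
    Grid m G :=
  ⟨fun a b hab => hasD_of_tendsto (h a b (by omega)) (h (a + 1) b (by omega))
      (hF.mono fun _ hn => hn.zero a b hab),
    fun b hb => hasD_of_tendsto (h 0 b (by omega)) (h 0 (b + 1) (by omega))
      (hF.mono fun _ hn => hn.one_zero b hb)⟩

theorem convH {ι : Type*} {l : Filter ι} {F : ι → ℕ → ℕ → E} (hF : ∀ᶠ n in l, Grid m (F n))
    (hG : Grid m G) (h : ∀ a b, a + b ≤ m → Tendsto (fun n => F n a b) l (𝓝 (G a b))) :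
    ConvH m (fun n => F n 0 0) l (G 0 0) := by
  refine convH_of_wd (hF.mono fun n hn => hn.hm) hG.hm fun a b hab => ?_
  rw [hG.dw_wd hab]
  refine (h a b hab).congr' ?_
  filter_upwards [hF] with n hn
  rw [hn.dw_wd hab]

/-- The time derivative of a curve of such families. -/
theorem of_hasDerivWithinAt {F : ℝ → ℕ → ℕ → E} {s : Set ℝ} {t : ℝ} [(𝓝[s \ {t}] t).NeBot]
    (ht : t ∈ s) (hF : ∀ r ∈ s, Grid m (F r))
    (h : ∀ a b, a + b ≤ m → HasDerivWithinAt (fun r => F r a b) (G a b) s t) : Grid m G := by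
  refine of_tendsto (l := 𝓝[s \ {t}] t) (F := fun r a b => (r - t)⁻¹ • (F r a b - F t a b)) ?_
    fun a b hab => ?_
  · filter_upwards [self_mem_nhdsWithin] with r hr
    exact ((hF r hr.1).sub (hF t ht)).smul _
  · have := hasDerivWithinAt_iff_tendsto_slope.1 (h a b hab)
    exact this.congr fun r => by rw [slope_def_module]

end Grid

end Grid

/-! ### Reflections of functions with boundary conditions -/

theorem exists_hasWeakDeriv_wderiv {U : Set (ℝ × ℝ)} (hU : IsOpen U) {v : ℝ × ℝ} {f : L2 U}
    (h : ∃ g : L2 U, HasWeakDeriv U v f g) : HasWeakDeriv U v f (wderiv v f) := by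
  obtain ⟨g, hg⟩ := h
  rwa [wderiv_eq hU hg]

theorem D_succ_left (a b : ℕ) (f : L2 strip) : D (a + 1) b f = dx (D a b f) :=
  Function.iterate_succ_apply' _ _ _

theorem D_zero_succ (b : ℕ) (f : L2 strip) : D 0 (b + 1) f = dy (D 0 b f) :=
  Function.iterate_succ_apply' _ _ _

/-- The reflections of the mixed derivatives of `f`, where `f` itself is reflected evenly
(`p = false`) or oddly (`p = true`). -/
def extD (p : Bool) (f : L2 strip) (a b : ℕ) : LG := dbl.ext (p ^^ b.bodd) (D a b f)

theorem extD_zero_zero (p : Bool) (f : L2 strip) : extD p f 0 0 = dbl.ext p f := by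
  simp [extD, D]

theorem MemH.grid_extD {m : ℕ} {p : Bool} {f : L2 strip} (h : MemH m f)
    (hb : ∀ b < m, (p ^^ b.bodd) = true → TraceZero ((0, 1) : ℝ × ℝ) (D 0 b f)) :
    Grid m (extD p f) := by
  refine ⟨fun a b hab => ?_, fun b hbm => ?_⟩
  · rw [extD, extD, D_succ_left]
    exact hasD_ext_zero _ (exists_hasWeakDeriv_wderiv isOpen_strip (h a b hab).1)
  · rw [extD, extD, D_zero_succ, Nat.bodd_succ]
    have h1 := exists_hasWeakDeriv_wderiv isOpen_strip (h 0 b (by omega)).2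
    have h2 := hb b hbm
    cases hp : (p ^^ b.bodd)
    · have : (p ^^ !b.bodd) = true := by revert hp; cases p <;> cases b.bodd <;> simp
      rw [this]
      exact hasD_ext_even h1
    · have : (p ^^ !b.bodd) = false := by revert hp; cases p <;> cases b.bodd <;> simp
      rw [this]
      exact hasD_ext_odd (h2 hp)

theorem MemY.grid_extD {m : ℕ} {f : L2 strip} (h : MemY m f) : Grid m (extD false f) :=
  h.1.grid_extD fun b hb hp => by
    obtain ⟨n, rfl⟩ : ∃ n, b = 2 * n + 1 := by
      refine ⟨b.div2, ?_⟩
      have := Nat.bodd_add_div2 b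
      rw [Bool.false_xor] at hp
      rw [hp] at this
      simp at this
      omega
    exact h.2 n hb

theorem MemX₀.grid_extD {m : ℕ} {f : L2 strip} (h : MemX₀ m f) : Grid m (extD true f) :=
  h.1.grid_extD fun b hb hp => by
    obtain ⟨n, rfl⟩ : ∃ n, b = 2 * n := by
      refine ⟨b.div2, ?_⟩
      have := Nat.bodd_add_div2 b
      have hp' : b.bodd = false := by simpa using hp
      rw [hp'] at this
      simp at this
      omega
    exact h.2 n hb

theorem norm_D_le_HNorm {m a b : ℕ} (hab : a + b ≤ m) (f : L2 strip) : ‖D a b f‖ ≤ HNorm m f := by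
  refine Real.le_sqrt_of_sq_le ?_
  have h1 : ‖D a b f‖ ^ 2 = ‖D a (a + b - a) f‖ ^ 2 := by rw [Nat.add_sub_cancel_left]
  rw [h1, HNormSq]
  refine (Finset.single_le_sum (f := fun i => ‖D i (a + b - i) f‖ ^ 2)
    (fun _ _ => by positivity) (Finset.mem_range.2 (by omega : a < a + b + 1))).trans ?_
  exact Finset.single_le_sum (f := fun j => ∑ i ∈ Finset.range (j + 1), ‖D i (j - i) f‖ ^ 2)
    (fun _ _ => Finset.sum_nonneg fun _ _ => by positivity)
    (Finset.mem_range.2 (by omega : a + b < m + 1))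

theorem N_ext_le {m : ℕ} {p : Bool} {f : L2 strip} (h : Grid m (extD p f)) :
    N m (dbl.ext p f) ≤ 2 ^ (m + 2) * HNorm m f := by
  have h0 : 0 ≤ HNorm m f := Real.sqrt_nonneg _
  have h1 := h.N_le (B := 2 * HNorm m f) fun a b hab => by
    rw [extD, dbl.norm_ext]
    exact mul_le_mul (Real.sqrt_le_iff.2 ⟨by norm_num, by norm_num⟩) (norm_D_le_HNorm hab f)
      (norm_nonneg _) (by norm_num)
  rw [extD_zero_zero] at h1
  refine h1.trans ?_
  rw [show (2 : ℝ) ^ (m + 2) * HNorm m f = 2 ^ (m + 1) * (2 * HNorm m f) by ring]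
  exact mul_le_mul_of_nonneg_right (by linarith) (by positivity)

theorem ContH.convH_ext {m : ℕ} {T : ℝ} {f : ℝ → L2 strip} (h : ContH m T f) {p : Bool}
    (hg : ∀ t ∈ Icc 0 T, Grid m (extD p (f t))) {t : ℝ} (ht : t ∈ Icc 0 T) :
    ConvH m (fun s => dbl.ext p (f s)) (𝓝[Icc 0 T] t) (dbl.ext p (f t)) := by
  have := Grid.convH (l := 𝓝[Icc 0 T] t) (F := fun s => extD p (f s))
    (eventually_mem_nhdsWithin.mono fun s hs => hg s hs) (hg t ht) fun a b hab =>
      ((dbl.ext (p ^^ b.bodd)).continuous.tendsto _).comp (h.2 a b hab t ht)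
  simpa only [extD_zero_zero] using this

theorem TimeDerivH.grid_extD {m : ℕ} {T : ℝ} {f f' : ℝ → L2 strip} (h : TimeDerivH m T f f')
    (hT : 0 < T) {p : Bool} (hg : ∀ t ∈ Icc 0 T, Grid m (extD p (f t))) {t : ℝ}
    (ht : t ∈ Icc 0 T) : Grid m (extD p (f' t)) := by
  have : (𝓝[Icc 0 T \ {t}] t).NeBot := by
    have := (uniqueDiffOn_Icc hT t ht).accPt
    rwa [accPt_principal_iff_nhdsWithin] at this
  exact Grid.of_hasDerivWithinAt (F := fun s => extD p (f s)) ht hg fun a b hab =>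
    (dbl.ext (p ^^ b.bodd)).hasFDerivAt.comp_hasDerivWithinAt t (h a b hab t ht)

theorem TimeDerivH.hasDerivWithinAt_dw {m : ℕ} {T : ℝ} {f f' : ℝ → L2 strip}
    (h : TimeDerivH m T f f') (hT : 0 < T) {p : Bool}
    (hg : ∀ t ∈ Icc 0 T, Grid m (extD p (f t))) {t : ℝ} (ht : t ∈ Icc 0 T) {v : List (Fin 2)}
    (hv : v.length ≤ m) :
    HasDerivWithinAt (fun s => dw v (dbl.ext p (f s))) (dw v (dbl.ext p (f' t))) (Icc 0 T) t := by
  have hc : v.count 0 + v.count 1 ≤ m := by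
    have : ∀ v : List (Fin 2), v.count 0 + v.count 1 = v.length := fun v => by
      induction v with
      | nil => rfl
      | cons i v ih =>
        rcases eq_or_ne i 0 with rfl | hi
        · simp; omega
        · obtain rfl : i = 1 := by omega
          simp; omega
    rwa [this]
  have e : ∀ g : L2 strip, Grid m (extD p g) →
      dw v (dbl.ext p g) = extD p g (v.count 0) (v.count 1) := fun g hg => by
    rw [← extD_zero_zero, hg.dw_eq hv]
  rw [e _ (h.grid_extD hT hg ht)]
  have h1 : HasDerivWithinAt (fun s => extD p (f s) (v.count 0) (v.count 1))
      (extD p (f' t) (v.count 0) (v.count 1)) (Icc 0 T) t :=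
    (dbl.ext (p ^^ (v.count 1).bodd)).hasFDerivAt.comp_hasDerivWithinAt t (h _ _ hc t ht)
  exact h1.congr (fun s hs => e _ (hg s hs)) (e _ (hg t ht))

/-! ### Functions of the cross-section variable -/

section Tensor

variable {S : Type*} [MeasurableSpace S] {μ : Measure S} {ν : Measure (ℝ × S)}

theorem ae_snd_of_prod (hν : ν = (volume : Measure ℝ).prod μ) {p : S → Prop} (h : ∀ᵐ y ∂μ, p y) :
    ∀ᵐ z ∂ν, p z.2 := by
  rw [hν]
  exact (Measure.quasiMeasurePreserving_snd (μ := (volume : Measure ℝ)) (ν := μ)).ae h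

variable [SFinite μ]

/-- The indicator function of `[0,1]`. -/
def cut (x : ℝ) : ℝ := (Icc (0 : ℝ) 1).indicator 1 x

theorem measurable_cut : Measurable cut := measurable_one.indicator measurableSet_Icc

theorem lintegral_cut : ∫⁻ x, ‖cut x‖ₑ ^ 2 = 1 := by
  have : ∀ x, ‖cut x‖ₑ ^ 2 = (Icc (0 : ℝ) 1).indicator 1 x := fun x => by
    by_cases hx : x ∈ Icc (0 : ℝ) 1 <;> simp [cut, hx]
  simp only [this]
  rw [lintegral_indicator_one measurableSet_Icc]
  simp

theorem lintegral_cut_mul (hν : ν = (volume : Measure ℝ).prod μ) {f : S → ℝ}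
    (hf : AEStronglyMeasurable f μ) :
    ∫⁻ z, ‖cut z.1 * f z.2‖ₑ ^ 2 ∂ν = ∫⁻ y, ‖f y‖ₑ ^ 2 ∂μ := by
  simp only [enorm_mul, mul_pow]
  rw [hν, lintegral_prod_mul (measurable_cut.enorm.pow_const 2).aemeasurable
    (hf.enorm.pow_const 2), lintegral_cut, one_mul]

theorem memLp_cut_mul (hν : ν = (volume : Measure ℝ).prod μ) (f : Lp ℝ 2 μ) :
    MemLp (fun z : ℝ × S => cut z.1 * f z.2) 2 ν := by
  have hm : AEStronglyMeasurable (fun z : ℝ × S => cut z.1 * f z.2) ν := by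
    refine (measurable_cut.comp measurable_fst).aestronglyMeasurable.mul ?_
    rw [hν]
    exact (Lp.aestronglyMeasurable f).comp_snd
  refine ⟨hm, (eLpNorm_lt_top_iff_lintegral_rpow_enorm_lt_top two_ne_zero
    ENNReal.ofNat_ne_top).2 ?_⟩
  have e : ∀ z : ℝ × S, ‖cut z.1 * f z.2‖ₑ ^ (2 : ENNReal).toReal = ‖cut z.1 * f z.2‖ₑ ^ 2 :=
    fun z => by simp
  simp only [e]
  rw [lintegral_cut_mul hν (Lp.aestronglyMeasurable f), ← ofReal_norm_sq]
  exact ENNReal.ofReal_lt_top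

/-- A function of the cross-section variable, cut off in the other variable. -/
def tens (hν : ν = (volume : Measure ℝ).prod μ) : Lp ℝ 2 μ →L[ℝ] Lp ℝ 2 ν :=
  LinearMap.mkContinuous
    { toFun := fun f => (memLp_cut_mul hν f).toLp
      map_add' := fun f g => by
        refine Lp.ext ?_
        filter_upwards [(memLp_cut_mul hν (f + g)).coeFn_toLp, (memLp_cut_mul hν f).coeFn_toLp,
          (memLp_cut_mul hν g).coeFn_toLp, ae_snd_of_prod hν (Lp.coeFn_add f g),
          Lp.coeFn_add (memLp_cut_mul hν f).toLp (memLp_cut_mul hν g).toLp] with z h1 h2 h3 h4 h5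
        rw [h1, h5, Pi.add_apply, h2, h3, h4, Pi.add_apply, mul_add]
      map_smul' := fun c f => by
        refine Lp.ext ?_
        filter_upwards [(memLp_cut_mul hν (c • f)).coeFn_toLp, (memLp_cut_mul hν f).coeFn_toLp,
          ae_snd_of_prod hν (Lp.coeFn_smul c f),
          Lp.coeFn_smul c (memLp_cut_mul hν f).toLp] with z h1 h2 h3 h4
        simp only [RingHom.id_apply]
        rw [h1, h4, Pi.smul_apply, h2, h3, Pi.smul_apply, smul_eq_mul, smul_eq_mul]
        ring } 1 fun f => by
      refine le_of_sq_le_sq ?_ (by positivity)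
      rw [one_mul]
      refine (ENNReal.ofReal_le_ofReal_iff (by positivity)).1 ?_
      rw [ofReal_norm_sq, ofReal_norm_sq, ← lintegral_cut_mul hν (Lp.aestronglyMeasurable f)]
      refine (lintegral_congr_ae ?_).le
      filter_upwards [(memLp_cut_mul hν f).coeFn_toLp] with z hz
      exact congrArg (fun r => ‖r‖ₑ ^ 2) hz

theorem tens_ae (hν : ν = (volume : Measure ℝ).prod μ) (f : Lp ℝ 2 μ) :
    (tens hν f : ℝ × S → ℝ) =ᵐ[ν] fun z => cut z.1 * f z.2 := (memLp_cut_mul hν f).coeFn_toLp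

theorem norm_tens (hν : ν = (volume : Measure ℝ).prod μ) (f : Lp ℝ 2 μ) : ‖tens hν f‖ = ‖f‖ := by
  have h : ENNReal.ofReal (‖tens hν f‖ ^ 2) = ENNReal.ofReal (‖f‖ ^ 2) := by
    rw [ofReal_norm_sq, ofReal_norm_sq, ← lintegral_cut_mul hν (Lp.aestronglyMeasurable f)]
    refine lintegral_congr_ae ?_
    filter_upwards [tens_ae hν f] with z hz
    exact congrArg (fun r => ‖r‖ₑ ^ 2) hz
  have := (ENNReal.ofReal_eq_ofReal_iff (by positivity) (by positivity)).1 h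
  exact (pow_left_inj₀ (norm_nonneg _) (norm_nonneg _) two_ne_zero).1 this

end Tensor

/-- The cut-off of a function of the cross-section variable, on the cylinder. -/
def tensC : LT →L[ℝ] LG := tens (Measure.volume_eq_prod ℝ Circ)

/-- The cut-off of a function of the cross-section variable, on the strip. -/
def tensI : L2 unitI →L[ℝ] L2 strip := tens volume_restrict_strip

theorem tensC_sh (t : ℝ) (f : LT) : tensC (sh 1 t f) = sh 1 t (tensC f) := by
  refine Lp.ext ?_
  have h1 := (measurePreserving_add_left (volume : Measure Cyl)
    (toCyl (t • dir 1))).quasiMeasurePreserving.ae_eq_comp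
      (tens_ae (Measure.volume_eq_prod ℝ Circ) f)
  filter_upwards [tens_ae (Measure.volume_eq_prod ℝ Circ) (sh 1 t f), ae_snd (sh_ae_circ 1 t f),
    sh_ae_cyl 1 t (tensC f), h1] with z a1 a2 a3 a4
  have a4' : tensC f (toCyl (t • dir 1) + z)
      = cut (toCyl (t • dir 1) + z).1 * f (toCyl (t • dir 1) + z).2 := a4
  rw [a3, a4']
  refine a1.trans ?_
  rw [a2]
  simp [toCyl_apply, toCirc_apply, dir]

theorem tensC_ext (p : Bool) (f : L2 unitI) : tensC (dblC.ext p f) = dbl.ext p (tensI f) := by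
  refine Lp.ext ?_
  filter_upwards [tens_ae (Measure.volume_eq_prod ℝ Circ) (dblC.ext p f), ae_snd (dblC.ext_ae p f),
    dbl.ext_ae p (tensI f), dbl.ae_fold (tens_ae volume_restrict_strip f)] with z a1 a2 a3 a4
  have a4' : tensI f (dbl.fold z) = cut z.1 * f (foldC z.2) := a4
  rw [a3, a4']
  refine a1.trans ?_
  rw [a2]
  have : dbl.sg p z = dblC.sg p z.2 := by cases p <;> rfl
  rw [this]
  change cut z.1 * (dblC.sg p z.2 * f (foldC z.2)) = _
  ring

theorem hasD_of_tensC {f g : LT} (h : HasD 1 (tensC f) (tensC g)) : HasD 1 f g :=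
  HasD.of_map tensC one_ne_zero (fun f => by rw [one_mul]; exact norm_tens _ f) tensC_sh h

theorem integral_tensI_mul (f : L2 unitI) {θ : ℝ × ℝ → ℝ}
    (hi : Integrable (fun z => tensI f z * θ z) (volume.restrict strip)) :
    ∫ z in strip, tensI f z * θ z = ∫ x, cut x * ∫ y in unitI, f y * θ (x, y) := by
  have h1 : (fun z => tensI f z * θ z) =ᵐ[volume.restrict strip]
      fun z => cut z.1 * (f z.2 * θ z) := by
    filter_upwards [tens_ae volume_restrict_strip f] with z hz
    have : tensI f z = cut z.1 * f z.2 := hz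
    rw [this, mul_assoc]
  rw [integral_congr_ae h1]
  have h2 := hi.congr h1
  rw [volume_restrict_strip] at h2
  rw [volume_restrict_strip, integral_prod _ h2]
  simp only [integral_const_mul]

theorem fderiv_slice {φ : ℝ × ℝ → ℝ} (h : ContDiff ℝ ∞ φ) (x y : ℝ) :
    fderiv ℝ (fun y => φ (x, y)) y 1 = fderiv ℝ φ (x, y) (0, 1) := by
  have h1 : HasFDerivAt (fun y : ℝ => (x, y)) (ContinuousLinearMap.inr ℝ ℝ ℝ) y :=
    (hasFDerivAt_prodMk_right x y)
  have h2 : HasFDerivAt (fun y => φ (x, y)) _ y :=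
    (h.differentiable (by norm_num) (x, y)).hasFDerivAt.comp y h1
  rw [h2.fderiv]
  simp

theorem integral_tensI_eq_neg {f g : L2 unitI} {φ : ℝ × ℝ → ℝ} (hφ : ContDiff ℝ ∞ φ) {R : ℝ}
    (hR : ∀ x y, R < |x| → φ (x, y) = 0)
    (h : ∀ x, ∫ y in unitI, f y * fderiv ℝ (fun y => φ (x, y)) y 1
      = -∫ y in unitI, g y * φ (x, y)) :
    ∫ z in strip, tensI f z * fderiv ℝ φ z (0, 1) = -∫ z in strip, tensI g z * φ z := by
  change ∫ z in strip, tensI f z * pd 1 φ z = _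
  rw [integral_tensI_mul f (integrable_mul_of_supp _ (contDiff_pd hφ 1).continuous (pd_supp hR 1)),
    integral_tensI_mul g (integrable_mul_of_supp _ hφ.continuous hR), ← integral_neg]
  refine integral_congr_ae (Eventually.of_forall fun x => ?_)
  have := h x
  simp only [fderiv_slice hφ] at this
  simp only [pd, dir, one_ne_zero, if_false, this, mul_neg, Fin.isValue]

theorem isTest_slice {U : Set ℝ} {φ : ℝ × ℝ → ℝ} (h : IsTest (univ ×ˢ U) φ) (x : ℝ) :
    IsTest U fun y => φ (x, y) := by
  have hsub : tsupport (fun y => φ (x, y)) ⊆ (fun y => (x, y)) ⁻¹' tsupport φ :=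
    closure_minimal (fun y hy => subset_tsupport φ hy)
      ((isClosed_tsupport φ).preimage (by fun_prop))
  refine ⟨h.1.comp (contDiff_const.prodMk contDiff_id), ?_, fun y hy => (h.2.2 (hsub hy)).2⟩
  have hK : IsCompact (Prod.snd '' tsupport φ) := h.2.1.image continuous_snd
  exact hK.of_isClosed_subset (isClosed_tsupport _) fun y hy => ⟨_, hsub hy, rfl⟩

theorem hasWeakDeriv_tensI {f g : L2 unitI} (h : HasWeakDeriv unitI 1 f g) :
    HasWeakDeriv strip (0, 1) (tensI f) (tensI g) := fun φ hφ => by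
  obtain ⟨R, hR⟩ := hφ.exists_supp
  exact integral_tensI_eq_neg hφ.1 hR fun x => h _ (isTest_slice hφ x)

theorem isOpen_unitI : IsOpen unitI := isOpen_Ioo

theorem hasWeakDeriv_of_traceZero {E : Type*} [NormedAddCommGroup E] [NormedSpace ℝ E]
    [MeasureSpace E] {U : Set E} {v : E} {f : L2 U} (h : TraceZero v f) :
    HasWeakDeriv U v f (wderiv v f) := fun φ hφ => h φ ⟨hφ.1, hφ.2.1, subset_univ _⟩

theorem traceZero_tensI {f : L2 unitI} (h : TraceZero (1 : ℝ) f) :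
    TraceZero ((0, 1) : ℝ × ℝ) (tensI f) ∧ dy (tensI f) = tensI (wderiv 1 f) := by
  have e : dy (tensI f) = tensI (wderiv 1 f) :=
    wderiv_eq isOpen_strip (hasWeakDeriv_tensI (hasWeakDeriv_of_traceZero h))
  refine ⟨fun φ hφ => ?_, e⟩
  rw [show wderiv ((0, 1) : ℝ × ℝ) (tensI f) = tensI (wderiv 1 f) from e]
  obtain ⟨R, hR⟩ := hφ.exists_supp
  have hφ' : IsTest (univ ×ˢ univ) φ := ⟨hφ.1, hφ.2.1, by rw [univ_prod_univ]; exact hφ.2.2⟩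
  exact integral_tensI_eq_neg hφ.1 hR fun x => h _ (isTest_slice hφ' x)

/-- The reflections of the derivatives of an even function on the interval; derivatives along the
strip vanish. -/
def extD1 (f : L2 unitI) (a b : ℕ) : LT := if a = 0 then dblC.ext b.bodd (D1 b f) else 0

theorem extD1_zero_zero (f : L2 unitI) : extD1 f 0 0 = dblC.ext false f := by
  simp [extD1, D1]

theorem D1_succ (j : ℕ) (f : L2 unitI) : D1 (j + 1) f = wderiv 1 (D1 j f) :=
  Function.iterate_succ_apply' _ _ _

theorem MemY1.grid_extD1 {m : ℕ} {f : L2 unitI} (h : MemY1 m f) : Grid m (extD1 f) := by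
  refine ⟨fun a b _ => ?_, fun b hb => ?_⟩
  · rw [show extD1 f (a + 1) b = 0 from if_neg (Nat.succ_ne_zero a)]
    exact hasD_zero_circ _
  · rw [extD1, extD1, if_pos rfl, if_pos rfl, D1_succ, Nat.bodd_succ]
    refine hasD_of_tensC ?_
    rw [tensC_ext, tensC_ext]
    cases hp : b.bodd
    · obtain ⟨g, hg⟩ := h.1 b hb
      rw [wderiv_eq isOpen_unitI hg]
      exact hasD_ext_even (hasWeakDeriv_tensI hg)
    · obtain ⟨n, rfl⟩ : ∃ n, b = 2 * n + 1 := by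
        refine ⟨b.div2, ?_⟩
        have := Nat.bodd_add_div2 b
        rw [hp] at this
        simp at this
        omega
      have ht := traceZero_tensI (h.2 n hb)
      rw [← ht.2]
      exact hasD_ext_odd ht.1

theorem norm_D1_le_HNorm1 {m j : ℕ} (hj : j ≤ m) (f : L2 unitI) : ‖D1 j f‖ ≤ HNorm1 m f :=
  Real.le_sqrt_of_sq_le (Finset.single_le_sum (f := fun j => ‖D1 j f‖ ^ 2)
    (fun _ _ => by positivity) (Finset.mem_range.2 (by omega : j < m + 1)))

theorem N_ext_circ_le {m : ℕ} {f : L2 unitI} (h : Grid m (extD1 f)) :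
    N m (dblC.ext false f) ≤ 2 ^ (m + 2) * HNorm1 m f := by
  have h0 : 0 ≤ HNorm1 m f := Real.sqrt_nonneg _
  have h1 := h.N_le (B := 2 * HNorm1 m f) fun a b hab => by
    rw [extD1]
    split_ifs
    · rw [dblC.norm_ext]
      exact mul_le_mul (Real.sqrt_le_iff.2 ⟨by norm_num, by norm_num⟩)
        (norm_D1_le_HNorm1 (by omega) f) (norm_nonneg _) (by norm_num)
    · rw [norm_zero]; positivity
  rw [extD1_zero_zero] at h1
  refine h1.trans ?_
  rw [show (2 : ℝ) ^ (m + 2) * HNorm1 m f = 2 ^ (m + 1) * (2 * HNorm1 m f) by ring]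
  exact mul_le_mul_of_nonneg_right (by linarith) (by positivity)

theorem ContH1.convH_ext {m : ℕ} {T : ℝ} {f : ℝ → L2 unitI} (h : ContH1 m T f)
    (hg : ∀ t ∈ Icc 0 T, Grid m (extD1 (f t))) {t : ℝ} (ht : t ∈ Icc 0 T) :
    ConvH m (fun s => dblC.ext false (f s)) (𝓝[Icc 0 T] t) (dblC.ext false (f t)) := by
  have := Grid.convH (l := 𝓝[Icc 0 T] t) (F := fun s => extD1 (f s))
    (eventually_mem_nhdsWithin.mono fun s hs => hg s hs) (hg t ht) fun a b hab => by
      simp only [extD1]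
      split_ifs
      · exact ((dblC.ext b.bodd).continuous.tendsto _).comp (h.2 b (by omega) t ht)
      · exact tendsto_const_nhds
  simpa only [extD1_zero_zero] using this

/-! ### The Elsässer variables of a solution -/

section Grid

variable {E : Type*} [NormedAddCommGroup E] [NormedSpace ℝ E] [Shift E]
  {m : ℕ} {F : ℕ → ℕ → E}

theorem Grid.der_zero (h : Grid m F) {a b : ℕ} (hab : a + b < m) : der 0 (F a b) = F (a + 1) b :=
  (h.zero a b hab).der_eq

theorem Grid.der_one [CompleteSpace E] (h : Grid m F) {a b : ℕ} (hab : a + b < m) : der 1 (F a b) = F a (b + 1) :=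
  (h.one a b hab).der_eq

end Grid

/-- The components of the reflected velocity. -/
def vel (u₁ u₂ : L2 strip) (c : Fin 2) : LG := if c = 0 then dbl.ext false u₁ else dbl.ext true u₂

/-- The components of the reflected magnetic perturbation `∇^⊥ρ`. -/
def mag (ρ : L2 strip) (c : Fin 2) : LG :=
  if c = 0 then der 1 (dbl.ext false ρ) else -der 0 (dbl.ext false ρ)

/-- The components of the reflected Elsässer variables `u ± ∇^⊥ρ`. -/
def els (u₁ u₂ ρ : L2 strip) (s : Bool × Fin 2) : LG := vel u₁ u₂ s.2 + sgn s.1 • mag ρ s.2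

/-- The reflected Elsässer variables `Ψ ± ∂_yΦ̄` of the background. -/
def bgEls (Φ Ψ : L2 unitI) (σ : Bool) : LT :=
  dblC.ext false Ψ + sgn σ • der 1 (dblC.ext false Φ)

theorem abs_sgn (σ : Bool) : |sgn σ| = 1 := by cases σ <;> simp [sgn]

theorem Grid.hm_ext {m : ℕ} {p : Bool} {f : L2 strip} (h : Grid m (extD p f)) :
    Hm m (dbl.ext p f) := extD_zero_zero p f ▸ h.hm

theorem Grid.hm_ext1 {m : ℕ} {f : L2 unitI} (h : Grid m (extD1 f)) :
    Hm m (dblC.ext false f) := extD1_zero_zero f ▸ h.hm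

section Els

variable {m : ℕ} {u₁ u₂ ρ : L2 strip} {Φ Ψ : L2 unitI}

theorem hm_vel (h₁ : Grid m (extD false u₁)) (h₂ : Grid m (extD true u₂)) (c : Fin 2) :
    Hm m (vel u₁ u₂ c) := by
  unfold vel
  split_ifs
  · exact h₁.hm_ext
  · exact h₂.hm_ext

theorem hm_mag (h : Grid (m + 1) (extD false ρ)) (c : Fin 2) : Hm m (mag ρ c) := by
  unfold mag
  split_ifs
  · exact h.hm_ext.der 1
  · exact (h.hm_ext.der 0).neg

theorem hm_els (h₁ : Grid m (extD false u₁)) (h₂ : Grid m (extD true u₂))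
    (h : Grid (m + 1) (extD false ρ)) (s : Bool × Fin 2) : Hm m (els u₁ u₂ ρ s) :=
  (hm_vel h₁ h₂ _).add ((hm_mag h _).smul _)

theorem N_vel_le (h₁ : Grid m (extD false u₁)) (h₂ : Grid m (extD true u₂)) (c : Fin 2) :
    N m (vel u₁ u₂ c) ≤ 2 ^ (m + 2) * (HNorm m u₁ + HNorm m u₂) := by
  have a1 : 0 ≤ 2 ^ (m + 2) * HNorm m u₁ := mul_nonneg (by positivity) (Real.sqrt_nonneg _)
  have a2 : 0 ≤ 2 ^ (m + 2) * HNorm m u₂ := mul_nonneg (by positivity) (Real.sqrt_nonneg _)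
  have b1 := N_ext_le h₁
  have b2 := N_ext_le h₂
  unfold vel
  split_ifs <;> linarith

theorem N_mag_le (h : Grid (m + 1) (extD false ρ)) (c : Fin 2) :
    N m (mag ρ c) ≤ 2 ^ (m + 3) * HNorm (m + 1) ρ := by
  have b := N_ext_le h
  have b0 := N_der_le m (dbl.ext false ρ) 0
  have b1 := N_der_le m (dbl.ext false ρ) 1
  unfold mag
  split_ifs
  · exact b1.trans b
  · rw [N_neg (h.hm_ext.der 0)]; exact b0.trans b

theorem N_els_le (h₁ : Grid m (extD false u₁)) (h₂ : Grid m (extD true u₂))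
    (h : Grid (m + 1) (extD false ρ)) (s : Bool × Fin 2) :
    N m (els u₁ u₂ ρ s) ≤ 2 ^ (m + 3) * (HNorm m u₁ + HNorm m u₂ + HNorm (m + 1) ρ) := by
  have a1 : 0 ≤ 2 ^ (m + 2) * (HNorm m u₁ + HNorm m u₂) :=
    mul_nonneg (by positivity) (add_nonneg (Real.sqrt_nonneg _) (Real.sqrt_nonneg _))
  have b := N_add_le (hm_vel h₁ h₂ s.2) ((hm_mag h s.2).smul (sgn s.1))
  rw [N_smul _ (hm_mag h s.2), abs_sgn, one_mul] at b
  have b1 := N_vel_le h₁ h₂ s.2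
  have b2 := N_mag_le h s.2
  have e : (2 : ℝ) ^ (m + 3) * (HNorm m u₁ + HNorm m u₂ + HNorm (m + 1) ρ)
      = 2 * (2 ^ (m + 2) * (HNorm m u₁ + HNorm m u₂)) + 2 ^ (m + 3) * HNorm (m + 1) ρ := by ring
  rw [e]
  exact b.trans (by linarith)

theorem N_bgEls_le (hΦ : Grid (m + 1) (extD1 Φ)) (hΨ : Grid (m + 1) (extD1 Ψ)) (σ : Bool) :
    N m (bgEls Φ Ψ σ) ≤ 2 ^ (m + 3) * (HNorm1 (m + 1) Φ + HNorm1 (m + 1) Ψ) := by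
  have b := N_add_le (hΨ.hm_ext1.mono (Nat.le_succ m)) ((hΦ.hm_ext1.der 1).smul (sgn σ))
  rw [N_smul _ (hΦ.hm_ext1.der 1), abs_sgn, one_mul] at b
  have b1 := (N_mono (Nat.le_add_right m 1) _).trans (N_ext_circ_le hΨ)
  have b2 := (N_der_le m (dblC.ext false Φ) 1).trans (N_ext_circ_le hΦ)
  rw [mul_add]
  exact b.trans (by linarith)

end Els

section Solution

variable {F : Flow} {k : ℕ} {κ C₀ T t : ℝ}

namespace Flow.IsSolution

theorem grid_u₁ (h : F.IsSolution k κ C₀ T) (ht : t ∈ Icc 0 T) :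
    Grid (k + 1) (extD false (F.u₁ t)) := (h.bdry_u₁ t ht).grid_extD

theorem grid_u₂ (h : F.IsSolution k κ C₀ T) (ht : t ∈ Icc 0 T) :
    Grid (k + 1) (extD true (F.u₂ t)) := (h.bdry_u₂ t ht).grid_extD

theorem grid_ρ (h : F.IsSolution k κ C₀ T) (ht : t ∈ Icc 0 T) :
    Grid (k + 2) (extD false (F.ρ t)) := (h.bdry_ρ t ht).grid_extD

theorem grid_ut₁ (h : F.IsSolution k κ C₀ T) (hT : 0 < T) (ht : t ∈ Icc 0 T) :
    Grid k (extD false (F.ut₁ t)) :=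
  h.deriv_u₁.grid_extD hT (fun _ hs => (h.grid_u₁ hs).mono (Nat.le_succ k)) ht

theorem grid_ut₂ (h : F.IsSolution k κ C₀ T) (hT : 0 < T) (ht : t ∈ Icc 0 T) :
    Grid k (extD true (F.ut₂ t)) :=
  h.deriv_u₂.grid_extD hT (fun _ hs => (h.grid_u₂ hs).mono (Nat.le_succ k)) ht

theorem grid_ρt (h : F.IsSolution k κ C₀ T) (hT : 0 < T) (ht : t ∈ Icc 0 T) :
    Grid (k + 1) (extD false (F.ρt t)) :=
  h.deriv_ρ.grid_extD hT (fun _ hs => (h.grid_ρ hs).mono (Nat.le_succ (k + 1))) ht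

theorem grid_Φ (h : F.IsSolution k κ C₀ T) (ht : t ∈ Icc 0 T) :
    Grid (k + 3) (extD1 (F.Φ t)) := (h.background.bdryΦ t ht).grid_extD1

theorem grid_Ψ (h : F.IsSolution k κ C₀ T) (ht : t ∈ Icc 0 T) :
    Grid (k + 3) (extD1 (F.Ψ t)) := (h.background.bdryΨ t ht).grid_extD1

theorem convH_els (h : F.IsSolution k κ C₀ T) (s : Bool × Fin 2) (ht : t ∈ Icc 0 T) :
    ConvH (k + 1) (fun t => els (F.u₁ t) (F.u₂ t) (F.ρ t) s) (𝓝[Icc 0 T] t)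
      (els (F.u₁ t) (F.u₂ t) (F.ρ t) s) := by
  have h1 := h.cont_u₁.convH_ext (fun s hs => h.grid_u₁ hs) ht
  have h2 := h.cont_u₂.convH_ext (fun s hs => h.grid_u₂ hs) ht
  have h3 := h.cont_ρ.convH_ext (fun s hs => h.grid_ρ hs) ht
  unfold els vel mag
  refine ConvH.add ?_ (ConvH.smul _ ?_)
  · split_ifs
    · exact h1
    · exact h2
  · split_ifs
    · exact h3.der 1
    · exact (h3.der 0).neg

theorem convH_els_time (h : F.IsSolution k κ C₀ T) (hT : 0 < T) (s : Bool × Fin 2)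
    (ht : t ∈ Icc 0 T) :
    ConvH k (fun t => els (F.ut₁ t) (F.ut₂ t) (F.ρt t) s) (𝓝[Icc 0 T] t)
      (els (F.ut₁ t) (F.ut₂ t) (F.ρt t) s) := by
  have h1 := h.cont_ut₁.convH_ext (fun s hs => h.grid_ut₁ hT hs) ht
  have h2 := h.cont_ut₂.convH_ext (fun s hs => h.grid_ut₂ hT hs) ht
  have h3 := h.cont_ρt.convH_ext (fun s hs => h.grid_ρt hT hs) ht
  unfold els vel mag
  refine ConvH.add ?_ (ConvH.smul _ ?_)
  · split_ifs
    · exact h1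
    · exact h2
  · split_ifs
    · exact h3.der 1
    · exact (h3.der 0).neg

theorem hasDerivWithinAt_els (h : F.IsSolution k κ C₀ T) (hT : 0 < T) (s : Bool × Fin 2)
    {v : List (Fin 2)} (hv : v.length ≤ k) (ht : t ∈ Icc 0 T) :
    HasDerivWithinAt (fun t => dw v (els (F.u₁ t) (F.u₂ t) (F.ρ t) s))
      (dw v (els (F.ut₁ t) (F.ut₂ t) (F.ρt t) s)) (Icc 0 T) t := by
  have h1 := h.deriv_u₁.hasDerivWithinAt_dw hT
    (fun s hs => (h.grid_u₁ hs).mono (Nat.le_succ k)) ht hv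
  have h2 := h.deriv_u₂.hasDerivWithinAt_dw hT
    (fun s hs => (h.grid_u₂ hs).mono (Nat.le_succ k)) ht hv
  have h3 : ∀ i, HasDerivWithinAt (fun t => dw v (der i (dbl.ext false (F.ρ t))))
      (dw v (der i (dbl.ext false (F.ρt t)))) (Icc 0 T) t := fun i => by
    have := h.deriv_ρ.hasDerivWithinAt_dw hT
      (fun s hs => (h.grid_ρ hs).mono (Nat.le_succ (k + 1))) ht (v := v ++ [i])
      (by rw [List.length_append]; simpa using hv)
    simpa only [dw_append, dw] using this
  have hvel : HasDerivWithinAt (fun t => dw v (vel (F.u₁ t) (F.u₂ t) s.2))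
      (dw v (vel (F.ut₁ t) (F.ut₂ t) s.2)) (Icc 0 T) t := by
    unfold vel
    split_ifs
    · exact h1
    · exact h2
  have hmag : HasDerivWithinAt (fun t => dw v (mag (F.ρ t) s.2))
      (dw v (mag (F.ρt t) s.2)) (Icc 0 T) t := by
    unfold mag
    split_ifs
    · exact h3 1
    · rw [dw_neg (((h.grid_ρt hT ht).hm_ext.der 0).mono hv)]
      exact (h3 0).fun_neg.congr
        (fun s hs => dw_neg (((h.grid_ρ hs).hm_ext.der 0).mono (by omega)))
        (dw_neg (((h.grid_ρ ht).hm_ext.der 0).mono (by omega)))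
  have e : ∀ u₁ u₂ ρ : L2 strip, Grid k (extD false u₁) → Grid k (extD true u₂) →
      Grid (k + 1) (extD false ρ) → dw v (els u₁ u₂ ρ s)
        = dw v (vel u₁ u₂ s.2) + sgn s.1 • dw v (mag ρ s.2) := fun u₁ u₂ ρ g1 g2 g3 => by
    rw [els, dw_add ((hm_vel g1 g2 _).mono hv) (((hm_mag g3 _).smul _).mono hv),
      dw_smul _ ((hm_mag g3 _).mono hv)]
  have es : ∀ s ∈ Icc 0 T, _ := fun s hs => e (F.u₁ s) (F.u₂ s) (F.ρ s)
    ((h.grid_u₁ hs).mono (by omega)) ((h.grid_u₂ hs).mono (by omega))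
    ((h.grid_ρ hs).mono (by omega))
  rw [e _ _ _ (h.grid_ut₁ hT ht) (h.grid_ut₂ hT ht) (h.grid_ρt hT ht)]
  exact (hvel.fun_add (hmag.fun_const_smul (sgn s.1))).congr es (es t ht)

theorem convH_bgEls (h : F.IsSolution k κ C₀ T) (σ : Bool) (ht : t ∈ Icc 0 T) :
    ConvH (k + 2) (fun t => bgEls (F.Φ t) (F.Ψ t) σ) (𝓝[Icc 0 T] t)
      (bgEls (F.Φ t) (F.Ψ t) σ) := by
  have h1 := h.background.contΦ.convH_ext (fun s hs => h.grid_Φ hs) ht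
  have h2 := h.background.contΨ.convH_ext (fun s hs => h.grid_Ψ hs) ht
  exact (h2.mono (by omega)).add ((h1.der 1).smul _)

theorem convH_slope (h : F.IsSolution k κ C₀ T) (hk : 4 ≤ k) (hT : 0 < T) (ht : t ∈ Icc 0 T) :
    ConvH 2 (fun s => (s - t)⁻¹ • (der 0 (dbl.ext false (F.ρ s)) - der 0 (dbl.ext false (F.ρ t))))
      (𝓝[Icc 0 T \ {t}] t) (der 0 (dbl.ext false (F.ρt t))) := by
  have hg : ∀ s ∈ Icc 0 T, Grid 3 (extD false (F.ρ s)) := fun s hs =>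
    (h.grid_ρ hs).mono (by omega)
  have h1 : ConvH 3 (fun s => (s - t)⁻¹ • (dbl.ext false (F.ρ s) - dbl.ext false (F.ρ t)))
      (𝓝[Icc 0 T \ {t}] t) (dbl.ext false (F.ρt t)) := by
    have := Grid.convH (l := 𝓝[Icc 0 T \ {t}] t)
      (F := fun s a b => (s - t)⁻¹ • (extD false (F.ρ s) a b - extD false (F.ρ t) a b))
      (eventually_mem_nhdsWithin.mono fun s hs => ((hg s hs.1).sub (hg t ht)).smul _)
      ((h.grid_ρt hT ht).mono (by omega : 3 ≤ k + 1)) fun a b hab => by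
        have h2 : HasDerivWithinAt (fun s => extD false (F.ρ s) a b) (extD false (F.ρt t) a b)
            (Icc 0 T) t :=
          (dbl.ext (false ^^ b.bodd)).hasFDerivAt.comp_hasDerivWithinAt t
            (h.deriv_ρ a b (by omega) t ht)
        exact (hasDerivWithinAt_iff_tendsto_slope.1 h2).congr fun r => by rw [slope_def_module]
    simpa only [extD_zero_zero] using this
  refine (h1.der 0).congr' ?_
  filter_upwards [self_mem_nhdsWithin] with s hs
  exact ((((hg s hs.1).hm_ext.hasD 0).sub ((hg t ht).hm_ext.hasD 0)).const_smul _).der_eq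

theorem der_vel (h : F.IsSolution k κ C₀ T) (ht : t ∈ Icc 0 T) :
    der 0 (dbl.ext false (F.u₁ t)) + der 1 (dbl.ext true (F.u₂ t)) = 0 := by
  have h1 := (h.grid_u₁ ht).der_zero (a := 0) (b := 0) (by omega)
  have h2 := (h.grid_u₂ ht).der_one (a := 0) (b := 0) (by omega)
  rw [extD_zero_zero] at h1 h2
  rw [h1, h2]
  have : extD false (F.u₁ t) 1 0 + extD true (F.u₂ t) 0 1
      = dbl.ext false (dx (F.u₁ t) + dy (F.u₂ t)) := by
    rw [map_add]; rfl
  rw [this, h.div_free t ht, map_zero]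

theorem div_els (h : F.IsSolution k κ C₀ T) (σ : Bool) (ht : t ∈ Icc 0 T) :
    ∑ c, der c (els (F.u₁ t) (F.u₂ t) (F.ρ t) (σ, c)) = 0 := by
  have hu₁ := (h.grid_u₁ ht).hm_ext.mono (by omega : 1 ≤ k + 1)
  have hu₂ := (h.grid_u₂ ht).hm_ext.mono (by omega : 1 ≤ k + 1)
  have hρ := (h.grid_ρ ht).hm_ext.mono (by omega : 2 ≤ k + 2)
  simp only [Fin.sum_univ_two, els, vel, mag, if_true, one_ne_zero, if_false, Fin.isValue]
  rw [der_add hu₁ ((hρ.der 1).smul _), der_add hu₂ ((hρ.der 0).neg.smul _), der_smul _ (hρ.der 1),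
    der_smul _ (hρ.der 0).neg, der_neg (hρ.der 0), der_comm hρ 0 1]
  have := h.der_vel ht
  rw [smul_neg, show ∀ a b c : LG, a + c + (b + -c) = a + b from fun a b c => by abel, this]

end Flow.IsSolution

end Solution

/-! ### The equations on the cylinder -/

section Pointwise

variable {f g : LG} {φ ψ : Cyl → ℝ}

theorem ae_add (hf : f =ᵐ[volume] φ) (hg : g =ᵐ[volume] ψ) :
    ((f + g : LG) : Cyl → ℝ) =ᵐ[volume] fun z => φ z + ψ z := by
  filter_upwards [Lp.coeFn_add f g, hf, hg] with z h1 h2 h3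
  rw [h1, Pi.add_apply, h2, h3]

theorem ae_neg (hf : f =ᵐ[volume] φ) : ((-f : LG) : Cyl → ℝ) =ᵐ[volume] fun z => -φ z := by
  filter_upwards [Lp.coeFn_neg f, hf] with z h1 h2
  rw [h1, Pi.neg_apply, h2]

theorem ae_smul (c : ℝ) (hf : f =ᵐ[volume] φ) :
    ((c • f : LG) : Cyl → ℝ) =ᵐ[volume] fun z => c * φ z := by
  filter_upwards [Lp.coeFn_smul c f, hf] with z h1 h2
  rw [h1, Pi.smul_apply, h2, smul_eq_mul]

theorem ae_mul {β : LT} {χ : Circ → ℝ} (hok : Ok (f, β) g) (hf : f =ᵐ[volume] φ)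
    (hβ : β =ᵐ[volume] χ) (hg : g =ᵐ[volume] ψ) :
    (mul (f, β) g : Cyl → ℝ) =ᵐ[volume] fun z => (φ z + χ z.2) * ψ z := by
  filter_upwards [coeFn_mul hok, hf, ae_snd hβ, hg] with z h1 h2 h3 h4
  rw [h1, fn, h2, h3, h4]

theorem ae_add_circ {α β : LT} {χ θ : Circ → ℝ} (hα : α =ᵐ[volume] χ) (hβ : β =ᵐ[volume] θ) :
    ((α + β : LT) : Circ → ℝ) =ᵐ[volume] fun y => χ y + θ y := by
  filter_upwards [Lp.coeFn_add α β, hα, hβ] with z h1 h2 h3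
  rw [h1, Pi.add_apply, h2, h3]

theorem ae_smul_circ (c : ℝ) {β : LT} {χ : Circ → ℝ} (hβ : β =ᵐ[volume] χ) :
    ((c • β : LT) : Circ → ℝ) =ᵐ[volume] fun y => c * χ y := by
  filter_upwards [Lp.coeFn_smul c β, hβ] with z h1 h2
  rw [h1, Pi.smul_apply, h2, smul_eq_mul]

/-- The factor `±1` of a reflection of parity `p`, at a point of the circle. -/
def par (p : Bool) (y : Circ) : ℝ := if p then signC y else 1

theorem ext_ae_cyl (p : Bool) (f : L2 strip) :
    (dbl.ext p f : Cyl → ℝ) =ᵐ[volume] fun z => par p z.2 * f (dbl.fold z) := dbl.ext_ae p f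

theorem ext_ae_circ (p : Bool) (f : L2 unitI) :
    (dblC.ext p f : Circ → ℝ) =ᵐ[volume] fun y => par p y * f (foldC y) := dblC.ext_ae p f

end Pointwise

section Equations

variable {u₁ u₂ ut₁ ut₂ ρ ρt q₁ q₂ : L2 strip} {Φ Ψ : L2 unitI} {κ C₀ : ℝ}

/-- The transport equation as an equation for reflected functions. -/
theorem ext_transport (hu₁ : Grid 4 (extD false u₁)) (hu₂ : Grid 4 (extD true u₂))
    (hρ : Grid 5 (extD false ρ)) (hΦ : Grid 5 (extD1 Φ)) (hΨ : Grid 5 (extD1 Ψ))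
    (h : ∀ᵐ z ∂(volume.restrict strip : Measure (ℝ × ℝ)),
      ρt z + u₂ z * D1 1 Φ z.2 + C₀ * u₁ z + (u₁ z * D 1 0 ρ z + u₂ z * D 0 1 ρ z)
        + Ψ z.2 * D 1 0 ρ z = 0) :
    dbl.ext false ρt = -(mul (dbl.ext false u₁, dblC.ext false Ψ) (der 0 (dbl.ext false ρ))
      + mul (der 1 (dbl.ext false ρ), der 1 (dblC.ext false Φ)) (dbl.ext true u₂)
      + C₀ • dbl.ext false u₁) := by
  have e0 := hρ.der_zero (a := 0) (b := 0) (by omega)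
  have e1 := hρ.der_one (a := 0) (b := 0) (by omega)
  have e2 := hΦ.der_one (a := 0) (b := 0) (by omega)
  rw [extD_zero_zero] at e0 e1
  rw [extD1_zero_zero] at e2
  have ok1 : Ok (dbl.ext false u₁, dblC.ext false Ψ) (der 0 (dbl.ext false ρ)) :=
    ok_of_hm (hu₁.hm_ext.prodMk (hΨ.hm_ext1.mono (by omega))) (hρ.hm_ext.der 0) (by omega)
  have ok2 : Ok (der 1 (dbl.ext false ρ), der 1 (dblC.ext false Φ)) (dbl.ext true u₂) :=
    ok_of_hm ((hρ.hm_ext.der 1).prodMk (hΦ.hm_ext1.der 1)) hu₂.hm_ext (by omega)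
  rw [e0] at ok1 ⊢
  rw [e1, e2] at ok2 ⊢
  refine Lp.ext ((ext_ae_cyl false ρt).trans (EventuallyEq.symm ?_))
  refine (ae_neg (ae_add (ae_add (ae_mul ok1 (ext_ae_cyl _ _) (ext_ae_circ _ _) (ext_ae_cyl _ _))
    (ae_mul ok2 (ext_ae_cyl _ _) (ext_ae_circ _ _) (ext_ae_cyl _ _)))
    (ae_smul _ (ext_ae_cyl _ _)))).trans ?_
  filter_upwards [dbl.ae_fold h] with z hz
  have hz2 : (dbl.fold z).2 = foldC z.2 := rfl
  rw [hz2] at hz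
  simp only [par, Nat.bodd_succ, Nat.bodd_zero, zero_add, Bool.not_false, Bool.false_xor, if_true,
    Bool.false_eq_true, if_false, one_mul]
  rcases signC_eq z.2 with hs | hs <;> rw [hs] <;> linear_combination -hz

/-- The derivatives of the reflected transport equation. -/
theorem der_ext_transport (hu₁ : Grid 4 (extD false u₁)) (hu₂ : Grid 4 (extD true u₂))
    (hρ : Grid 5 (extD false ρ)) (hΦ : Grid 5 (extD1 Φ)) (hΨ : Grid 5 (extD1 Ψ))
    (h : dbl.ext false ρt = -(mul (dbl.ext false u₁, dblC.ext false Ψ) (der 0 (dbl.ext false ρ))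
      + mul (der 1 (dbl.ext false ρ), der 1 (dblC.ext false Φ)) (dbl.ext true u₂)
      + C₀ • dbl.ext false u₁)) (i : Fin 2) :
    der i (dbl.ext false ρt) = -((mul (der i (dbl.ext false u₁), der i (dblC.ext false Ψ))
          (der 0 (dbl.ext false ρ))
        + mul (dbl.ext false u₁, dblC.ext false Ψ) (der i (der 0 (dbl.ext false ρ))))
      + (mul (der i (der 1 (dbl.ext false ρ)), der i (der 1 (dblC.ext false Φ))) (dbl.ext true u₂)
        + mul (der 1 (dbl.ext false ρ), der 1 (dblC.ext false Φ)) (der i (dbl.ext true u₂)))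
      + C₀ • der i (dbl.ext false u₁)) := by
  have a1 := hu₁.hm_ext
  have a2 := hΨ.hm_ext1.mono (by omega : 4 ≤ 5)
  have a3 := hρ.hm_ext
  have a4 := hΦ.hm_ext1
  have a5 := hu₂.hm_ext
  have h1 := HasD.mul (a1.prodMk a2) (a3.der 0) (by omega) (by omega) (by omega) i
  have h2 := HasD.mul ((a3.der 1).prodMk (a4.der 1)) a5 (by omega) (by omega) (by omega) i
  rw [der_mk (a1.mono (by omega)) (a2.mono (by omega))] at h1
  rw [der_mk ((a3.der 1).mono (by omega)) ((a4.der 1).mono (by omega))] at h2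
  rw [h]
  exact ((h1.add h2).add ((a1.hasD i).const_smul C₀)).neg.der_eq

end Equations

/-! ### The system satisfied by the reflected solution -/

section Equations

variable {u₁ u₂ ut₁ ut₂ ρ ρt q₁ q₂ : L2 strip} {Φ Ψ : L2 unitI} {κ C₀ : ℝ}

theorem ext_zero_ae : ((0 : LG) : Cyl → ℝ) =ᵐ[volume] fun _ => 0 :=
  Lp.coeFn_zero ℝ 2 (volume : Measure Cyl)

theorem zero_circ_ae : ((0 : LT) : Circ → ℝ) =ᵐ[volume] fun _ => 0 :=
  Lp.coeFn_zero ℝ 2 (volume : Measure Circ)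

theorem der_els_zero (hu₁ : Grid 2 (extD false u₁)) (hρ : Grid 3 (extD false ρ)) (σ : Bool)
    (j : Fin 2) : der j (els u₁ u₂ ρ (σ, 0))
      = der j (dbl.ext false u₁) + sgn σ • der j (der 1 (dbl.ext false ρ)) := by
  have h1 := hu₁.hm_ext.mono (by omega : 1 ≤ 2)
  have h2 := (hρ.hm_ext.mono (by omega : 2 ≤ 3)).der 1
  rw [els, vel, mag, if_pos rfl, if_pos rfl, der_add h1 (h2.smul _), der_smul _ h2]

theorem der_els_one (hu₂ : Grid 2 (extD true u₂)) (hρ : Grid 3 (extD false ρ)) (σ : Bool)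
    (j : Fin 2) : der j (els u₁ u₂ ρ (σ, 1))
      = der j (dbl.ext true u₂) + sgn σ • -der j (der 0 (dbl.ext false ρ)) := by
  have h1 := hu₂.hm_ext.mono (by omega : 1 ≤ 2)
  have h2 := (hρ.hm_ext.mono (by omega : 2 ≤ 3)).der 0
  rw [els, vel, mag, if_neg (by simp), if_neg (by simp), der_add h1 (h2.neg.smul _),
    der_smul _ h2.neg, der_neg h2]

theorem els_zero_ae (hρ : Grid 2 (extD false ρ)) (σ : Bool) : (els u₁ u₂ ρ (σ, 0) : Cyl → ℝ)
    =ᵐ[volume] fun z => u₁ (dbl.fold z) + sgn σ * (signC z.2 * D 0 1 ρ (dbl.fold z)) := by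
  have e1 := hρ.der_one (a := 0) (b := 0) (by omega)
  rw [extD_zero_zero] at e1
  rw [els, vel, mag, if_pos rfl, if_pos rfl, e1]
  refine (ae_add (ext_ae_cyl _ _) (ae_smul _ (ext_ae_cyl _ _))).trans
    (Eventually.of_forall fun z => ?_)
  simp [par]

theorem els_one_ae (hρ : Grid 2 (extD false ρ)) (σ : Bool) : (els u₁ u₂ ρ (σ, 1) : Cyl → ℝ)
    =ᵐ[volume] fun z => signC z.2 * u₂ (dbl.fold z) + sgn σ * -D 1 0 ρ (dbl.fold z) := by
  have e0 := hρ.der_zero (a := 0) (b := 0) (by omega)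
  rw [extD_zero_zero] at e0
  rw [els, vel, mag, if_neg (by simp), if_neg (by simp), e0]
  refine (ae_add (ext_ae_cyl _ _) (ae_smul _ (ae_neg (ext_ae_cyl _ _)))).trans
    (Eventually.of_forall fun z => ?_)
  simp [par]

theorem bgEls_ae (hΦ : Grid 2 (extD1 Φ)) (σ : Bool) : (bgEls Φ Ψ σ : Circ → ℝ)
    =ᵐ[volume] fun y => Ψ (foldC y) + sgn σ * (signC y * D1 1 Φ (foldC y)) := by
  have e2 := hΦ.der_one (a := 0) (b := 0) (by omega)
  rw [extD1_zero_zero] at e2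
  rw [bgEls, e2]
  refine (ae_add_circ (ext_ae_circ _ _) (ae_smul_circ _ (ext_ae_circ _ _))).trans
    (Eventually.of_forall fun z => ?_)
  simp [par]

theorem der_bgEls_ae (hΦ : Grid 3 (extD1 Φ)) (hΨ : Grid 2 (extD1 Ψ)) (σ : Bool) :
    ((der 1 (bgEls Φ Ψ σ) : LT) : Circ → ℝ)
    =ᵐ[volume] fun y => signC y * D1 1 Ψ (foldC y) + sgn σ * D1 2 Φ (foldC y) := by
  have e1 := hΨ.der_one (a := 0) (b := 0) (by omega)
  have e2 := hΦ.der_one (a := 0) (b := 0) (by omega)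
  have e3 := hΦ.der_one (a := 0) (b := 1) (by omega)
  rw [extD1_zero_zero] at e1 e2
  have h2 := (hΦ.hm_ext1.mono (by omega : 2 ≤ 3)).der 1
  rw [bgEls, der_add (hΨ.hm_ext1.mono (by omega)) (h2.smul _), der_smul _ h2, e1, e2, e3]
  refine (ae_add_circ (ext_ae_circ _ _) (ae_smul_circ _ (ext_ae_circ _ _))).trans
    (Eventually.of_forall fun z => ?_)
  simp [par]

/-- The first component of the system in Elsässer variables: the momentum equation combined with
the derivative of the transport equation across the strip. -/
theorem els_eq_zero (hu₁ : Grid 4 (extD false u₁)) (hu₂ : Grid 4 (extD true u₂))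
    (hρ : Grid 5 (extD false ρ)) (hΦ : Grid 5 (extD1 Φ)) (hΨ : Grid 5 (extD1 Ψ))
    (h : dbl.ext false ρt = -(mul (dbl.ext false u₁, dblC.ext false Ψ) (der 0 (dbl.ext false ρ))
      + mul (der 1 (dbl.ext false ρ), der 1 (dblC.ext false Φ)) (dbl.ext true u₂)
      + C₀ • dbl.ext false u₁))
    (hdiv : ∀ᵐ z ∂(volume.restrict strip : Measure (ℝ × ℝ)), D 1 0 u₁ z + D 0 1 u₂ z = 0)
    (hmom : ∀ᵐ z ∂(volume.restrict strip : Measure (ℝ × ℝ)),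
      ut₁ z + (u₁ z * D 1 0 u₁ z + u₂ z * D 0 1 u₁ z) + u₂ z * D1 1 Ψ z.2 + κ * u₁ z
          + Ψ z.2 * D 1 0 u₁ z + q₁ z
        = (D 0 1 ρ z * D 1 1 ρ z - D 1 0 ρ z * D 0 2 ρ z) - D 1 0 ρ z * D1 2 Φ z.2
          + D1 1 Φ z.2 * D 1 1 ρ z - C₀ * D 0 2 ρ z) (σ : Bool) :
    els ut₁ ut₂ ρt (σ, 0) = -((∑ j, mul (transp C₀ (els u₁ u₂ ρ) (bgEls Φ Ψ) σ j)
        (der j (els u₁ u₂ ρ (σ, 0)))) + reac (els u₁ u₂ ρ) (bgEls Φ Ψ) σ 0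
      + (κ / 2) • (els u₁ u₂ ρ (true, 0) + els u₁ u₂ ρ (false, 0)) + vel q₁ q₂ 0) := by
  have hz : ∀ s, Hm 4 (els u₁ u₂ ρ s) := hm_els hu₁ hu₂ hρ
  have hβ : ∀ σ, Hm 4 (bgEls Φ Ψ σ) := fun σ =>
    (hΨ.hm_ext1.mono (by omega)).add ((hΦ.hm_ext1.der 1).smul _)
  have oka : Ok (els u₁ u₂ ρ (!σ, 0), bgEls Φ Ψ (!σ)) (der 0 (els u₁ u₂ ρ (σ, 0))) :=
    ok_of_hm ((hz _).prodMk (hβ _)) ((hz _).der 0) (by omega)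
  have okb : Ok (els u₁ u₂ ρ (!σ, 1), (-(sgn (!σ) * C₀)) • one) (der 1 (els u₁ u₂ ρ (σ, 0))) :=
    ok_of_hm ((hz _).prodMk ((hm_one 4).smul _)) ((hz _).der 1) (by omega)
  have okc : Ok ((0 : LG), der 1 (bgEls Φ Ψ σ)) (els u₁ u₂ ρ (!σ, 1)) :=
    ok_of_hm (((Hm.zero 3).prodMk ((hβ _).der 1))) (hz _) (by omega)
  have okd : Ok (der 1 (dbl.ext false u₁), der 1 (dblC.ext false Ψ)) (der 0 (dbl.ext false ρ)) :=
    ok_of_hm ((hu₁.hm_ext.der 1).prodMk ((hΨ.hm_ext1.der 1).mono (by omega))) (hρ.hm_ext.der 0)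
      (by omega)
  have oke : Ok (dbl.ext false u₁, dblC.ext false Ψ) (der 1 (der 0 (dbl.ext false ρ))) :=
    ok_of_hm (hu₁.hm_ext.prodMk (hΨ.hm_ext1.mono (by omega))) ((hρ.hm_ext.der 0).der 1) (by omega)
  have okf : Ok (der 1 (der 1 (dbl.ext false ρ)), der 1 (der 1 (dblC.ext false Φ)))
      (dbl.ext true u₂) :=
    ok_of_hm (((hρ.hm_ext.der 1).der 1).prodMk ((hΦ.hm_ext1.der 1).der 1)) hu₂.hm_ext (by omega)
  have okg : Ok (der 1 (dbl.ext false ρ), der 1 (dblC.ext false Φ)) (der 1 (dbl.ext true u₂)) :=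
    ok_of_hm ((hρ.hm_ext.der 1).prodMk (hΦ.hm_ext1.der 1)) (hu₂.hm_ext.der 1) (by omega)
  have eu0 := hu₁.der_zero (a := 0) (b := 0) (by omega)
  have eu1 := hu₁.der_one (a := 0) (b := 0) (by omega)
  have ev1 := hu₂.der_one (a := 0) (b := 0) (by omega)
  have er0 := hρ.der_zero (a := 0) (b := 0) (by omega)
  have er1 := hρ.der_one (a := 0) (b := 0) (by omega)
  have er10 := hρ.der_one (a := 1) (b := 0) (by omega)
  have er01 := hρ.der_zero (a := 0) (b := 1) (by omega)
  have er11 := hρ.der_one (a := 0) (b := 1) (by omega)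
  have ep := hΨ.der_one (a := 0) (b := 0) (by omega)
  have ef1 := hΦ.der_one (a := 0) (b := 0) (by omega)
  have ef2 := hΦ.der_one (a := 0) (b := 1) (by omega)
  rw [extD_zero_zero] at eu0 eu1 ev1 er0 er1
  rw [extD1_zero_zero] at ep ef1
  rw [zero_add] at er0 er1 ef1
  have hL : els ut₁ ut₂ ρt (σ, 0) = dbl.ext false ut₁ + sgn σ • der 1 (dbl.ext false ρt) := by
    rw [els, vel, mag, if_pos rfl, if_pos rfl]
  have hder0 := der_els_zero (u₂ := u₂) (hu₁.mono (by omega)) (hρ.mono (by omega)) σ 0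
  have hder1 := der_els_zero (u₂ := u₂) (hu₁.mono (by omega)) (hρ.mono (by omega)) σ 1
  rw [hder0] at oka
  rw [hder1] at okb
  rw [hL, der_ext_transport hu₁ hu₂ hρ hΦ hΨ h 1, Fin.sum_univ_two, hder0, hder1]
  simp only [transp, reac, if_true, one_ne_zero, if_false, Fin.isValue]
  rw [er1, eu0, er01] at oka
  rw [er1, eu1, er11] at okb
  rw [eu1, ep, er0] at okd
  rw [er0, er10] at oke
  rw [er1, er11, ef1, ef2] at okf
  rw [er1, ef1, ev1] at okg
  rw [eu0, eu1, er0, er1, er10, er01, er11, ep, ef1, ef2, ev1, vel, if_pos rfl]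
  have hρ2 := hρ.mono (by omega : 2 ≤ 5)
  refine Lp.ext ((ae_add (ext_ae_cyl _ _) (ae_smul _ (ae_neg (ae_add (ae_add (ae_add
    (ae_mul okd (ext_ae_cyl _ _) (ext_ae_circ _ _) (ext_ae_cyl _ _))
    (ae_mul oke (ext_ae_cyl _ _) (ext_ae_circ _ _) (ext_ae_cyl _ _))) (ae_add
    (ae_mul okf (ext_ae_cyl _ _) (ext_ae_circ _ _) (ext_ae_cyl _ _))
    (ae_mul okg (ext_ae_cyl _ _) (ext_ae_circ _ _) (ext_ae_cyl _ _))))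
    (ae_smul _ (ext_ae_cyl _ _)))))).trans (EventuallyEq.symm ?_))
  refine (ae_neg (ae_add (ae_add (ae_add (ae_add
    (ae_mul oka (els_zero_ae hρ2 _) (bgEls_ae (hΦ.mono (by omega)) _)
      (ae_add (ext_ae_cyl _ _) (ae_smul _ (ext_ae_cyl _ _))))
    (ae_mul okb (els_one_ae hρ2 _) (ae_smul_circ _ one_ae)
      (ae_add (ext_ae_cyl _ _) (ae_smul _ (ext_ae_cyl _ _)))))
    (ae_mul okc ext_zero_ae (der_bgEls_ae (hΦ.mono (by omega)) (hΨ.mono (by omega)) _)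
      (els_one_ae hρ2 _)))
    (ae_smul _ (ae_add (els_zero_ae hρ2 _) (els_zero_ae hρ2 _)))) (ext_ae_cyl _ _))).trans ?_
  filter_upwards [dbl.ae_fold hmom, dbl.ae_fold hdiv] with z hm hd
  have hz2 : (dbl.fold z).2 = foldC z.2 := rfl
  rw [hz2] at hm
  simp only [par, Nat.bodd_succ, Nat.bodd_zero, zero_add, Bool.not_false, Bool.not_true,
    Bool.false_xor, Bool.true_xor, if_true, Bool.false_eq_true, if_false, one_mul]
  rcases signC_eq z.2 with hs | hs <;> rw [hs] <;> cases σ <;>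
    simp only [sgn, Bool.not_false, Bool.not_true, if_true, Bool.false_eq_true, if_false]
  · linear_combination -hm - (D 0 1 ρ (dbl.fold z) + D1 1 Φ (foldC z.2)) * hd
  · linear_combination -hm + (D 0 1 ρ (dbl.fold z) + D1 1 Φ (foldC z.2)) * hd
  · linear_combination -hm + (D 0 1 ρ (dbl.fold z) + D1 1 Φ (foldC z.2)) * hd
  · linear_combination -hm - (D 0 1 ρ (dbl.fold z) + D1 1 Φ (foldC z.2)) * hd

/-- The second component of the system in Elsässer variables: the momentum equation combined with
the derivative of the transport equation along the strip. -/
theorem els_eq_one (hu₁ : Grid 4 (extD false u₁)) (hu₂ : Grid 4 (extD true u₂))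
    (hρ : Grid 5 (extD false ρ)) (hΦ : Grid 5 (extD1 Φ)) (hΨ : Grid 5 (extD1 Ψ))
    (h : dbl.ext false ρt = -(mul (dbl.ext false u₁, dblC.ext false Ψ) (der 0 (dbl.ext false ρ))
      + mul (der 1 (dbl.ext false ρ), der 1 (dblC.ext false Φ)) (dbl.ext true u₂)
      + C₀ • dbl.ext false u₁))
    (hdiv : ∀ᵐ z ∂(volume.restrict strip : Measure (ℝ × ℝ)), D 1 0 u₁ z + D 0 1 u₂ z = 0)
    (hmom : ∀ᵐ z ∂(volume.restrict strip : Measure (ℝ × ℝ)),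
      ut₂ z + (u₁ z * D 1 0 u₂ z + u₂ z * D 0 1 u₂ z) + κ * u₂ z
          + Ψ z.2 * D 1 0 u₂ z + q₂ z
        = (-(D 0 1 ρ z * D 2 0 ρ z) + D 1 0 ρ z * D 1 1 ρ z)
          - D1 1 Φ z.2 * D 2 0 ρ z + C₀ * D 1 1 ρ z) (σ : Bool) :
    els ut₁ ut₂ ρt (σ, 1) = -((∑ j, mul (transp C₀ (els u₁ u₂ ρ) (bgEls Φ Ψ) σ j)
        (der j (els u₁ u₂ ρ (σ, 1)))) + reac (els u₁ u₂ ρ) (bgEls Φ Ψ) σ 1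
      + (κ / 2) • (els u₁ u₂ ρ (true, 1) + els u₁ u₂ ρ (false, 1)) + vel q₁ q₂ 1) := by
  have hz : ∀ s, Hm 4 (els u₁ u₂ ρ s) := hm_els hu₁ hu₂ hρ
  have hβ : ∀ σ, Hm 4 (bgEls Φ Ψ σ) := fun σ =>
    (hΨ.hm_ext1.mono (by omega)).add ((hΦ.hm_ext1.der 1).smul _)
  have oka : Ok (els u₁ u₂ ρ (!σ, 0), bgEls Φ Ψ (!σ)) (der 0 (els u₁ u₂ ρ (σ, 1))) :=
    ok_of_hm ((hz _).prodMk (hβ _)) ((hz _).der 0) (by omega)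
  have okb : Ok (els u₁ u₂ ρ (!σ, 1), (-(sgn (!σ) * C₀)) • one) (der 1 (els u₁ u₂ ρ (σ, 1))) :=
    ok_of_hm ((hz _).prodMk ((hm_one 4).smul _)) ((hz _).der 1) (by omega)
  have okd : Ok (der 0 (dbl.ext false u₁), der 0 (dblC.ext false Ψ)) (der 0 (dbl.ext false ρ)) :=
    ok_of_hm ((hu₁.hm_ext.der 0).prodMk ((hΨ.hm_ext1.der 0).mono (by omega))) (hρ.hm_ext.der 0)
      (by omega)
  have oke : Ok (dbl.ext false u₁, dblC.ext false Ψ) (der 0 (der 0 (dbl.ext false ρ))) :=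
    ok_of_hm (hu₁.hm_ext.prodMk (hΨ.hm_ext1.mono (by omega))) ((hρ.hm_ext.der 0).der 0) (by omega)
  have okf : Ok (der 0 (der 1 (dbl.ext false ρ)), der 0 (der 1 (dblC.ext false Φ)))
      (dbl.ext true u₂) :=
    ok_of_hm (((hρ.hm_ext.der 1).der 0).prodMk ((hΦ.hm_ext1.der 1).der 0)) hu₂.hm_ext (by omega)
  have okg : Ok (der 1 (dbl.ext false ρ), der 1 (dblC.ext false Φ)) (der 0 (dbl.ext true u₂)) :=
    ok_of_hm ((hρ.hm_ext.der 1).prodMk (hΦ.hm_ext1.der 1)) (hu₂.hm_ext.der 0) (by omega)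
  have eu0 := hu₁.der_zero (a := 0) (b := 0) (by omega)
  have ev0 := hu₂.der_zero (a := 0) (b := 0) (by omega)
  have ev1 := hu₂.der_one (a := 0) (b := 0) (by omega)
  have er0 := hρ.der_zero (a := 0) (b := 0) (by omega)
  have er1 := hρ.der_one (a := 0) (b := 0) (by omega)
  have er00 := hρ.der_zero (a := 1) (b := 0) (by omega)
  have er10 := hρ.der_one (a := 1) (b := 0) (by omega)
  have er01 := hρ.der_zero (a := 0) (b := 1) (by omega)
  have ep : der 0 (dblC.ext false Ψ) = 0 := (hasD_zero_circ _).der_eq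
  have ef2 : der 0 (extD1 Φ 0 1) = 0 := (hasD_zero_circ _).der_eq
  have ef1 := hΦ.der_one (a := 0) (b := 0) (by omega)
  rw [extD_zero_zero] at eu0 ev0 ev1 er0 er1
  rw [extD1_zero_zero] at ef1
  rw [zero_add] at er0 er1 ef1
  have hL : els ut₁ ut₂ ρt (σ, 1) = dbl.ext true ut₂ + sgn σ • -der 0 (dbl.ext false ρt) := by
    rw [els, vel, mag, if_neg (by simp), if_neg (by simp)]
  have hder0 := der_els_one (u₁ := u₁) (hu₂.mono (by omega)) (hρ.mono (by omega)) σ 0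
  have hder1 := der_els_one (u₁ := u₁) (hu₂.mono (by omega)) (hρ.mono (by omega)) σ 1
  rw [hder0] at oka
  rw [hder1] at okb
  rw [hL, der_ext_transport hu₁ hu₂ hρ hΦ hΨ h 0, Fin.sum_univ_two, hder0, hder1]
  simp only [transp, reac, if_true, one_ne_zero, if_false, Fin.isValue]
  rw [er0, ev0, er00] at oka
  rw [er0, ev1, er10] at okb
  rw [eu0, ep, er0] at okd
  rw [er0, er00] at oke
  rw [er1, er01, ef1, ef2] at okf
  rw [er1, ef1, ev0] at okg
  rw [eu0, ev0, er0, er1, er00, er10, er01, ep, ef1, ef2, ev1, vel, if_neg (by simp)]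
  have hρ2 := hρ.mono (by omega : 2 ≤ 5)
  refine Lp.ext ((ae_add (ext_ae_cyl _ _) (ae_smul _ (ae_neg (ae_neg (ae_add (ae_add (ae_add
    (ae_mul okd (ext_ae_cyl _ _) zero_circ_ae (ext_ae_cyl _ _))
    (ae_mul oke (ext_ae_cyl _ _) (ext_ae_circ _ _) (ext_ae_cyl _ _))) (ae_add
    (ae_mul okf (ext_ae_cyl _ _) zero_circ_ae (ext_ae_cyl _ _))
    (ae_mul okg (ext_ae_cyl _ _) (ext_ae_circ _ _) (ext_ae_cyl _ _))))
    (ae_smul _ (ext_ae_cyl _ _))))))).trans (EventuallyEq.symm ?_))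
  refine (ae_neg (ae_add (ae_add (ae_add (ae_add
    (ae_mul oka (els_zero_ae hρ2 _) (bgEls_ae (hΦ.mono (by omega)) _)
      (ae_add (ext_ae_cyl _ _) (ae_smul _ (ae_neg (ext_ae_cyl _ _)))))
    (ae_mul okb (els_one_ae hρ2 _) (ae_smul_circ _ one_ae)
      (ae_add (ext_ae_cyl _ _) (ae_smul _ (ae_neg (ext_ae_cyl _ _))))))
    ext_zero_ae)
    (ae_smul _ (ae_add (els_one_ae hρ2 _) (els_one_ae hρ2 _)))) (ext_ae_cyl _ _))).trans ?_
  filter_upwards [dbl.ae_fold hmom, dbl.ae_fold hdiv] with z hm hd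
  have hz2 : (dbl.fold z).2 = foldC z.2 := rfl
  rw [hz2] at hm
  simp only [par, Nat.bodd_succ, Nat.bodd_zero, zero_add, Bool.not_false, Bool.not_true,
    Bool.false_xor, Bool.true_xor, if_true, Bool.false_eq_true, if_false, one_mul]
  rcases signC_eq z.2 with hs | hs <;> rw [hs] <;> cases σ <;>
    simp only [sgn, Bool.not_false, Bool.not_true, if_true, Bool.false_eq_true, if_false]
  · linear_combination -hm + (D 1 0 ρ (dbl.fold z) + C₀) * hd
  · linear_combination -hm - (D 1 0 ρ (dbl.fold z) + C₀) * hd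
  · linear_combination hm + (D 1 0 ρ (dbl.fold z) + C₀) * hd
  · linear_combination hm - (D 1 0 ρ (dbl.fold z) + C₀) * hd

end Equations

/-! ### The reflected solution solves the Elsässer system -/

section Solution

variable {F : Flow} {k : ℕ} {κ C₀ T t : ℝ}

namespace Flow.IsSolution

/-- At each time, the reflected solution satisfies the system in Elsässer variables with a
curl free field in place of the pressure gradient. -/
theorem exists_pressure (h : F.IsSolution k κ C₀ T) (hk : 4 ≤ k) (hT : 0 < T)
    (ht : t ∈ Icc 0 T) : ∃ q : Fin 2 → LG, der 0 (q 1) = der 1 (q 0) ∧ ∀ σ c,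
      els (F.ut₁ t) (F.ut₂ t) (F.ρt t) (σ, c)
        = -((∑ j, mul (transp C₀ (els (F.u₁ t) (F.u₂ t) (F.ρ t)) (bgEls (F.Φ t) (F.Ψ t)) σ j)
            (der j (els (F.u₁ t) (F.u₂ t) (F.ρ t) (σ, c))))
          + reac (els (F.u₁ t) (F.u₂ t) (F.ρ t)) (bgEls (F.Φ t) (F.Ψ t)) σ c
          + (κ / 2) • (els (F.u₁ t) (F.u₂ t) (F.ρ t) (true, c)
            + els (F.u₁ t) (F.u₂ t) (F.ρ t) (false, c)) + q c) := by
  obtain ⟨P, q₁, q₂, -, hq₁, hq₂, hm⟩ := h.momentum t ht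
  have gu₁ := (h.grid_u₁ ht).mono (by omega : 4 ≤ k + 1)
  have gu₂ := (h.grid_u₂ ht).mono (by omega : 4 ≤ k + 1)
  have gρ := (h.grid_ρ ht).mono (by omega : 5 ≤ k + 2)
  have gΦ := (h.grid_Φ ht).mono (by omega : 5 ≤ k + 3)
  have gΨ := (h.grid_Ψ ht).mono (by omega : 5 ≤ k + 3)
  have htr := ext_transport gu₁ gu₂ gρ gΦ gΨ (h.transport t ht)
  have hdiv : ∀ᵐ z ∂(volume.restrict strip : Measure (ℝ × ℝ)),
      D 1 0 (F.u₁ t) z + D 0 1 (F.u₂ t) z = 0 := by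
    have e : D 1 0 (F.u₁ t) + D 0 1 (F.u₂ t) = 0 := h.div_free t ht
    have e' := Lp.coeFn_add (D 1 0 (F.u₁ t)) (D 0 1 (F.u₂ t))
    rw [e] at e'
    filter_upwards [e', Lp.coeFn_zero ℝ 2 (volume.restrict strip : Measure (ℝ × ℝ))] with z h1 h2
    rw [h2] at h1
    exact h1.symm
  have heq : ∀ σ c, els (F.ut₁ t) (F.ut₂ t) (F.ρt t) (σ, c)
        = -((∑ j, mul (transp C₀ (els (F.u₁ t) (F.u₂ t) (F.ρ t)) (bgEls (F.Φ t) (F.Ψ t)) σ j)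
            (der j (els (F.u₁ t) (F.u₂ t) (F.ρ t) (σ, c))))
          + reac (els (F.u₁ t) (F.u₂ t) (F.ρ t)) (bgEls (F.Φ t) (F.Ψ t)) σ c
          + (κ / 2) • (els (F.u₁ t) (F.u₂ t) (F.ρ t) (true, c)
            + els (F.u₁ t) (F.u₂ t) (F.ρ t) (false, c)) + vel q₁ q₂ c) := by
    intro σ c
    fin_cases c
    · exact els_eq_zero gu₁ gu₂ gρ gΦ gΨ htr hdiv (hm.mono fun z hz => hz.1) σ
    · exact els_eq_one gu₁ gu₂ gρ gΦ gΨ htr hdiv (hm.mono fun z hz => hz.2) σ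
  refine ⟨vel q₁ q₂, ?_, heq⟩
  have hz : ∀ s, Hm 4 (els (F.u₁ t) (F.u₂ t) (F.ρ t) s) := hm_els gu₁ gu₂ gρ
  have hβ : ∀ σ, Hm 4 (bgEls (F.Φ t) (F.Ψ t) σ) := fun σ =>
    (gΨ.hm_ext1.mono (by omega)).add ((gΦ.hm_ext1.der 1).smul _)
  have hV : ∀ j, Hm 4 (transp C₀ (els (F.u₁ t) (F.u₂ t) (F.ρ t)) (bgEls (F.Φ t) (F.Ψ t))
      true j) := fun j => by
    refine (hz _).prodMk ?_
    split_ifs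
    · exact hβ _
    · exact (hm_one 4).smul _
  have hq : ∀ c, Hm 1 (vel q₁ q₂ c) := fun c => by
    have e : vel q₁ q₂ c = -(els (F.ut₁ t) (F.ut₂ t) (F.ρt t) (true, c)
        + ((∑ j, mul (transp C₀ (els (F.u₁ t) (F.u₂ t) (F.ρ t)) (bgEls (F.Φ t) (F.Ψ t)) true j)
            (der j (els (F.u₁ t) (F.u₂ t) (F.ρ t) (true, c))))
          + reac (els (F.u₁ t) (F.u₂ t) (F.ρ t)) (bgEls (F.Φ t) (F.Ψ t)) true c
          + (κ / 2) • (els (F.u₁ t) (F.u₂ t) (F.ρ t) (true, c)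
            + els (F.u₁ t) (F.u₂ t) (F.ρ t) (false, c)))) := by
      rw [heq true c]; abel
    rw [e]
    refine (Hm.add ?_ ((Hm.add (Hm.sum _ fun j _ => ?_) ?_).add (Hm.smul _ ?_))).neg
    · exact hm_els ((h.grid_ut₁ hT ht).mono (by omega)) ((h.grid_ut₂ hT ht).mono (by omega))
        ((h.grid_ρt hT ht).mono (by omega)) _
    · exact (hV j).mul ((hz _).der j) (by omega) (by omega) (by omega)
    · unfold reac
      split_ifs
      · exact ((Hm.zero 3).prodMk ((hβ true).der 1)).mul (hz _) (by omega) (by omega) (by omega)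
      · exact Hm.zero 1
    · exact ((hz _).add (hz _)).mono (by omega)
  have e0 : vel q₁ q₂ 0 = dbl.ext false q₁ := if_pos rfl
  have e1 : vel q₁ q₂ 1 = dbl.ext true q₂ := if_neg (by simp)
  have h0 := (hq 0).hasD 1
  have h1 := (hq 1).hasD 0
  rw [e0] at h0 ⊢
  rw [e1] at h1 ⊢
  exact curl_free_ext hq₁ hq₂ h1 h0

/-- The reflected solution solves the system in Elsässer variables on the cylinder. -/
theorem exists_elsasser (h : F.IsSolution k κ C₀ T) (hk : 4 ≤ k) (hT : 0 < T) :
    ∃ q : Fin 2 → ℝ → LG, Elsasser k κ C₀ T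
      (fun s t => els (F.u₁ t) (F.u₂ t) (F.ρ t) s)
      (fun s t => els (F.ut₁ t) (F.ut₂ t) (F.ρt t) s)
      (fun σ t => bgEls (F.Φ t) (F.Ψ t) σ) q
      (fun t => der 0 (dbl.ext false (F.ρ t))) (fun t => der 0 (dbl.ext false (F.ρt t))) := by
  have hq : ∀ t, ∃ q : Fin 2 → LG, t ∈ Icc 0 T → _ := fun t => by
    by_cases ht : t ∈ Icc 0 T
    · obtain ⟨q, hq⟩ := h.exists_pressure hk hT ht
      exact ⟨q, fun _ => hq⟩
    · exact ⟨0, fun h => absurd h ht⟩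
  choose q hq using hq
  exact ⟨fun c t => q t c,
    { cont_z := fun s t ht => h.convH_els s ht
      cont_zt := fun s t ht => h.convH_els_time hT s ht
      deriv_z := fun s v hv t ht => h.hasDerivWithinAt_els hT s hv ht
      cont_β := fun σ t ht => h.convH_bgEls σ ht
      cont_r := fun t ht => ((h.cont_ρ.convH_ext (fun s hs => h.grid_ρ hs) ht).der 0).mono
        (by omega)
      cont_rt := fun t ht => ((h.cont_ρt.convH_ext (fun s hs => h.grid_ρt hT hs) ht).der 0).mono
        (by omega)
      deriv_r := fun t ht => h.convH_slope hk hT ht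
      div_free := fun σ t ht => h.div_els σ ht
      curl_free := fun t ht => (hq t ht).1
      eq := fun σ c t ht => (hq t ht).2 σ c }⟩

end Flow.IsSolution

end Solution

/-! ### Energies on the strip and on the cylinder -/

section Strip

/-- Mixed weak derivatives commute: if `∂_x∂_yP` exists, then so does `∂_y∂_xP`. -/
theorem HasWeakDeriv.comm {P : ℝ × ℝ → ℝ} {f g h : ℝ × ℝ → ℝ}
    (hf : HasWeakDeriv strip (1, 0) P f) (hg : HasWeakDeriv strip (0, 1) P g)
    (hh : HasWeakDeriv strip (1, 0) g h) : HasWeakDeriv strip (0, 1) f h := by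
  intro φ hφ
  have ht : ∀ i, IsTest strip (pd i φ) := fun i =>
    ⟨contDiff_pd hφ.1 i, hφ.2.1.fderiv_apply ℝ (dir i),
      (tsupport_fderiv_apply_subset ℝ (dir i)).trans hφ.2.2⟩
  have t1 : ∫ z in strip, P z * pd 0 (pd 1 φ) z = -∫ z in strip, f z * pd 1 φ z := hf _ (ht 1)
  have t2 : ∫ z in strip, P z * pd 1 (pd 0 φ) z = -∫ z in strip, g z * pd 0 φ z := hg _ (ht 0)
  have t3 : ∫ z in strip, g z * pd 0 φ z = -∫ z in strip, h z * φ z := hh φ hφ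
  simp only [pd_comm hφ.1] at t1
  change ∫ z in strip, f z * pd 1 φ z = _
  linarith

theorem MemH.D_zero_dx {m b : ℕ} {f : L2 strip} (h : MemH m f) (hb : b < m) :
    D 0 b (dx f) = D 1 b f := by
  induction b with
  | zero => rfl
  | succ b ih =>
    rw [D_zero_succ, ih (by omega), D_succ_left 0 b]
    refine wderiv_eq isOpen_strip (HasWeakDeriv.comm
      (exists_hasWeakDeriv_wderiv isOpen_strip (h 0 b (by omega)).1)
      (exists_hasWeakDeriv_wderiv isOpen_strip (h 0 b (by omega)).2) ?_)
    rw [D_succ_left, D_zero_succ]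
    have := exists_hasWeakDeriv_wderiv isOpen_strip (h 0 (b + 1) (by omega)).1
    rwa [D_zero_succ] at this

theorem MemH.D_dx {m a b : ℕ} {f : L2 strip} (h : MemH m f) (hab : a + b < m) :
    D a b (dx f) = D (a + 1) b f := by
  induction a with
  | zero => exact h.D_zero_dx (by omega)
  | succ a ih => rw [D_succ_left, ih (by omega), ← D_succ_left]

theorem D_dy (a b : ℕ) (f : L2 strip) : D a b (dy f) = D a (b + 1) f := rfl

theorem wderiv_neg {v : ℝ × ℝ} {f : L2 strip} (h : ∃ g : L2 strip, HasWeakDeriv strip v f g) :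
    wderiv v (-f) = -wderiv v f := by
  have h1 := exists_hasWeakDeriv_wderiv isOpen_strip h
  refine wderiv_eq isOpen_strip fun φ hφ => ?_
  have h2 := h1 φ hφ
  have e1 : ∫ z in strip, (-f) z * fderiv ℝ φ z v = -∫ z in strip, f z * fderiv ℝ φ z v := by
    rw [← integral_neg]
    refine integral_congr_ae ?_
    filter_upwards [Lp.coeFn_neg f] with z hz
    rw [hz, Pi.neg_apply, neg_mul]
  have e2 : ∫ z in strip, (-wderiv v f) z * φ z = -∫ z in strip, wderiv v f z * φ z := by
    rw [← integral_neg]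
    refine integral_congr_ae ?_
    filter_upwards [Lp.coeFn_neg (wderiv v f)] with z hz
    rw [hz, Pi.neg_apply, neg_mul]
  rw [e1, e2, h2]

theorem MemH.D_neg_dx {m a b : ℕ} {f : L2 strip} (h : MemH m f) (hab : a + b < m) :
    D a b (-dx f) = -D (a + 1) b f := by
  induction a with
  | zero =>
    induction b with
    | zero => rfl
    | succ b ih =>
      rw [D_zero_succ, ih (by omega), dy, wderiv_neg]
      · rw [← h.D_zero_dx (by omega), ← h.D_zero_dx (by omega), D_zero_succ]
      · exact (h 1 b (by omega)).2
  | succ a ih =>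
    rw [D_succ_left, ih (by omega), dx, wderiv_neg, ← dx, ← D_succ_left]
    exact (h (a + 1) b (by omega)).1

end Strip

section Energy

variable {F : Flow} {k : ℕ} {κ C₀ T t : ℝ}

/-- `∫_Ω (1 + r) f²`. -/
def wInt (r f : L2 strip) : ℝ := ∫ z in strip, (1 + r z) * f z ^ 2

theorem wInt_neg (r f : L2 strip) : wInt r (-f) = wInt r f := by
  refine integral_congr_ae ?_
  filter_upwards [Lp.coeFn_neg f] with z hz
  rw [hz, Pi.neg_apply, neg_sq]

theorem fn_wt_ae (r : L2 strip) :
    fn (Elsasser.wt (dbl.ext false r)) =ᵐ[volume] fun z => 1 + r (dbl.fold z) := by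
  filter_upwards [ext_ae_cyl false r, ae_snd one_ae] with z h1 h2
  simp only [fn, Elsasser.wt, h1, h2, par]
  simp [add_comm]

theorem inner_wt_ext {r : L2 strip} (hr : Hm 2 (dbl.ext false r)) (p : Bool) (f : L2 strip) :
    ⟪mul (Elsasser.wt (dbl.ext false r)) (dbl.ext p f), dbl.ext p f⟫ = 2 * wInt r f := by
  have ok : Ok (Elsasser.wt (dbl.ext false r)) (dbl.ext p f) :=
    (norm_mul_le_left (hr.prodMk (hm_one 2)) (dbl.ext p f)).1
  have h := coeFn_mul ok
  have h' : (mul (Elsasser.wt (dbl.ext false r)) (dbl.ext p f) : Cyl → ℝ)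
      =ᵐ[volume] fun z => (1 + r (dbl.fold z)) * dbl.ext p f z := by
    filter_upwards [h, fn_wt_ae r] with z h1 h2
    rw [h1, h2]
  rw [real_inner_comm, dbl.inner_ext, wInt, ← integral_const_mul]
  refine integral_congr_ae ?_
  filter_upwards [dbl.ae_inj h' false, dbl.ae_inj h' true, dbl.ext_inj p false f,
    dbl.ext_inj p true f, dbl.fold_inj false, dbl.fold_inj true] with s h0 h1 h2 h3 h4 h5
  rw [h0, h1, h2, h3, h4, h5]
  cases p <;> simp <;> ring

theorem inner_wt_parallelogram {r : LG} (hr : Hm 2 r) (G H : LG) :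
    ∑ σ, (1 / 2 : ℝ) * ⟪mul (Elsasser.wt r) (G + sgn σ • H), G + sgn σ • H⟫
      = ⟪mul (Elsasser.wt r) G, G⟫ + ⟪mul (Elsasser.wt r) H, H⟫ := by
  have hw : Hm 2 (Elsasser.wt r) := hr.prodMk (hm_one 2)
  have ok : ∀ g, Ok (Elsasser.wt r) g := fun g => (norm_mul_le_left hw g).1
  have e : ∀ c : ℝ, mul (Elsasser.wt r) (G + c • H)
      = mul (Elsasser.wt r) G + c • mul (Elsasser.wt r) H := fun c => by
    rw [(ok_mul_add_right (ok G) (ok (c • H))).2, (ok_mul_smul_right c (ok H)).2]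
  simp only [Fintype.sum_bool, e, sgn, inner_add_left, inner_add_right, inner_smul_left,
    inner_smul_right, if_true, Bool.false_eq_true, if_false, conj_trivial]
  ring

/-- The derivatives of the reflected Elsässer variables. -/
theorem dw_els {m a b : ℕ} {u₁ u₂ ρ : L2 strip} (h₁ : Grid m (extD false u₁))
    (h₂ : Grid m (extD true u₂)) (h : Grid (m + 1) (extD false ρ)) (hab : a + b ≤ m) (σ : Bool) :
    dw (wd a b) (els u₁ u₂ ρ (σ, 0)) = extD false u₁ a b + sgn σ • extD false ρ a (b + 1) ∧
    dw (wd a b) (els u₁ u₂ ρ (σ, 1)) = extD true u₂ a b + sgn σ • -extD false ρ (a + 1) b := by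
  have hv : (wd a b).length ≤ m := by rwa [length_wd]
  have e1 := h₁.dw_wd hab
  have e2 := h₂.dw_wd hab
  have e3 := h.dw_wd (a := a) (b := b + 1) (by omega)
  have e4 := h.dw_wd (a := a + 1) (b := b) (by omega)
  rw [extD_zero_zero] at e1 e2 e3 e4
  have hd := h.hm_ext
  constructor
  · rw [els, vel, mag, if_pos rfl, if_pos rfl,
      dw_add (h₁.hm_ext.mono hv) (((hd.der 1).smul _).mono hv), dw_smul _ ((hd.der 1).mono hv),
      dw_wd_der_one, e1, e3]
  · rw [els, vel, mag, if_neg (by simp), if_neg (by simp),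
      dw_add (h₂.hm_ext.mono hv) (((hd.der 0).neg.smul _).mono hv),
      dw_smul _ ((hd.der 0).neg.mono hv), dw_neg ((hd.der 0).mono hv),
      dw_wd_der_zero (hd.mono (by omega)), e2, e4]

namespace Flow.IsSolution

theorem ext_D_one_zero (h : F.IsSolution k κ C₀ T) (ht : t ∈ Icc 0 T) :
    der 0 (dbl.ext false (F.ρ t)) = dbl.ext false (D 1 0 (F.ρ t)) := by
  have e := (h.grid_ρ ht).der_zero (a := 0) (b := 0) (by omega)
  rwa [extD_zero_zero] at e

/-- The energy of the derivatives `∂_x^a ∂_y^b` on the cylinder, for both Elsässer variables, is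
twice the energy of these derivatives on the strip. -/
theorem energy_eq (h : F.IsSolution k κ C₀ T) (hk : 4 ≤ k) (ht : t ∈ Icc 0 T) {a b : ℕ}
    (hab : a + b = k + 1) :
    ∑ σ, (1 / 2 : ℝ) * ∑ c, ⟪mul (Elsasser.wt (der 0 (dbl.ext false (F.ρ t))))
        (dw (wd a b) (els (F.u₁ t) (F.u₂ t) (F.ρ t) (σ, c))),
        dw (wd a b) (els (F.u₁ t) (F.u₂ t) (F.ρ t) (σ, c))⟫
      = 2 * (wInt (D 1 0 (F.ρ t)) (D a b (F.u₁ t)) + wInt (D 1 0 (F.ρ t)) (D a b (F.u₂ t))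
        + (wInt (D 1 0 (F.ρ t)) (D a b (dy (F.ρ t)))
          + wInt (D 1 0 (F.ρ t)) (D a b (-dx (F.ρ t))))) := by
  have hr : Hm 2 (dbl.ext false (D 1 0 (F.ρ t))) := by
    rw [← h.ext_D_one_zero ht]
    exact ((h.grid_ρ ht).hm_ext.mono (by omega : 3 ≤ k + 2)).der 0
  have e := dw_els (h.grid_u₁ ht) (h.grid_u₂ ht) (h.grid_ρ ht) hab.le
  rw [h.ext_D_one_zero ht, (h.cont_ρ.1 t ht).D_neg_dx (by omega), D_dy, wInt_neg]
  simp only [Fin.sum_univ_two, (e _).1, (e _).2, mul_add, Finset.sum_add_distrib]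
  rw [inner_wt_parallelogram hr, inner_wt_parallelogram hr]
  simp only [extD, ← map_neg, inner_wt_ext hr, wInt_neg]
  ring

theorem damping_eq (h : F.IsSolution k κ C₀ T) (hk : 4 ≤ k) (ht : t ∈ Icc 0 T) {a b : ℕ}
    (hab : a + b = k + 1) :
    ∑ c, ⟪mul (Elsasser.wt (der 0 (dbl.ext false (F.ρ t))))
        (dw (wd a b) (els (F.u₁ t) (F.u₂ t) (F.ρ t) (true, c))
          + dw (wd a b) (els (F.u₁ t) (F.u₂ t) (F.ρ t) (false, c))),
        dw (wd a b) (els (F.u₁ t) (F.u₂ t) (F.ρ t) (true, c))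
          + dw (wd a b) (els (F.u₁ t) (F.u₂ t) (F.ρ t) (false, c))⟫
      = 8 * (wInt (D 1 0 (F.ρ t)) (D a b (F.u₁ t)) + wInt (D 1 0 (F.ρ t)) (D a b (F.u₂ t))) := by
  have hr : Hm 2 (dbl.ext false (D 1 0 (F.ρ t))) := by
    rw [← h.ext_D_one_zero ht]
    exact ((h.grid_ρ ht).hm_ext.mono (by omega : 3 ≤ k + 2)).der 0
  have e := dw_els (h.grid_u₁ ht) (h.grid_u₂ ht) (h.grid_ρ ht) hab.le
  have hs : ∀ G H : LG, G + sgn true • H + (G + sgn false • H) = (2 : ℝ) • G := fun G H => by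
    simp only [sgn, if_true, Bool.false_eq_true, if_false]
    module
  have ok : ∀ g, Ok (Elsasser.wt (dbl.ext false (D 1 0 (F.ρ t)))) g := fun g =>
    (norm_mul_le_left (hr.prodMk (hm_one 2)) g).1
  rw [h.ext_D_one_zero ht]
  simp only [Fin.sum_univ_two, (e _).1, (e _).2, hs, (ok_mul_smul_right _ (ok _)).2,
    inner_smul_left, inner_smul_right, extD, inner_wt_ext hr, conj_trivial]
  ring

end Flow.IsSolution

end Energy

/-! ### The energy inequality on the strip -/

section Final

variable {F : Flow} {k : ℕ} {κ C₀ T t : ℝ}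

theorem HNormSq_nonneg (m : ℕ) (f : L2 strip) : 0 ≤ HNormSq m f :=
  Finset.sum_nonneg fun _ _ => Finset.sum_nonneg fun _ _ => by positivity

namespace Flow

theorem HNorm_le_En (F : Flow) (m : ℕ) (t : ℝ) :
    HNorm m (F.u₁ t) ≤ 2 * F.En m t ∧ HNorm m (F.u₂ t) ≤ 2 * F.En m t ∧
    HNorm m (F.ut₁ t) ≤ 2 * F.En m t ∧ HNorm m (F.ut₂ t) ≤ 2 * F.En m t ∧
    HNorm (m + 1) (F.ρ t) ≤ 2 * F.En m t ∧ HNorm (m + 1) (F.ρt t) ≤ 2 * F.En m t := by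
  have a1 := HNormSq_nonneg m (F.u₁ t)
  have a2 := HNormSq_nonneg m (F.u₂ t)
  have a3 := HNormSq_nonneg m (F.ut₁ t)
  have a4 := HNormSq_nonneg m (F.ut₂ t)
  have a5 := HNormSq_nonneg (m + 1) (F.ρ t)
  have a6 := HNormSq_nonneg (m + 1) (F.ρt t)
  have key : ∀ n (f : L2 strip), HNormSq n f ≤ 4 * F.ESq m t → HNorm n f ≤ 2 * F.En m t := by
    intro n f hf
    refine Real.sqrt_le_iff.2 ⟨mul_nonneg zero_le_two (Real.sqrt_nonneg _), hf.trans (le_of_eq ?_)⟩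
    have : 0 ≤ F.ESq m t := by rw [ESq]; positivity
    rw [mul_pow, En, Real.sq_sqrt this]
    norm_num
  refine ⟨key _ _ ?_, key _ _ ?_, key _ _ ?_, key _ _ ?_, key _ _ ?_, key _ _ ?_⟩ <;>
    · rw [ESq]; linarith

theorem ESq_nonneg (F : Flow) (m : ℕ) (t : ℝ) : 0 ≤ F.ESq m t := by
  have a1 := HNormSq_nonneg m (F.u₁ t)
  have a2 := HNormSq_nonneg m (F.u₂ t)
  have a3 := HNormSq_nonneg m (F.ut₁ t)
  have a4 := HNormSq_nonneg m (F.ut₂ t)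
  have a5 := HNormSq_nonneg (m + 1) (F.ρ t)
  have a6 := HNormSq_nonneg (m + 1) (F.ρt t)
  rw [ESq]; positivity

namespace IsSolution

/-- The weight is bounded from below. On the cylinder squared norms double, so the Sobolev embedding
gives `|∂_xρ|² ≤ 4 · 2 · ‖∂_xρ‖²_{H²} < 1/2 ≤ (3/4)²`. -/
theorem wt_ge (h : F.IsSolution k κ C₀ T) (hk : 4 ≤ k) (ht : t ∈ Icc 0 T)
    (hρ : HNorm 2 (dx (F.ρ t)) < 1 / 4) :
    ∀ᵐ z : Cyl, 1 / 4 ≤ fn (Elsasser.wt (der 0 (dbl.ext false (F.ρ t)))) z := by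
  have g := (h.grid_ρ ht).mono (by omega : 4 ≤ k + 2)
  have hD : ∀ a b : ℕ, a + b < 4 → D a b (dx (F.ρ t)) = D (a + 1) b (F.ρ t) := fun a b hab =>
    (h.cont_ρ.1 t ht).D_dx (by omega)
  have hn : ∀ a b : ℕ, ‖extD false (F.ρ t) a b‖ ^ 2 = 2 * ‖D a b (F.ρ t)‖ ^ 2 := fun a b =>
    dbl.norm_ext_sq _ _
  have hsq : HNormSq 2 (dx (F.ρ t)) < 1 / 16 := by
    have := (Real.sqrt_lt' (by norm_num)).1 hρ
    linarith
  have hsum : ‖D 1 0 (F.ρ t)‖ ^ 2 + ‖D 1 1 (F.ρ t)‖ ^ 2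
      + (‖D 2 0 (F.ρ t)‖ ^ 2 + ‖D 2 1 (F.ρ t)‖ ^ 2) ≤ HNormSq 2 (dx (F.ρ t)) := by
    simp only [HNormSq, Finset.sum_range_succ, Finset.sum_range_zero, zero_add, Nat.sub_zero,
      Nat.sub_self]
    rw [hD 0 0 (by omega), hD 0 1 (by omega), hD 1 0 (by omega), hD 1 1 (by omega)]
    have p1 := sq_nonneg ‖D 0 2 (dx (F.ρ t))‖
    have p2 := sq_nonneg ‖D 2 0 (dx (F.ρ t))‖
    linarith
  have hb := cyl_sup_bound_real (b := 3 / 4) (g.zero 1 0 (by omega)) (g.one 1 0 (by omega))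
    (g.one 2 0 (by omega)) (by norm_num) (by
      rw [hn, hn, hn, hn]; linarith)
  rw [h.ext_D_one_zero ht]
  filter_upwards [hb, fn_wt_ae (D 1 0 (F.ρ t)), ext_ae_cyl false (D 1 0 (F.ρ t))] with z h1 h2 h3
  have h3' : extD false (F.ρ t) 1 0 z = D 1 0 (F.ρ t) (dbl.fold z) := by
    refine h3.trans ?_
    simp [par]
  rw [h3'] at h1
  rw [h2]
  linarith [(abs_le.1 h1).1]

theorem sq_norm_le_inner {w : Coef} (hw : Hm 2 w) (hge : ∀ᵐ z : Cyl, 1 / 4 ≤ fn w z) (f : LG) :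
    ‖f‖ ^ 2 ≤ 4 * ⟪mul w f, f⟫ := by
  rw [← real_inner_self_eq_norm_sq, L2.inner_def, L2.inner_def, ← integral_const_mul]
  refine integral_mono_ae (L2.integrable_inner _ _) ((L2.integrable_inner _ _).const_mul 4) ?_
  filter_upwards [hge, coeFn_mul (norm_mul_le_left hw f).1] with z h1 h2
  simp only [RCLike.inner_apply, conj_trivial, h2]
  nlinarith [sq_nonneg (f z)]

theorem hm_wt (h : F.IsSolution k κ C₀ T) (hk : 4 ≤ k) (ht : t ∈ Icc 0 T) :
    Hm 2 (Elsasser.wt (der 0 (dbl.ext false (F.ρ t)))) :=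
  (((h.grid_ρ ht).hm_ext.mono (by omega : 3 ≤ k + 2)).der 0).prodMk (hm_one 2)

/-- The weighted energy of the derivatives `∂_x^a ∂_y^b` of the Elsässer variables on the
cylinder. -/
def energy (F : Flow) (a b : ℕ) (t : ℝ) : ℝ :=
  ∑ σ, (1 / 2 : ℝ) * ∑ c, ⟪mul (Elsasser.wt (der 0 (dbl.ext false (F.ρ t))))
        (dw (wd a b) (els (F.u₁ t) (F.u₂ t) (F.ρ t) (σ, c))),
        dw (wd a b) (els (F.u₁ t) (F.u₂ t) (F.ρ t) (σ, c))⟫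

/-- `Γ_{k+1}²` as a combination of energies on the cylinder. The binomial coefficient counts the
derivatives with the same exponents. The factor `1/4` combines the `1/2` in the definition of `Γ`
with the double cover of the strip by the cylinder. -/
theorem ΓSq_eq (h : F.IsSolution k κ C₀ T) (hk : 4 ≤ k) (ht : t ∈ Icc 0 T) :
    F.ΓSq (k + 1) t = ∑ a ∈ Finset.range (k + 2),
      ((k + 1).choose a / 4 : ℝ) * energy F a (k + 1 - a) t := by
  simp only [ΓSq, weightedU, weighted, ← Finset.sum_add_distrib, Finset.mul_sum]
  refine Finset.sum_congr rfl fun a ha => ?_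
  have ha' : a + (k + 1 - a) = k + 1 := by have := Finset.mem_range.1 ha; omega
  rw [show energy F a (k + 1 - a) t = _ from h.energy_eq hk ht ha']
  simp only [wInt]
  ring

theorem norm_sq_le_energy (h : F.IsSolution k κ C₀ T) (hk : 4 ≤ k) (ht : t ∈ Icc 0 T)
    (hρ : HNorm 2 (dx (F.ρ t)) < 1 / 4) (a b : ℕ) (s : Bool × Fin 2) :
    ‖dw (wd a b) (els (F.u₁ t) (F.u₂ t) (F.ρ t) s)‖ ^ 2 ≤ 8 * energy F a b t ∧
      0 ≤ energy F a b t := by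
  have key := sq_norm_le_inner (h.hm_wt hk ht) (h.wt_ge hk ht hρ)
  have h0 : ∀ f : LG, 0 ≤ ⟪mul (Elsasser.wt (der 0 (dbl.ext false (F.ρ t)))) f, f⟫ := fun f => by
    have := key f
    nlinarith [sq_nonneg ‖f‖]
  have k1 := key (dw (wd a b) (els (F.u₁ t) (F.u₂ t) (F.ρ t) s))
  have p := fun σ c => h0 (dw (wd a b) (els (F.u₁ t) (F.u₂ t) (F.ρ t) (σ, c)))
  have p1 := p true 0
  have p2 := p true 1
  have p3 := p false 0
  have p4 := p false 1
  simp only [energy, Fintype.sum_bool, Fin.sum_univ_two]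
  refine ⟨?_, by positivity⟩
  obtain ⟨σ, c⟩ := s
  cases σ <;> fin_cases c <;> simp only [Fin.zero_eta, Fin.mk_one] at k1 ⊢ <;> linarith

/-- All derivatives of order `k + 1` are controlled by `Γ_{k+1}`. -/
theorem norm_sq_le_ΓSq (h : F.IsSolution k κ C₀ T) (hk : 4 ≤ k) (ht : t ∈ Icc 0 T)
    (hρ : HNorm 2 (dx (F.ρ t)) < 1 / 4) {a b : ℕ} (hab : a + b = k + 1) (s : Bool × Fin 2) :
    ‖dw (wd a b) (els (F.u₁ t) (F.u₂ t) (F.ρ t) s)‖ ^ 2 ≤ 32 * F.ΓSq (k + 1) t := by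
  have e0 := fun a b => (h.norm_sq_le_energy hk ht hρ a b s).2
  rw [h.ΓSq_eq hk ht]
  have hs := Finset.single_le_sum
    (f := fun a => ((k + 1).choose a / 4 : ℝ) * energy F a (k + 1 - a) t)
    (fun a _ => mul_nonneg (by positivity) (e0 _ _)) (Finset.mem_range.2 (by omega : a < k + 2))
  rw [show k + 1 - a = b by omega] at hs
  have hc : (1 : ℝ) ≤ (k + 1).choose a := by
    exact_mod_cast Nat.choose_pos (by omega)
  have hm := mul_le_mul_of_nonneg_right hc (e0 a b)
  linarith [(h.norm_sq_le_energy hk ht hρ a b s).1]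

theorem ΓSq_nonneg (h : F.IsSolution k κ C₀ T) (hk : 4 ≤ k) (ht : t ∈ Icc 0 T)
    (hρ : HNorm 2 (dx (F.ρ t)) < 1 / 4) : 0 ≤ F.ΓSq (k + 1) t := by
  have := h.norm_sq_le_ΓSq hk ht hρ (a := k + 1) (b := 0) (by omega) (true, 0)
  linarith [sq_nonneg ‖dw (wd (k + 1) 0) (els (F.u₁ t) (F.u₂ t) (F.ρ t) (true, 0))‖]

/-- The quantities in the energy estimate are controlled by `E_k` and `Γ_{k+1}`. -/
theorem NN_le (h : F.IsSolution k κ C₀ T) (hk : 4 ≤ k) (hT : 0 < T) (ht : t ∈ Icc 0 T)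
    (hρ : HNorm 2 (dx (F.ρ t)) < 1 / 4) :
    NN (k + 1) (els (F.u₁ t) (F.u₂ t) (F.ρ t))
      ≤ 2 ^ (2 * k + 10) * √(F.ESq k t + F.ΓSq (k + 1) t) ∧
    NN k (els (F.ut₁ t) (F.ut₂ t) (F.ρt t))
      ≤ 2 ^ (2 * k + 10) * √(F.ESq k t + F.ΓSq (k + 1) t) := by
  have hΓ := h.ΓSq_nonneg hk ht hρ
  have hE := F.ESq_nonneg k t
  set Y := √(F.ESq k t + F.ΓSq (k + 1) t) with hY
  have hEY : F.En k t ≤ Y := Real.sqrt_le_sqrt (by linarith)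
  have hY0 : 0 ≤ Y := Real.sqrt_nonneg _
  obtain ⟨b1, b2, b3, b4, b5, b6⟩ := F.HNorm_le_En k t
  have hp : (1 : ℝ) ≤ 2 ^ k := one_le_pow₀ (by norm_num)
  have hcard : ∀ (f : Bool × Fin 2 → ℝ) (B : ℝ), (∀ s, f s ≤ B) → ∑ s, f s ≤ 4 * B :=
    fun f B hB => by
      refine (Finset.sum_le_card_nsmul Finset.univ f B fun s _ => hB s).trans (le_of_eq ?_)
      simp
  have c1 : ∀ s, N k (els (F.u₁ t) (F.u₂ t) (F.ρ t) s) ≤ 2 ^ (k + 3) * (6 * Y) := fun s => by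
    refine (N_els_le ((h.grid_u₁ ht).mono (by omega)) ((h.grid_u₂ ht).mono (by omega))
      ((h.grid_ρ ht).mono (by omega)) s).trans ?_
    exact mul_le_mul_of_nonneg_left (by linarith) (by positivity)
  have c2 : ∀ s, N k (els (F.ut₁ t) (F.ut₂ t) (F.ρt t) s) ≤ 2 ^ (k + 3) * (6 * Y) := fun s => by
    refine (N_els_le (h.grid_ut₁ hT ht) (h.grid_ut₂ hT ht) (h.grid_ρt hT ht) s).trans ?_
    exact mul_le_mul_of_nonneg_left (by linarith) (by positivity)
  have hz : ∀ s, Hm (k + 1) (els (F.u₁ t) (F.u₂ t) (F.ρ t) s) :=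
    hm_els (h.grid_u₁ ht) (h.grid_u₂ ht) (h.grid_ρ ht)
  have c3 : ∀ s, N (k + 1) (els (F.u₁ t) (F.u₂ t) (F.ρ t) s)
      ≤ (2 ^ (k + 1 + 1) - 1) * (2 ^ (k + 6) * Y) := fun s => by
    refine N_le_of_wd (hz s) fun a b hab => ?_
    rcases Nat.lt_or_ge (a + b) (k + 1) with hlt | hge
    · have := norm_dw_le (wd a b) (els (F.u₁ t) (F.u₂ t) (F.ρ t) s)
      rw [length_wd] at this
      refine (this.trans ((N_mono (by omega : a + b ≤ k) _).trans (c1 s))).trans ?_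
      rw [pow_add, pow_add]
      have := mul_nonneg (by positivity : (0 : ℝ) ≤ 2 ^ k) hY0
      linarith
    · have h1 := h.norm_sq_le_ΓSq hk ht hρ (by omega : a + b = k + 1) s
      have h2 : ‖dw (wd a b) (els (F.u₁ t) (F.u₂ t) (F.ρ t) s)‖ ^ 2 ≤ (2 ^ (k + 6) * Y) ^ 2 := by
        rw [mul_pow, hY, Real.sq_sqrt (by positivity)]
        have h3 : (32 : ℝ) ≤ (2 ^ (k + 6)) ^ 2 := by
          rw [pow_add, mul_pow]
          nlinarith
        nlinarith
      exact le_of_sq_le_sq h2 (by positivity)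
  have hq := mul_nonneg (by positivity : (0 : ℝ) ≤ 2 ^ k) hY0
  have hqq := mul_nonneg (by positivity : (0 : ℝ) ≤ 2 ^ k * 2 ^ k) hY0
  have e10 : (2 : ℝ) ^ (2 * k + 10) * Y = 1024 * (2 ^ k * 2 ^ k * Y) := by
    rw [pow_add, two_mul, pow_add]; ring
  constructor
  · refine (hcard _ _ c3).trans ?_
    rw [e10, pow_add, pow_add, pow_add]
    nlinarith
  · refine (hcard _ _ c2).trans ?_
    rw [e10, pow_add]
    nlinarith [mul_le_mul_of_nonneg_right hp hq]

/-- The low norms in the energy estimate are controlled by `E_4`. -/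
theorem low_norms_le (h : F.IsSolution k κ C₀ T) (hk : 4 ≤ k) (hT : 0 < T) (ht : t ∈ Icc 0 T) :
    NN 4 (els (F.u₁ t) (F.u₂ t) (F.ρ t)) ≤ 2 ^ 12 * F.En 4 t ∧
    N 3 (der 0 (dbl.ext false (F.ρ t))) ≤ 2 ^ 12 * F.En 4 t ∧
    N 2 (der 0 (dbl.ext false (F.ρt t))) ≤ 2 ^ 12 * F.En 4 t := by
  obtain ⟨b1, b2, b3, b4, b5, b6⟩ := F.HNorm_le_En 4 t
  have hE : 0 ≤ F.En 4 t := Real.sqrt_nonneg _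
  have c1 : ∀ s, N 4 (els (F.u₁ t) (F.u₂ t) (F.ρ t) s) ≤ 2 ^ 7 * (6 * F.En 4 t) := fun s => by
    refine (N_els_le ((h.grid_u₁ ht).mono (by omega)) ((h.grid_u₂ ht).mono (by omega))
      ((h.grid_ρ ht).mono (by omega)) s).trans ?_
    exact mul_le_mul_of_nonneg_left (by linarith) (by positivity)
  refine ⟨?_, ?_, ?_⟩
  · refine (Finset.sum_le_card_nsmul Finset.univ _ _ fun s _ => c1 s).trans ?_
    simp
    linarith
  · have := N_ext_le ((h.grid_ρ ht).mono (by omega : 4 + 1 ≤ k + 2))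
    exact ((N_der_le 3 _ 0).trans (N_mono (by omega : 3 + 1 ≤ 4 + 1) _)).trans
      (this.trans (by norm_num; linarith))
  · have := N_ext_le ((h.grid_ρt hT ht).mono (by omega : 4 + 1 ≤ k + 1))
    exact ((N_der_le 2 _ 0).trans (N_mono (by omega : 2 + 1 ≤ 4 + 1) _)).trans
      (this.trans (by norm_num; linarith))

theorem N_bg_le (h : F.IsSolution k κ C₀ T) (ht : t ∈ Icc 0 T) (σ : Bool) :
    N (k + 2) (bgEls (F.Φ t) (F.Ψ t) σ) ≤ 2 ^ (k + 5) * F.bgNorm (k + 3) t :=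
  N_bgEls_le (h.grid_Φ ht) (h.grid_Ψ ht) σ

theorem bgNorm_nonneg (F : Flow) (m : ℕ) (t : ℝ) : 0 ≤ F.bgNorm m t :=
  add_nonneg (Real.sqrt_nonneg _) (Real.sqrt_nonneg _)

/-- The constant in the energy inequality: the one of the estimate on the cylinder, with the factors
that bound its norms by `E_4`, the background norm and `(E_k² + Γ_{k+1}²)^{1/2}`. -/
def cFinal (k : ℕ) (κ C₀ M : ℝ) : ℝ :=
  2 ^ k * |cEnergy k κ C₀| * (2 ^ 12 + 2 ^ (k + 5) + (2 ^ 12) ^ 2 + 2 ^ 12 * 2 ^ (k + 5) * |M|)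
    * (2 ^ (2 * k + 10)) ^ 2

/-- The energy inequality, with the derivative of `Γ_{k+1}²` given by some number `R`. -/
theorem main_estimate (h : F.IsSolution k κ C₀ T) (hk : 4 ≤ k) (hκ : 0 ≤ κ) (hT : 0 < T)
    (ht : t ∈ Icc 0 T) (hρ : HNorm 2 (dx (F.ρ t)) < 1 / 4) :
    ∃ R, HasDerivWithinAt (fun t => F.ΓSq (k + 1) t) R (Icc 0 T) t ∧
      ∀ M, F.En 4 t ≤ M ∨ F.bgNorm (k + 3) t ≤ M →
        R + κ * F.weightedU (k + 1) t ≤ cFinal k κ C₀ M * (F.ESq k t + F.ΓSq (k + 1) t)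
          * (F.En 4 t + F.En 4 t ^ 2 + F.bgNorm (k + 3) t) := by
  obtain ⟨q, hel⟩ := h.exists_elsasser hk hT
  -- One derivative `∂_x^a ∂_y^{k+1-a}` for each class of words with the same exponents.
  have hR : ∀ a : ℕ, ∃ R, a ∈ Finset.range (k + 2) → _ := fun a => by
    by_cases ha : a ∈ Finset.range (k + 2)
    · obtain ⟨R, hR⟩ := hel.energy_estimate hT hκ hk (v := wd a (k + 1 - a))
        (by rw [length_wd]; have := Finset.mem_range.1 ha; omega) ht
      exact ⟨R, fun _ => hR⟩
    · exact ⟨0, fun h => absurd h ha⟩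
  choose R hR using hR
  refine ⟨∑ a ∈ Finset.range (k + 2), ((k + 1).choose a / 4 : ℝ) * R a, ?_, fun M hM => ?_⟩
  · refine (HasDerivWithinAt.fun_sum fun a ha => (hR a ha).1.const_mul _).congr
      (fun s hs => h.ΓSq_eq hk hs) (h.ΓSq_eq hk ht)
  have hΓ := h.ΓSq_nonneg hk ht hρ
  have hE := F.ESq_nonneg k t
  obtain ⟨n1, n2⟩ := h.NN_le hk hT ht hρ
  obtain ⟨l1, l2, l3⟩ := h.low_norms_le hk hT ht
  set Y := √(F.ESq k t + F.ΓSq (k + 1) t) with hY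
  set e := 2 ^ 12 * F.En 4 t with he
  set g := 2 ^ (k + 5) * F.bgNorm (k + 3) t with hg
  have E0 : 0 ≤ F.En 4 t := Real.sqrt_nonneg _
  have B0 := bgNorm_nonneg F (k + 3) t
  set W := 2 * (cEnergy k κ C₀ * (e + g + e ^ 2 + e * g) * (2 ^ (2 * k + 10) * Y) ^ 2) with hW
  -- `4 * κ`: the damping coefficient is `κ / 2`, `z⁺ + z⁻ = 2u` enters quadratically, and the
  -- cylinder covers the strip twice.
  have hb : ∀ a ∈ Finset.range (k + 2), R a + 4 * κ * (wInt (D 1 0 (F.ρ t))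
      (D a (k + 1 - a) (F.u₁ t)) + wInt (D 1 0 (F.ρ t)) (D a (k + 1 - a) (F.u₂ t))) ≤ W := by
    intro a ha
    have ha' : a + (k + 1 - a) = k + 1 := by have := Finset.mem_range.1 ha; omega
    have := (hR a ha).2 e g (2 ^ (2 * k + 10) * Y) l1 l2 l3
      (fun σ i => (N_der_le (k + 1) _ i).trans (h.N_bg_le ht σ))
      (fun σ => (N_mono (by omega) _).trans (h.N_bg_le ht σ)) n1 n2
    rw [h.damping_eq hk ht ha'] at this
    linarith
  have hsum : ∑ a ∈ Finset.range (k + 2), ((k + 1).choose a / 4 : ℝ) * R a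
      + κ * F.weightedU (k + 1) t ≤ 2 ^ (k + 1) / 4 * W := by
    have e1 : κ * F.weightedU (k + 1) t = ∑ a ∈ Finset.range (k + 2), ((k + 1).choose a / 4 : ℝ)
        * (4 * κ * (wInt (D 1 0 (F.ρ t)) (D a (k + 1 - a) (F.u₁ t))
          + wInt (D 1 0 (F.ρ t)) (D a (k + 1 - a) (F.u₂ t)))) := by
      simp only [weightedU, weighted, ← Finset.sum_add_distrib, Finset.mul_sum, wInt]
      exact Finset.sum_congr rfl fun a _ => by ring
    have e2 : (2 : ℝ) ^ (k + 1) / 4 * W = ∑ a ∈ Finset.range (k + 2),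
        ((k + 1).choose a / 4 : ℝ) * W := by
      rw [← Finset.sum_mul, ← Finset.sum_div]
      congr 2
      exact_mod_cast (Nat.sum_range_choose (k + 1)).symm
    rw [e1, e2, ← Finset.sum_add_distrib]
    refine Finset.sum_le_sum fun a ha => ?_
    rw [← mul_add]
    exact mul_le_mul_of_nonneg_left (hb a ha) (by positivity)
  refine hsum.trans ?_
  -- The mixed product is the only term that needs one of the two factors to be bounded by `M`.
  have hEB : F.En 4 t * F.bgNorm (k + 3) t ≤ |M| * (F.En 4 t + F.bgNorm (k + 3) t) := by
    rcases hM with hM | hM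
    · have := mul_le_mul_of_nonneg_right (hM.trans (le_abs_self M)) B0
      nlinarith [mul_nonneg (abs_nonneg M) E0]
    · have := mul_le_mul_of_nonneg_left (hM.trans (le_abs_self M)) E0
      nlinarith [mul_nonneg (abs_nonneg M) B0]
  set S := F.En 4 t + F.En 4 t ^ 2 + F.bgNorm (k + 3) t with hS
  have E2 := sq_nonneg (F.En 4 t)
  have hp : (0 : ℝ) < 2 ^ (k + 5) := by positivity
  have hK : e + g + e ^ 2 + e * g
      ≤ (2 ^ 12 + 2 ^ (k + 5) + (2 ^ 12) ^ 2 + 2 ^ 12 * 2 ^ (k + 5) * |M|) * S := by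
    have i1 : e ≤ 2 ^ 12 * S := mul_le_mul_of_nonneg_left (by linarith) (by positivity)
    have i2 : g ≤ 2 ^ (k + 5) * S := mul_le_mul_of_nonneg_left (by linarith) hp.le
    have i3 : e ^ 2 ≤ (2 ^ 12) ^ 2 * S := by
      rw [he, mul_pow]
      exact mul_le_mul_of_nonneg_left (by linarith) (by positivity)
    have i4 : e * g ≤ 2 ^ 12 * 2 ^ (k + 5) * |M| * S := by
      calc e * g = 2 ^ 12 * 2 ^ (k + 5) * (F.En 4 t * F.bgNorm (k + 3) t) := by rw [he, hg]; ring
        _ ≤ 2 ^ 12 * 2 ^ (k + 5) * (|M| * S) := by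
          refine mul_le_mul_of_nonneg_left (hEB.trans ?_) (by positivity)
          exact mul_le_mul_of_nonneg_left (by linarith) (abs_nonneg M)
        _ = _ := by ring
    linarith
  have hQ0 : 0 ≤ e + g + e ^ 2 + e * g := by positivity
  have hYsq : Y ^ 2 = F.ESq k t + F.ΓSq (k + 1) t := Real.sq_sqrt (by linarith)
  calc (2 : ℝ) ^ (k + 1) / 4 * W
      = 2 ^ k * (2 ^ (2 * k + 10)) ^ 2 * Y ^ 2 * (cEnergy k κ C₀ * (e + g + e ^ 2 + e * g)) := by
        rw [hW, pow_succ]; ring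
    _ ≤ 2 ^ k * (2 ^ (2 * k + 10)) ^ 2 * Y ^ 2 * (|cEnergy k κ C₀|
        * ((2 ^ 12 + 2 ^ (k + 5) + (2 ^ 12) ^ 2 + 2 ^ 12 * 2 ^ (k + 5) * |M|) * S)) := by
        refine mul_le_mul_of_nonneg_left ?_ (by positivity)
        exact mul_le_mul (le_abs_self _) hK hQ0 (abs_nonneg _)
    _ = _ := by rw [hYsq, cFinal]; ring

end IsSolution

end Flow

end Final

end MHDStrip

end

theorem proposition3p3 (k : ℕ) (hk : 4 ≤ k) (κ C₀ : ℝ) (hκ : 0 < κ) (hC₀ : C₀ ≠ 0) (M : ℝ) :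
    ∃ C : ℝ, ∀ T : ℝ, 0 < T → ∀ F : MHDStrip.Flow, F.IsSolution k κ C₀ T →
      (∀ t ∈ Set.Icc 0 T, MHDStrip.HNorm 2 (MHDStrip.dx (F.ρ t)) < 1 / 4) →
      DifferentiableOn ℝ (fun t => F.ΓSq (k + 1) t) (Set.Icc 0 T) ∧
      ∀ t ∈ Set.Icc 0 T, (F.En 4 t ≤ M ∨ F.bgNorm (k + 3) t ≤ M) →
        derivWithin (fun s => F.ΓSq (k + 1) s) (Set.Icc 0 T) t + κ * F.weightedU (k + 1) t
          ≤ C * (F.ESq k t + F.ΓSq (k + 1) t)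
              * (F.En 4 t + F.En 4 t ^ 2 + F.bgNorm (k + 3) t) := by
  refine ⟨MHDStrip.Flow.IsSolution.cFinal k κ C₀ M, fun T hT F h hρ => ⟨fun t ht => ?_,
    fun t ht hM => ?_⟩⟩
  · obtain ⟨R, hR, -⟩ := h.main_estimate hk hκ.le hT ht (hρ t ht)
    exact hR.differentiableWithinAt
  · obtain ⟨R, hR, hle⟩ := h.main_estimate hk hκ.le hT ht (hρ t ht)
    rw [hR.derivWithin (uniqueDiffOn_Icc hT t ht)]
    exact hle M hM
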